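/- **Setting.** Let $\mathcal H$ be a separable complex Hilbert space, $\mathcal I=(a,b)$ a finite interval with $0\in\bar{\mathcal I}=[a,b]$, $D=d/dt$. A differential expression of (formal) order $N$ is $$L[y]=\sum_{0\le 2j\le N} i^{2j}D^j(P_jD^jy)+\sum_{1\le 2j-1\le N}\tfrac{i^{2j-1}}2\{D^{j}(Q_jD^{j-1}y)+D^{j-1}(S_jD^jy)\},$$ with coefficients $P_j,Q_j,S_j\in C^j(\bar{\mathcal I},B(\mathcal H))$; coefficients beyond the order are zero and $Q_0=0$. Its form is $$L\{f,g\}=\sum_j(P_jf^{(j)},g^{(j)})+\tfrac i2\sum_j\big[(S_jf^{(j)},g^{(j-1)})-(Q_jf^{(j-1)},g^{(j)})\big];$$ the adjoint $L^*$ has coefficients $P_j^*,S_j^*,Q_j^*$; $\Re L=\frac12(L+L^*)$, $\Im L=\frac1{2i}(L-L^*)$. The quasi-derivatives are $y^{[k]}(t|L)=y^{(k)}$ for $k<[N/2]$; $y^{[n]}=P_ny^{(n)}-\frac i2Q_ny^{(n-1)}$ if $N=2n$ and $y^{[n]}=-\frac i2Q_{n+1}y^{(n)}$ if $N=2n+1$;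 and, for $k=N-j>[N/2]$, $y^{[k]}=-Dy^{[k-1]}+P_jy^{(j)}+\frac i2[S_{j+1}y^{(j+1)}-Q_jy^{(j-1)}]$. Let $l_\lambda$ be a family of expressions of order $r>0$, $n=[r/2]$, with coefficients $p_j(t,\lambda),q_j(t,\lambda),s_j(t,\lambda)$ for $\lambda$ in a set $\mathcal B\supseteq\mathbb C\setminus\mathbb R$, and let $m$ be an expression of even order $s\le r$ with coefficients $\tilde p_j=\tilde p_j^*$, $\tilde q_j$, $\tilde s_j=\tilde q_j^*$. Suppose: every point of $\mathcal B$ has a neighbourhood, independent of $t\in\bar{\mathcal I}$, in which the coefficients of $l_\lambda$ are analytic in $\lambda$; $l_\lambda=l_{\bar\lambda}^*$ for $\lambda\in\mathcal B$; for all $\lambda\in\mathcal B$, $t\in\bar{\mathcal I}$, the operator $p_n(t,\lambda)$ (if $r=2n$), resp. $q_{n+1}(t,\lambda)+s_{n+1}(t,\lambda)$ (if $r=2n+1$), has an inverse in $B(\mathcal H)$; and for $\Im\lambda\ne0$, $t\in\bar{\mathcal I}$, $$0\le m\{\cdot,\cdot\}\le-(\Im l_\lambda)\{\cdot,\cdot\}/\Im\lambda$$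 as quadratic forms in independent vectors $h_0,h_1,\dots\in\mathcal H$ put in place of $f,f',\dots$. Put $l=\Re l_i$ and $n_\lambda=l-\lambda m-l_\lambda$, so that $l_\lambda=l-\lambda m-n_\lambda$. For an expression $L$ of order $r$ let $$\vec y(t,L,m,f)=\Big(y,\dots,y^{(n-1)},\ \big(y^{[r-j]}(t|L)-f^{[s-j]}(t|m)\big)_{j=1}^{n}\Big),$$ where $f^{[k]}(t|m):=0$ for $k<s/2$, with the additional last component $-iy^{(n)}$ if $r=2n+1>1$; $\vec y=y$ if $r=1$. In $\vec y(t,l-n_\lambda,m,f)$ the expression $l-n_\lambda=l_\lambda+\lambda m$ is regarded as an expression of formal order $r$. With $\vec y(t)=\vec y(t,l_\lambda,m,f)$ the equation $l_\lambda[y]=m[f]$ is equivalent to a system in $\mathcal H^r$ $$\tfrac i2\big((Q\vec y)'+Q^*\vec y\,'\big)-H(t,l_\lambda)\vec y=W(t,l_{\bar\lambda},m)F(t,l_{\bar\lambda},m),\qquad Q=Q(t,l_\lambda),$$ with the following data. If $r=2n$, $Q=\begin{pmatrix}0&iI_n\\-iI_n&0\end{pmatrix}$; if $r=2n+1$, $Q=\begin{pmatrix}0&iI_n\\-iI_n&0\end{pmatrix}\oplus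 q_{n+1}$ (just $q_1$ for $r=1$). $H(t,l_\lambda)$ is the operator matrix for which the vectors $\vec y(t,l_\lambda,m,0)$ satisfy $\frac i2((Q\vec y)'+Q^*\vec y\,')-H\vec y=\mathrm{col}(l_\lambda[y],0,\dots,0)$ for all $y\in C^r$ and whose entries do not depend on $y$ (the usual Hamiltonian of the quasi-derivative system). For an expression $L$ of order $r$, $F(t,L,m)$ is $(f,\dots,f^{(s/2)},0,\dots,0)$ if $s<2n$; $(f,\dots,f^{(n-1)},0,\dots,0,-if^{(n)})$ if $r=2n+1>1$, $s=2n$; $f$ if $r=1$; and $(f,\dots,f^{(n-1)},f^{[r-1]}(t|L),\dots,f^{[r-n]}(t|L))$ if $r=s=2n$. The weight is $W(t,L,m)=E^*\mathbf mE$, where $\mathbf m$ is the operator matrix of the form $m\{\cdot,\cdot\}$ on the jets $(f,f',\dots,f^{(n)})$ and $E=E(t,L)$ maps a vector $(x_1,\dots,x_r)\in\mathcal H^r$ to the jet $(x_1,\dots,x_n,x)$ with $x=P_n^{-1}(x_{2n}+\frac i2Q_nx_n)$ if $r=2n$ and $x=ix_r$ if $r=2n+1$ ($P_n,Q_n$ being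 coefficients of $L$). Let $X_\lambda(t)$ be the operator solution of the homogeneous system with $X_\lambda(0)=I_r$, $G=\Re Q(0,l_\lambda)$, $W_\lambda(t)=\Im H(t,l_\lambda)/\Im\lambda$, $U_t[x]=([\Re Q(t,l_\lambda)]x,x)$, and $$K_\lambda(t,\tau)=X_\lambda(t)\{M(\lambda)-\tfrac12\mathrm{sgn}(\tau-t)(iG)^{-1}\}X_{\bar\lambda}^*(\tau).$$ A *characteristic operator* is an analytic function $M(\lambda)=M^*(\bar\lambda)\in B(\mathcal H^r)$ of non-real $\lambda$ such that, for $\Im\lambda\ne0$ and every $\mathcal H^r$-valued $F\in L^2_{W_\lambda}(\mathcal I)$ with compact support in $\mathcal I$, the function $x_\lambda(t)=\int_{\mathcal I}K_\lambda(t,\tau)W_\lambda(\tau)F(\tau)\,d\tau$ satisfies $(\Im\lambda)\lim_{(\alpha,\beta)\uparrow\mathcal I}(U_\beta[x_\lambda(\beta)]-U_\alpha[x_\lambda(\alpha)])\le0$. Let $H$ be the space $C^s(\bar{\mathcal I},\mathcal H)$ with the (semi-definite) scalar product $m[f,g]=\int_{\mathcal I}m\{f,g\}\,dt$, and $L^2_m(\mathcal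 I)$ its completion. The *resolvent* $R(\lambda)$ ($\Im\lambda\ne0$) corresponding to a characteristic operator $M$ is the closure in $L_m^2(\mathcal I)$ of the operator which takes $f\in H$ to the first component of $\int_{\mathcal I}K_\lambda(t,\tau)W(\tau,l_{\bar\lambda},m)F(\tau,l_{\bar\lambda},m)\,d\tau$. A *boundary pair* is a pair of functions $\mathcal M_\lambda,\mathcal N_\lambda\in B(\mathcal H^r)$, analytic for non-real $\lambda$, such that for $\Im\lambda\ne0$: $\mathcal M_{\bar\lambda}^*[\Re Q(a,l_\lambda)]\mathcal M_\lambda=\mathcal N_{\bar\lambda}^*[\Re Q(b,l_\lambda)]\mathcal N_\lambda$; $\|\mathcal M_\lambda h\|+\|\mathcal N_\lambda h\|>0$ for $h\ne0$; and $\{\mathcal M_\lambda h\oplus\mathcal N_\lambda h\mid h\in\mathcal H^r\}$ is a maximal $\mathcal Q$-nonnegative subspace of $\mathcal H^{2r}$, $\mathcal Q=(\Im\lambda)\,\mathrm{diag}(\Re Q(a,l_\lambda),-\Re Q(b,l_\lambda))$. For a boundary pair and $\Im\lambda\ne0$, let $T(\lambda)$ be the closure in $L^2_m(\mathcal I)\times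 L_m^2(\mathcal I)$ of the set of (classes of) pairs $\{y,f\}$ with $y\in C^r(\bar{\mathcal I},\mathcal H)$, $f\in H$, $(l-n_\lambda)[y]=m[f]$ and $$\exists h\in\mathcal H^r:\quad\vec y(a,l-n_\lambda,m,f)=\mathcal M_\lambda h,\qquad\vec y(b,l-n_\lambda,m,f)=\mathcal N_\lambda h .$$ **Corollary 3.1.** Suppose in addition that there are $\lambda_0\in\mathcal B$, $\alpha,\beta\in\bar{\mathcal I}$ with $0\in[\alpha,\beta]$ and $\delta>0$ such that $$-\int_\alpha^\beta\frac{\Im l_{\lambda_0}}{\Im\lambda_0}\{y,y\}\,dt\ge\delta\,\|\vec y(0,l_{\lambda_0},m,0)\|^2$$ for every solution $y\in C^r(\bar{\mathcal I},\mathcal H)$ of $l_{\lambda_0}[y]=0$ (for real $\lambda_0$, $\Im l_{\lambda_0}/\Im\lambda_0$ means $\partial l_\lambda/\partial\lambda|_{\lambda=\lambda_0}$). 1°. Let $\mathcal M_\lambda,\mathcal N_\lambda$ be a boundary pair. Then, for $\Im\lambda\neq0$, $X_\lambda^{-1}(a)\mathcal M_\lambda-X_\lambda^{-1}(b)\mathcal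 N_\lambda$ has an inverse in $B(\mathcal H^r)$, $$M(\lambda)=-\tfrac12\big(X_\lambda^{-1}(a)\mathcal M_\lambda+X_\lambda^{-1}(b)\mathcal N_\lambda\big)\big(X_\lambda^{-1}(a)\mathcal M_\lambda-X_\lambda^{-1}(b)\mathcal N_\lambda\big)^{-1}(iG)^{-1}$$ is a characteristic operator, the function defining $R(\lambda)f$ belongs to $C^r(\bar{\mathcal I},\mathcal H)$ for every $f\in H$, and $(T(\lambda)-\lambda)^{-1}=R(\lambda)$, the resolvent corresponding to this $M(\lambda)$. 2°. Conversely, for every characteristic operator $M(\lambda)$ there is a boundary pair $\mathcal M_\lambda,\mathcal N_\lambda$ such that for all non-real $\lambda$ the resolvent corresponding to $M(\lambda)$ (again defined on $H$ by functions of class $C^r$) is $R(\lambda)=(T(\lambda)-\lambda)^{-1}$, with $T(\lambda)$ the relation of that boundary pair. -/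

import Mathlib

open Set Filter Topology MeasureTheory
open scoped ComplexConjugate

noncomputable section

/-- The coefficients of a differential expression in divergent form,
`L = ∑ iᵏ L_k`, `L_{2j} = Dʲ p_j Dʲ`, `L_{2j-1} = ½ D^{j-1} (D q_j + s_j D) D^{j-1}`,
with values in the bounded operators on `𝓗`. The (formal) order is a separate parameter. -/
@[ext] structure OpExpr (𝓗 : Type*) [NormedAddCommGroup 𝓗] [InnerProductSpace ℂ 𝓗] where
  p : ℕ → ℝ → 𝓗 →L[ℂ] 𝓗
  q : ℕ → ℝ → 𝓗 →L[ℂ] 𝓗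
  s : ℕ → ℝ → 𝓗 →L[ℂ] 𝓗

namespace OpExpr

variable {𝓗 : Type*} [NormedAddCommGroup 𝓗] [InnerProductSpace ℂ 𝓗]

instance : Add (OpExpr 𝓗) := ⟨fun L K => ⟨L.p + K.p, L.q + K.q, L.s + K.s⟩⟩
instance : Sub (OpExpr 𝓗) := ⟨fun L K => ⟨L.p - K.p, L.q - K.q, L.s - K.s⟩⟩
instance : SMul ℂ (OpExpr 𝓗) := ⟨fun c L => ⟨c • L.p, c • L.q, c • L.s⟩⟩

/-- The formally adjoint expression `L*`. -/
def adj [CompleteSpace 𝓗] (L : OpExpr 𝓗) : OpExpr 𝓗 where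
  p j t := ContinuousLinearMap.adjoint (L.p j t)
  q j t := ContinuousLinearMap.adjoint (L.s j t)
  s j t := ContinuousLinearMap.adjoint (L.q j t)

/-- `Re L = (L + L*) / 2`. -/
def re [CompleteSpace 𝓗] (L : OpExpr 𝓗) : OpExpr 𝓗 := (1 / 2 : ℂ) • (L + L.adj)

/-- `L` is an expression of formal order (at most) `N`: there are only coefficients `p_j` with
`2j ≤ N` and `q_j`, `s_j` with `1 ≤ j`, `2j - 1 ≤ N`; all other entries are zero. -/
structure IsOfOrder (L : OpExpr 𝓗) (N : ℕ) : Prop where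
  p_eq_zero : ∀ j, N < 2 * j → L.p j = 0
  q_eq_zero : ∀ j, N + 1 < 2 * j → L.q j = 0
  s_eq_zero : ∀ j, N + 1 < 2 * j → L.s j = 0
  q_zero : L.q 0 = 0
  s_zero : L.s 0 = 0

/-- The coefficients with index `j` are of class `Cʲ` on `I` in the operator norm. -/
structure IsSmoothOn (L : OpExpr 𝓗) (I : Set ℝ) : Prop where
  p_smooth : ∀ j : ℕ, ContDiffOn ℝ j (L.p j) I
  q_smooth : ∀ j : ℕ, ContDiffOn ℝ j (L.q j) I
  s_smooth : ∀ j : ℕ, ContDiffOn ℝ j (L.s j) I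

/-- The vector function `L[y]` for an expression of order `N` (derivatives are taken relative to
the interval `I`, so they are one-sided at its ends):
`∑_{2j ≤ N} i^{2j} Dʲ (p_j Dʲ y) + ∑_{2j-1 ≤ N} i^{2j-1} ½ (Dʲ (q_j D^{j-1} y) + D^{j-1} (s_j Dʲ y))`;
the index of the second sum is shifted by one. -/
def apply (L : OpExpr 𝓗) (I : Set ℝ) (N : ℕ) (y : ℝ → 𝓗) (t : ℝ) : 𝓗 :=
  ∑ j ∈ Finset.range (N / 2 + 1), Complex.I ^ (2 * j) •
      iteratedDerivWithin j (fun τ => L.p j τ (iteratedDerivWithin j y I τ)) I t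
  + ∑ j ∈ Finset.range ((N + 1) / 2), (Complex.I ^ (2 * j + 1) * (1 / 2)) •
      (iteratedDerivWithin (j + 1)
          (fun τ => L.q (j + 1) τ (iteratedDerivWithin j y I τ)) I t
        + iteratedDerivWithin j
          (fun τ => L.s (j + 1) τ (iteratedDerivWithin (j + 1) y I τ)) I t)

/-- The pointwise sesquilinear form of `L` (order `N`) on jets `u = (u_0, u_1, …)`, `v`:
`∑ (p_j u_j, v_j) + (i/2) ∑ ((s_j u_j, v_{j-1}) - (q_j u_{j-1}, v_j))`. The scalar product of the
paper is linear in its first argument, so `(x, y)` is `inner ℂ y x`. -/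
def jetForm (L : OpExpr 𝓗) (N : ℕ) (t : ℝ) (u v : ℕ → 𝓗) : ℂ :=
  ∑ j ∈ Finset.range (N / 2 + 1), inner ℂ (v j) (L.p j t (u j))
  + (Complex.I / 2) * ∑ j ∈ Finset.range ((N + 1) / 2),
      (inner ℂ (v j) (L.s (j + 1) t (u (j + 1))) - inner ℂ (v (j + 1)) (L.q (j + 1) t (u j)))

/-- `L{f, g}(t)`: the form evaluated on the jets of two functions. -/
def form (L : OpExpr 𝓗) (I : Set ℝ) (N : ℕ) (f g : ℝ → 𝓗) (t : ℝ) : ℂ :=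
  L.jetForm N t (fun j => iteratedDerivWithin j f I t) (fun j => iteratedDerivWithin j g I t)

/-- The quasi-derivative of middle index `[N/2]`. -/
def midQuasiDeriv (L : OpExpr 𝓗) (I : Set ℝ) (N : ℕ) (y : ℝ → 𝓗) (t : ℝ) : 𝓗 :=
  if Even N then
    L.p (N / 2) t (iteratedDerivWithin (N / 2) y I t)
      - (Complex.I / 2) • L.q (N / 2) t (iteratedDerivWithin (N / 2 - 1) y I t)
  else
    -((Complex.I / 2) • L.q (N / 2 + 1) t (iteratedDerivWithin (N / 2) y I t))

/-- The quasi-derivatives `y^{[k]}(t | L)` of an expression of order `N`: `y^{[k]} = y^{(k)}` for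
`k < [N/2]`, and, with `j = N - k`,
`y^{[k]} = -D y^{[k-1]} + p_j y^{(j)} + (i/2) (s_{j+1} y^{(j+1)} - q_j y^{(j-1)})`
for `[N/2] < k ≤ N` (here `q_0 = 0`). -/
def quasiDeriv (L : OpExpr 𝓗) (I : Set ℝ) (N : ℕ) (y : ℝ → 𝓗) : ℕ → ℝ → 𝓗
  | 0 => if N / 2 = 0 then L.midQuasiDeriv I N y else y
  | k + 1 =>
    if k + 1 < N / 2 then iteratedDerivWithin (k + 1) y I
    else if k + 1 = N / 2 then L.midQuasiDeriv I N y
    else fun t =>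
      -derivWithin (quasiDeriv L I N y k) I t
        + L.p (N - (k + 1)) t (iteratedDerivWithin (N - (k + 1)) y I t)
        + (Complex.I / 2) •
          (L.s (N - (k + 1) + 1) t (iteratedDerivWithin (N - (k + 1) + 1) y I t)
            - L.q (N - (k + 1)) t (iteratedDerivWithin (N - (k + 1) - 1) y I t))

/-! ### The coefficients of the equivalent first order system

Vectors of `𝓗^r` have the components `(y, …, y^{(n-1)}, y^{[r-1]}, …, y^{[r-n]})` and, for
`r = 2n + 1`, the additional last component `-i y^{(n)}`; here `n = [r/2]`. Rows and columns are
numbered from `0`. -/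

/-- Entries of `Q(t, L)`: `[[0, i], [-i, 0]]`, and additionally `q_{n+1}` in the corner if `r` is
odd. -/
def entryQ (L : OpExpr 𝓗) (r : ℕ) (t : ℝ) (i j : ℕ) : 𝓗 →L[ℂ] 𝓗 :=
  let n := r / 2
  if i < n ∧ j = n + i then Complex.I • 1
  else if j < n ∧ i = n + j then -(Complex.I • 1)
  else if i = 2 * n ∧ j = 2 * n then L.q (n + 1) t
  else 0

/-- Entries of `H(t, L)` for even `r = 2n`. -/
def entryHEven (L : OpExpr 𝓗) (r : ℕ) (t : ℝ) (i j : ℕ) : 𝓗 →L[ℂ] 𝓗 :=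
  let n := r / 2
  let pinv := Ring.inverse (L.p n t)
  if i < n ∧ j < n then
    if i = j then
      (if i + 1 = n then (1 / 4 : ℂ) • (L.s n t * pinv * L.q n t) else 0) - L.p i t
    else if i = j + 1 then (Complex.I / 2) • L.q i t
    else if j = i + 1 then -((Complex.I / 2) • L.s j t)
    else 0
  else if i < n then
    if n + i = j + 1 then 1
    else if i + 1 = n ∧ j + 1 = 2 * n then -((Complex.I / 2) • (L.s n t * pinv))
    else 0
  else if j < n then
    if n + j = i + 1 then 1
    else if j + 1 = n ∧ i + 1 = 2 * n then (Complex.I / 2) • (pinv * L.q n t)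
    else 0
  else if i + 1 = 2 * n ∧ j + 1 = 2 * n then pinv
  else 0

/-- Entries of `H(t, L)` for odd `r = 2n + 1`. -/
def entryHOdd (L : OpExpr 𝓗) (r : ℕ) (t : ℝ) (i j : ℕ) : 𝓗 →L[ℂ] 𝓗 :=
  let n := r / 2
  if i < n ∧ j < n then
    if i = j then -L.p i t
    else if i = j + 1 then (Complex.I / 2) • L.q i t
    else if j = i + 1 then -((Complex.I / 2) • L.s j t)
    else 0
  else if i < n then
    if n + i = j + 1 then 1
    else if i + 1 = n ∧ j = 2 * n then (1 / 2 : ℂ) • L.s n t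
    else 0
  else if j < n then
    if n + j = i + 1 then 1
    else if j + 1 = n ∧ i = 2 * n then (1 / 2 : ℂ) • L.q n t
    else 0
  else if i + 1 = 2 * n ∧ j = 2 * n then Complex.I • 1
  else if i = 2 * n ∧ j + 1 = 2 * n then -(Complex.I • 1)
  else if i = 2 * n ∧ j = 2 * n then -L.p n t
  else 0

/-- Entries of `H(t, L)`. -/
def entryH (L : OpExpr 𝓗) (r : ℕ) (t : ℝ) (i j : ℕ) : 𝓗 →L[ℂ] 𝓗 :=
  if Even r then L.entryHEven r t i j else L.entryHOdd r t i j

/-- Entries of the operator that recovers the jet `(f, f', …, f^{(n)})` (row index `k ≤ n`) from a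
vector of quasi-derivatives (column index `j < r`). For `r = 2n` its rows are the first `n` rows and
the last row `f^{(n)} = p_n⁻¹ f^{[n]} + (i/2) p_n⁻¹ q_n f^{(n-1)}` of the inverse of the operator
`C(t, L)` which takes `(f, …, f^{(n-1)}, f^{(2n-1)}, …, f^{(n)})` to
`(f^{[0]}, …, f^{[n-1]}, f^{[2n-1]}, …, f^{[n]})`; the other rows of this inverse meet only zero
entries in the weight. For `r = 2n + 1` the last row is `f^{(n)} = i (-i f^{(n)})`. -/
def entryJet (L : OpExpr 𝓗) (r : ℕ) (t : ℝ) (k j : ℕ) : 𝓗 →L[ℂ] 𝓗 :=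
  let n := r / 2
  if k < n then (if j = k then 1 else 0)
  else if Even r then
    if j + 1 = 2 * n then Ring.inverse (L.p n t)
    else if j + 1 = n then (Complex.I / 2) • (Ring.inverse (L.p n t) * L.q n t)
    else 0
  else if j = 2 * n then Complex.I • 1
  else 0

/-- Entries of the operator matrix of the form of `m` on jets. -/
def entryForm (m : OpExpr 𝓗) (t : ℝ) (k l : ℕ) : 𝓗 →L[ℂ] 𝓗 :=
  if k = l then m.p k t
  else if l = k + 1 then (Complex.I / 2) • m.s l t
  else if k = l + 1 then -((Complex.I / 2) • m.q k t)
  else 0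

end OpExpr

section Blocks

variable {𝓗 : Type*} [NormedAddCommGroup 𝓗] [InnerProductSpace ℂ 𝓗]

/-- The Hilbert space `𝓗^r`. -/
abbrev HilbertPow (𝓗 : Type*) (r : ℕ) : Type _ := PiLp 2 (fun _ : Fin r => 𝓗)

/-- The operator on `𝓗^r` with the given operator matrix. -/
def blockOp (r : ℕ) (A : ℕ → ℕ → 𝓗 →L[ℂ] 𝓗) : HilbertPow 𝓗 r →L[ℂ] HilbertPow 𝓗 r :=
  ((PiLp.continuousLinearEquiv 2 ℂ (fun _ : Fin r => 𝓗)).symm :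
      (Fin r → 𝓗) →L[ℂ] HilbertPow 𝓗 r) ∘L
    ContinuousLinearMap.pi (fun i : Fin r =>
      ∑ j : Fin r, (A i j) ∘L PiLp.proj (𝕜 := ℂ) 2 (fun _ : Fin r => 𝓗) j)

/-- `Re A = (A + A*) / 2`. -/
def opRe {E : Type*} [NormedAddCommGroup E] [InnerProductSpace ℂ E] [CompleteSpace E]
    (A : E →L[ℂ] E) : E →L[ℂ] E := (1 / 2 : ℂ) • (A + ContinuousLinearMap.adjoint A)

/-- `Im A = (A - A*) / (2i)`. -/
def opIm {E : Type*} [NormedAddCommGroup E] [InnerProductSpace ℂ E] [CompleteSpace E]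
    (A : E →L[ℂ] E) : E →L[ℂ] E :=
  (1 / (2 * Complex.I)) • (A - ContinuousLinearMap.adjoint A)

end Blocks

namespace OpExpr

variable {𝓗 : Type*} [NormedAddCommGroup 𝓗] [InnerProductSpace ℂ 𝓗]

/-- `Q(t, L)`. -/
def opQ (L : OpExpr 𝓗) (r : ℕ) (t : ℝ) : HilbertPow 𝓗 r →L[ℂ] HilbertPow 𝓗 r := blockOp r (L.entryQ r t)

/-- `H(t, L)`. -/
def opH (L : OpExpr 𝓗) (r : ℕ) (t : ℝ) : HilbertPow 𝓗 r →L[ℂ] HilbertPow 𝓗 r := blockOp r (L.entryH r t)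

/-- The weight `W(t, L, m)`: the operator of the form `m{f, g}` with respect to the vectors of
quasi-derivatives of `L`. -/
def opW [CompleteSpace 𝓗] (L m : OpExpr 𝓗) (r : ℕ) (t : ℝ) : HilbertPow 𝓗 r →L[ℂ] HilbertPow 𝓗 r :=
  blockOp r fun i j =>
    ∑ k ∈ Finset.range (r / 2 + 1), ∑ l ∈ Finset.range (r / 2 + 1),
      ContinuousLinearMap.adjoint (L.entryJet r t k i) * m.entryForm t k l * L.entryJet r t l j

/-- The vector `F(t, L, m) ∈ 𝓗^r` of a function `f`; `r` is the order of `L` and `s` is the order of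
`m`. -/
def vecF (L : OpExpr 𝓗) (I : Set ℝ) (r s : ℕ) (f : ℝ → 𝓗) (t : ℝ) : HilbertPow 𝓗 r :=
  WithLp.toLp 2 fun i : Fin r =>
    if r = 1 then f t
    else if (i : ℕ) < r / 2 then
      (if (i : ℕ) ≤ s / 2 then iteratedDerivWithin i f I t else 0)
    else if (i : ℕ) < 2 * (r / 2) then
      (if s = r then L.quasiDeriv I r f (r - (i - r / 2 + 1)) t else 0)
    else
      (if s + 1 = r then -(Complex.I • iteratedDerivWithin (r / 2) f I t) else 0)

/-- The vector `y⃗(t, L, m, f) ∈ 𝓗^r`: its components are `y^{(j)}`, `j < n`, then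
`y^{[r-j]}(t|L) - f^{[s-j]}(t|m)`, `j = 1, …, n` (with `f^{[k]}(t|m) = 0` for `k < s/2`), then
`-i y^{(n)}` if `r = 2n + 1 > 1`. If `r = 1` it is `y(t)`. -/
def vecY (L m : OpExpr 𝓗) (I : Set ℝ) (r s : ℕ) (y f : ℝ → 𝓗) (t : ℝ) : HilbertPow 𝓗 r :=
  WithLp.toLp 2 fun i : Fin r =>
    if r = 1 then y t
    else if (i : ℕ) < r / 2 then iteratedDerivWithin i y I t
    else if (i : ℕ) < 2 * (r / 2) then
      L.quasiDeriv I r y (r - (i - r / 2 + 1)) t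
        - (if 2 * (i - r / 2 + 1) ≤ s then m.quasiDeriv I s f (s - (i - r / 2 + 1)) t else 0)
    else -(Complex.I • iteratedDerivWithin (r / 2) y I t)

end OpExpr

/-- A pair consisting of a family `l_λ` of differential expressions of order `r` which depends on
the spectral parameter in the Nevanlinna manner and a symmetric expression `m` of even order
`s ≤ r`, on a finite interval `[a, b]` that contains `0`, with the standing assumptions. -/
structure NevanlinnaExprPair (𝓗 : Type*) [NormedAddCommGroup 𝓗] [InnerProductSpace ℂ 𝓗]
    [CompleteSpace 𝓗] where
  a : ℝ
  b : ℝ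
  a_lt_b : a < b
  zero_mem : (0 : ℝ) ∈ Icc a b
  r : ℕ
  s : ℕ
  r_pos : 0 < r
  s_even : Even s
  s_le_r : s ≤ r
  /-- The family `l_λ`. -/
  l : ℂ → OpExpr 𝓗
  m : OpExpr 𝓗
  /-- The set of admissible values of the spectral parameter. -/
  dom : Set ℂ
  nonreal_mem : ∀ z : ℂ, z.im ≠ 0 → z ∈ dom
  l_order : ∀ z ∈ dom, (l z).IsOfOrder r
  l_analytic : ∀ μ ∈ dom, ∃ U : Set ℂ, IsOpen U ∧ μ ∈ U ∧ ∀ t ∈ Icc a b, ∀ j : ℕ,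
    DifferentiableOn ℂ (fun z => (l z).p j t) U ∧
    DifferentiableOn ℂ (fun z => (l z).q j t) U ∧
    DifferentiableOn ℂ (fun z => (l z).s j t) U
  l_smooth : ∀ z ∈ dom, (l z).IsSmoothOn (Icc a b)
  l_unit_even : Even r → ∀ z ∈ dom, ∀ t ∈ Icc a b, IsUnit ((l z).p (r / 2) t)
  l_unit_odd : ¬ Even r → ∀ z ∈ dom, ∀ t ∈ Icc a b,
    IsUnit ((l z).q (r / 2 + 1) t + (l z).s (r / 2 + 1) t)
  /-- `l_λ = (l_{conj λ})*`. -/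
  l_symm : ∀ z ∈ dom, ∀ t ∈ Icc a b, ∀ j : ℕ,
    (l z).p j t = ContinuousLinearMap.adjoint ((l (conj z)).p j t) ∧
    (l z).q j t = ContinuousLinearMap.adjoint ((l (conj z)).s j t)
  m_order : m.IsOfOrder s
  m_smooth : m.IsSmoothOn (Icc a b)
  m_symm : ∀ t ∈ Icc a b, ∀ j : ℕ,
    m.p j t = ContinuousLinearMap.adjoint (m.p j t) ∧
    m.s j t = ContinuousLinearMap.adjoint (m.q j t)
  /-- The form of `m` is nonnegative. -/
  m_nonneg : ∀ t ∈ Icc a b, ∀ h : ℕ → 𝓗, 0 ≤ (m.jetForm s t h h).re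
  /-- The form of `m` is dominated by the form of `-Im l_λ / Im λ`. -/
  m_le : ∀ z : ℂ, z.im ≠ 0 → ∀ t ∈ Icc a b, ∀ h : ℕ → 𝓗,
    (m.jetForm s t h h).re ≤ -((l z).jetForm r t h h).im / z.im

namespace OpExpr

variable {𝓗 : Type*} [NormedAddCommGroup 𝓗] [InnerProductSpace ℂ 𝓗]

theorem jetForm_add_right (L : OpExpr 𝓗) (N : ℕ) (t : ℝ) (u v w : ℕ → 𝓗) :
    L.jetForm N t u (v + w) = L.jetForm N t u v + L.jetForm N t u w := by
  simp only [jetForm, Pi.add_apply, inner_add_left, Finset.sum_add_distrib,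
    Finset.sum_sub_distrib]
  ring

theorem jetForm_smul_right (L : OpExpr 𝓗) (N : ℕ) (t : ℝ) (u v : ℕ → 𝓗) (c : ℂ) :
    L.jetForm N t u (c • v) = conj c * L.jetForm N t u v := by
  simp only [jetForm, Pi.smul_apply, inner_smul_left, Finset.mul_sum, mul_add]
  congr 1
  refine Finset.sum_congr rfl fun j _ => ?_
  ring

theorem jetForm_conj [CompleteSpace 𝓗] (L : OpExpr 𝓗) (N : ℕ) (t : ℝ) (u v : ℕ → 𝓗)
    (h : ∀ j : ℕ, L.p j t = ContinuousLinearMap.adjoint (L.p j t) ∧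
      L.s j t = ContinuousLinearMap.adjoint (L.q j t)) :
    conj (L.jetForm N t u v) = L.jetForm N t v u := by
  have hp : ∀ j (x y : 𝓗), inner ℂ (L.p j t x) y = inner ℂ x (L.p j t y) := fun j x y => by
    conv_lhs => rw [(h j).1]
    exact ContinuousLinearMap.adjoint_inner_left _ _ _
  have hs : ∀ j (x y : 𝓗), inner ℂ (L.s j t x) y = inner ℂ x (L.q j t y) := fun j x y => by
    rw [(h j).2]
    exact ContinuousLinearMap.adjoint_inner_left _ _ _
  have hq : ∀ j (x y : 𝓗), inner ℂ (L.q j t x) y = inner ℂ x (L.s j t y) := fun j x y => by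
    rw [(h j).2]
    exact (ContinuousLinearMap.adjoint_inner_right _ _ _).symm
  simp only [jetForm, map_add, map_mul, map_sum, map_sub, inner_conj_symm, hp, hs, hq, map_div₀,
    Complex.conj_I, Complex.conj_ofNat]
  congr 1
  rw [Finset.mul_sum, Finset.mul_sum]
  refine Finset.sum_congr rfl fun j _ => ?_
  ring

theorem continuousOn_form (L : OpExpr 𝓗) {I : Set ℝ} (hI : UniqueDiffOn ℝ I) {N : ℕ}
    (hN : Even N) (hL : L.IsSmoothOn I) {f g : ℝ → 𝓗} (hf : ContDiffOn ℝ N f I)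
    (hg : ContDiffOn ℝ N g I) : ContinuousOn (L.form I N f g) I := by
  obtain ⟨k, rfl⟩ := hN
  have d : ∀ (e : ℝ → 𝓗), ContDiffOn ℝ (k + k : ℕ) e I → ∀ j, j ≤ k →
      ContinuousOn (iteratedDerivWithin j e I) I := fun e he j hj =>
    he.continuousOn_iteratedDerivWithin (by exact_mod_cast (by omega : j ≤ k + k)) hI
  unfold form jetForm
  refine ContinuousOn.add ?_ (ContinuousOn.mul continuousOn_const ?_)
  · refine continuousOn_finsetSum _ fun j hj => ?_
    have hj' : j ≤ k := by have := Finset.mem_range.1 hj; omega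
    exact (d g hg j hj').inner (𝕜 := ℂ) ((hL.p_smooth j).continuousOn.clm_apply (d f hf j hj'))
  · refine continuousOn_finsetSum _ fun j hj => ?_
    have hj' : j + 1 ≤ k := by have := Finset.mem_range.1 hj; omega
    exact ((d g hg j (by omega)).inner (𝕜 := ℂ)
        ((hL.s_smooth _).continuousOn.clm_apply (d f hf _ hj'))).sub
      ((d g hg _ hj').inner (𝕜 := ℂ) ((hL.q_smooth _).continuousOn.clm_apply (d f hf j (by omega))))

end OpExpr

namespace NevanlinnaExprPair

variable {𝓗 : Type*} [NormedAddCommGroup 𝓗] [InnerProductSpace ℂ 𝓗] [CompleteSpace 𝓗]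
variable (D : NevanlinnaExprPair 𝓗)

/-- The closed interval `[a, b]`. -/
abbrev ivl : Set ℝ := Icc D.a D.b

/-! ### The space `L²_m` -/

/-- The functions of class `Cˢ` on `[a, b]` (their values outside `[a, b]` are irrelevant). -/
def smoothFns : Submodule ℂ (ℝ → 𝓗) where
  carrier := {f | ContDiffOn ℝ D.s f D.ivl}
  add_mem' hf hg := ContDiffOn.add hf hg
  zero_mem' := contDiffOn_const
  smul_mem' c _ hf := ContDiffOn.const_smul c hf

/-- The pre-Hilbert space `H` of the functions of class `Cˢ` on `[a, b]`, with the scalar product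
`m[f, g] = ∫ m{f, g} dt`. -/
def PreH : Type _ := D.smoothFns

instance : AddCommGroup D.PreH := inferInstanceAs (AddCommGroup D.smoothFns)
instance : Module ℂ D.PreH := inferInstanceAs (Module ℂ D.smoothFns)

variable {D} in
/-- The function underlying an element of `H`. -/
def PreH.fn (f : D.PreH) : ℝ → 𝓗 := f.1

/-- `m[f, g]`. -/
def mForm (f g : ℝ → 𝓗) : ℂ := ∫ t in D.a..D.b, D.m.form D.ivl D.s f g t

theorem uniqueDiffOn : UniqueDiffOn ℝ D.ivl := uniqueDiffOn_Icc D.a_lt_b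

theorem intervalIntegrable_form (f g : D.PreH) :
    IntervalIntegrable (D.m.form D.ivl D.s f.fn g.fn) volume D.a D.b := by
  refine ContinuousOn.intervalIntegrable ?_
  rw [uIcc_of_le D.a_lt_b.le]
  exact D.m.continuousOn_form D.uniqueDiffOn D.s_even D.m_smooth f.2 g.2

theorem mForm_conj (f g : ℝ → 𝓗) : conj (D.mForm f g) = D.mForm g f := by
  unfold mForm
  rw [intervalIntegral.integral_of_le D.a_lt_b.le, intervalIntegral.integral_of_le D.a_lt_b.le,
    ← integral_conj]
  refine setIntegral_congr_fun measurableSet_Ioc fun t ht => ?_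
  exact D.m.jetForm_conj D.s t _ _ (D.m_symm t (Ioc_subset_Icc_self ht))

theorem mForm_add_right (f g h : D.PreH) :
    D.mForm f.fn (g + h).fn = D.mForm f.fn g.fn + D.mForm f.fn h.fn := by
  unfold mForm
  rw [← intervalIntegral.integral_add (D.intervalIntegrable_form f g)
    (D.intervalIntegrable_form f h)]
  refine intervalIntegral.integral_congr fun t ht => ?_
  rw [uIcc_of_le D.a_lt_b.le] at ht
  simp only [OpExpr.form]
  rw [← OpExpr.jetForm_add_right]
  have key : ∀ j ∈ Finset.range (D.s + 1), iteratedDerivWithin j (g + h).fn D.ivl t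
      = iteratedDerivWithin j g.fn D.ivl t + iteratedDerivWithin j h.fn D.ivl t := fun j hj => by
    have hj' : (j : WithTop ℕ∞) ≤ D.s := by
      exact_mod_cast Nat.lt_succ_iff.1 (Finset.mem_range.1 hj)
    exact iteratedDerivWithin_add (f := g.fn) (g := h.fn) ht D.uniqueDiffOn
      ((g.2.of_le hj').contDiffWithinAt ht) ((h.2.of_le hj').contDiffWithinAt ht)
  have hs := D.s_even
  simp only [OpExpr.jetForm, Pi.add_apply]
  congr 1
  · refine Finset.sum_congr rfl fun j hj => ?_
    rw [key j (by simp only [Finset.mem_range] at hj ⊢; omega)]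
  · congr 1
    refine Finset.sum_congr rfl fun j hj => ?_
    rw [Finset.mem_range] at hj
    rw [key j (by simp only [Finset.mem_range]; omega),
      key (j + 1) (by simp only [Finset.mem_range]; omega)]

theorem mForm_smul_right (f g : D.PreH) (c : ℂ) :
    D.mForm f.fn (c • g).fn = conj c * D.mForm f.fn g.fn := by
  unfold mForm
  rw [← intervalIntegral.integral_const_mul]
  refine intervalIntegral.integral_congr fun t ht => ?_
  rw [uIcc_of_le D.a_lt_b.le] at ht
  simp only [OpExpr.form]
  rw [← OpExpr.jetForm_smul_right]
  have key : ∀ j ∈ Finset.range (D.s + 1), iteratedDerivWithin j (c • g).fn D.ivl t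
      = c • iteratedDerivWithin j g.fn D.ivl t := fun j hj => by
    have hj' : (j : WithTop ℕ∞) ≤ D.s := by
      exact_mod_cast Nat.lt_succ_iff.1 (Finset.mem_range.1 hj)
    exact iteratedDerivWithin_const_smul (f := g.fn) ht D.uniqueDiffOn c
      ((g.2.of_le hj').contDiffWithinAt ht)
  simp only [OpExpr.jetForm, Pi.smul_apply]
  congr 1
  · refine Finset.sum_congr rfl fun j hj => ?_
    rw [key j (by simp only [Finset.mem_range] at hj ⊢; omega)]
  · congr 1
    refine Finset.sum_congr rfl fun j hj => ?_
    rw [Finset.mem_range] at hj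
    rw [key j (by simp only [Finset.mem_range]; omega),
      key (j + 1) (by simp only [Finset.mem_range]; omega)]

theorem mForm_self_nonneg (f : D.PreH) : 0 ≤ (D.mForm f.fn f.fn).re := by
  have h : (D.mForm f.fn f.fn).re
      = ∫ t in D.a..D.b, (D.m.form D.ivl D.s f.fn f.fn t).re :=
    (intervalIntegral.intervalIntegral_re (𝕜 := ℂ) (D.intervalIntegrable_form f f)).symm
  rw [h]
  exact intervalIntegral.integral_nonneg D.a_lt_b.le fun t ht => D.m_nonneg t ht _

/-- The scalar product of `H`; Mathlib's scalar products are linear in the second argument. -/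
@[reducible] def core : PreInnerProductSpace.Core ℂ D.PreH where
  inner f g := D.mForm g.fn f.fn
  conj_inner_symm f g := D.mForm_conj f.fn g.fn
  re_inner_nonneg f := D.mForm_self_nonneg f
  add_left f g h := D.mForm_add_right h f g
  smul_left f g c := D.mForm_smul_right g f c

instance : SeminormedAddCommGroup D.PreH :=
  @InnerProductSpace.Core.toSeminormedAddCommGroup ℂ D.PreH _ _ _ D.core

instance : InnerProductSpace ℂ D.PreH := InnerProductSpace.ofCore D.core

/-- The Hilbert space `L²_m(a, b)`: the completion of `H`. -/
abbrev L2m : Type _ := UniformSpace.Completion D.PreH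

/-- The element of `L²_m` given by an element of `H`. -/
def toL2m (f : D.PreH) : D.L2m := (f : UniformSpace.Completion D.PreH)

/-! ### The expressions `l`, `n_λ`; the definiteness condition -/

/-- `l = Re l_i`. -/
def lRe : OpExpr 𝓗 := (D.l Complex.I).re

/-- `n_λ = l - λ m - l_λ`, so that `l_λ = l - λ m - n_λ`. -/
def n (z : ℂ) : OpExpr 𝓗 := D.lRe - z • D.m - D.l z

/-- The expression `l - n_λ`. -/
def lSubN (z : ℂ) : OpExpr 𝓗 := D.lRe - D.n z

/-- `-((Im l_λ) / Im λ){y, y}`, which for real `λ` means `-(∂ l_λ / ∂λ){y, y}`. Note that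
`(Im l_λ){y, y} = Im (l_λ{y, y})`. -/
def nevForm (z : ℂ) (y : ℝ → 𝓗) (t : ℝ) : ℝ :=
  if z.im = 0 then -(deriv (fun w => (D.l w).form D.ivl D.r y y t) z).re
  else -((D.l z).form D.ivl D.r y y t).im / z.im

/-- The definiteness condition: for some `λ₀`, some `[α, β] ∋ 0` and some `δ > 0`,
`-∫_α^β ((Im l_{λ₀}) / Im λ₀){y, y} dt ≥ δ ‖y⃗(0, l_{λ₀}, m, 0)‖²` for every solution of
`l_{λ₀}[y] = 0`. -/
def IsDefinite : Prop :=
  ∃ z ∈ D.dom, ∃ α ∈ D.ivl, ∃ β ∈ D.ivl, (0 : ℝ) ∈ Icc α β ∧ ∃ δ : ℝ, 0 < δ ∧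
    ∀ y : ℝ → 𝓗, ContDiffOn ℝ D.r y D.ivl → (∀ t ∈ D.ivl, (D.l z).apply D.ivl D.r y t = 0) →
      δ * ‖(D.l z).vecY D.m D.ivl D.r D.s y 0 0‖ ^ 2 ≤ ∫ t in α..β, D.nevForm z y t

/-! ### The first order system, characteristic operators and the resolvent -/

/-- The bounded operators on `𝓗^r`. -/
abbrev Op : Type _ := HilbertPow 𝓗 D.r →L[ℂ] HilbertPow 𝓗 D.r

/-- `Q(t, l_λ)`. -/
def Q (z : ℂ) (t : ℝ) : D.Op := (D.l z).opQ D.r t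

/-- `H(t, l_λ)`. -/
def H (z : ℂ) (t : ℝ) : D.Op := (D.l z).opH D.r t

/-- The weight `Im H(t, l_λ) / Im λ = W(t, l_λ, -Im l_λ / Im λ)`. -/
def weight (z : ℂ) (t : ℝ) : D.Op := ((z.im : ℂ)⁻¹) • opIm (D.H z t)

/-- `U[x] = ([Re Q(t, l_λ)] x, x)`. -/
def U (z : ℂ) (t : ℝ) (x : HilbertPow 𝓗 D.r) : ℝ := (inner ℂ x (opRe (D.Q z t) x)).re

/-- `G = Re Q(0, l_λ)`. -/
def G (z : ℂ) : D.Op := opRe (D.Q z 0)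

/-- `X` is the operator solution on `[a, b]` of the homogeneous system
`(i/2) ((Q X)' + Q* X') - H X = 0` with `X(0) = I`. -/
structure IsFundSol (z : ℂ) (X : ℝ → D.Op) : Prop where
  smooth : ContDiffOn ℝ 1 X D.ivl
  initial : X 0 = 1
  equation : ∀ t ∈ D.ivl,
    (Complex.I / 2) • (derivWithin (fun τ => D.Q z τ * X τ) D.ivl t
      + ContinuousLinearMap.adjoint (D.Q z t) * derivWithin X D.ivl t) - D.H z t * X t = 0

/-- The operator solution `X_λ(t)` (it exists and is unique on `[a, b]`). -/
def X (z : ℂ) : ℝ → D.Op := Classical.epsilon (D.IsFundSol z)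

/-- The kernel `X_λ(t) {M(λ) - ½ sgn(s - t) (iG)⁻¹} X_{conj λ}(s)*`. -/
def kernel (M : ℂ → D.Op) (z : ℂ) (t s : ℝ) : D.Op :=
  D.X z t * (M z - ((1 / 2 * Real.sign (s - t) : ℝ) : ℂ) • Ring.inverse (Complex.I • D.G z))
    * ContinuousLinearMap.adjoint (D.X (conj z) s)

/-- The function `x_λ(t, F)`. -/
def systemSol (M : ℂ → D.Op) (z : ℂ) (F : ℝ → HilbertPow 𝓗 D.r) (t : ℝ) : HilbertPow 𝓗 D.r :=
  ∫ s in D.a..D.b, D.kernel M z t s (D.weight z s (F s))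

/-- `M` is a characteristic operator of the equation `l_λ[y] = -((Im l_λ) / Im λ)[f]`, that is, of
the system `(i/2) ((Q x)' + Q* x') - H x = W_λ F`. -/
structure IsCharOp (M : ℂ → D.Op) : Prop where
  analytic : DifferentiableOn ℂ M {z | z.im ≠ 0}
  symm : ∀ z : ℂ, z.im ≠ 0 → M z = ContinuousLinearMap.adjoint (M (conj z))
  boundary : ∀ z : ℂ, z.im ≠ 0 → ∀ F : ℝ → HilbertPow 𝓗 D.r,
    AEStronglyMeasurable F (volume.restrict D.ivl) →
    IntegrableOn (fun t => (inner ℂ (F t) (D.weight z t (F t))).re) D.ivl →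
    (∃ α β : ℝ, D.a < α ∧ β < D.b ∧ ∀ t, t ∉ Icc α β → F t = 0) →
    ∃ c : ℝ, c ≤ 0 ∧ Tendsto
      (fun e : ℝ × ℝ => z.im * (D.U z e.2 (D.systemSol M z F e.2)
        - D.U z e.1 (D.systemSol M z F e.1)))
      (𝓝[>] D.a ×ˢ 𝓝[<] D.b) (𝓝 c)

/-- The function `y_1(t, λ, f)`: the first component of
`∫ X_λ(t) {M(λ) - ½ sgn(s - t) (iG)⁻¹} X_{conj λ}(s)* W(s, l_{conj λ}, m) F(s, l_{conj λ}, m) ds`. -/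
def resolventFn (M : ℂ → D.Op) (z : ℂ) (f : ℝ → 𝓗) (t : ℝ) : 𝓗 :=
  (∫ s in D.a..D.b, D.kernel M z t s
    ((D.l (conj z)).opW D.m D.r s ((D.l (conj z)).vecF D.ivl D.r D.s f s))) ⟨0, D.r_pos⟩

/-- The graph of the resolvent `R(λ)`: the closure in `L²_m × L²_m` of the graph of the operator
`f ↦ y_1(·, λ, f)`, `f ∈ H`. -/
def resolvent (M : ℂ → D.Op) (z : ℂ) : Set (D.L2m × D.L2m) :=
  closure {x | ∃ f y : D.PreH, (∀ t ∈ D.ivl, y.fn t = D.resolventFn M z f.fn t) ∧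
    x = (D.toL2m f, D.toL2m y)}

/-! ### Boundary conditions and the relation `T(λ)` -/

/-- The quadratic form of `(Im λ) diag (Re Q(a, l_λ), -Re Q(b, l_λ))` on `𝓗^r ⊕ 𝓗^r`. -/
def bdryForm (z : ℂ) (x : HilbertPow 𝓗 D.r × HilbertPow 𝓗 D.r) : ℝ :=
  z.im * (D.U z D.a x.1 - D.U z D.b x.2)

/-- A maximal subspace among those on which the quadratic form is nonnegative. -/
def IsMaxNonneg (z : ℂ) (S : Submodule ℂ (HilbertPow 𝓗 D.r × HilbertPow 𝓗 D.r)) : Prop :=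
  (∀ x ∈ S, 0 ≤ D.bdryForm z x) ∧
    ∀ S' : Submodule ℂ (HilbertPow 𝓗 D.r × HilbertPow 𝓗 D.r), S ≤ S' → (∀ x ∈ S', 0 ≤ D.bdryForm z x) → S' = S

/-- The conditions on the operator functions `𝓜_λ`, `𝓝_λ` of the boundary conditions. -/
structure IsBdryPair (Mb Nb : ℂ → D.Op) : Prop where
  analytic_left : DifferentiableOn ℂ Mb {z | z.im ≠ 0}
  analytic_right : DifferentiableOn ℂ Nb {z | z.im ≠ 0}
  symm : ∀ z : ℂ, z.im ≠ 0 →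
    ContinuousLinearMap.adjoint (Mb (conj z)) * opRe (D.Q z D.a) * Mb z
      = ContinuousLinearMap.adjoint (Nb (conj z)) * opRe (D.Q z D.b) * Nb z
  nondegenerate : ∀ z : ℂ, z.im ≠ 0 → ∀ h : HilbertPow 𝓗 D.r, h ≠ 0 → 0 < ‖Mb z h‖ + ‖Nb z h‖
  maxNonneg : ∀ z : ℂ, z.im ≠ 0 →
    D.IsMaxNonneg z (LinearMap.range
      ((Mb z : HilbertPow 𝓗 D.r →ₗ[ℂ] HilbertPow 𝓗 D.r).prod (Nb z : HilbertPow 𝓗 D.r →ₗ[ℂ] HilbertPow 𝓗 D.r)))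

/-- `X_λ(a)⁻¹ 𝓜_λ - X_λ(b)⁻¹ 𝓝_λ`. -/
def bdryDiff (Mb Nb : ℂ → D.Op) (z : ℂ) : D.Op :=
  Ring.inverse (D.X z D.a) * Mb z - Ring.inverse (D.X z D.b) * Nb z

/-- The operator `M(λ) = -½ (X_λ(a)⁻¹ 𝓜_λ + X_λ(b)⁻¹ 𝓝_λ) (X_λ(a)⁻¹ 𝓜_λ - X_λ(b)⁻¹ 𝓝_λ)⁻¹ (iG)⁻¹`. -/
def bdryCharOp (Mb Nb : ℂ → D.Op) (z : ℂ) : D.Op :=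
  (-(1 / 2) : ℂ) • ((Ring.inverse (D.X z D.a) * Mb z + Ring.inverse (D.X z D.b) * Nb z)
    * Ring.inverse (D.bdryDiff Mb Nb z) * Ring.inverse (Complex.I • D.G z))

/-- The vector `y⃗(t, l - n_λ, m, f)`; here `l - n_λ` is regarded as an expression of the same formal
order `r` as `l_λ`. -/
def vecYN (z : ℂ) (y f : ℝ → 𝓗) (t : ℝ) : HilbertPow 𝓗 D.r :=
  (D.lSubN z).vecY D.m D.ivl D.r D.s y f t

/-- The relation `T'(λ)` of the pairs `{y, f}` with `y` of class `C^r`, `f ∈ H`,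
`(l - n_λ)[y] = m[f]`, subject to the boundary conditions
`y⃗(a, l - n_λ, m, f) = 𝓜_λ h`, `y⃗(b, l - n_λ, m, f) = 𝓝_λ h` for some `h ∈ 𝓗^r`. -/
def preT (Mb Nb : ℂ → D.Op) (z : ℂ) : Set (D.L2m × D.L2m) :=
  {x | ∃ y f : D.PreH, ContDiffOn ℝ D.r y.fn D.ivl ∧
    (∀ t ∈ D.ivl, (D.lSubN z).apply D.ivl D.r y.fn t = D.m.apply D.ivl D.s f.fn t) ∧
    (∃ h : HilbertPow 𝓗 D.r, D.vecYN z y.fn f.fn D.a = Mb z h ∧ D.vecYN z y.fn f.fn D.b = Nb z h) ∧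
    x = (D.toL2m y, D.toL2m f)}

/-- `T(λ)`: the closure of `T'(λ)` in `L²_m × L²_m`. -/
def T (Mb Nb : ℂ → D.Op) (z : ℂ) : Set (D.L2m × D.L2m) := closure (D.preT Mb Nb z)

/-- `(T - λ)⁻¹ = {(f - λ y, y) | (y, f) ∈ T}` for a relation `T`. -/
def relResolvent (T : Set (D.L2m × D.L2m)) (z : ℂ) : Set (D.L2m × D.L2m) :=
  {x | ∃ y f : D.L2m, (y, f) ∈ T ∧ x = (f - z • y, y)}

end NevanlinnaExprPair

end

noncomputable section

/-! The equation `l_λ[y] = m[f]` is equivalent to a Hamiltonian system for the vector of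
quasi-derivatives; the corollary is a theorem about that system together with a translation back to
functions.

Translation. Quasi-derivatives satisfy the recursion `z_j = c_j - z_{j+1}'`, which has only one
solution that vanishes for large `j`. This gives `vecY_solves` and, after a bootstrap of regularity,
the converse `apply_of_system`. Moreover `(l - n_λ)[y] = m[f]` means `l_λ[y] = m[f - λy]`, with the
same vector of quasi-derivatives. So the relation `T(λ)` corresponds to the solution operator under
`(y, f) ↦ (f - λy, y)`, a homeomorphism of `L²_m × L²_m` and hence compatible with closures.

Nevanlinna structure. For a fixed point `t` and a fixed jet `u` the function `z ↦ -l_z{u, u}` has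
the Nevanlinna property. Harnack's inequality compares its values at two parameters with constants
independent of `t` and `u`, and estimates for typically real functions include real parameters.
Consequently the leading odd coefficients, and with them `Q`, do not depend on `λ` (`s_top_eq`); and
the definiteness hypothesis at `λ₀` yields `∫ (W_λ X_λ u, X_λ u) ≥ δ_λ ‖u‖²` at every nonreal `λ`
(`exists_le_integral_energy`). The same inequality for `z ↦ (H_z x, x)` makes `X_λ` analytic
(`differentiableAt_X`).

Boundary values. By Lagrange's identity the form `𝒬` is uniformly negative on `{(X_λ(a)u, X_λ(b)u)}`
and uniformly positive on the same space formed with `conj λ`. The first fact bounds `K = X_λ(a)⁻¹𝓜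
- X_λ(b)⁻¹𝓝` from below. By the second, a vector orthogonal to the range of `K` produces an element
that is `𝒬`-orthogonal to the maximal nonnegative subspace, so it lies in that subspace, is
isotropic and vanishes. Hence `K` is invertible (`isUnit_diffOp`). With `J = (iG)⁻¹` the definition
of `M(λ)` says that `M - ½J = -X_λ(a)⁻¹𝓜 K⁻¹J` and `M + ½J = -X_λ(b)⁻¹𝓝 K⁻¹J`. Thus the kernel
integrals are exactly the solutions that satisfy the boundary conditions, and the inequality for a
characteristic operator is the nonnegativity of the subspace.

Converse. Given `M`, take `𝓜 = X_λ(a)(M - ½J)` and `𝓝 = X_λ(b)(M + ½J)`. Definiteness survives on a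
compact part of the open interval, so every vector is `∫ X*WF` for some compactly supported `F`, and
the inequality for all such `F` is nonnegativity on the whole subspace. Maximality holds because
this subspace and the negative one together span the space. For this pair `K = -J`, and the formula
returns `M`. -/

/-! ### Harnack-type estimates for holomorphic functions -/

theorem norm_sub_le_of_re_nonneg {f : ℂ → ℂ} {c : ℂ} {R : ℝ} (hR : 0 < R)
    (hf : DifferentiableOn ℂ f (Metric.ball c R)) (h0 : ∀ z ∈ Metric.ball c R, 0 ≤ (f z).re)
    {z : ℂ} (hz : ‖z - c‖ ≤ R / 2) : ‖f z - f c‖ ≤ 4 * ‖z - c‖ / R * (f c).re := by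
  have hc : c ∈ Metric.ball c R := Metric.mem_ball_self hR
  -- Borel–Carathéodory for `w ↦ f c - f (w + c)`, whose real part is at most `Re f(c)`. A positive
  -- bound is required while `Re f(c)` may vanish, so every larger `M` is used and then `M` tends to
  -- `Re f(c)`. The restriction to half the radius turns `2r/(R - r)` into `4r/R`.
  have key : ∀ M : ℝ, (f c).re < M → ‖f z - f c‖ ≤ 4 * ‖z - c‖ / R * M := by
    intro M hM
    have hM0 : 0 < M := (h0 c hc).trans_lt hM
    have hmap : ∀ w ∈ Metric.ball (0 : ℂ) R, w + c ∈ Metric.ball c R := fun w hw => by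
      simpa [Metric.mem_ball, dist_eq_norm] using hw
    have h := Complex.borelCaratheodory_zero (f := fun w => f c - f (w + c)) (R := R)
      (z := z - c) hM0 ?_ ?_ hR ?_ ?_
    · simp only [sub_add_cancel] at h
      rw [norm_sub_rev] at h
      refine h.trans ?_
      rw [div_mul_eq_mul_div, div_le_div_iff₀ (by linarith) hR]
      nlinarith [mul_nonneg (norm_nonneg (z - c)) hM0.le]
    · exact (differentiableOn_const _).sub
        (hf.comp (differentiableOn_id.add (differentiableOn_const _)) hmap)
    · intro w hw
      have := h0 _ (hmap w hw)
      simp only [Set.mem_ofPred_eq, Complex.sub_re]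
      linarith
    · simp only [Metric.mem_ball, dist_zero_right]; linarith
    · simp
  have hlim : Tendsto (fun M : ℝ => 4 * ‖z - c‖ / R * M) (𝓝[>] (f c).re)
      (𝓝 (4 * ‖z - c‖ / R * (f c).re)) :=
    ((continuous_const.mul continuous_id).tendsto _).mono_left nhdsWithin_le_nhds
  exact ge_of_tendsto hlim (eventually_nhdsWithin_of_forall fun M hM => key M hM)

/-- On the circle `|w - c| = R` one has `R² = (w - c) conj(w - c)`, so the expression equals `-2i Im
w (h(w) - h(c))`. Its real part is `2 Im w Im h(w) ≥ 0`, because `h(c)` is real. The maximum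
principle for `exp(-P)` carries the sign into the disc. -/
theorem re_typicallyReal_nonneg {h : ℂ → ℂ} {c R : ℝ} (hR : 0 < R)
    (hh : DifferentiableOn ℂ h (Metric.closedBall (c : ℂ) R)) (h0 : (h c).im = 0)
    (hpos : ∀ z ∈ Metric.closedBall (c : ℂ) R, z.im ≠ 0 → 0 ≤ (h z).im / z.im)
    {z : ℂ} (hz : z ∈ Metric.closedBall (c : ℂ) R) :
    0 ≤ (((R : ℂ) ^ 2 - (z - c) ^ 2) * dslope h c z).re := by
  have hds : DifferentiableOn ℂ (dslope h (c : ℂ)) (Metric.closedBall (c : ℂ) R) :=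
    (Complex.differentiableOn_dslope (Metric.closedBall_mem_nhds _ hR)).2 hh
  set P : ℂ → ℂ := fun z => ((R : ℂ) ^ 2 - (z - c) ^ 2) * dslope h c z with hP
  have hPd : DifferentiableOn ℂ P (Metric.closedBall (c : ℂ) R) :=
    (DifferentiableOn.sub (differentiableOn_const _)
      ((differentiableOn_id.sub (differentiableOn_const _)).pow 2)).mul hds
  have hE : DifferentiableOn ℂ (fun z => Complex.exp (-P z)) (Metric.closedBall (c : ℂ) R) :=
    hPd.neg.cexp
  have hcl : closure (Metric.ball (c : ℂ) R) = Metric.closedBall (c : ℂ) R :=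
    closure_ball _ hR.ne'
  have hd : DiffContOnCl ℂ (fun z => Complex.exp (-P z)) (Metric.ball (c : ℂ) R) := by
    refine DifferentiableOn.diffContOnCl ?_
    rwa [hcl]
  have hbd : ∀ w ∈ frontier (Metric.ball (c : ℂ) R), ‖Complex.exp (-P w)‖ ≤ 1 := by
    intro w hw
    rw [frontier_ball _ hR.ne', Metric.mem_sphere, dist_eq_norm] at hw
    have hwc : w ≠ c := by rintro rfl; simp at hw; linarith
    have hw0 : w - c ≠ 0 := sub_ne_zero.2 hwc
    rw [Complex.norm_exp]
    refine Real.exp_le_one_iff.2 ?_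
    have e1 : (R : ℂ) ^ 2 = (w - c) * conj (w - c) := by
      rw [Complex.mul_conj, Complex.normSq_eq_norm_sq, hw]; push_cast; ring
    have e2 : P w = (-(2 * w.im : ℝ) * Complex.I) * (h w - h c) := by
      simp only [hP]
      rw [dslope_of_ne _ hwc, slope_def_field, e1]
      have : (w - c) * conj (w - c) - (w - c) ^ 2 = (w - c) * (conj (w - c) - (w - c)) := by ring
      rw [this]
      have e3 : conj (w - (c : ℂ)) - (w - c) = (-(2 * w.im : ℝ) * Complex.I) := by
        apply Complex.ext <;> simp; ring
      rw [e3]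
      field_simp
    rw [e2]
    have hw' : w ∈ Metric.closedBall (c : ℂ) R := by
      rw [Metric.mem_closedBall, dist_eq_norm]; exact hw.le
    have e4 : (-((-(2 * w.im : ℝ) * Complex.I) * (h w - h c))).re = -(2 * (w.im * (h w).im)) := by
      simp [Complex.mul_re, h0]; ring
    rw [e4]
    by_cases hi : w.im = 0
    · simp [hi]
    · have h1 := hpos w hw' hi
      have : w.im * (h w).im = (h w).im / w.im * w.im ^ 2 := by field_simp
      rw [this]
      nlinarith [mul_nonneg h1 (sq_nonneg w.im)]
  have := Complex.norm_le_of_forall_mem_frontier_norm_le Metric.isBounded_ball hd hbd (z := z)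
    (by rwa [hcl])
  rw [Complex.norm_exp, Real.exp_le_one_iff, Complex.neg_re] at this
  exact neg_nonpos.1 this

/-- Conjugation exchanges the difference quotients at `c + ie` and `c - ie`, so their common limit
is its own conjugate. -/
theorem im_deriv_eq_zero {h : ℂ → ℂ} {c R : ℝ} (hR : 0 < R)
    (hh : DifferentiableOn ℂ h (Metric.closedBall (c : ℂ) R)) (h0 : (h c).im = 0)
    (hsymm : ∀ z ∈ Metric.closedBall (c : ℂ) R, z.im ≠ 0 → h (conj z) = conj (h z)) :
    (deriv h (c : ℂ)).im = 0 := by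
  have hmem := Metric.closedBall_mem_nhds (c : ℂ) hR
  have hcont : ContinuousAt (dslope h (c : ℂ)) c :=
    continuousAt_dslope_same.2 (hh.differentiableAt hmem)
  have t1 : Tendsto (fun e : ℝ => (c : ℂ) + e * Complex.I) (𝓝[>] 0) (𝓝 (c : ℂ)) := by
    have : Continuous (fun e : ℝ => (c : ℂ) + e * Complex.I) := by fun_prop
    simpa using (this.tendsto 0).mono_left nhdsWithin_le_nhds
  have t2 : Tendsto (fun e : ℝ => (c : ℂ) - e * Complex.I) (𝓝[>] 0) (𝓝 (c : ℂ)) := by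
    have : Continuous (fun e : ℝ => (c : ℂ) - e * Complex.I) := by fun_prop
    simpa using (this.tendsto 0).mono_left nhdsWithin_le_nhds
  have l1 := (Complex.continuous_conj.tendsto _).comp (hcont.tendsto.comp t1)
  have l2 := hcont.tendsto.comp t2
  have heq : (conj ∘ dslope h (c : ℂ) ∘ fun e : ℝ => (c : ℂ) + e * Complex.I) =ᶠ[𝓝[>] 0]
      (dslope h (c : ℂ) ∘ fun e : ℝ => (c : ℂ) - e * Complex.I) := by
    filter_upwards [t1.eventually hmem, self_mem_nhdsWithin] with e he he0
    have he0 : (0 : ℝ) < e := he0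
    have n1 : (c : ℂ) + e * Complex.I ≠ c := by simpa using he0.ne'
    have n2 : (c : ℂ) - e * Complex.I ≠ c := by simpa using he0.ne'
    have hs := hsymm _ he (by simpa using he0.ne')
    have hcc : conj (h c) = h c := Complex.conj_eq_iff_im.2 h0
    simp only [map_add, map_mul, Complex.conj_ofReal, Complex.conj_I, mul_neg,
      ← sub_eq_add_neg] at hs
    simp only [Function.comp, dslope_of_ne _ n1, dslope_of_ne _ n2, slope_def_field, hs, map_div₀,
      map_sub, map_add, map_mul, Complex.conj_ofReal, Complex.conj_I, hcc]
    ring_nf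
  have := tendsto_nhds_unique (l1.congr' heq) l2
  rw [dslope_same] at this
  exact Complex.conj_eq_iff_im.1 this

/-- Comparison of a typically real function near a real point with its values at a nonreal point. -/
theorem typicallyReal_bounds {h : ℂ → ℂ} {c R : ℝ} (hR : 0 < R)
    (hh : DifferentiableOn ℂ h (Metric.closedBall (c : ℂ) R)) (h0 : (h c).im = 0)
    (hpos : ∀ z ∈ Metric.closedBall (c : ℂ) R, z.im ≠ 0 → 0 ≤ (h z).im / z.im)
    (hsymm : ∀ z ∈ Metric.closedBall (c : ℂ) R, z.im ≠ 0 → h (conj z) = conj (h z)) :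
    (deriv h c).re ≤ 4 * ((h (c + (R / 8 : ℝ) * Complex.I)).im / (R / 8)) ∧
    ‖h (c + (R / 8 : ℝ) * Complex.I) - h c‖
      ≤ 4 * (R / 8) * ((h (c + (R / 8 : ℝ) * Complex.I)).im / (R / 8)) := by
  -- At distance `R/8` the Harnack constant `4(R/8)/R` is `1/2`, so `P(c)` and `P(z₁)` are
  -- comparable. Up to explicit factors `P(c)` is `h'(c)` and `P(z₁)` is `h(z₁) - h(c)`.
  set z₁ : ℂ := c + (R / 8 : ℝ) * Complex.I with hz₁
  have hz1c : z₁ - c = (R / 8 : ℝ) * Complex.I := by rw [hz₁]; ring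
  have hnorm : ‖z₁ - c‖ = R / 8 := by
    rw [hz1c]; simp only [norm_mul, Complex.norm_I, mul_one, Complex.norm_real, Real.norm_eq_abs]
    exact abs_of_pos (by linarith)
  have hne : z₁ ≠ c := fun e => by rw [e, sub_self, norm_zero] at hnorm; linarith
  set P : ℂ → ℂ := fun z => ((R : ℂ) ^ 2 - (z - c) ^ 2) * dslope h c z with hP
  have hds : DifferentiableOn ℂ (dslope h (c : ℂ)) (Metric.closedBall (c : ℂ) R) :=
    (Complex.differentiableOn_dslope (Metric.closedBall_mem_nhds _ hR)).2 hh
  have hPd : DifferentiableOn ℂ P (Metric.ball (c : ℂ) R) :=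
    ((DifferentiableOn.sub (differentiableOn_const _)
      ((differentiableOn_id.sub (differentiableOn_const _)).pow 2)).mul hds).mono
      Metric.ball_subset_closedBall
  have hbc := norm_sub_le_of_re_nonneg hR hPd (fun z hz =>
    re_typicallyReal_nonneg hR hh h0 hpos (Metric.ball_subset_closedBall hz)) (z := z₁)
    (by rw [hnorm]; linarith)
  have hPc : P c = (R : ℂ) ^ 2 * deriv h c := by simp [hP]
  have hPcre : (P c).re = R ^ 2 * (deriv h c).re := by
    rw [hPc]; norm_cast; rw [Complex.re_ofReal_mul]
  have hP1 : P z₁ = ((R ^ 2 + (R / 8) ^ 2) / (R / 8) : ℝ) * (-Complex.I * (h z₁ - h c)) := by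
    simp only [hP]
    rw [dslope_of_ne _ hne, slope_def_field, hz1c]
    have hRc : (R : ℂ) ≠ 0 := by exact_mod_cast hR.ne'
    push_cast
    field_simp
    have : Complex.I ^ 2 = -1 := Complex.I_sq
    linear_combination ((h z₁ - h c) * 64) * this
  have hP1re : (P z₁).re = (R ^ 2 + (R / 8) ^ 2) * ((h z₁).im / (R / 8)) := by
    rw [hP1, Complex.re_ofReal_mul]
    simp [h0]; ring
  have hP1n : ‖P z₁‖ = (R ^ 2 + (R / 8) ^ 2) / (R / 8) * ‖h z₁ - h c‖ := by
    rw [hP1, norm_mul, norm_mul, norm_neg, Complex.norm_I, one_mul, Complex.norm_real,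
      Real.norm_of_nonneg (by positivity)]
  have e : 4 * (R / 8) / R = (1 / 2 : ℝ) := by field_simp; norm_num
  rw [hnorm, e] at hbc
  have hre := (abs_le.1 ((Complex.abs_re_le_norm (P z₁ - P c)).trans hbc)).1
  rw [Complex.sub_re] at hre
  have hPc2 : (P c).re ≤ 2 * (P z₁).re := by linarith
  set v := (h z₁).im / (R / 8) with hv
  have hPc0 : 0 ≤ (P c).re :=
    re_typicallyReal_nonneg hR hh h0 hpos (Metric.mem_closedBall_self hR.le)
  have hv0 : 0 ≤ v := by
    have : 0 ≤ (P z₁).re := by linarith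
    rw [hP1re] at this
    exact nonneg_of_mul_nonneg_right this (by positivity)
  constructor
  · rw [hPcre, hP1re] at hPc2
    have hR2 : 0 < R ^ 2 := by positivity
    by_contra hcon
    push Not at hcon
    nlinarith [mul_lt_mul_of_pos_left hcon hR2, mul_nonneg hR2.le hv0]
  · have hIm : (deriv h (c : ℂ)).im = 0 := im_deriv_eq_zero hR hh h0 hsymm
    have hPcn : ‖P c‖ = (P c).re := by
      have : (P c).im = 0 := by
        rw [hPc]; norm_cast; rw [Complex.im_ofReal_mul, hIm, mul_zero]
      have e2 : P c = ((P c).re : ℂ) := Complex.ext (by simp) (by simp [this])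
      rw [e2, Complex.norm_real, Complex.ofReal_re, Real.norm_of_nonneg hPc0]
    have h2 : ‖P z₁‖ ≤ 4 * (P z₁).re := by
      have := norm_le_norm_add_norm_sub' (P z₁) (P c)
      linarith
    rw [hP1n, hP1re] at h2
    have hK : 0 < (R ^ 2 + (R / 8) ^ 2) := by positivity
    rw [div_mul_eq_mul_div, div_le_iff₀ (by positivity)] at h2
    refine le_of_mul_le_mul_left (h2.trans (le_of_eq ?_)) hK
    ring

/-- Multiplication by `t` gives `pt² - bt + q ≥ 0` for `t > 0`; for `t ≤ 0` this is clear from the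
signs, so the discriminant is nonpositive. This optimisation over a scale replaces the
Cauchy–Schwarz inequality below. -/
theorem sq_le_of_forall_pos_le {p q b : ℝ} (hp : 0 ≤ p) (hq : 0 ≤ q) (hb : 0 ≤ b)
    (h : ∀ t : ℝ, 0 < t → b ≤ t * p + q / t) : b ^ 2 ≤ 4 * p * q := by
  have := discrim_le_zero (a := p) (b := -b) (c := q) fun t => by
    rcases le_or_gt t 0 with ht | ht
    · nlinarith [mul_nonneg hp (mul_self_nonneg t), mul_nonneg hb (neg_nonneg.2 ht)]
    · have := mul_le_mul_of_nonneg_right (h t ht) ht.le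
      rw [add_mul, div_mul_cancel₀ _ ht.ne'] at this
      nlinarith
  rw [discrim] at this
  linarith

/-! ### Sesquilinear forms dominated by a nonnegative form -/

section Sesq

variable {V : Type*} [AddCommGroup V] [Module ℂ V]

/-- Polarization bounds `‖B u v‖` by `C (N(u) + N(v))`, since the cross terms of `N` cancel in the
parallelogram law. Replacing `(u, v)` by `(√t u, v/√t)` and optimising over `t` turns the sum into a
product. `B` is not assumed Hermitian, which costs the factor 4. -/
theorem norm_sq_le_of_norm_diag_le (B N : V →ₗ⋆[ℂ] V →ₗ[ℂ] ℂ) {C : ℝ} (hC : 0 ≤ C)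
    (hN : ∀ u, 0 ≤ (N u u).re) (hB : ∀ u, ‖B u u‖ ≤ C * (N u u).re) (u v : V) :
    ‖B u v‖ ^ 2 ≤ 4 * C ^ 2 * ((N u u).re * (N v v).re) := by
  have h1 : ∀ u v : V, ‖B u v‖ ≤ C * ((N u u).re + (N v v).re) := by
    intro u v
    have e : 4 * B u v = (B (u + v) (u + v) - B (u - v) (u - v))
        - Complex.I * (B (u + Complex.I • v) (u + Complex.I • v)
          - B (u - Complex.I • v) (u - Complex.I • v)) := by
      simp only [map_add, map_sub, LinearMap.add_apply, LinearMap.sub_apply, map_smul,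
        LinearMap.map_smulₛₗ, LinearMap.smul_apply, smul_eq_mul, Complex.conj_I]
      linear_combination (2 * B u v - 2 * B v u) * Complex.I_sq
    have p1 : (N (u + v) (u + v)).re + (N (u - v) (u - v)).re
        = 2 * (N u u).re + 2 * (N v v).re := by
      simp only [map_add, map_sub, LinearMap.add_apply, LinearMap.sub_apply, Complex.add_re,
        Complex.sub_re]
      ring
    have p2 : (N (u + Complex.I • v) (u + Complex.I • v)).re
        + (N (u - Complex.I • v) (u - Complex.I • v)).re
        = 2 * (N u u).re + 2 * (N v v).re := by
      have e2 : N (u + Complex.I • v) (u + Complex.I • v) + N (u - Complex.I • v) (u - Complex.I • v)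
          = (2 : ℝ) * N u u + (2 : ℝ) * N v v := by
        simp only [map_add, map_sub, LinearMap.add_apply, LinearMap.sub_apply, map_smul,
          LinearMap.map_smulₛₗ, LinearMap.smul_apply, smul_eq_mul, Complex.conj_I]
        push_cast
        linear_combination (-2 * N v v) * Complex.I_sq
      rw [← Complex.add_re, e2, Complex.add_re, Complex.re_ofReal_mul, Complex.re_ofReal_mul]
    have h4 : ‖(4 : ℂ) * B u v‖ = 4 * ‖B u v‖ := by simp
    have hle : ‖(4 : ℂ) * B u v‖ ≤ (‖B (u + v) (u + v)‖ + ‖B (u - v) (u - v)‖)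
        + (‖B (u + Complex.I • v) (u + Complex.I • v)‖
          + ‖B (u - Complex.I • v) (u - Complex.I • v)‖) := by
      rw [e]
      refine (norm_sub_le _ _).trans (add_le_add (norm_sub_le _ _) ?_)
      rw [norm_mul, Complex.norm_I, one_mul]
      exact norm_sub_le _ _
    have b1 := hB (u + v)
    have b2 := hB (u - v)
    have b3 := hB (u + Complex.I • v)
    have b4 := hB (u - Complex.I • v)
    rw [h4] at hle
    have s1 : C * (N (u + v) (u + v)).re + C * (N (u - v) (u - v)).re
        = C * (2 * (N u u).re + 2 * (N v v).re) := by rw [← mul_add, p1]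
    have s2 : C * (N (u + Complex.I • v) (u + Complex.I • v)).re
        + C * (N (u - Complex.I • v) (u - Complex.I • v)).re
        = C * (2 * (N u u).re + 2 * (N v v).re) := by rw [← mul_add, p2]
    linarith
  have h2 := sq_le_of_forall_pos_le (p := C * (N u u).re) (q := C * (N v v).re) (b := ‖B u v‖)
    (mul_nonneg hC (hN u)) (mul_nonneg hC (hN v)) (norm_nonneg _) fun t ht => by
    have hs : 0 < Real.sqrt t := Real.sqrt_pos.2 ht
    have hs2 : Real.sqrt t * Real.sqrt t = t := Real.mul_self_sqrt ht.le
    have := h1 ((Real.sqrt t : ℂ) • u) ((Real.sqrt t : ℂ)⁻¹ • v)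
    have hsc : (Real.sqrt t : ℂ) ≠ 0 := by exact_mod_cast hs.ne'
    simp only [map_smul, LinearMap.map_smulₛₗ, LinearMap.smul_apply, smul_eq_mul,
      Complex.conj_ofReal, map_inv₀] at this
    rw [inv_mul_cancel_left₀ hsc, ← mul_assoc, ← mul_assoc, ← mul_inv] at this
    norm_cast at this
    rw [hs2, Complex.re_ofReal_mul, Complex.re_ofReal_mul] at this
    refine this.trans (le_of_eq ?_)
    field_simp
  nlinarith

end Sesq

section OperatorBounds

variable {E : Type*} [NormedAddCommGroup E] [InnerProductSpace ℂ E]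

/-- The sesquilinear form `(u, v) ↦ ⟪u, T v⟫`. -/
def opSesq (T : E →L[ℂ] E) : E →ₗ⋆[ℂ] E →ₗ[ℂ] ℂ :=
  LinearMap.mk₂'ₛₗ _ _ (fun u v => inner ℂ u (T v)) (fun u v w => inner_add_left _ _ _)
    (fun c u v => inner_smul_left _ _ _) (fun u v w => by rw [map_add, inner_add_right])
    (fun c u v => by rw [map_smul, inner_smul_right]; rfl)

@[simp] theorem opSesq_apply (T : E →L[ℂ] E) (u v : E) : opSesq T u v = inner ℂ u (T v) := rfl

/-- The bound of the norm by twice the numerical radius: the form estimate at the pair `(T x, x)`,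
divided by `‖T x‖²`. -/
theorem opNorm_le_of_norm_inner_self_le (T : E →L[ℂ] E) {C : ℝ} (hC : 0 ≤ C)
    (h : ∀ x, ‖(inner ℂ x (T x) : ℂ)‖ ≤ C * ‖x‖ ^ 2) : ‖T‖ ≤ 2 * C := by
  have hid : ∀ x : E, (opSesq (ContinuousLinearMap.id ℂ E) x x).re = ‖x‖ ^ 2 := fun x => by
    simp only [opSesq_apply, ContinuousLinearMap.id_apply]
    exact inner_self_eq_norm_sq (𝕜 := ℂ) x
  refine T.opNorm_le_bound (by positivity) fun x => ?_
  have := norm_sq_le_of_norm_diag_le (opSesq T) (opSesq (ContinuousLinearMap.id ℂ E)) hC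
    (fun u => by rw [hid]; positivity) (fun u => by rw [hid]; exact h u) (T x) x
  rw [hid, hid, opSesq_apply, inner_self_eq_norm_sq_to_K] at this
  simp only [Complex.coe_algebraMap, norm_pow, Complex.norm_real, norm_norm] at this
  rcases eq_or_ne (T x) 0 with h0 | h0
  · rw [h0, norm_zero]; positivity
  · have hp : 0 < ‖T x‖ := norm_pos_iff.2 h0
    refine le_of_sq_le_sq ?_ (by positivity)
    have hp2 : 0 < ‖T x‖ ^ 2 := by positivity
    refine le_of_mul_le_mul_left (this.trans' (le_of_eq ?_) |>.trans (le_of_eq ?_)) hp2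
    · ring
    · ring

/-- The form estimate with both forms equal to that of `W`, at the pair `(W x, x)`. It controls `W
F` when only the density `(W F, F)` is known to be integrable. -/
theorem norm_sq_apply_le_of_nonneg (W : E →L[ℂ] E) (h0 : ∀ x, 0 ≤ (inner ℂ x (W x) : ℂ).re)
    (him : ∀ x, (inner ℂ x (W x) : ℂ).im = 0) (x : E) :
    ‖W x‖ ^ 2 ≤ 4 * ‖W‖ * (inner ℂ x (W x) : ℂ).re := by
  have hn : ∀ u, ‖(inner ℂ u (W u) : ℂ)‖ = (inner ℂ u (W u) : ℂ).re := fun u => by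
    have e : (inner ℂ u (W u) : ℂ) = ((inner ℂ u (W u) : ℂ).re : ℂ) :=
      Complex.ext (by simp) (by simp [him u])
    rw [e, Complex.norm_real, Complex.ofReal_re, Real.norm_of_nonneg (h0 u)]
  have := norm_sq_le_of_norm_diag_le (opSesq W) (opSesq W) zero_le_one h0
    (fun u => by rw [one_mul]; exact (hn u).le) (W x) x
  simp only [opSesq_apply] at this
  rw [inner_self_eq_norm_sq_to_K] at this
  simp only [Complex.coe_algebraMap, norm_pow, Complex.norm_real, norm_norm] at this
  have h1 : (inner ℂ (W x) (W (W x)) : ℂ).re ≤ ‖W‖ * ‖W x‖ ^ 2 := by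
    refine (Complex.re_le_norm _).trans ((norm_inner_le_norm _ _).trans ?_)
    have := W.le_opNorm (W x)
    nlinarith [norm_nonneg (W x)]
  rcases eq_or_ne (W x) 0 with hz | hz
  · rw [hz, norm_zero]; simp
  · have hp2 : 0 < ‖W x‖ ^ 2 := by have := norm_pos_iff.2 hz; positivity
    refine le_of_mul_le_mul_left ?_ hp2
    nlinarith [mul_le_mul_of_nonneg_right h1 (h0 x)]

end OperatorBounds

/-- A function with values in `C(K, F)` which is continuous and pointwise holomorphic is
holomorphic. -/
theorem differentiableOn_continuousMap {K F : Type*} [TopologicalSpace K] [CompactSpace K]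
    [NormedAddCommGroup F] [NormedSpace ℂ F] [CompleteSpace F] {U : Set ℂ} (hU : IsOpen U)
    {f : ℂ → C(K, F)} (hf : ContinuousOn f U)
    (hp : ∀ t : K, DifferentiableOn ℂ (fun z => f z t) U) : DifferentiableOn ℂ f U := by
  intro z₀ hz₀
  obtain ⟨ε, hε, hball⟩ := Metric.isOpen_iff.1 hU z₀ hz₀
  set R : NNReal := ⟨ε / 2, by positivity⟩ with hR
  have hR0 : 0 < (R : ℝ) := half_pos hε
  have hcb : Metric.closedBall z₀ R ⊆ U := fun z hz => hball <| by
    rw [Metric.mem_closedBall] at hz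
    rw [Metric.mem_ball]
    have : (R : ℝ) = ε / 2 := rfl
    linarith
  have hci : CircleIntegrable f z₀ R := (hf.mono hcb |>.mono
    Metric.sphere_subset_closedBall).circleIntegrable R.2
  -- The Cauchy integral of a continuous `C(K, F)`-valued function is a convergent power series.
  -- Evaluation at each `t` commutes with the integral, and there Cauchy's formula returns `f`, so
  -- the two agree near `z₀`.
  have hps := hasFPowerSeriesOn_cauchy_integral hci (by exact_mod_cast hR0)
  have hd := hps.analyticAt.differentiableAt
  refine (hd.congr_of_eventuallyEq ?_).differentiableWithinAt
  filter_upwards [Metric.ball_mem_nhds z₀ hR0] with w hw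
  ext t
  have h1 := DifferentiableOn.circleIntegral_sub_inv_smul
    (f := fun z => f z t) ((hp t).mono hcb) hw
  have hne : ∀ z ∈ Metric.sphere z₀ R, z - w ≠ 0 := fun z hz h => by
    rw [sub_eq_zero] at h
    rw [h, Metric.mem_sphere] at hz
    rw [Metric.mem_ball] at hw
    linarith
  have hci2 : CircleIntegrable (fun z => (z - w)⁻¹ • f z) z₀ R := by
    refine ContinuousOn.circleIntegrable R.2 ?_
    exact ((continuousOn_id.sub continuousOn_const).inv₀ hne).smul
      (hf.mono hcb |>.mono Metric.sphere_subset_closedBall)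
  have h2 : (∮ z in C(z₀, R), (z - w)⁻¹ • f z) t = ∮ z in C(z₀, R), (z - w)⁻¹ • f z t := by
    have h3 := ContinuousLinearMap.intervalIntegral_comp_comm (𝕜 := ℂ)
      (ContinuousMap.evalCLM (M := F) ℂ t) hci2.out
    simp only [map_smul] at h3
    exact h3.symm
  rw [ContinuousMap.smul_apply, h2, h1, smul_smul, inv_mul_cancel₀, one_smul]
  exact Complex.two_pi_I_ne_zero

/-! ### Linear Volterra equations and analytic dependence on the coefficient -/

section BanachSpace

variable {W : Type*} [NormedAddCommGroup W] [NormedSpace ℂ W] [CompleteSpace W]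

/-- `1 - V ^ k` is the product of `1 - V` and a geometric sum, and factors of a unit that commute
are units. For a Volterra operator only some power need have small norm. -/
theorem isUnit_one_sub_of_norm_pow_lt_one (V : W →L[ℂ] W) (k : ℕ) (hV : ‖V ^ k‖ < 1) :
    IsUnit (1 - V) := by
  have hu : IsUnit (1 - V ^ k) := isUnit_one_sub_of_norm_lt_one hV
  rw [← mul_neg_geom_sum] at hu
  refine ((Commute.isUnit_mul_iff ?_).1 hu).1
  refine Commute.sum_right _ _ _ fun i _ => ?_
  exact (Commute.one_left _).sub_left ((Commute.refl V).pow_right i)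

theorem differentiableAt_inverse_one_sub_apply {V : ℂ → W →L[ℂ] W} {z : ℂ}
    (hV : DifferentiableAt ℂ V z) (hu : IsUnit (1 - V z)) (v : W) :
    DifferentiableAt ℂ (fun w => Ring.inverse (1 - V w) v) z := by
  have h2 : DifferentiableAt ℂ (fun w => Ring.inverse (1 - V w)) z :=
    DifferentiableAt.comp z (g := Ring.inverse) (differentiableAt_inverse hu) (hV.const_sub _)
  exact h2.clm_apply (differentiableAt_const _)

end BanachSpace

section BanachAlgebra

variable {W : Type*} [NormedRing W] [NormedAlgebra ℂ W] [CompleteSpace W]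

/-- The operator `X ↦ P (A X)`. -/
def volterraOp (P : W →L[ℂ] W) : W →L[ℂ] W →L[ℂ] W :=
  (ContinuousLinearMap.compL ℂ _ _ _ P).comp (ContinuousLinearMap.mul ℂ W)

/-- The solution of `X = 1 + P (A X)`. -/
def volterraSol (P : W →L[ℂ] W) (A : W) : W := Ring.inverse (1 - volterraOp P A) 1

theorem volterraSol_eq (P : W →L[ℂ] W) (A : W) (k : ℕ) (hk : ‖(volterraOp P A) ^ k‖ < 1) :
    volterraSol P A = 1 + P (A * volterraSol P A) := by
  have h := Ring.mul_inverse_cancel _ (isUnit_one_sub_of_norm_pow_lt_one _ k hk)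
  have h1 := congrArg (fun T : W →L[ℂ] W => T 1) h
  simp only [mul_apply_eq_comp, sub_apply, one_apply_eq_self] at h1
  exact sub_eq_iff_eq_add.1 h1

theorem differentiableAt_volterraSol (P : W →L[ℂ] W) {A : ℂ → W} {z : ℂ} (k : ℕ)
    (hk : ‖(volterraOp P (A z)) ^ k‖ < 1) (hA : DifferentiableAt ℂ A z) :
    DifferentiableAt ℂ (fun w => volterraSol P (A w)) z :=
  differentiableAt_inverse_one_sub_apply (V := fun w => volterraOp P (A w))
    ((volterraOp P).differentiableAt.comp z hA) (isUnit_one_sub_of_norm_pow_lt_one _ k hk) 1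

end BanachAlgebra

section Volterra

variable {𝔸 : Type*} [NormedRing 𝔸] [NormedAlgebra ℂ 𝔸] [CompleteSpace 𝔸] {a b : ℝ}

/-- The operator `f ↦ ∫₀ᵗ f` on `C([a, b], 𝔸)`. -/
def primitiveCLM (𝔸 : Type*) [NormedRing 𝔸] [NormedAlgebra ℂ 𝔸] [CompleteSpace 𝔸] (hab : a ≤ b)
    (h0 : (0 : ℝ) ∈ Icc a b) : C(Icc a b, 𝔸) →L[ℂ] C(Icc a b, 𝔸) :=
  LinearMap.mkContinuous
    { toFun := fun f => ⟨fun t => ∫ s in (0 : ℝ)..t, IccExtend hab f s, by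
        have hc : Continuous (IccExtend hab f) := f.continuous.Icc_extend'
        exact (intervalIntegral.continuous_primitive (fun _ _ => hc.intervalIntegrable _ _) 0).comp
          continuous_subtype_val⟩
      map_add' := fun f g => by
        ext t
        have hf : Continuous (IccExtend hab f) := f.continuous.Icc_extend'
        have hg : Continuous (IccExtend hab g) := g.continuous.Icc_extend'
        exact intervalIntegral.integral_add (hf.intervalIntegrable _ _) (hg.intervalIntegrable _ _)
      map_smul' := fun c f => by
        ext t
        exact intervalIntegral.integral_smul c _ }
    (b - a) fun f => by
      refine (ContinuousMap.norm_le _ (mul_nonneg (by linarith) (norm_nonneg _))).2 fun t => ?_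
      have h := intervalIntegral.norm_integral_le_of_norm_le_const (a := 0) (b := (t : ℝ))
        (f := IccExtend hab f) (C := ‖f‖) fun x _ => f.norm_coe_le_norm _
      refine h.trans ?_
      rw [mul_comm]
      gcongr
      rw [sub_zero, abs_le]
      have := t.2; have h1 := this.1; have h2 := this.2; have h3 := h0.1; have h4 := h0.2
      constructor <;> linarith

theorem primitiveCLM_apply (hab : a ≤ b) (h0 : (0 : ℝ) ∈ Icc a b) (f : C(Icc a b, 𝔸))
    (t : Icc a b) : primitiveCLM 𝔸 hab h0 f t = ∫ s in (0 : ℝ)..t, IccExtend hab f s := rfl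

/-- Each application contributes a factor `‖A‖` and integrates `|t|ᵏ/k!` once more. The factorial
wins on an interval of any length, so the solution is obtained globally. -/
theorem norm_volterra_pow_apply_le (hab : a ≤ b) (h0 : (0 : ℝ) ∈ Icc a b) (A f : C(Icc a b, 𝔸))
    (k : ℕ) (t : Icc a b) :
    ‖((volterraOp (primitiveCLM 𝔸 hab h0) A) ^ k) f t‖ ≤ (‖A‖ ^ k * |(t : ℝ)| ^ k / k.factorial) * ‖f‖ := by
  induction k generalizing t with
  | zero => simpa using f.norm_coe_le_norm t
  | succ k ih =>
    rw [pow_succ', mul_apply_eq_comp]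
    set g := ((volterraOp (primitiveCLM 𝔸 hab h0) A) ^ k) f
    change ‖∫ s in (0 : ℝ)..t, IccExtend hab (A * g) s‖ ≤ _
    refine intervalIntegral.norm_integral_le_integral_norm_uIoc.trans ?_
    have hsub : ∀ x ∈ uIoc (0 : ℝ) t, x ∈ Icc a b := fun x hx =>
      (uIcc_subset_Icc h0 t.2) (uIoc_subset_uIcc hx)
    have hle : ∀ x ∈ uIoc (0 : ℝ) t, ‖IccExtend hab (A * g) x‖
        ≤ (‖A‖ ^ (k + 1) / k.factorial * ‖f‖) * |x - 0| ^ k := fun x hx => by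
      rw [IccExtend_of_mem _ _ (hsub x hx), ContinuousMap.mul_apply, sub_zero]
      refine (norm_mul_le _ _).trans ?_
      refine (mul_le_mul (A.norm_coe_le_norm _) (ih ⟨x, hsub x hx⟩) (norm_nonneg _)
        (norm_nonneg _)).trans (le_of_eq ?_)
      rw [pow_succ]; ring
    have hc : Continuous (IccExtend hab (A * g)) := (A * g).continuous.Icc_extend'
    have hm := setIntegral_mono_on (μ := volume)
      (hc.norm.integrableOn_uIoc (a := 0) (b := (t : ℝ)))
      (Continuous.integrableOn_uIoc (a := (0 : ℝ)) (b := (t : ℝ))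
        (f := fun x : ℝ => (‖A‖ ^ (k + 1) / k.factorial * ‖f‖) * |x - 0| ^ k) (by fun_prop))
      measurableSet_uIoc hle
    refine hm.trans (le_of_eq ?_)
    rw [integral_const_mul, integral_pow_abs_sub_uIoc, sub_zero, Nat.factorial_succ]
    push_cast
    field_simp

theorem exists_norm_volterra_pow_lt_one (hab : a ≤ b) (h0 : (0 : ℝ) ∈ Icc a b)
    (A : C(Icc a b, 𝔸)) : ∃ k, ‖(volterraOp (primitiveCLM 𝔸 hab h0) A) ^ k‖ < 1 := by
  set V := volterraOp (primitiveCLM 𝔸 hab h0) A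
  have hlim := FloorSemiring.tendsto_pow_div_factorial_atTop (‖A‖ * (b - a))
  obtain ⟨k, hk⟩ := (hlim.eventually (gt_mem_nhds (zero_lt_one (α := ℝ)))).exists
  have hba : 0 ≤ b - a := by linarith
  refine ⟨k, lt_of_le_of_lt ?_ hk⟩
  refine ContinuousLinearMap.opNorm_le_bound _ (by positivity) fun f => ?_
  refine (ContinuousMap.norm_le _ (by positivity)).2 fun t => ?_
  refine (norm_volterra_pow_apply_le hab h0 A f k t).trans ?_
  rw [mul_pow]
  gcongr
  rw [abs_le]
  have := t.2; have h1 := this.1; have h2 := this.2; have h3 := h0.1; have h4 := h0.2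
  constructor <;> linarith

/-- The solution of `X' = A X`, `X(0) = 1` on `[a, b]`. -/
def odeSol (hab : a ≤ b) (h0 : (0 : ℝ) ∈ Icc a b) (A : C(Icc a b, 𝔸)) : C(Icc a b, 𝔸) :=
  volterraSol (primitiveCLM 𝔸 hab h0) A

theorem odeSol_eq (hab : a ≤ b) (h0 : (0 : ℝ) ∈ Icc a b) (A : C(Icc a b, 𝔸)) :
    odeSol hab h0 A = 1 + primitiveCLM 𝔸 hab h0 (A * odeSol hab h0 A) := by
  obtain ⟨k, hk⟩ := exists_norm_volterra_pow_lt_one hab h0 A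
  exact volterraSol_eq _ A k hk

theorem odeSol_zero (hab : a ≤ b) (h0 : (0 : ℝ) ∈ Icc a b) (A : C(Icc a b, 𝔸)) :
    odeSol hab h0 A ⟨0, h0⟩ = 1 := by
  rw [odeSol_eq, ContinuousMap.add_apply, primitiveCLM_apply]
  simp

theorem hasDerivWithinAt_odeSol (hab : a ≤ b) (h0 : (0 : ℝ) ∈ Icc a b) (A : C(Icc a b, 𝔸))
    {t : ℝ} (ht : t ∈ Icc a b) :
    HasDerivWithinAt (IccExtend hab (odeSol hab h0 A)) (A ⟨t, ht⟩ * odeSol hab h0 A ⟨t, ht⟩)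
      (Icc a b) t := by
  have hc : Continuous (IccExtend hab (A * odeSol hab h0 A)) :=
    (A * odeSol hab h0 A).continuous.Icc_extend'
  have h1 : HasDerivAt (fun t => (1 : 𝔸) + ∫ s in (0 : ℝ)..t, IccExtend hab (A * odeSol hab h0 A) s)
      (IccExtend hab (A * odeSol hab h0 A) t) t :=
    (intervalIntegral.integral_hasDerivAt_right (hc.intervalIntegrable _ _)
      (hc.stronglyMeasurableAtFilter _ _) hc.continuousAt).const_add _
  rw [IccExtend_of_mem _ _ ht] at h1
  have key : ∀ x ∈ Icc a b, IccExtend hab (odeSol hab h0 A) x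
      = 1 + ∫ s in (0 : ℝ)..x, IccExtend hab (A * odeSol hab h0 A) s := fun x hx => by
    rw [IccExtend_of_mem _ _ hx]
    conv_lhs => rw [odeSol_eq]
    rfl
  exact h1.hasDerivWithinAt.congr key (key t ht)

/-- The solution is `(1 - V_A)⁻¹ 1` with `V_A` linear in `A`, so holomorphy in the parameter only
has to be known for `A` as an element of `C([a, b])`, that is, uniformly in `t`. -/
theorem differentiableAt_odeSol (hab : a ≤ b) (h0 : (0 : ℝ) ∈ Icc a b) {A : ℂ → C(Icc a b, 𝔸)}
    {z : ℂ} (hA : DifferentiableAt ℂ A z) :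
    DifferentiableAt ℂ (fun w => odeSol hab h0 (A w)) z := by
  obtain ⟨k, hk⟩ := exists_norm_volterra_pow_lt_one hab h0 (A z)
  exact differentiableAt_volterraSol _ k hk hA

end Volterra

/-! ### Hamiltonian systems: fundamental solutions and variation of constants -/

section HamiltonianSystem

variable {E : Type*} [NormedAddCommGroup E] [InnerProductSpace ℂ E] [CompleteSpace E]

/-- The value of the left-hand side of `(i/2) ((Q x)' + Q* x') - H x`, given `Q'` and `x'`. -/
def sysLHS (Q Q' H : E →L[ℂ] E) (x x' : E) : E :=
  Complex.I • opRe Q x' + (Complex.I / 2) • Q' x - H x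

theorem sysLHS_sub (Q Q' H : E →L[ℂ] E) (x x' y y' : E) :
    sysLHS Q Q' H (x - y) (x' - y') = sysLHS Q Q' H x x' - sysLHS Q Q' H y y' := by
  simp only [sysLHS, map_sub, smul_sub]; abel

theorem opRe_apply (Q : E →L[ℂ] E) (x : E) :
    opRe Q x = (1 / 2 : ℂ) • (Q x + ContinuousLinearMap.adjoint Q x) := rfl

theorem inner_opRe_left (Q : E →L[ℂ] E) (x y : E) :
    inner ℂ (opRe Q x) y = (inner ℂ x (opRe Q y) : ℂ) := by
  simp only [opRe_apply, inner_smul_left, inner_smul_right, inner_add_left, inner_add_right,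
    ContinuousLinearMap.adjoint_inner_left, ContinuousLinearMap.adjoint_inner_right, map_div₀,
    map_one, Complex.conj_ofNat]
  ring

theorem adjoint_opRe (Q : E →L[ℂ] E) : ContinuousLinearMap.adjoint (opRe Q) = opRe Q :=
  ContinuousLinearMap.ext fun x => ext_inner_right ℂ fun y => by
    rw [ContinuousLinearMap.adjoint_inner_left, inner_opRe_left]

theorem hasDerivWithinAt_opRe {Q : ℝ → E →L[ℂ] E} {Q' : E →L[ℂ] E} {s : Set ℝ} {t : ℝ}
    (h : HasDerivWithinAt Q Q' s t) : HasDerivWithinAt (fun t => opRe (Q t)) (opRe Q') s t := by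
  have hadj : HasDerivWithinAt (fun t => ContinuousLinearMap.adjoint (Q t))
      (ContinuousLinearMap.adjoint Q') s t := by
    let A : (E →L[ℂ] E) →L[ℝ] (E →L[ℂ] E) :=
      { toFun := fun T => ContinuousLinearMap.adjoint T
        map_add' := fun _ _ => map_add _ _ _
        map_smul' := fun c T => by
          have : c • T = (c : ℂ) • T := rfl
          rw [this, map_smulₛₗ, Complex.conj_ofReal]; rfl
        cont := ContinuousLinearMap.adjoint.continuous }
    exact A.hasFDerivAt.comp_hasDerivWithinAt t h
  exact (h.add hadj).const_smul (1 / 2 : ℂ)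

/-- Lagrange's identity. -/
theorem hasDerivWithinAt_inner_opRe {Q : ℝ → E →L[ℂ] E} {Q' H K : E →L[ℂ] E} {s : Set ℝ} {t : ℝ}
    (hQ : HasDerivWithinAt Q Q' s t) {x y : ℝ → E} {x' y' g k : E}
    (hx : HasDerivWithinAt x x' s t) (hy : HasDerivWithinAt y y' s t)
    (ex : sysLHS (Q t) Q' H (x t) x' = g) (ey : sysLHS (Q t) Q' K (y t) y' = k) :
    HasDerivWithinAt (fun t => (inner ℂ (y t) (opRe (Q t) (x t)) : ℂ))
      (Complex.I * (inner ℂ (K (y t)) (x t) - inner ℂ (y t) (H (x t)))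
        + Complex.I * (inner ℂ k (x t) - inner ℂ (y t) g)) s t := by
  have h1 : HasDerivWithinAt (fun t => opRe (Q t) (x t)) (opRe Q' (x t) + opRe (Q t) x') s t := by
    have hR := hasDerivWithinAt_opRe hQ
    let B : (E →L[ℂ] E) →L[ℝ] E →L[ℝ] E :=
      (ContinuousLinearMap.restrictScalarsL ℂ E E ℝ ℝ).restrictScalars ℝ
    have hB : HasDerivWithinAt (fun t => B (opRe (Q t))) (B (opRe Q')) s t :=
      B.hasFDerivAt.comp_hasDerivWithinAt t hR
    exact hB.clm_apply hx
  refine (hy.inner ℂ h1).congr_deriv ?_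
  have e1 : opRe (Q t) x' = -Complex.I • (g + H (x t) - (Complex.I / 2) • Q' (x t)) := by
    have : Complex.I • opRe (Q t) x' = g + H (x t) - (Complex.I / 2) • Q' (x t) := by
      rw [← ex, sysLHS]; abel
    rw [← this, smul_smul]; simp
  have e2 : opRe (Q t) y' = -Complex.I • (k + K (y t) - (Complex.I / 2) • Q' (y t)) := by
    have : Complex.I • opRe (Q t) y' = k + K (y t) - (Complex.I / 2) • Q' (y t) := by
      rw [← ey, sysLHS]; abel
    rw [← this, smul_smul]; simp
  rw [inner_add_right, e1, ← inner_opRe_left (Q t) y', e2, opRe_apply]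
  simp only [inner_smul_left, inner_smul_right, inner_add_left, inner_add_right, inner_sub_left,
    inner_sub_right, ContinuousLinearMap.adjoint_inner_right, map_div₀, map_neg, Complex.conj_I,
    Complex.conj_ofNat]
  linear_combination ((1 / 2) * inner ℂ (y t) (Q' (x t)) + (1 / 2) * inner ℂ (Q' (y t)) (x t)) *
    Complex.I_sq

variable {a b : ℝ}

/-- The operator solution `X`, `X(0) = 1`, of `(i/2) ((Q X)' + Q* X') - H X = 0` on `[a, b]`. -/
structure IsFund (a b : ℝ) (Q H X : ℝ → E →L[ℂ] E) : Prop where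
  smooth : ContDiffOn ℝ 1 X (Icc a b)
  initial : X 0 = 1
  equation : ∀ t ∈ Icc a b,
    (Complex.I / 2) • (derivWithin (fun τ => Q τ * X τ) (Icc a b) t
      + ContinuousLinearMap.adjoint (Q t) * derivWithin X (Icc a b) t) - H t * X t = 0

/-- `A` in the normal form `X' = A X` of the system. -/
def sysCoef (a b : ℝ) (Q H : ℝ → E →L[ℂ] E) (t : ℝ) : E →L[ℂ] E :=
  -Complex.I • (Ring.inverse (opRe (Q t)) * (H t - (Complex.I / 2) • derivWithin Q (Icc a b) t))

theorem opRe_mul_sysCoef {Q H : ℝ → E →L[ℂ] E} {t : ℝ} (hu : IsUnit (opRe (Q t))) :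
    Complex.I • (opRe (Q t) * sysCoef a b Q H t)
      = H t - (Complex.I / 2) • derivWithin Q (Icc a b) t := by
  rw [sysCoef, mul_smul_comm, smul_smul, Ring.mul_inverse_cancel_left _ _ hu]
  simp

theorem half_smul_add_adjoint (Q Q' X X' : E →L[ℂ] E) :
    (Complex.I / 2) • (Q' * X + Q * X' + ContinuousLinearMap.adjoint Q * X')
      = Complex.I • (opRe Q * X') + (Complex.I / 2) • (Q' * X) := by
  rw [opRe, smul_mul_assoc, smul_smul, add_mul]
  module

theorem hasDerivWithinAt_mul_fund {Q X : ℝ → E →L[ℂ] E} {Q' X' : E →L[ℂ] E} {s : Set ℝ} {t : ℝ}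
    (hQ : HasDerivWithinAt Q Q' s t) (hX : HasDerivWithinAt X X' s t) :
    HasDerivWithinAt (fun τ => Q τ * X τ) (Q' * X t + Q t * X') s t := hQ.mul hX

theorem continuousOn_opRe {s : Set ℝ} {Q : ℝ → E →L[ℂ] E} (hQ : ContinuousOn Q s) :
    ContinuousOn (fun t => opRe (Q t)) s :=
  ContinuousOn.const_smul (hQ.add (ContinuousLinearMap.adjoint.continuous.comp_continuousOn hQ))
    (1 / 2 : ℂ)

theorem continuousOn_sysCoef (hab : a < b) {Q H : ℝ → E →L[ℂ] E}
    (hQ : ContDiffOn ℝ 1 Q (Icc a b)) (hu : ∀ t ∈ Icc a b, IsUnit (opRe (Q t)))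
    (hH : ContinuousOn H (Icc a b)) : ContinuousOn (sysCoef a b Q H) (Icc a b) := by
  have h1 := continuousOn_opRe hQ.continuousOn
  have h2 : ContinuousOn (fun t => Ring.inverse (opRe (Q t))) (Icc a b) := fun t ht => by
    obtain ⟨u, hu⟩ := hu t ht
    have := NormedRing.inverse_continuousAt u
    rw [hu] at this
    exact ContinuousAt.comp_continuousWithinAt (g := Ring.inverse) this (h1 t ht)
  have h3 := hQ.continuousOn_derivWithin (uniqueDiffOn_Icc hab) le_rfl
  exact ContinuousOn.const_smul (h2.mul (hH.sub (ContinuousOn.const_smul h3 (Complex.I / 2))))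
    (-Complex.I)

theorem isFund_odeSol (hab : a < b) (h0 : (0 : ℝ) ∈ Icc a b) {Q H : ℝ → E →L[ℂ] E}
    (hQ : ContDiffOn ℝ 1 Q (Icc a b)) (hu : ∀ t ∈ Icc a b, IsUnit (opRe (Q t)))
    (A : C(Icc a b, E →L[ℂ] E)) (hA : ∀ t : Icc a b, A t = sysCoef a b Q H t) :
    IsFund a b Q H (IccExtend hab.le (odeSol hab.le h0 A)) := by
  have hd : ∀ t (ht : t ∈ Icc a b), HasDerivWithinAt (IccExtend hab.le (odeSol hab.le h0 A))
      (sysCoef a b Q H t * IccExtend hab.le (odeSol hab.le h0 A) t) (Icc a b) t := fun t ht => by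
    have := hasDerivWithinAt_odeSol hab.le h0 A ht
    rwa [hA, ← IccExtend_of_mem hab.le (odeSol hab.le h0 A) ht] at this
  have hU := uniqueDiffOn_Icc hab
  refine ⟨?_, ?_, fun t ht => ?_⟩
  · have h1 : ContDiffOn ℝ (0 + 1) (IccExtend hab.le (odeSol hab.le h0 A)) (Icc a b) := by
      rw [contDiffOn_succ_iff_derivWithin hU]
      refine ⟨fun t ht => (hd t ht).differentiableWithinAt, by simp, ?_⟩
      rw [contDiffOn_zero]
      have : ContinuousOn (fun t => A (projIcc a b hab.le t) *
          IccExtend hab.le (odeSol hab.le h0 A) t) (Icc a b) :=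
        ((A.continuous.comp continuous_projIcc).mul
          (odeSol hab.le h0 A).continuous.Icc_extend').continuousOn
      refine this.congr fun t ht => ?_
      rw [(hd t ht).derivWithin (hU t ht), ← hA ⟨t, ht⟩]
      simp only [projIcc_of_mem hab.le ht]
    simpa using h1
  · rw [IccExtend_of_mem _ _ h0, odeSol_zero]
  · have hQt := (hQ.differentiableOn one_ne_zero t ht).hasDerivWithinAt
    rw [(hasDerivWithinAt_mul_fund hQt (hd t ht)).derivWithin (hU t ht),
      (hd t ht).derivWithin (hU t ht), half_smul_add_adjoint, ← mul_assoc, ← smul_mul_assoc,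
      opRe_mul_sysCoef (hu t ht), sub_mul, smul_mul_assoc]
    abel

theorem IsFund.exists_deriv (hab : a < b) {Q H X : ℝ → E →L[ℂ] E}
    (hQ : ContDiffOn ℝ 1 Q (Icc a b)) (hX : IsFund a b Q H X) {t : ℝ} (ht : t ∈ Icc a b) :
    ∃ X' : E →L[ℂ] E, HasDerivWithinAt X X' (Icc a b) t ∧
      ∀ ξ, sysLHS (Q t) (derivWithin Q (Icc a b) t) (H t) (X t ξ) (X' ξ) = 0 := by
  have hU := uniqueDiffOn_Icc hab
  have hXt := (hX.smooth.differentiableOn one_ne_zero t ht).hasDerivWithinAt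
  have hQt := (hQ.differentiableOn one_ne_zero t ht).hasDerivWithinAt
  refine ⟨_, hXt, fun ξ => ?_⟩
  have h := hX.equation t ht
  rw [(hasDerivWithinAt_mul_fund hQt hXt).derivWithin (hU t ht), half_smul_add_adjoint] at h
  exact congrArg (fun T : E →L[ℂ] E => T ξ) h

theorem hasDerivWithinAt_apply_vec {X : ℝ → E →L[ℂ] E} {X' : E →L[ℂ] E} {s : Set ℝ} {t : ℝ}
    (hX : HasDerivWithinAt X X' s t) {x : ℝ → E} {x' : E} (hx : HasDerivWithinAt x x' s t) :
    HasDerivWithinAt (fun t => X t (x t)) (X' (x t) + X t x') s t := by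
  let B : (E →L[ℂ] E) →L[ℝ] E →L[ℝ] E := ContinuousLinearMap.restrictScalarsL ℂ E E ℝ ℝ
  have hB : HasDerivWithinAt (fun t => B (X t)) (B X') s t :=
    B.hasFDerivAt.comp_hasDerivWithinAt t hX
  exact hB.clm_apply hx

theorem eq_of_hasDerivWithinAt_zero {F : Type*} [NormedAddCommGroup F] [NormedSpace ℝ F]
    {f : ℝ → F} (hf : ∀ t ∈ Icc a b, HasDerivWithinAt f 0 (Icc a b) t) {t u : ℝ}
    (ht : t ∈ Icc a b) (hu : u ∈ Icc a b) : f t = f u := by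
  have h := (convex_Icc a b).norm_image_sub_le_of_norm_hasDerivWithin_le (C := 0)
    (fun x hx => hf x hx) (fun x _ => by simp) hu ht
  rw [zero_mul, norm_le_zero_iff, sub_eq_zero] at h
  exact h

/-- A pair of fundamental solutions of the systems with `H` and `H*`. -/
structure IsFundPair (a b : ℝ) (Q H X Y : ℝ → E →L[ℂ] E) : Prop where
  lt : a < b
  zero_mem : (0 : ℝ) ∈ Icc a b
  smooth : ContDiffOn ℝ 1 Q (Icc a b)
  unit : ∀ t ∈ Icc a b, IsUnit (opRe (Q t))
  fund : IsFund a b Q H X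
  fund_adj : IsFund a b Q (fun t => ContinuousLinearMap.adjoint (H t)) Y

namespace IsFundPair

variable {Q H X Y : ℝ → E →L[ℂ] E}

/-- Lagrange's identity for a solution and a solution of the adjoint system: the contributions of
`H` and `H*` cancel, so the pairing keeps its value at `0`, where `Y = 1`. -/
theorem inner_const (h : IsFundPair a b Q H X Y) {x x' : ℝ → E}
    (hx : ∀ t ∈ Icc a b, HasDerivWithinAt x (x' t) (Icc a b) t)
    (ex : ∀ t ∈ Icc a b, sysLHS (Q t) (derivWithin Q (Icc a b) t) (H t) (x t) (x' t) = 0)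
    (η : E) {t : ℝ} (ht : t ∈ Icc a b) :
    (inner ℂ (Y t η) (opRe (Q t) (x t)) : ℂ) = inner ℂ η (opRe (Q 0) (x 0)) := by
  have key := eq_of_hasDerivWithinAt_zero
    (f := fun t => (inner ℂ (Y t η) (opRe (Q t) (x t)) : ℂ)) (a := a) (b := b)
    (fun t ht => by
      obtain ⟨Y', hY', eY⟩ := h.fund_adj.exists_deriv h.lt h.smooth ht
      have hQt := (h.smooth.differentiableOn one_ne_zero t ht).hasDerivWithinAt
      have hy : HasDerivWithinAt (fun t => Y t η) (Y' η) (Icc a b) t := by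
        simpa using hasDerivWithinAt_apply_vec hY' (hasDerivWithinAt_const t _ η)
      refine (hasDerivWithinAt_inner_opRe hQt (hx t ht) hy (ex t ht) (eY η)).congr_deriv ?_
      simp [ContinuousLinearMap.adjoint_inner_left]) ht h.zero_mem
  simpa [h.fund_adj.initial] using key

theorem hasDeriv_apply (h : IsFundPair a b Q H X Y) (ξ : E) :
    ∃ x' : ℝ → E, (∀ t ∈ Icc a b, HasDerivWithinAt (fun t => X t ξ) (x' t) (Icc a b) t) ∧
      ∀ t ∈ Icc a b, sysLHS (Q t) (derivWithin Q (Icc a b) t) (H t) (X t ξ) (x' t) = 0 := by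
  have : ∀ t, ∃ v : E, t ∈ Icc a b → HasDerivWithinAt (fun t => X t ξ) v (Icc a b) t ∧
      sysLHS (Q t) (derivWithin Q (Icc a b) t) (H t) (X t ξ) v = 0 := fun t => by
    by_cases ht : t ∈ Icc a b
    · obtain ⟨X', hX', eX⟩ := h.fund.exists_deriv h.lt h.smooth ht
      exact ⟨X' ξ, fun _ => ⟨by
        simpa using hasDerivWithinAt_apply_vec hX' (hasDerivWithinAt_const t _ ξ), eX ξ⟩⟩
    · exact ⟨0, fun h => absurd h ht⟩
  choose x' hx' using this
  exact ⟨x', fun t ht => (hx' t ht).1, fun t ht => (hx' t ht).2⟩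

theorem adjoint_mul_mul (h : IsFundPair a b Q H X Y) {t : ℝ} (ht : t ∈ Icc a b) :
    ContinuousLinearMap.adjoint (Y t) * opRe (Q t) * X t = opRe (Q 0) := by
  refine ContinuousLinearMap.ext fun ξ => ext_inner_left ℂ fun η => ?_
  obtain ⟨x', hx, ex⟩ := h.hasDeriv_apply ξ
  have := h.inner_const hx ex η ht
  rw [h.fund.initial] at this
  simpa [ContinuousLinearMap.adjoint_inner_right] using this

/-- The inverse of `X(t)`. -/
def invFund (Q Y : ℝ → E →L[ℂ] E) (t : ℝ) : E →L[ℂ] E :=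
  Ring.inverse (opRe (Q 0)) * ContinuousLinearMap.adjoint (Y t) * opRe (Q t)

theorem invFund_mul (h : IsFundPair a b Q H X Y) {t : ℝ} (ht : t ∈ Icc a b) :
    invFund Q Y t * X t = 1 := by
  rw [invFund, mul_assoc, mul_assoc, ← mul_assoc _ (opRe (Q t)), h.adjoint_mul_mul ht,
    Ring.inverse_mul_cancel _ (h.unit 0 h.zero_mem)]

theorem continuousOn_invFund (h : IsFundPair a b Q H X Y) :
    ContinuousOn (invFund Q Y) (Icc a b) :=
  (continuousOn_const.mul
    (ContinuousLinearMap.adjoint.continuous.comp_continuousOn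
      h.fund_adj.smooth.continuousOn)).mul (continuousOn_opRe h.smooth.continuousOn)

/-- In infinite dimensions a left inverse need not be a right inverse. Since a left inverse exists
at every point, being also a right inverse is the same as `X(t)` being a unit. The first condition
is closed in `[a, b]`, the second is open and holds at `0`, and the interval is connected. -/
theorem mul_invFund (h : IsFundPair a b Q H X Y) {t : ℝ} (ht : t ∈ Icc a b) :
    X t * invFund Q Y t = 1 := by
  have hXc := h.fund.smooth.continuousOn
  have hsub : Icc a b ⊆ {t | t ∈ Icc a b ∧ X t * invFund Q Y t = 1} := by
    have hpre : IsPreconnected (Icc a b) := isPreconnected_Icc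
    let f : Icc a b → E →L[ℂ] E := fun t => X t * invFund Q Y t
    have hf : Continuous f := by
      have := hXc.mul h.continuousOn_invFund
      exact continuousOn_iff_continuous_domRestrict.1 this
    let S : Set (Icc a b) := {t | f t = 1}
    have hcl : IsClosed S := isClosed_eq hf continuous_const
    have hS : S = {t : Icc a b | IsUnit (X t)} := by
      ext u
      refine ⟨fun hu => ?_, fun hu => ?_⟩
      · exact ⟨⟨X u, invFund Q Y u, hu, h.invFund_mul u.2⟩, rfl⟩
      · obtain ⟨v, hv⟩ := hu
        have h1 := h.invFund_mul u.2
        have h2 : invFund Q Y u = ↑v⁻¹ := by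
          rw [← hv] at h1
          exact Units.eq_inv_of_mul_eq_one_right h1
        change X u * invFund Q Y u = 1
        rw [h2, ← hv, Units.mul_inv]
    have hop : IsOpen S := by
      rw [hS]
      exact Units.isOpen.preimage (continuousOn_iff_continuous_domRestrict.1 hXc)
    have : PreconnectedSpace (Icc a b) := isPreconnected_iff_preconnectedSpace.1 hpre
    have h0S : (⟨0, h.zero_mem⟩ : Icc a b) ∈ S := by
      rw [hS]
      change IsUnit (X 0)
      rw [h.fund.initial]
      exact isUnit_one
    have huniv := IsClopen.eq_univ ⟨hcl, hop⟩ ⟨_, h0S⟩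
    intro u hu
    exact ⟨hu, (huniv ▸ mem_univ (⟨u, hu⟩ : Icc a b) : (⟨u, hu⟩ : Icc a b) ∈ S)⟩
  exact (hsub ht).2

theorem isUnit (h : IsFundPair a b Q H X Y) {t : ℝ} (ht : t ∈ Icc a b) : IsUnit (X t) :=
  ⟨⟨X t, invFund Q Y t, h.mul_invFund ht, h.invFund_mul ht⟩, rfl⟩

/-- Solutions of the homogeneous system are determined by their value at `0`. -/
theorem eq_apply_zero (h : IsFundPair a b Q H X Y) {x x' : ℝ → E}
    (hx : ∀ t ∈ Icc a b, HasDerivWithinAt x (x' t) (Icc a b) t)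
    (ex : ∀ t ∈ Icc a b, sysLHS (Q t) (derivWithin Q (Icc a b) t) (H t) (x t) (x' t) = 0)
    {t : ℝ} (ht : t ∈ Icc a b) : x t = X t (x 0) := by
  have h1 : ContinuousLinearMap.adjoint (Y t) (opRe (Q t) (x t)) = opRe (Q 0) (x 0) :=
    ext_inner_left ℂ fun η => by
      rw [ContinuousLinearMap.adjoint_inner_right]
      exact h.inner_const hx ex η ht
  have h2 : invFund Q Y t (x t) = x 0 := by
    change Ring.inverse (opRe (Q 0)) (ContinuousLinearMap.adjoint (Y t) (opRe (Q t) (x t))) = _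
    rw [h1]
    exact congrArg (fun T : E →L[ℂ] E => T (x 0))
      (Ring.inverse_mul_cancel _ (h.unit 0 h.zero_mem))
  rw [← h2]
  exact (congrArg (fun T : E →L[ℂ] E => T (x t)) (h.mul_invFund ht)).symm

theorem unique (h : IsFundPair a b Q H X Y) {X₂ : ℝ → E →L[ℂ] E} (h₂ : IsFund a b Q H X₂)
    {t : ℝ} (ht : t ∈ Icc a b) : X₂ t = X t := by
  refine ContinuousLinearMap.ext fun ξ => ?_
  obtain ⟨x', hx, ex⟩ := IsFundPair.hasDeriv_apply (Y := Y)
    ⟨h.lt, h.zero_mem, h.smooth, h.unit, h₂, h.fund_adj⟩ ξ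
  rw [h.eq_apply_zero hx ex ht, h₂.initial]
  rfl

/-- `X G⁻¹ Y* (Re Q) = 1`. -/
theorem opRe_mul_mul (h : IsFundPair a b Q H X Y) {t : ℝ} (ht : t ∈ Icc a b) :
    opRe (Q t) * (X t * (Ring.inverse (opRe (Q 0)) * ContinuousLinearMap.adjoint (Y t))) = 1 := by
  have h1 := h.mul_invFund ht
  rw [invFund] at h1
  have h2 := h.unit t ht
  obtain ⟨u, hu⟩ := h2
  rw [← hu] at h1 ⊢
  rw [← mul_assoc] at h1
  rw [Units.eq_inv_of_mul_eq_one_right h1, Units.mul_inv]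

/-- Variation of constants. -/
theorem variation (h : IsFundPair a b Q H X Y) {g : ℝ → E} (hg : ContinuousOn g (Icc a b))
    (ξ : E) {x : ℝ → E} (hx : ∀ t ∈ Icc a b, x t = X t (ξ
      + Ring.inverse (Complex.I • opRe (Q 0)) (∫ s in a..t, ContinuousLinearMap.adjoint (Y s) (g s)))) :
    ∃ x' : ℝ → E, (∀ t ∈ Icc a b, HasDerivWithinAt x (x' t) (Icc a b) t) ∧
      ∀ t ∈ Icc a b, sysLHS (Q t) (derivWithin Q (Icc a b) t) (H t) (x t) (x' t) = g t := by
  have hc : ContinuousOn (fun s => ContinuousLinearMap.adjoint (Y s) (g s)) (Icc a b) :=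
    (ContinuousLinearMap.adjoint.continuous.comp_continuousOn
      h.fund_adj.smooth.continuousOn).clm_apply hg
  set J := Ring.inverse (Complex.I • opRe (Q 0)) with hJ
  have : ∀ t, ∃ v : E, t ∈ Icc a b → HasDerivWithinAt x v (Icc a b) t ∧
      sysLHS (Q t) (derivWithin Q (Icc a b) t) (H t) (x t) v = g t := fun t => by
    by_cases ht : t ∈ Icc a b
    · obtain ⟨X', hX', eX⟩ := h.fund.exists_deriv h.lt h.smooth ht
      have hint : HasDerivWithinAt
          (fun t => ∫ s in a..t, ContinuousLinearMap.adjoint (Y s) (g s))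
          (ContinuousLinearMap.adjoint (Y t) (g t)) (Icc a b) t := by
        have : Fact (t ∈ Icc a b) := ⟨ht⟩
        refine intervalIntegral.integral_hasDerivWithinAt_right (s := Icc a b) (t := Icc a b)
          ?_ ?_ (hc t ht)
        · exact (hc.mono (by rw [uIcc_of_le ht.1]; exact Icc_subset_Icc_right ht.2)).intervalIntegrable
        · exact hc.stronglyMeasurableAtFilter_nhdsWithin measurableSet_Icc t
      have hv : HasDerivWithinAt (fun t => ξ + J (∫ s in a..t,
          ContinuousLinearMap.adjoint (Y s) (g s)))
          (J (ContinuousLinearMap.adjoint (Y t) (g t))) (Icc a b) t :=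
        ((J.restrictScalars ℝ).hasFDerivAt.comp_hasDerivWithinAt t hint).const_add ξ
      have hd := (hasDerivWithinAt_apply_vec hX' hv).congr hx (hx t ht)
      refine ⟨_, fun _ => ⟨hd, ?_⟩⟩
      rw [hx t ht]
      set v := ξ + J (∫ s in a..t, ContinuousLinearMap.adjoint (Y s) (g s))
      have e1 := eX v
      rw [sysLHS] at e1 ⊢
      rw [map_add, smul_add]
      -- Only the derivative of the integral produces the right-hand side, through `i Re Q · X J Y*
      -- = Re Q · X (Re Q(0))⁻¹ Y* = 1`.
      have e2 : Complex.I • opRe (Q t) (X t (J (ContinuousLinearMap.adjoint (Y t) (g t)))) = g t := by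
        have hJ2 : Complex.I • J = Ring.inverse (opRe (Q 0)) := by
          obtain ⟨u, hu⟩ := h.unit 0 h.zero_mem
          have hmul : (Complex.I • opRe (Q 0)) * J = 1 := by
            refine Ring.mul_inverse_cancel _ ?_
            rw [← hu]
            exact ((Units.mk0 Complex.I Complex.I_ne_zero) • u).isUnit
          rw [smul_mul_assoc, ← mul_smul_comm, ← hu] at hmul
          rw [← hu, Ring.inverse_unit]
          exact Units.eq_inv_of_mul_eq_one_left hmul
        have h3 := congrArg (fun T : E →L[ℂ] E => T (g t)) (h.opRe_mul_mul ht)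
        rw [← hJ2] at h3
        simp only [mul_apply_eq_comp, one_apply_eq_self, smul_apply,
          map_smul] at h3
        exact h3
      rw [e2]
      rw [show ∀ p q r s : E, p + q + r - s = (p + r - s) + q by intros; abel, e1, zero_add]
    · exact ⟨0, fun h => absurd h ht⟩
  choose x' hx' using this
  exact ⟨x', fun t ht => (hx' t ht).1, fun t ht => (hx' t ht).2⟩

end IsFundPair

end HamiltonianSystem

/-! ### Operator matrices on `𝓗^r` and their coordinates -/

section Sandwich

variable {𝓗 E : Type*} [NormedAddCommGroup 𝓗] [NormedSpace ℂ 𝓗] [NormedAddCommGroup E]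
  [NormedSpace ℂ E]

/-- The bounded linear map `A ↦ ι A π`. -/
def sandwich (ι : 𝓗 →L[ℂ] E) (π : E →L[ℂ] 𝓗) : (𝓗 →L[ℂ] 𝓗) →L[ℂ] (E →L[ℂ] E) :=
  (ContinuousLinearMap.compL ℂ E 𝓗 E ι).comp ((ContinuousLinearMap.compL ℂ E 𝓗 𝓗).flip π)

/-- An operator matrix is a finite sum of images of its entries under fixed bounded linear maps `A ↦
ι A π`; continuity, holomorphy and smoothness in norm are therefore inherited from the entries. -/
theorem continuousOn_sum_sandwich {X : Type*} [TopologicalSpace X] {r : ℕ} (ι : ℕ → 𝓗 →L[ℂ] E)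
    (π : ℕ → E →L[ℂ] 𝓗)
    {A : X → ℕ → ℕ → 𝓗 →L[ℂ] 𝓗} {s : Set X}
    (h : ∀ i < r, ∀ j < r, ContinuousOn (fun t => A t i j) s) :
    ContinuousOn (fun t => ∑ i ∈ Finset.range r, ∑ j ∈ Finset.range r,
      (ι i ∘L (A t i j ∘L π j))) s :=
  continuousOn_finsetSum _ fun i hi => continuousOn_finsetSum _ fun j hj =>
    (sandwich (ι i) (π j)).continuous.comp_continuousOn
      (h i (Finset.mem_range.1 hi) j (Finset.mem_range.1 hj))

theorem differentiableAt_sum_sandwich {r : ℕ} (ι : ℕ → 𝓗 →L[ℂ] E) (π : ℕ → E →L[ℂ] 𝓗)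
    {A : ℂ → ℕ → ℕ → 𝓗 →L[ℂ] 𝓗} {z : ℂ}
    (h : ∀ i < r, ∀ j < r, DifferentiableAt ℂ (fun t => A t i j) z) :
    DifferentiableAt ℂ (fun t => ∑ i ∈ Finset.range r, ∑ j ∈ Finset.range r,
      (ι i ∘L (A t i j ∘L π j))) z :=
  DifferentiableAt.fun_sum fun i hi => DifferentiableAt.fun_sum fun j hj =>
    (sandwich (ι i) (π j)).differentiableAt.comp z
      (h i (Finset.mem_range.1 hi) j (Finset.mem_range.1 hj))

theorem hasDerivWithinAt_sum_sandwich {r : ℕ} (ι : ℕ → 𝓗 →L[ℂ] E) (π : ℕ → E →L[ℂ] 𝓗)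
    {A : ℝ → ℕ → ℕ → 𝓗 →L[ℂ] 𝓗} {A' : ℕ → ℕ → 𝓗 →L[ℂ] 𝓗} {s : Set ℝ} {t : ℝ}
    (h : ∀ i < r, ∀ j < r, HasDerivWithinAt (fun t => A t i j) (A' i j) s t) :
    HasDerivWithinAt (fun t => ∑ i ∈ Finset.range r, ∑ j ∈ Finset.range r,
      (ι i ∘L (A t i j ∘L π j))) (∑ i ∈ Finset.range r, ∑ j ∈ Finset.range r,
      (ι i ∘L (A' i j ∘L π j))) s t :=
  HasDerivWithinAt.fun_sum fun i hi => HasDerivWithinAt.fun_sum fun j hj =>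
    ((sandwich (ι i) (π j)).restrictScalars ℝ).hasFDerivAt.comp_hasDerivWithinAt t
      (h i (Finset.mem_range.1 hi) j (Finset.mem_range.1 hj))

theorem derivWithin_sum_sandwich {r : ℕ} (ι : ℕ → 𝓗 →L[ℂ] E) (π : ℕ → E →L[ℂ] 𝓗)
    {A : ℝ → ℕ → ℕ → 𝓗 →L[ℂ] 𝓗} {A' : ℕ → ℕ → 𝓗 →L[ℂ] 𝓗} {s : Set ℝ} {t : ℝ}
    (hs : UniqueDiffWithinAt ℝ s t)
    (h : ∀ i < r, ∀ j < r, HasDerivWithinAt (fun t => A t i j) (A' i j) s t) :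
    derivWithin (fun t => ∑ i ∈ Finset.range r, ∑ j ∈ Finset.range r,
      (ι i ∘L (A t i j ∘L π j))) s t = ∑ i ∈ Finset.range r, ∑ j ∈ Finset.range r,
      (ι i ∘L (A' i j ∘L π j)) :=
  (hasDerivWithinAt_sum_sandwich ι π h).derivWithin hs

theorem contDiffOn_sum_sandwich {r : ℕ} (ι : ℕ → 𝓗 →L[ℂ] E) (π : ℕ → E →L[ℂ] 𝓗)
    {A : ℝ → ℕ → ℕ → 𝓗 →L[ℂ] 𝓗} {s : Set ℝ} {k : WithTop ℕ∞}
    (h : ∀ i < r, ∀ j < r, ContDiffOn ℝ k (fun t => A t i j) s) :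
    ContDiffOn ℝ k (fun t => ∑ i ∈ Finset.range r, ∑ j ∈ Finset.range r,
      (ι i ∘L (A t i j ∘L π j))) s :=
  ContDiffOn.sum fun i hi => ContDiffOn.sum fun j hj =>
    ((sandwich (ι i) (π j)).restrictScalars ℝ).contDiff.comp_contDiffOn
      (h i (Finset.mem_range.1 hi) j (Finset.mem_range.1 hj))

theorem hasDerivWithinAt_clm_apply (T : E →L[ℂ] 𝓗) {x : ℝ → E} {x' : E} {s : Set ℝ} {t : ℝ}
    (h : HasDerivWithinAt x x' s t) : HasDerivWithinAt (fun t => T (x t)) (T x') s t :=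
  (T.restrictScalars ℝ).hasFDerivAt.comp_hasDerivWithinAt t h

theorem hasDerivWithinAt_of_sum {r : ℕ} (ι : ℕ → 𝓗 →L[ℂ] E) (π : ℕ → E →L[ℂ] 𝓗)
    (hsum : ∀ x, ∑ k ∈ Finset.range r, ι k (π k x) = x) {x : ℝ → E} {x' : E} {s : Set ℝ} {t : ℝ}
    (h : ∀ k < r, HasDerivWithinAt (fun t => π k (x t)) (π k x') s t) :
    HasDerivWithinAt x x' s t := by
  have : HasDerivWithinAt (fun t => ∑ k ∈ Finset.range r, ι k (π k (x t)))
      (∑ k ∈ Finset.range r, ι k (π k x')) s t :=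
    HasDerivWithinAt.fun_sum fun k hk =>
      hasDerivWithinAt_clm_apply (ι k) (h k (Finset.mem_range.1 hk))
  simpa only [hsum] using this

end Sandwich

section Coordinates

variable {𝓗 : Type*} [NormedAddCommGroup 𝓗] [InnerProductSpace ℂ 𝓗]

/-- The component with index `k` of a vector of `𝓗^r`, `0` for `k ≥ r`. -/
def coord (r k : ℕ) : HilbertPow 𝓗 r →L[ℂ] 𝓗 :=
  if h : k < r then PiLp.proj (𝕜 := ℂ) 2 (fun _ : Fin r => 𝓗) ⟨k, h⟩ else 0

/-- The embedding of `𝓗` into `𝓗^r` as the component with index `k`. -/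
def single (r k : ℕ) : 𝓗 →L[ℂ] HilbertPow 𝓗 r :=
  if h : k < r then ((PiLp.continuousLinearEquiv 2 ℂ (fun _ : Fin r => 𝓗)).symm :
      (Fin r → 𝓗) →L[ℂ] HilbertPow 𝓗 r) ∘L ContinuousLinearMap.single ℂ (fun _ : Fin r => 𝓗) ⟨k, h⟩
  else 0

theorem coord_apply {r k : ℕ} (h : k < r) (x : HilbertPow 𝓗 r) : coord r k x = x ⟨k, h⟩ := by
  rw [coord, dif_pos h]; rfl

theorem coord_eq_zero {r k : ℕ} (h : r ≤ k) : (coord r k : HilbertPow 𝓗 r →L[ℂ] 𝓗) = 0 := by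
  rw [coord, dif_neg (by omega)]

theorem ext_coord {r : ℕ} {x y : HilbertPow 𝓗 r} (h : ∀ k < r, coord r k x = coord r k y) :
    x = y := by
  ext i
  have := h i i.2
  rwa [coord_apply i.2, coord_apply i.2] at this

theorem coord_single {r k : ℕ} (hk : k < r) (j : ℕ) (v : 𝓗) :
    coord r j (single r k v) = if j = k then v else 0 := by
  by_cases hj : j < r
  · rw [coord_apply hj, single, dif_pos hk]
    by_cases h : j = k
    · subst h
      simp
    · rw [if_neg h]
      simp [Fin.ext_iff, h]
  · rw [coord_eq_zero (by omega), if_neg (by omega)]; rfl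

theorem inner_eq_sum_coord {r : ℕ} (x y : HilbertPow 𝓗 r) :
    inner ℂ x y = ∑ k ∈ Finset.range r, (inner ℂ (coord r k x) (coord r k y) : ℂ) := by
  rw [PiLp.inner_apply, Finset.sum_range]
  exact Finset.sum_congr rfl fun i _ => by rw [coord_apply i.2, coord_apply i.2]

theorem coord_blockOp {r k : ℕ} (hk : k < r) (A : ℕ → ℕ → 𝓗 →L[ℂ] 𝓗) (x : HilbertPow 𝓗 r) :
    coord r k (blockOp r A x) = ∑ j ∈ Finset.range r, A k j (coord r j x) := by
  rw [coord_apply hk, Finset.sum_range]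
  simp only [blockOp, ContinuousLinearMap.comp_apply, ContinuousLinearEquiv.coe_coe,
    PiLp.continuousLinearEquiv_symm_apply, ContinuousLinearMap.coe_pi', sum_apply]
  exact Finset.sum_congr rfl fun i _ => by rw [coord_apply i.2]; rfl

theorem sum_single_coord {r : ℕ} (x : HilbertPow 𝓗 r) :
    ∑ k ∈ Finset.range r, single r k (coord r k x) = x := by
  refine ext_coord fun j hj => ?_
  rw [map_sum, Finset.sum_congr rfl fun k hk => coord_single (Finset.mem_range.1 hk) j _,
    Finset.sum_ite_eq, if_pos (Finset.mem_range.2 hj)]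

theorem blockOp_eq_sum {r : ℕ} (A : ℕ → ℕ → 𝓗 →L[ℂ] 𝓗) :
    blockOp r A = ∑ i ∈ Finset.range r, ∑ j ∈ Finset.range r,
      single r i ∘L (A i j ∘L coord r j) := by
  ext1 x
  rw [← sum_single_coord (blockOp r A x)]
  simp only [sum_apply, ContinuousLinearMap.comp_apply]
  refine Finset.sum_congr rfl fun i hi => ?_
  rw [coord_blockOp (Finset.mem_range.1 hi), map_sum]

theorem continuousOn_blockOp {X : Type*} [TopologicalSpace X] {r : ℕ}
    {A : X → ℕ → ℕ → 𝓗 →L[ℂ] 𝓗} {s : Set X}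
    (h : ∀ i < r, ∀ j < r, ContinuousOn (fun t => A t i j) s) :
    ContinuousOn (fun t => blockOp r (A t)) s := by
  simp only [blockOp_eq_sum]
  exact continuousOn_sum_sandwich _ _ h

theorem differentiableAt_blockOp {r : ℕ} {A : ℂ → ℕ → ℕ → 𝓗 →L[ℂ] 𝓗} {z : ℂ}
    (h : ∀ i < r, ∀ j < r, DifferentiableAt ℂ (fun t => A t i j) z) :
    DifferentiableAt ℂ (fun t => blockOp r (A t)) z := by
  simp only [blockOp_eq_sum]
  exact differentiableAt_sum_sandwich _ _ h

theorem derivWithin_blockOp {r : ℕ} {A : ℝ → ℕ → ℕ → 𝓗 →L[ℂ] 𝓗} {A' : ℕ → ℕ → 𝓗 →L[ℂ] 𝓗}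
    {s : Set ℝ} {t : ℝ} (hs : UniqueDiffWithinAt ℝ s t)
    (h : ∀ i < r, ∀ j < r, HasDerivWithinAt (fun t => A t i j) (A' i j) s t) :
    derivWithin (fun t => blockOp r (A t)) s t = blockOp r A' := by
  simp only [blockOp_eq_sum]
  exact derivWithin_sum_sandwich _ _ hs h

theorem contDiffOn_blockOp {r : ℕ} {A : ℝ → ℕ → ℕ → 𝓗 →L[ℂ] 𝓗} {s : Set ℝ} {k : WithTop ℕ∞}
    (h : ∀ i < r, ∀ j < r, ContDiffOn ℝ k (fun t => A t i j) s) :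
    ContDiffOn ℝ k (fun t => blockOp r (A t)) s := by
  simp only [blockOp_eq_sum]
  exact contDiffOn_sum_sandwich _ _ h

theorem hasDerivWithinAt_of_coord {r : ℕ} {x : ℝ → HilbertPow 𝓗 r} {x' : HilbertPow 𝓗 r}
    {s : Set ℝ} {t : ℝ}
    (h : ∀ k < r, HasDerivWithinAt (fun t => coord r k (x t)) (coord r k x') s t) :
    HasDerivWithinAt x x' s t :=
  hasDerivWithinAt_of_sum (single r) (coord r) sum_single_coord h

theorem hasDerivWithinAt_coord {r : ℕ} {x : ℝ → HilbertPow 𝓗 r} {x' : HilbertPow 𝓗 r}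
    {s : Set ℝ} {t : ℝ} (h : HasDerivWithinAt x x' s t) (k : ℕ) :
    HasDerivWithinAt (fun t => coord r k (x t)) (coord r k x') s t :=
  hasDerivWithinAt_clm_apply (coord r k) h

theorem adjoint_blockOp [CompleteSpace 𝓗] {r : ℕ} {A B : ℕ → ℕ → 𝓗 →L[ℂ] 𝓗}
    (h : ∀ i < r, ∀ j < r, ContinuousLinearMap.adjoint (A j i) = B i j) :
    ContinuousLinearMap.adjoint (blockOp r A) = blockOp r B := by
  refine ContinuousLinearMap.ext fun x => ext_inner_right ℂ fun y => ?_
  rw [ContinuousLinearMap.adjoint_inner_left, inner_eq_sum_coord, inner_eq_sum_coord]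
  have e1 : ∀ k ∈ Finset.range r, (inner ℂ (coord r k x) (coord r k (blockOp r A y)) : ℂ)
      = ∑ j ∈ Finset.range r, inner ℂ (coord r k x) (A k j (coord r j y)) := fun k hk => by
    rw [coord_blockOp (Finset.mem_range.1 hk), inner_sum]
  have e2 : ∀ k ∈ Finset.range r, (inner ℂ (coord r k (blockOp r B x)) (coord r k y) : ℂ)
      = ∑ j ∈ Finset.range r, inner ℂ (coord r j x) (A j k (coord r k y)) := fun k hk => by
    rw [coord_blockOp (Finset.mem_range.1 hk), sum_inner]
    refine Finset.sum_congr rfl fun j hj => ?_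
    rw [← h k (Finset.mem_range.1 hk) j (Finset.mem_range.1 hj),
      ContinuousLinearMap.adjoint_inner_left]
  rw [Finset.sum_congr rfl e1, Finset.sum_congr rfl e2, Finset.sum_comm]

end Coordinates

/-! ### The rows of the Hamiltonian -/

namespace OpExpr

variable {𝓗 : Type*} [NormedAddCommGroup 𝓗] [InnerProductSpace ℂ 𝓗]

/-- `p_j u_j + (i/2) (s_{j+1} u_{j+1} - q_j u_{j-1})`. -/
def coef (L : OpExpr 𝓗) (j : ℕ) (t : ℝ) (u : ℕ → 𝓗) : 𝓗 :=
  L.p j t (u j) + (Complex.I / 2) • (L.s (j + 1) t (u (j + 1)) - L.q j t (u (j - 1)))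

/-- The jet `(y, …, y^{(n)}, 0, …)` recovered from a vector of quasi-derivatives. -/
def jetVec (L : OpExpr 𝓗) (r : ℕ) (t : ℝ) (x : HilbertPow 𝓗 r) (k : ℕ) : 𝓗 :=
  if k < r / 2 then coord r k x
  else if k = r / 2 then
    (if Even r then Ring.inverse (L.p (r / 2) t) (coord r (2 * (r / 2) - 1) x
        + (Complex.I / 2) • L.q (r / 2) t (coord r (r / 2 - 1) x))
      else Complex.I • coord r (2 * (r / 2)) x)
  else 0

/-- The quasi-derivatives of order `r - j`, `1 ≤ j ≤ r / 2`. -/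
def quasiVec (r : ℕ) (x : HilbertPow 𝓗 r) (j : ℕ) : 𝓗 :=
  if 1 ≤ j ∧ j ≤ r / 2 then coord r (r / 2 + j - 1) x else 0

/-- The matrix is sparse, and the case split isolates the columns met by row `i`. Only row `n - 1`
meets the recovered `n`-th derivative: for even `r`, substituting `p_n⁻¹ (x_{2n} + (i/2) q_n x_n)`
into `-(i/2) s_n y^{(n)}` produces the entries with `p_n⁻¹`, among them `¼ s_n p_n⁻¹ q_n`. In row
`0` the truncated index `0 - 1` is harmless because `q_0 = 0`. -/
theorem coord_opH_lt {L : OpExpr 𝓗} {r : ℕ} (hL : L.IsOfOrder r) {t : ℝ} (x : HilbertPow 𝓗 r)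
    {i : ℕ} (hi : i < r / 2) :
    coord r i (L.opH r t x) = quasiVec r x i - L.coef i t (L.jetVec r t x) := by
  have hq0 : L.q 0 t = 0 := congrFun hL.q_zero t
  rw [opH, coord_blockOp (by omega)]
  obtain ⟨n, rfl | rfl⟩ := Nat.even_or_odd' r
  · have hn : 2 * n / 2 = n := by omega
    rw [hn] at hi
    set P := Ring.inverse (L.p n t) with hP
    have hI2 : ∀ v : 𝓗, (Complex.I / 2) • (Complex.I / 2) • v = -((1 / 4 : ℂ) • v) := fun v => by
      rw [smul_smul, ← neg_smul]; congr 1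
      linear_combination (1 / 4 : ℂ) * Complex.I_sq
    simp only [quasiVec, coef, jetVec, entryH, entryHEven, even_two_mul, if_true, hn, ← hP]
    rcases Nat.eq_zero_or_pos i with h0 | h0
    · subst h0
      rcases Nat.lt_or_ge 1 n with h1 | h1
      · rw [Finset.sum_eq_add_of_mem 0 1 (Finset.mem_range.2 (by omega))
          (Finset.mem_range.2 (by omega)) (by omega)]
        · simp (disch := omega) only [if_pos, if_neg]
          simp [hq0]
          try module
        · intro j hj hj'
          rw [Finset.mem_range] at hj
          rcases Nat.lt_or_ge j n with h | h <;>
          · simp (disch := omega) only [if_pos, if_neg]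
            simp
      · obtain rfl : n = 1 := by omega
        simp [Finset.sum_range_succ, hq0, smul_add, hI2]
        module
    · rcases Nat.lt_or_ge (i + 1) n with h1 | h1
      · rw [← Finset.sum_subset (s₁ := {i - 1, i, i + 1, n + i - 1})
          (by intro k hk; simp at hk ⊢; omega)]
        · rw [Finset.sum_insert (by simp; omega), Finset.sum_insert (by simp; omega),
            Finset.sum_insert (by simp; omega), Finset.sum_singleton]
          simp (disch := omega) only [if_pos, if_neg]
          simp
          module
        · intro j hj hj'
          rw [Finset.mem_range] at hj
          simp at hj'
          rcases Nat.lt_or_ge j n with h | h <;>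
          · simp (disch := omega) only [if_pos, if_neg]
            simp
      · obtain rfl : n = i + 1 := by omega
        rw [← Finset.sum_subset (s₁ := {i - 1, i, 2 * i, 2 * i + 1})
          (by intro k hk; simp at hk ⊢; omega)]
        · rw [Finset.sum_insert (by simp; omega), Finset.sum_insert (by simp; omega),
            Finset.sum_insert (by simp), Finset.sum_singleton]
          simp (disch := omega) only [if_pos, if_neg]
          simp [show i + 1 + i - 1 = 2 * i by omega, show 2 * (i + 1) - 1 = 2 * i + 1 by omega,
            show 2 * i + 1 + 1 = 2 * (i + 1) by omega, smul_add, smul_sub, hI2]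
          module
        · intro j hj hj'
          rw [Finset.mem_range] at hj
          simp at hj'
          rcases Nat.lt_or_ge j (i + 1) with h | h <;>
          · simp (disch := omega) only [if_pos, if_neg]
            simp
  · have hn : (2 * n + 1) / 2 = n := by omega
    have hodd : ¬ Even (2 * n + 1) := by simp
    rw [hn] at hi
    have hI : ∀ v : 𝓗, (Complex.I / 2) • Complex.I • v = -((1 / 2 : ℂ) • v) := fun v => by
      rw [smul_smul, ← neg_smul]; congr 1
      linear_combination (1 / 2 : ℂ) * Complex.I_sq
    simp only [quasiVec, coef, jetVec, entryH, entryHOdd, hodd, if_false, hn]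
    rcases Nat.eq_zero_or_pos i with h0 | h0
    · subst h0
      rcases Nat.lt_or_ge 1 n with h1 | h1
      · rw [Finset.sum_eq_add_of_mem 0 1 (Finset.mem_range.2 (by omega))
          (Finset.mem_range.2 (by omega)) (by omega)]
        · simp (disch := omega) only [if_pos, if_neg]
          simp [hq0]
          try module
        · intro j hj hj'
          rw [Finset.mem_range] at hj
          rcases Nat.lt_or_ge j n with h | h <;>
          · simp (disch := omega) only [if_pos, if_neg]
            simp
      · obtain rfl : n = 1 := by omega
        simp [Finset.sum_range_succ, hq0, hI]
        try module
    · rcases Nat.lt_or_ge (i + 1) n with h1 | h1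
      · rw [← Finset.sum_subset (s₁ := {i - 1, i, i + 1, n + i - 1})
          (by intro k hk; simp at hk ⊢; omega)]
        · rw [Finset.sum_insert (by simp; omega), Finset.sum_insert (by simp; omega),
            Finset.sum_insert (by simp; omega), Finset.sum_singleton]
          simp (disch := omega) only [if_pos, if_neg]
          simp
          module
        · intro j hj hj'
          rw [Finset.mem_range] at hj
          simp at hj'
          rcases Nat.lt_or_ge j n with h | h <;>
          · simp (disch := omega) only [if_pos, if_neg]
            simp
      · obtain rfl : n = i + 1 := by omega
        rw [← Finset.sum_subset (s₁ := {i - 1, i, 2 * i, 2 * i + 2})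
          (by intro k hk; simp at hk ⊢; omega)]
        · rw [Finset.sum_insert (by simp; omega), Finset.sum_insert (by simp; omega),
            Finset.sum_insert (by simp), Finset.sum_singleton]
          simp (disch := omega) only [if_pos, if_neg]
          simp [show i + 1 + i - 1 = 2 * i by omega, show 2 * (i + 1) = 2 * i + 2 by omega,
            smul_sub, hI]
          module
        · intro j hj hj'
          rw [Finset.mem_range] at hj
          simp at hj'
          rcases Nat.lt_or_ge j (i + 1) with h | h <;>
          · simp (disch := omega) only [if_pos, if_neg]
            simp

/-- These rows make the system contain the homogeneous relations `(y^{(k)})' = y^{(k+1)}`, where the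
last derivative is the recovered one. -/
theorem coord_opH_add {L : OpExpr 𝓗} {r : ℕ} {t : ℝ} (x : HilbertPow 𝓗 r)
    {k : ℕ} (hk : k < r / 2) :
    coord r (r / 2 + k) (L.opH r t x) = L.jetVec r t x (k + 1) := by
  rw [opH, coord_blockOp (by omega)]
  obtain ⟨n, rfl | rfl⟩ := Nat.even_or_odd' r
  · have hn : 2 * n / 2 = n := by omega
    rw [hn] at hk ⊢
    simp only [jetVec, entryH, entryHEven, even_two_mul, if_true, hn]
    rcases Nat.lt_or_ge (k + 1) n with h1 | h1
    · rw [Finset.sum_eq_single_of_mem (k + 1) (Finset.mem_range.2 (by omega))]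
      · simp (disch := omega) only [if_pos, if_neg]
        simp
      · intro j hj hj'
        rw [Finset.mem_range] at hj
        rcases Nat.lt_or_ge j n with h | h <;>
        · simp (disch := omega) only [if_pos, if_neg]
          simp
    · obtain rfl : n = k + 1 := by omega
      rw [Finset.sum_eq_add_of_mem k (2 * k + 1) (Finset.mem_range.2 (by omega))
        (Finset.mem_range.2 (by omega)) (by omega)]
      · simp (disch := omega) only [if_pos, if_neg]
        simp [show k + 1 + k = 2 * k + 1 by omega, show 2 * (k + 1) - 1 = 2 * k + 1 by omega,
          show 2 * k + 1 + 1 = 2 * (k + 1) by omega]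
        exact add_comm _ _
      · intro j hj hj'
        rw [Finset.mem_range] at hj
        rcases Nat.lt_or_ge j (k + 1) with h | h <;>
        · simp (disch := omega) only [if_pos, if_neg]
          simp
  · have hn : (2 * n + 1) / 2 = n := by omega
    have hodd : ¬ Even (2 * n + 1) := by simp
    rw [hn] at hk ⊢
    simp only [jetVec, entryH, entryHOdd, hodd, if_false, hn]
    rcases Nat.lt_or_ge (k + 1) n with h1 | h1
    · rw [Finset.sum_eq_single_of_mem (k + 1) (Finset.mem_range.2 (by omega))]
      · simp (disch := omega) only [if_pos, if_neg]
        simp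
      · intro j hj hj'
        rw [Finset.mem_range] at hj
        rcases Nat.lt_or_ge j n with h | h <;>
        · simp (disch := omega) only [if_pos, if_neg]
          simp
    · obtain rfl : n = k + 1 := by omega
      rw [Finset.sum_eq_single_of_mem (2 * (k + 1)) (Finset.mem_range.2 (by omega))]
      · simp (disch := omega) only [if_pos, if_neg]
        simp [show k + 1 + k + 1 = 2 * (k + 1) by omega]
      · intro j hj hj'
        rw [Finset.mem_range] at hj
        rcases Nat.lt_or_ge j (k + 1) with h | h <;>
        · simp (disch := omega) only [if_pos, if_neg]
          simp

theorem coord_opH_last {L : OpExpr 𝓗} {r : ℕ} (hL : L.IsOfOrder r) {t : ℝ} (x : HilbertPow 𝓗 r)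
    (hr : ¬ Even r) :
    coord r (2 * (r / 2)) (L.opH r t x)
      = -Complex.I • (quasiVec r x (r / 2) - L.coef (r / 2) t (L.jetVec r t x)) := by
  have hq0 : L.q 0 t = 0 := congrFun hL.q_zero t
  obtain ⟨n, rfl | rfl⟩ := Nat.even_or_odd' r
  · simp at hr
  rw [opH, coord_blockOp (by omega)]
  have hn : (2 * n + 1) / 2 = n := by omega
  have hI : ∀ v : 𝓗, Complex.I • Complex.I • v = -v := fun v => by
    rw [smul_smul, Complex.I_mul_I, neg_one_smul]
  have hI2 : ∀ v : 𝓗, Complex.I • (Complex.I / 2) • v = -((1 / 2 : ℂ) • v) := fun v => by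
    rw [smul_smul, ← neg_smul]; congr 1
    linear_combination (1 / 2 : ℂ) * Complex.I_sq
  simp only [quasiVec, coef, jetVec, entryH, entryHOdd, hr, if_false, hn]
  rcases Nat.eq_zero_or_pos n with h0 | h0
  · subst h0
    simp [hq0, hI]
  · obtain ⟨k, rfl⟩ : ∃ k, n = k + 1 := ⟨n - 1, by omega⟩
    rw [← Finset.sum_subset (s₁ := {k, 2 * k + 1, 2 * k + 2})
      (by intro k hk; simp at hk ⊢; omega)]
    · rw [Finset.sum_insert (by simp; omega), Finset.sum_insert (by simp), Finset.sum_singleton]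
      simp (disch := omega) only [if_pos, if_neg]
      simp [show k + 1 + (k + 1) - 1 = 2 * k + 1 by omega, show 2 * (k + 1) = 2 * k + 2 by omega,
        smul_sub, smul_add, hI, hI2]
      module
    · intro j hj hj'
      rw [Finset.mem_range] at hj
      simp at hj'
      rcases Nat.lt_or_ge j (k + 1) with h | h <;>
      · simp (disch := omega) only [if_pos, if_neg]
        simp

end OpExpr

/-! ### Linearity, orders and adjoints of expressions -/

namespace OpExpr

variable {𝓗 : Type*} [NormedAddCommGroup 𝓗] [InnerProductSpace ℂ 𝓗]

theorem coef_sub_left (L K : OpExpr 𝓗) (j : ℕ) (t : ℝ) (u : ℕ → 𝓗) :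
    (L - K).coef j t u = L.coef j t u - K.coef j t u := by
  change (L.p j t - K.p j t) (u j) + (Complex.I / 2) • ((L.s (j + 1) t - K.s (j + 1) t) (u (j + 1))
    - (L.q j t - K.q j t) (u (j - 1))) = _
  simp only [coef, sub_apply]
  module

theorem coef_add_left (L K : OpExpr 𝓗) (j : ℕ) (t : ℝ) (u : ℕ → 𝓗) :
    (L + K).coef j t u = L.coef j t u + K.coef j t u := by
  change (L.p j t + K.p j t) (u j) + (Complex.I / 2) • ((L.s (j + 1) t + K.s (j + 1) t) (u (j + 1))
    - (L.q j t + K.q j t) (u (j - 1))) = _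
  simp only [coef, add_apply]
  module

theorem coef_smul_left (c : ℂ) (L : OpExpr 𝓗) (j : ℕ) (t : ℝ) (u : ℕ → 𝓗) :
    (c • L).coef j t u = c • L.coef j t u := by
  change (c • L.p j t) (u j) + (Complex.I / 2) • ((c • L.s (j + 1) t) (u (j + 1))
    - (c • L.q j t) (u (j - 1))) = _
  simp only [coef, smul_apply]
  module

theorem coef_add (L : OpExpr 𝓗) (j : ℕ) (t : ℝ) (u v : ℕ → 𝓗) :
    L.coef j t (u + v) = L.coef j t u + L.coef j t v := by
  simp only [coef, Pi.add_apply, map_add]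
  module

theorem coef_smul (L : OpExpr 𝓗) (j : ℕ) (t : ℝ) (c : ℂ) (u : ℕ → 𝓗) :
    L.coef j t (c • u) = c • L.coef j t u := by
  simp only [coef, Pi.smul_apply, map_smul]
  module

theorem IsOfOrder.mono {L : OpExpr 𝓗} {N N' : ℕ} (h : L.IsOfOrder N) (hN : N ≤ N') :
    L.IsOfOrder N' where
  p_eq_zero j hj := h.p_eq_zero j (by omega)
  q_eq_zero j hj := h.q_eq_zero j (by omega)
  s_eq_zero j hj := h.s_eq_zero j (by omega)
  q_zero := h.q_zero
  s_zero := h.s_zero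

theorem IsOfOrder.sub {L K : OpExpr 𝓗} {N : ℕ} (h : L.IsOfOrder N) (h' : K.IsOfOrder N) :
    (L - K).IsOfOrder N where
  p_eq_zero j hj := by
    change L.p j - K.p j = 0
    rw [h.p_eq_zero j hj, h'.p_eq_zero j hj, sub_zero]
  q_eq_zero j hj := by
    change L.q j - K.q j = 0
    rw [h.q_eq_zero j hj, h'.q_eq_zero j hj, sub_zero]
  s_eq_zero j hj := by
    change L.s j - K.s j = 0
    rw [h.s_eq_zero j hj, h'.s_eq_zero j hj, sub_zero]
  q_zero := by
    change L.q 0 - K.q 0 = 0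
    rw [h.q_zero, h'.q_zero, sub_zero]
  s_zero := by
    change L.s 0 - K.s 0 = 0
    rw [h.s_zero, h'.s_zero, sub_zero]

theorem IsOfOrder.add {L K : OpExpr 𝓗} {N : ℕ} (h : L.IsOfOrder N) (h' : K.IsOfOrder N) :
    (L + K).IsOfOrder N where
  p_eq_zero j hj := by
    change L.p j + K.p j = 0
    rw [h.p_eq_zero j hj, h'.p_eq_zero j hj, add_zero]
  q_eq_zero j hj := by
    change L.q j + K.q j = 0
    rw [h.q_eq_zero j hj, h'.q_eq_zero j hj, add_zero]
  s_eq_zero j hj := by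
    change L.s j + K.s j = 0
    rw [h.s_eq_zero j hj, h'.s_eq_zero j hj, add_zero]
  q_zero := by
    change L.q 0 + K.q 0 = 0
    rw [h.q_zero, h'.q_zero, add_zero]
  s_zero := by
    change L.s 0 + K.s 0 = 0
    rw [h.s_zero, h'.s_zero, add_zero]

theorem IsOfOrder.smul {L : OpExpr 𝓗} {N : ℕ} (c : ℂ) (h : L.IsOfOrder N) :
    (c • L).IsOfOrder N where
  p_eq_zero j hj := by
    change c • L.p j = 0
    rw [h.p_eq_zero j hj, smul_zero]
  q_eq_zero j hj := by
    change c • L.q j = 0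
    rw [h.q_eq_zero j hj, smul_zero]
  s_eq_zero j hj := by
    change c • L.s j = 0
    rw [h.s_eq_zero j hj, smul_zero]
  q_zero := by
    change c • L.q 0 = 0
    rw [h.q_zero, smul_zero]
  s_zero := by
    change c • L.s 0 = 0
    rw [h.s_zero, smul_zero]

theorem coef_eq_zero {L : OpExpr 𝓗} {N : ℕ} (h : L.IsOfOrder N) {j : ℕ} (hj : (N + 1) / 2 < j)
    (t : ℝ) (u : ℕ → 𝓗) : L.coef j t u = 0 := by
  rw [coef, congrFun (h.p_eq_zero j (by omega)) t, congrFun (h.q_eq_zero j (by omega)) t,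
    congrFun (h.s_eq_zero (j + 1) (by omega)) t]
  simp

/-- An expression of even order `N` has no coefficient that acts on derivatives beyond `N/2`, so the
higher entries of a recovered jet are irrelevant for `m`. -/
theorem coef_congr {m : OpExpr 𝓗} {N : ℕ} (h : m.IsOfOrder N) (hN : Even N) (j : ℕ) (t : ℝ)
    {u v : ℕ → 𝓗} (huv : ∀ k, 2 * k ≤ N → u k = v k) : m.coef j t u = m.coef j t v := by
  obtain ⟨k, rfl⟩ := hN
  have e1 : m.p j t (u j) = m.p j t (v j) := by
    by_cases hj : 2 * j ≤ k + k
    · rw [huv j hj]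
    · rw [congrFun (h.p_eq_zero j (by omega)) t]; rfl
  have e2 : m.s (j + 1) t (u (j + 1)) = m.s (j + 1) t (v (j + 1)) := by
    by_cases hj : 2 * (j + 1) ≤ k + k
    · rw [huv (j + 1) hj]
    · rw [congrFun (h.s_eq_zero (j + 1) (by omega)) t]; rfl
  have e3 : m.q j t (u (j - 1)) = m.q j t (v (j - 1)) := by
    by_cases hj : 2 * (j - 1) ≤ k + k
    · rw [huv (j - 1) hj]
    · rw [congrFun (h.q_eq_zero j (by omega)) t]; rfl
  rw [coef, coef, e1, e2, e3]

/-- The form is collected according to the test index; the sum with the `q_j` is shifted by one, and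
`q_0 = 0` supplies the missing term. The free cutoff `K` allows sums of a common length and tests
with a single jet entry. -/
theorem jetForm_eq_sum {L : OpExpr 𝓗} {N K : ℕ} (h : L.IsOfOrder N) (hK : (N + 1) / 2 ≤ K) (t : ℝ)
    (u v : ℕ → 𝓗) :
    L.jetForm N t u v = ∑ j ∈ Finset.range (K + 1), inner ℂ (v j) (L.coef j t u) := by
  have e1 : ∑ j ∈ Finset.range (N / 2 + 1), (inner ℂ (v j) (L.p j t (u j)) : ℂ)
      = ∑ j ∈ Finset.range (K + 1), inner ℂ (v j) (L.p j t (u j)) := by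
    refine Finset.sum_subset (Finset.range_mono (by omega)) fun j _ hj => ?_
    rw [Finset.mem_range] at hj
    rw [congrFun (h.p_eq_zero j (by omega)) t]
    simp
  have e2 : ∑ j ∈ Finset.range ((N + 1) / 2), (inner ℂ (v j) (L.s (j + 1) t (u (j + 1))) : ℂ)
      = ∑ j ∈ Finset.range (K + 1), inner ℂ (v j) (L.s (j + 1) t (u (j + 1))) := by
    refine Finset.sum_subset (Finset.range_mono (by omega)) fun j _ hj => ?_
    rw [Finset.mem_range] at hj
    rw [congrFun (h.s_eq_zero (j + 1) (by omega)) t]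
    simp
  have e3 : ∑ j ∈ Finset.range ((N + 1) / 2), (inner ℂ (v (j + 1)) (L.q (j + 1) t (u j)) : ℂ)
      = ∑ j ∈ Finset.range (K + 1), inner ℂ (v j) (L.q j t (u (j - 1))) := by
    rw [Finset.sum_range_succ', congrFun h.q_zero t]
    simp only [Nat.add_sub_cancel, Pi.zero_apply, zero_apply, inner_zero_right, add_zero]
    refine Finset.sum_subset (Finset.range_mono (by omega)) fun j _ hj => ?_
    rw [Finset.mem_range] at hj
    rw [congrFun (h.q_eq_zero (j + 1) (by omega)) t]
    simp
  rw [jetForm, Finset.sum_sub_distrib, e1, e2, e3]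
  simp only [coef, inner_add_right, inner_smul_right, inner_sub_right, Finset.sum_add_distrib,
    Finset.mul_sum, mul_sub, Finset.sum_sub_distrib]

/-- `K` is the formal adjoint of `L` at the point `t`. -/
structure IsAdjointAt [CompleteSpace 𝓗] (L K : OpExpr 𝓗) (t : ℝ) : Prop where
  p : ∀ j, ContinuousLinearMap.adjoint (L.p j t) = K.p j t
  q : ∀ j, ContinuousLinearMap.adjoint (L.q j t) = K.s j t
  s : ∀ j, ContinuousLinearMap.adjoint (L.s j t) = K.q j t

theorem IsAdjointAt.symm [CompleteSpace 𝓗] {L K : OpExpr 𝓗} {t : ℝ} (h : L.IsAdjointAt K t) :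
    K.IsAdjointAt L t where
  p j := by rw [← h.p, ContinuousLinearMap.adjoint_adjoint]
  q j := by rw [← h.s, ContinuousLinearMap.adjoint_adjoint]
  s j := by rw [← h.q, ContinuousLinearMap.adjoint_adjoint]

theorem adjoint_ringInverse [CompleteSpace 𝓗] (A : 𝓗 →L[ℂ] 𝓗) :
    ContinuousLinearMap.adjoint (Ring.inverse A)
      = Ring.inverse (ContinuousLinearMap.adjoint A) := by
  rw [← ContinuousLinearMap.star_eq_adjoint, ← ContinuousLinearMap.star_eq_adjoint,
    Ring.inverse_star]

theorem adjoint_mul' [CompleteSpace 𝓗] (A B : 𝓗 →L[ℂ] 𝓗) :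
    ContinuousLinearMap.adjoint (A * B)
      = ContinuousLinearMap.adjoint B * ContinuousLinearMap.adjoint A := by
  simp only [← ContinuousLinearMap.star_eq_adjoint, star_mul]

theorem adjoint_one' [CompleteSpace 𝓗] :
    ContinuousLinearMap.adjoint (1 : 𝓗 →L[ℂ] 𝓗) = 1 := by
  rw [← ContinuousLinearMap.star_eq_adjoint, star_one]

theorem adjoint_smul' [CompleteSpace 𝓗] (c : ℂ) (A : 𝓗 →L[ℂ] 𝓗) :
    ContinuousLinearMap.adjoint (c • A) = conj c • ContinuousLinearMap.adjoint A := by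
  simp only [← ContinuousLinearMap.star_eq_adjoint, star_smul]
  rfl

theorem adjoint_opH [CompleteSpace 𝓗] {L K : OpExpr 𝓗} {t : ℝ} (h : L.IsAdjointAt K t) (r : ℕ) :
    ContinuousLinearMap.adjoint (L.opH r t) = K.opH r t := by
  refine adjoint_blockOp fun i _ j _ => ?_
  have hp := h.p
  have hq := h.q
  have hs := h.s
  have h4 : conj (4 : ℂ) = 4 := Complex.conj_ofNat 4
  have h2 : conj (2 : ℂ) = 2 := Complex.conj_ofNat 2
  unfold entryH
  by_cases hr : Even r
  · rw [if_pos hr, if_pos hr]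
    unfold entryHEven
    dsimp only
    by_cases hi : i < r / 2 <;> by_cases hj : j < r / 2
    · simp only [hi, hj, and_self, if_true]
      rcases lt_trichotomy i j with hij | rfl | hij
      · by_cases hij' : j = i + 1
        · subst hij'
          simp [hp, hq, hs, neg_div, adjoint_smul', h2, h4, show ¬ i = i + 1 + 1 by omega]
        · simp (disch := omega) only [if_neg, map_zero]
      · by_cases hij' : i + 1 = r / 2
        · simp [hij', hp, hq, hs, adjoint_mul', adjoint_ringInverse, mul_assoc, adjoint_smul', h2, h4]
        · simp [hij', hp]
      · by_cases hij' : i = j + 1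
        · subst hij'
          simp [hp, hq, hs, adjoint_smul', h2, h4, show ¬ j = j + 1 + 1 by omega, neg_div]
        · simp (disch := omega) only [if_neg, map_zero]
    · simp only [hi, hj, and_false, and_true, if_false, if_true]
      split_ifs <;> simp [hp, hq, hs, adjoint_mul', adjoint_ringInverse, adjoint_one',
        adjoint_smul', h2, h4, neg_div]
    · simp only [hi, hj, and_false, false_and, if_false, if_true]
      split_ifs <;> simp [hp, hq, hs, adjoint_mul', adjoint_ringInverse, adjoint_one',
        adjoint_smul', h2, h4, neg_div]
    · simp only [hi, hj, and_false, if_false]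
      split_ifs <;> first
        | (exfalso; omega)
        | simp [hp, adjoint_ringInverse]
  · rw [if_neg hr, if_neg hr]
    unfold entryHOdd
    dsimp only
    by_cases hi : i < r / 2 <;> by_cases hj : j < r / 2
    · simp only [hi, hj, and_self, if_true]
      rcases lt_trichotomy i j with hij | rfl | hij
      · by_cases hij' : j = i + 1
        · subst hij'
          simp [hp, hq, hs, neg_div, adjoint_smul', h2, h4, show ¬ i = i + 1 + 1 by omega]
        · simp (disch := omega) only [if_neg, map_zero]
      · simp [hp]
      · by_cases hij' : i = j + 1
        · subst hij'
          simp [hp, hq, hs, adjoint_smul', h2, h4, show ¬ j = j + 1 + 1 by omega, neg_div]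
        · simp (disch := omega) only [if_neg, map_zero]
    · simp only [hi, hj, and_false, and_true, if_false, if_true]
      split_ifs <;> simp [hp, hq, hs, adjoint_one', adjoint_smul', h2, h4]
    · simp only [hi, hj, and_false, false_and, if_false, if_true]
      split_ifs <;> simp [hp, hq, hs, adjoint_one', adjoint_smul', h2, h4]
    · simp only [hi, hj, and_false, if_false]
      split_ifs <;> first
        | (exfalso; omega)
        | simp [hp, adjoint_one', adjoint_smul', h2, h4]

end OpExpr

/-! ### The Hamiltonian and the weight as forms on recovered jets -/

namespace OpExpr

variable {𝓗 : Type*} [NormedAddCommGroup 𝓗] [InnerProductSpace ℂ 𝓗]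

theorem sum_range_blocks {A : Type*} [AddCommMonoid A] (r : ℕ) (f : ℕ → A) :
    ∑ k ∈ Finset.range r, f k = ∑ k ∈ Finset.range (r / 2), f k
      + ∑ k ∈ Finset.range (r / 2), f (r / 2 + k) + if Even r then 0 else f (2 * (r / 2)) := by
  obtain ⟨n, rfl | rfl⟩ := Nat.even_or_odd' r
  · rw [if_pos (even_two_mul n), add_zero, show 2 * n / 2 = n by omega, two_mul,
      Finset.sum_range_add]
  · rw [if_neg (by simp), show (2 * n + 1) / 2 = n by omega, Finset.sum_range_succ, two_mul,
      Finset.sum_range_add]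

theorem inner_opH {L : OpExpr 𝓗} {r : ℕ} (hL : L.IsOfOrder r) {t : ℝ} (x' x : HilbertPow 𝓗 r) :
    (inner ℂ x' (L.opH r t x) : ℂ)
      = ∑ i ∈ Finset.range (r / 2),
          inner ℂ (coord r i x') (quasiVec r x i - L.coef i t (L.jetVec r t x))
        + ∑ k ∈ Finset.range (r / 2), inner ℂ (coord r (r / 2 + k) x') (L.jetVec r t x (k + 1))
        + if Even r then 0 else inner ℂ (coord r (2 * (r / 2)) x')
            (-Complex.I • (quasiVec r x (r / 2) - L.coef (r / 2) t (L.jetVec r t x))) := by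
  rw [inner_eq_sum_coord, sum_range_blocks]
  congr 1
  · congr 1
    · exact Finset.sum_congr rfl fun i hi => by rw [coord_opH_lt hL x (Finset.mem_range.1 hi)]
    · exact Finset.sum_congr rfl fun i hi => by rw [coord_opH_add x (Finset.mem_range.1 hi)]
  · split_ifs with h
    · rfl
    · rw [coord_opH_last hL x h]

theorem jetVec_of_lt (L : OpExpr 𝓗) {r k : ℕ} (t : ℝ) (x : HilbertPow 𝓗 r) (h : k < r / 2) :
    L.jetVec r t x k = coord r k x := if_pos h

theorem jetVec_of_gt (L : OpExpr 𝓗) {r k : ℕ} (t : ℝ) (x : HilbertPow 𝓗 r) (h : r / 2 < k) :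
    L.jetVec r t x k = 0 := by
  rw [jetVec, if_neg (by omega), if_neg (by omega)]

theorem jetVec_even (L : OpExpr 𝓗) {r : ℕ} (hr : Even r) (t : ℝ) (x : HilbertPow 𝓗 r) :
    L.jetVec r t x (r / 2) = Ring.inverse (L.p (r / 2) t) (coord r (2 * (r / 2) - 1) x
        + (Complex.I / 2) • L.q (r / 2) t (coord r (r / 2 - 1) x)) := by
  rw [jetVec, if_neg (by omega), if_pos rfl, if_pos hr]

theorem jetVec_odd (L : OpExpr 𝓗) {r : ℕ} (hr : ¬Even r) (t : ℝ) (x : HilbertPow 𝓗 r) :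
    L.jetVec r t x (r / 2) = Complex.I • coord r (2 * (r / 2)) x := by
  rw [jetVec, if_neg (by omega), if_pos rfl, if_neg hr]

theorem p_jetVec {L : OpExpr 𝓗} {r : ℕ} (hr : Even r) {t : ℝ} (hu : IsUnit (L.p (r / 2) t))
    (x : HilbertPow 𝓗 r) :
    L.p (r / 2) t (L.jetVec r t x (r / 2)) = coord r (2 * (r / 2) - 1) x
        + (Complex.I / 2) • L.q (r / 2) t (coord r (r / 2 - 1) x) := by
  rw [jetVec_even L hr]
  have := congrArg (fun A : 𝓗 →L[ℂ] 𝓗 => A (coord r (2 * (r / 2) - 1) x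
        + (Complex.I / 2) • L.q (r / 2) t (coord r (r / 2 - 1) x))) (Ring.mul_inverse_cancel _ hu)
  simpa only [mul_apply_eq_comp, one_apply_eq_self] using this

theorem jetVec_odd_indep (L K : OpExpr 𝓗) {r : ℕ} (hr : ¬Even r) (t : ℝ) (x : HilbertPow 𝓗 r) :
    L.jetVec r t x = K.jetVec r t x := by
  funext k
  simp only [jetVec, hr, if_false]

theorem jetVec_add (L : OpExpr 𝓗) (r : ℕ) (t : ℝ) (x y : HilbertPow 𝓗 r) :
    L.jetVec r t (x + y) = L.jetVec r t x + L.jetVec r t y := by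
  funext k
  simp only [jetVec, Pi.add_apply]
  split_ifs <;> (simp only [map_add, smul_add, add_zero]; try abel)

/-- The difference of the Hamiltonians of two expressions as a form on the recovered jets. -/
theorem inner_opH_sub [CompleteSpace 𝓗] {L K K' : OpExpr 𝓗} {r : ℕ} (hr : 0 < r)
    (hL : L.IsOfOrder r) (hK : K.IsOfOrder r) {t : ℝ} (hKK : K.IsAdjointAt K' t)
    (huL : Even r → IsUnit (L.p (r / 2) t)) (huK : Even r → IsUnit (K.p (r / 2) t))
    (x' x : HilbertPow 𝓗 r) :
    (inner ℂ x' (L.opH r t x) : ℂ) - inner ℂ x' (K.opH r t x)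
      = -(L - K).jetForm r t (L.jetVec r t x) (K'.jetVec r t x') := by
  rw [inner_opH hL, inner_opH hK, jetForm_eq_sum (hL.sub hK) (K := r / 2 + 1) (by omega),
    Finset.sum_range_succ, K'.jetVec_of_gt t x' (Nat.lt_succ_self _), inner_zero_left, add_zero]
  simp only [coef_sub_left]
  by_cases he : Even r
  · simp only [he, if_true, add_zero]
    obtain ⟨m, hm⟩ : ∃ m, r / 2 = m + 1 := ⟨r / 2 - 1, by
      obtain ⟨k, rfl⟩ := he
      omega⟩
    -- For even `r` the jets recovered through `L` and `K` agree below index `n` and differ at `n`.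
    -- The discrepancy cancels because of the relation `p_n u_n = x_{2n} + (i/2) q_n x_n`, used for
    -- `L` and `K` on `x` and for the adjoint `K'` on `x'`.
    have hpL := p_jetVec he (huL he) x
    have hpK := p_jetVec he (huK he) x
    have hpK' := p_jetVec he (t := t) (L := K') (by
      rw [← hKK.p, ← ContinuousLinearMap.star_eq_adjoint, isUnit_star]; exact huK he) x'
    rw [hm] at hpL hpK hpK' ⊢
    have hr2 : r = 2 * (m + 1) := by
      obtain ⟨k, rfl⟩ := he
      omega
    simp only [Finset.sum_range_succ]
    set u := L.jetVec r t x with hu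
    set v := K.jetVec r t x with hv
    set w := K'.jetVec r t x' with hw
    have huv : ∀ k, k < m + 1 → u k = v k := fun k hk => by
      rw [hu, hv, L.jetVec_of_lt t x (by omega), K.jetVec_of_lt t x (by omega)]
    have hxw : ∀ k, k < m + 1 → coord r k x' = w k := fun k hk => by
      rw [hw, K'.jetVec_of_lt t x' (by omega)]
    have hcoef : ∀ i, i < m → K.coef i t v = K.coef i t u := fun i hi => by
      rw [coef, coef, huv i (by omega), huv (i + 1) (by omega), huv (i - 1) (by omega)]
    have hcm : K.coef m t v = K.coef m t u
        - (Complex.I / 2) • K.s (m + 1) t (u (m + 1) - v (m + 1)) := by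
      rw [coef, coef, ← huv m (by omega), ← huv (m - 1) (by omega), map_sub]
      module
    have hcn : ∀ {J : OpExpr 𝓗}, J.IsOfOrder r → ∀ a : ℕ → 𝓗, J.coef (m + 1) t a
        = J.p (m + 1) t (a (m + 1)) - (Complex.I / 2) • J.q (m + 1) t (a m) := fun {J} hJ a => by
      rw [coef, congrFun (hJ.s_eq_zero (m + 1 + 1) (by omega)) t]
      simp [sub_eq_add_neg]
    have s1 : ∑ i ∈ Finset.range m, (inner ℂ (coord r i x') (quasiVec r x i - L.coef i t u) : ℂ)
        - ∑ i ∈ Finset.range m, inner ℂ (coord r i x') (quasiVec r x i - K.coef i t v)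
        = -∑ i ∈ Finset.range m, inner ℂ (w i) (L.coef i t u - K.coef i t u) := by
      rw [← Finset.sum_sub_distrib, ← Finset.sum_neg_distrib]
      refine Finset.sum_congr rfl fun i hi => ?_
      rw [Finset.mem_range] at hi
      rw [hcoef i hi, hxw i (by omega), ← inner_sub_right, ← inner_neg_right]
      congr 1
      abel
    have s2 : ∑ i ∈ Finset.range m, (inner ℂ (coord r (m + 1 + i) x') (u (i + 1)) : ℂ)
        = ∑ i ∈ Finset.range m, inner ℂ (coord r (m + 1 + i) x') (v (i + 1)) := by
      refine Finset.sum_congr rfl fun i hi => ?_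
      rw [Finset.mem_range] at hi
      rw [huv (i + 1) (by omega)]
    have e1 : m + 1 + m = 2 * (m + 1) - 1 := by omega
    simp only [Nat.add_sub_cancel] at hpL hpK hpK'
    have hx1 : coord r m x = u m := by rw [hu, L.jetVec_of_lt t x (by omega)]
    rw [hx1] at hpL hpK
    rw [hxw m (by omega)] at hpK'
    have hlast : coord r (2 * (m + 1) - 1) x' = K'.p (m + 1) t (w (m + 1))
        - (Complex.I / 2) • K'.q (m + 1) t (w m) := by
      rw [hpK']
      abel
    rw [e1, hlast, hcn hL, hcn hK, hcm, s2, hxw m (by omega), ← hKK.p, ← hKK.s, hpL]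
    have key : K.p (m + 1) t (u (m + 1)) - K.p (m + 1) t (v (m + 1))
        = K.p (m + 1) t (u (m + 1)) - (coord r (2 * (m + 1) - 1) x
          + (Complex.I / 2) • K.q (m + 1) t (u m)) := by rw [hpK]
    have key2 := congrArg (fun a => (inner ℂ (w (m + 1)) a : ℂ)) key
    simp only [inner_sub_right, inner_add_right, inner_smul_right] at key2
    simp only [inner_sub_left, inner_smul_left, ContinuousLinearMap.adjoint_inner_left, map_div₀,
      Complex.conj_I, Complex.conj_ofNat, inner_sub_right, inner_add_right, inner_smul_right,
      map_sub] at s1 key2 ⊢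
    linear_combination s1 + key2
  · simp only [he, if_false]
    -- For odd `r` the recovery of the jet does not involve the coefficients, so the two
    -- Hamiltonians can be subtracted term by term.
    have hjet : ∀ J : OpExpr 𝓗, J.jetVec r t x = L.jetVec r t x :=
      fun J => J.jetVec_odd_indep L he t x
    rw [hjet K]
    set u := L.jetVec r t x with hu
    rw [Finset.sum_range_succ, K'.jetVec_odd he]
    have s1 : ∑ i ∈ Finset.range (r / 2),
          (inner ℂ (coord r i x') (quasiVec r x i - L.coef i t u) : ℂ)
        - ∑ i ∈ Finset.range (r / 2), inner ℂ (coord r i x') (quasiVec r x i - K.coef i t u)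
        = -∑ i ∈ Finset.range (r / 2),
          inner ℂ (K'.jetVec r t x' i) (L.coef i t u - K.coef i t u) := by
      rw [← Finset.sum_sub_distrib, ← Finset.sum_neg_distrib]
      refine Finset.sum_congr rfl fun i hi => ?_
      rw [Finset.mem_range] at hi
      rw [K'.jetVec_of_lt t x' hi, ← inner_sub_right, ← inner_neg_right]
      congr 1
      abel
    simp only [inner_sub_left, inner_smul_left, Complex.conj_I, inner_sub_right, inner_add_right,
      inner_smul_right] at s1 ⊢
    linear_combination s1

theorem sum_entryJet {L : OpExpr 𝓗} {r : ℕ} (hr : 0 < r) (t : ℝ) (x : HilbertPow 𝓗 r) {k : ℕ}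
    (hk : k ≤ r / 2) :
    ∑ j ∈ Finset.range r, L.entryJet r t k j (coord r j x) = L.jetVec r t x k := by
  rcases hk.lt_or_eq with h | rfl
  · rw [L.jetVec_of_lt t x h, Finset.sum_eq_single_of_mem k (Finset.mem_range.2 (by omega))]
    · simp [entryJet, h]
    · intro j _ hj
      simp [entryJet, h, hj]
  · by_cases he : Even r
    · rw [L.jetVec_even he]
      obtain ⟨m, hm⟩ : ∃ m, r = 2 * (m + 1) := ⟨r / 2 - 1, by
        obtain ⟨k, rfl⟩ := he
        omega⟩
      subst hm
      have h2 : 2 * (m + 1) / 2 = m + 1 := by omega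
      simp only [entryJet, h2, lt_irrefl, if_false, even_two_mul, if_true]
      rw [Finset.sum_eq_add_of_mem m (2 * m + 1) (Finset.mem_range.2 (by omega))
        (Finset.mem_range.2 (by omega)) (by omega)]
      · simp (disch := omega) only [if_pos, if_neg]
        simp [show 2 * (m + 1) - 1 = 2 * m + 1 by omega,
          show 2 * m + 1 + 1 = 2 * (m + 1) by omega, add_comm]
      · intro j hj hj'
        rw [Finset.mem_range] at hj
        simp (disch := omega) only [if_neg]
        simp
    · rw [L.jetVec_odd he, Finset.sum_eq_single_of_mem (2 * (r / 2)) (Finset.mem_range.2 (by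
        have := Nat.not_even_iff.1 he
        omega))]
      · simp [entryJet, he]
      · intro j _ hj
        simp [entryJet, he, hj]

theorem sum_entryForm {m : OpExpr 𝓗} (t : ℝ) {n k : ℕ} (hk : k ≤ n) {u : ℕ → 𝓗}
    (hu : u (n + 1) = 0) (hm : m.q 0 t = 0) :
    ∑ l ∈ Finset.range (n + 1), m.entryForm t k l (u l) = m.coef k t u := by
  have hsum : ∑ l ∈ Finset.range (n + 1), m.entryForm t k l (u l)
      = ∑ l ∈ Finset.range (n + 2), m.entryForm t k l (u l) := by
    rw [Finset.sum_range_succ _ (n + 1), hu, map_zero, add_zero]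
  rw [hsum, coef]
  rcases Nat.eq_zero_or_pos k with rfl | h0
  · rw [Finset.sum_eq_add_of_mem 0 1 (Finset.mem_range.2 (by omega))
      (Finset.mem_range.2 (by omega)) (by omega)]
    · simp [entryForm, hm]
    · intro j _ hj
      simp (disch := omega) only [entryForm, if_neg]
      simp
  · obtain ⟨k, rfl⟩ : ∃ j, k = j + 1 := ⟨k - 1, by omega⟩
    rw [← Finset.sum_subset (s₁ := {k, k + 1, k + 2})
      (by intro j hj; simp at hj ⊢; omega)]
    · rw [Finset.sum_insert (by simp), Finset.sum_insert (by simp), Finset.sum_singleton]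
      simp [entryForm, show ¬ k = k + 1 + 1 by omega]
      module
    · intro j _ hj
      simp at hj
      simp (disch := omega) only [entryForm, if_neg]
      simp

theorem coord_opW [CompleteSpace 𝓗] {L m : OpExpr 𝓗} {r : ℕ} (hr : 0 < r) (hm : m.q 0 = 0) (t : ℝ)
    (x : HilbertPow 𝓗 r) {i : ℕ} (hi : i < r) :
    coord r i (L.opW m r t x) = ∑ k ∈ Finset.range (r / 2 + 1),
      ContinuousLinearMap.adjoint (L.entryJet r t k i) (m.coef k t (L.jetVec r t x)) := by
  rw [opW, coord_blockOp hi]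
  simp only [sum_apply, mul_apply_eq_comp]
  rw [Finset.sum_comm]
  refine Finset.sum_congr rfl fun k hk => ?_
  rw [Finset.mem_range] at hk
  rw [Finset.sum_comm, ← sum_entryForm t (by omega : k ≤ r / 2)
    (L.jetVec_of_gt t x (Nat.lt_succ_self _)) (congrFun hm t), map_sum]
  refine Finset.sum_congr rfl fun l hl => ?_
  rw [Finset.mem_range] at hl
  rw [← sum_entryJet hr t x (by omega : l ≤ r / 2), map_sum, map_sum]

theorem inner_opW [CompleteSpace 𝓗] {L m : OpExpr 𝓗} {r : ℕ} (hr : 0 < r) (hm : m.IsOfOrder r)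
    (t : ℝ) (x' x : HilbertPow 𝓗 r) :
    inner ℂ x' (L.opW m r t x) = m.jetForm r t (L.jetVec r t x) (L.jetVec r t x') := by
  rw [jetForm_eq_sum hm (K := r / 2 + 1) (by omega), Finset.sum_range_succ,
    L.jetVec_of_gt t x' (Nat.lt_succ_self _), inner_zero_left, add_zero, inner_eq_sum_coord]
  have e1 : ∀ i ∈ Finset.range r, (inner ℂ (coord r i x') (coord r i (L.opW m r t x)) : ℂ)
      = ∑ k ∈ Finset.range (r / 2 + 1),
        inner ℂ (L.entryJet r t k i (coord r i x')) (m.coef k t (L.jetVec r t x)) := fun i hi => by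
    rw [coord_opW hr hm.q_zero t x (Finset.mem_range.1 hi), inner_sum]
    exact Finset.sum_congr rfl fun k _ => ContinuousLinearMap.adjoint_inner_right _ _ _
  rw [Finset.sum_congr rfl e1, Finset.sum_comm]
  refine Finset.sum_congr rfl fun k hk => ?_
  rw [Finset.mem_range] at hk
  rw [← sum_inner, sum_entryJet hr t x' (by omega)]

end OpExpr

/-! ### The matrix `Q` and its real part -/

section Corner

variable {𝓗 : Type*} [NormedAddCommGroup 𝓗] [InnerProductSpace ℂ 𝓗]

/-- The operator `[[0, i], [-i, 0]]` on `𝓗^r`, with `C` in the corner if `r` is odd. -/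
def cornerOp (r : ℕ) (C : 𝓗 →L[ℂ] 𝓗) : HilbertPow 𝓗 r →L[ℂ] HilbertPow 𝓗 r :=
  blockOp r fun i j =>
    if i < r / 2 ∧ j = r / 2 + i then Complex.I • 1
    else if j < r / 2 ∧ i = r / 2 + j then -(Complex.I • 1)
    else if i = 2 * (r / 2) ∧ j = 2 * (r / 2) then C
    else 0

theorem index_cases {r k : ℕ} (hk : k < r) :
    k < r / 2 ∨ (∃ i < r / 2, k = r / 2 + i) ∨ (¬Even r ∧ k = 2 * (r / 2)) := by
  obtain ⟨n, rfl | rfl⟩ := Nat.even_or_odd' r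
  · rcases Nat.lt_or_ge k n with h | h
    · exact Or.inl (by omega)
    · exact Or.inr (Or.inl ⟨k - n, by omega, by omega⟩)
  · rcases Nat.lt_or_ge k n with h | h
    · exact Or.inl (by omega)
    · rcases Nat.lt_or_ge k (2 * n) with h' | h'
      · exact Or.inr (Or.inl ⟨k - n, by omega, by omega⟩)
      · exact Or.inr (Or.inr ⟨by simp, by omega⟩)

theorem coord_cornerOp_lt {r i : ℕ} (C : 𝓗 →L[ℂ] 𝓗) (x : HilbertPow 𝓗 r) (hi : i < r / 2) :
    coord r i (cornerOp r C x) = Complex.I • coord r (r / 2 + i) x := by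
  rw [cornerOp, coord_blockOp (by omega),
    Finset.sum_eq_single_of_mem (r / 2 + i) (Finset.mem_range.2 (by omega))]
  · simp [hi]
  · intro j _ hj
    simp (disch := omega) only [if_neg]
    simp

theorem coord_cornerOp_add {r i : ℕ} (C : 𝓗 →L[ℂ] 𝓗) (x : HilbertPow 𝓗 r) (hi : i < r / 2) :
    coord r (r / 2 + i) (cornerOp r C x) = -(Complex.I • coord r i x) := by
  rw [cornerOp, coord_blockOp (by omega),
    Finset.sum_eq_single_of_mem i (Finset.mem_range.2 (by omega))]
  · simp [hi]
  · intro j _ hj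
    simp (disch := omega) only [if_neg]
    simp

theorem coord_cornerOp_last {r : ℕ} (C : 𝓗 →L[ℂ] 𝓗) (x : HilbertPow 𝓗 r) (hr : ¬Even r) :
    coord r (2 * (r / 2)) (cornerOp r C x) = C (coord r (2 * (r / 2)) x) := by
  have hr' : 2 * (r / 2) < r := by
    have := Nat.not_even_iff.1 hr
    omega
  rw [cornerOp, coord_blockOp hr',
    Finset.sum_eq_single_of_mem (2 * (r / 2)) (Finset.mem_range.2 hr')]
  · simp (disch := omega) only [if_pos, if_neg]
    simp
  · intro j _ hj
    simp (disch := omega) only [if_neg]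
    simp

theorem cornerOp_mul_cornerOp {r : ℕ} {C C' : 𝓗 →L[ℂ] 𝓗} (h : ¬Even r → C * C' = 1) :
    cornerOp r C * cornerOp r C' = 1 := by
  refine ContinuousLinearMap.ext fun x => ext_coord fun k hk => ?_
  rw [mul_apply_eq_comp, one_apply_eq_self]
  have hI : ∀ v : 𝓗, Complex.I • Complex.I • v = -v := fun v => by
    rw [smul_smul, Complex.I_mul_I, neg_one_smul]
  rcases index_cases hk with hk | ⟨i, hi, rfl⟩ | ⟨hr, rfl⟩
  · rw [coord_cornerOp_lt _ _ hk, coord_cornerOp_add _ _ hk, smul_neg, hI, neg_neg]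
  · rw [coord_cornerOp_add _ _ hi, coord_cornerOp_lt _ _ hi, hI, neg_neg]
  · rw [coord_cornerOp_last _ _ hr, coord_cornerOp_last _ _ hr, ← mul_apply_eq_comp, h hr,
      one_apply_eq_self]

theorem isUnit_cornerOp {r : ℕ} {C : 𝓗 →L[ℂ] 𝓗} (h : ¬Even r → IsUnit C) :
    IsUnit (cornerOp r C) :=
  ⟨⟨cornerOp r C, cornerOp r (Ring.inverse C),
    cornerOp_mul_cornerOp fun hr => Ring.mul_inverse_cancel _ (h hr),
    cornerOp_mul_cornerOp fun hr => Ring.inverse_mul_cancel _ (h hr)⟩, rfl⟩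

theorem adjoint_cornerOp [CompleteSpace 𝓗] (r : ℕ) (C : 𝓗 →L[ℂ] 𝓗) :
    ContinuousLinearMap.adjoint (cornerOp r C) = cornerOp r (ContinuousLinearMap.adjoint C) := by
  refine adjoint_blockOp fun i _ j _ => ?_
  have h1 : ContinuousLinearMap.adjoint (1 : 𝓗 →L[ℂ] 𝓗) = 1 := OpExpr.adjoint_one'
  split_ifs <;> first
    | (exfalso; omega)
    | simp [OpExpr.adjoint_smul', h1]

theorem opRe_cornerOp [CompleteSpace 𝓗] (r : ℕ) (C : 𝓗 →L[ℂ] 𝓗) :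
    opRe (cornerOp r C) = cornerOp r (opRe C) := by
  rw [opRe, adjoint_cornerOp]
  refine ContinuousLinearMap.ext fun x => ext_coord fun k hk => ?_
  rw [smul_apply, add_apply, map_smul, map_add]
  rcases index_cases hk with hk | ⟨i, hi, rfl⟩ | ⟨hr, rfl⟩
  · rw [coord_cornerOp_lt _ _ hk, coord_cornerOp_lt _ _ hk, coord_cornerOp_lt _ _ hk]
    module
  · rw [coord_cornerOp_add _ _ hi, coord_cornerOp_add _ _ hi, coord_cornerOp_add _ _ hi]
    module
  · rw [coord_cornerOp_last _ _ hr, coord_cornerOp_last _ _ hr, coord_cornerOp_last _ _ hr, opRe,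
      smul_apply, add_apply]

end Corner

/-! ### The rows of the first order system and of the weight -/

namespace OpExpr

variable {𝓗 : Type*} [NormedAddCommGroup 𝓗] [InnerProductSpace ℂ 𝓗]

theorem opQ_eq_cornerOp (L : OpExpr 𝓗) (r : ℕ) (t : ℝ) :
    L.opQ r t = cornerOp r (L.q (r / 2 + 1) t) := rfl

theorem contDiffOn_opQ {L : OpExpr 𝓗} {r : ℕ} {I : Set ℝ} {k : WithTop ℕ∞}
    (h : ContDiffOn ℝ k (L.q (r / 2 + 1)) I) : ContDiffOn ℝ k (L.opQ r) I := by
  refine contDiffOn_blockOp fun i _ j _ => ?_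
  unfold entryQ
  dsimp only
  split_ifs
  · exact contDiffOn_const
  · exact contDiffOn_const
  · exact h
  · exact contDiffOn_const

theorem derivWithin_opQ {L : OpExpr 𝓗} {r : ℕ} {I : Set ℝ} {t : ℝ} {q' : 𝓗 →L[ℂ] 𝓗}
    (hI : UniqueDiffWithinAt ℝ I t) (h : HasDerivWithinAt (L.q (r / 2 + 1)) q' I t) :
    derivWithin (L.opQ r) I t
      = blockOp r fun i j => if i = 2 * (r / 2) ∧ j = 2 * (r / 2) then q' else 0 := by
  refine derivWithin_blockOp hI fun i _ j _ => ?_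
  unfold entryQ
  dsimp only
  split_ifs
  · omega
  · exact hasDerivWithinAt_const _ _ _
  · omega
  · exact hasDerivWithinAt_const _ _ _
  · exact h
  · exact hasDerivWithinAt_const _ _ _

theorem coord_derivWithin_opQ {L : OpExpr 𝓗} {r : ℕ} {I : Set ℝ} {t : ℝ} {q' : 𝓗 →L[ℂ] 𝓗}
    (hI : UniqueDiffWithinAt ℝ I t) (h : HasDerivWithinAt (L.q (r / 2 + 1)) q' I t)
    (x : HilbertPow 𝓗 r) {k : ℕ} (hk : k < r) :
    coord r k (derivWithin (L.opQ r) I t x)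
      = if k = 2 * (r / 2) then q' (coord r (2 * (r / 2)) x) else 0 := by
  rw [derivWithin_opQ hI h, coord_blockOp hk]
  split_ifs with hk'
  · subst hk'
    rw [Finset.sum_eq_single_of_mem (2 * (r / 2)) (Finset.mem_range.2 hk)]
    · simp
    · intro j _ hj
      simp [hj]
  · simp [hk']

/-- The rows of the first order system. -/
theorem sysLHS_eq_iff [CompleteSpace 𝓗] {L : OpExpr 𝓗} {r : ℕ} (hL : L.IsOfOrder r) {I : Set ℝ}
    {t : ℝ} {q' : 𝓗 →L[ℂ] 𝓗} (hI : UniqueDiffWithinAt ℝ I t)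
    (h : HasDerivWithinAt (L.q (r / 2 + 1)) q' I t)
    (hs : ContinuousLinearMap.adjoint (L.q (r / 2 + 1) t) = L.s (r / 2 + 1) t)
    (x x' g : HilbertPow 𝓗 r) :
    sysLHS (L.opQ r t) (derivWithin (L.opQ r) I t) (L.opH r t) x x' = g ↔
      (∀ i < r / 2, -coord r (r / 2 + i) x'
        - (quasiVec r x i - L.coef i t (L.jetVec r t x)) = coord r i g) ∧
      (∀ i < r / 2, coord r i x' - L.jetVec r t x (i + 1) = coord r (r / 2 + i) g) ∧
      (¬Even r → (Complex.I / 2) • (L.q (r / 2 + 1) t (coord r (2 * (r / 2)) x')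
          + L.s (r / 2 + 1) t (coord r (2 * (r / 2)) x'))
        + (Complex.I / 2) • q' (coord r (2 * (r / 2)) x)
        + Complex.I • (quasiVec r x (r / 2) - L.coef (r / 2) t (L.jetVec r t x))
          = coord r (2 * (r / 2)) g) := by
  have hI2 : ∀ v : 𝓗, Complex.I • Complex.I • v = -v := fun v => by
    rw [smul_smul, Complex.I_mul_I, neg_one_smul]
  have e1 : ∀ i < r / 2, coord r i (sysLHS (L.opQ r t) (derivWithin (L.opQ r) I t) (L.opH r t) x x')
      = -coord r (r / 2 + i) x' - (quasiVec r x i - L.coef i t (L.jetVec r t x)) := fun i hi => by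
    rw [sysLHS, map_sub, map_add, map_smul, map_smul, opQ_eq_cornerOp, opRe_cornerOp,
      coord_cornerOp_lt _ _ hi, coord_derivWithin_opQ hI h x (by omega : i < r),
      if_neg (by omega), coord_opH_lt hL x hi, hI2, smul_zero, add_zero]
  have e2 : ∀ i < r / 2, coord r (r / 2 + i)
        (sysLHS (L.opQ r t) (derivWithin (L.opQ r) I t) (L.opH r t) x x')
      = coord r i x' - L.jetVec r t x (i + 1) := fun i hi => by
    rw [sysLHS, map_sub, map_add, map_smul, map_smul, opQ_eq_cornerOp, opRe_cornerOp,
      coord_cornerOp_add _ _ hi, coord_derivWithin_opQ hI h x (by omega : r / 2 + i < r),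
      if_neg (by omega), coord_opH_add x hi, smul_neg, hI2, smul_zero, add_zero, neg_neg]
  have e3 : ¬Even r → coord r (2 * (r / 2))
        (sysLHS (L.opQ r t) (derivWithin (L.opQ r) I t) (L.opH r t) x x')
      = (Complex.I / 2) • (L.q (r / 2 + 1) t (coord r (2 * (r / 2)) x')
          + L.s (r / 2 + 1) t (coord r (2 * (r / 2)) x'))
        + (Complex.I / 2) • q' (coord r (2 * (r / 2)) x)
        + Complex.I • (quasiVec r x (r / 2) - L.coef (r / 2) t (L.jetVec r t x)) := fun hr => by
    have hr' : 2 * (r / 2) < r := by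
      have := Nat.not_even_iff.1 hr
      omega
    rw [sysLHS, map_sub, map_add, map_smul, map_smul, opQ_eq_cornerOp, opRe_cornerOp,
      coord_cornerOp_last _ _ hr, coord_derivWithin_opQ hI h x hr', if_pos rfl,
      coord_opH_last hL x hr, opRe, hs, smul_apply, add_apply]
    module
  constructor
  · intro hg
    refine ⟨fun i hi => ?_, fun i hi => ?_, fun hr => ?_⟩
    · rw [← e1 i hi, hg]
    · rw [← e2 i hi, hg]
    · rw [← e3 hr, hg]
  · rintro ⟨h1, h2, h3⟩
    refine ext_coord fun k hk => ?_
    rcases index_cases hk with hk | ⟨i, hi, rfl⟩ | ⟨hr, rfl⟩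
    · rw [e1 k hk, h1 k hk]
    · rw [e2 i hi, h2 i hi]
    · rw [e3 hr, h3 hr]

section Weight

variable [CompleteSpace 𝓗] {L K m : OpExpr 𝓗} {r : ℕ}

/-- Row `n - 1` receives the adjoint of the operator `(i/2) p_n⁻¹ q_n` of `K`, and the adjoints of
the coefficients of `K` are those of `L`. This is why the weight in the system of `l_λ` has to be
formed with `l_{conj λ}`. -/
theorem coord_opW_lt (hr : 0 < r) (hm : m.q 0 = 0) {t : ℝ} (h : K.IsAdjointAt L t)
    (x : HilbertPow 𝓗 r) {i : ℕ} (hi : i < r / 2) :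
    coord r i (K.opW m r t x) = m.coef i t (K.jetVec r t x)
      - if Even r ∧ i + 1 = r / 2 then (Complex.I / 2) • L.s (r / 2) t
          (Ring.inverse (L.p (r / 2) t) (m.coef (r / 2) t (K.jetVec r t x))) else 0 := by
  have h2 : conj (2 : ℂ) = 2 := Complex.conj_ofNat 2
  rw [coord_opW hr hm t x (by omega), Finset.sum_range_succ,
    Finset.sum_eq_single_of_mem i (Finset.mem_range.2 hi)]
  · by_cases he : Even r
    · by_cases hi' : i + 1 = r / 2
      · have : i + 1 ≠ 2 * (r / 2) := by omega
        simp [entryJet, hi, he, hi', this, adjoint_one', adjoint_smul', adjoint_mul',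
          adjoint_ringInverse, h.p, h.q, neg_div, h2, sub_eq_add_neg]
        rw [if_neg (by omega)]
        simp [adjoint_smul', adjoint_mul', adjoint_ringInverse, h.p, h.q, neg_div, h2]
      · have : i + 1 ≠ 2 * (r / 2) := by omega
        simp [entryJet, hi, he, hi', this, adjoint_one']
    · have : i ≠ 2 * (r / 2) := by omega
      simp [entryJet, hi, he, this, adjoint_one']
  · intro j hj hj'
    rw [Finset.mem_range] at hj
    simp [entryJet, hj, hj'.symm]

theorem coord_opW_add (hr : 0 < r) (hm : m.q 0 = 0) {t : ℝ} (h : K.IsAdjointAt L t)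
    (x : HilbertPow 𝓗 r) {i : ℕ} (hi : i < r / 2) :
    coord r (r / 2 + i) (K.opW m r t x) = if Even r ∧ i + 1 = r / 2 then
      Ring.inverse (L.p (r / 2) t) (m.coef (r / 2) t (K.jetVec r t x)) else 0 := by
  rw [coord_opW hr hm t x (by omega), Finset.sum_range_succ, Finset.sum_eq_zero, zero_add]
  · by_cases he : Even r
    · by_cases hi' : i + 1 = r / 2
      · have : r / 2 + i + 1 = 2 * (r / 2) := by omega
        simp [entryJet, he, hi', this, adjoint_ringInverse, h.p]
      · have h1 : r / 2 + i + 1 ≠ 2 * (r / 2) := by omega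
        have h2 : r / 2 + i + 1 ≠ r / 2 := by omega
        simp [entryJet, he, hi', h1, h2]
    · have : r / 2 + i ≠ 2 * (r / 2) := by omega
      simp [entryJet, he, this]
  · intro j hj
    rw [Finset.mem_range] at hj
    have : r / 2 + i ≠ j := by omega
    simp [entryJet, hj, this]

theorem coord_opW_last (hm : m.q 0 = 0) {t : ℝ} (x : HilbertPow 𝓗 r) (he : ¬Even r) :
    coord r (2 * (r / 2)) (K.opW m r t x)
      = -(Complex.I • m.coef (r / 2) t (K.jetVec r t x)) := by
  have hr' : 2 * (r / 2) < r := by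
    have := Nat.not_even_iff.1 he
    omega
  rw [coord_opW (by omega) hm t x hr', Finset.sum_range_succ, Finset.sum_eq_zero, zero_add]
  · simp [entryJet, he, adjoint_smul', adjoint_one']
  · intro j hj
    rw [Finset.mem_range] at hj
    have : 2 * (r / 2) ≠ j := by omega
    simp [entryJet, hj, this]

end Weight

end OpExpr

/-! ### Derivatives on an interval and the recursion of quasi-derivatives -/

section Calculus

variable {𝓗 : Type*} [NormedAddCommGroup 𝓗] [NormedSpace ℂ 𝓗] {I : Set ℝ}

theorem contDiffOn_clm_apply_complex {A : ℝ → 𝓗 →L[ℂ] 𝓗} {u : ℝ → 𝓗} {k : WithTop ℕ∞}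
    (hA : ContDiffOn ℝ k A I) (hu : ContDiffOn ℝ k u I) : ContDiffOn ℝ k (fun t => A t (u t)) I :=
  ContDiffOn.clm_apply
    ((ContinuousLinearMap.restrictScalarsL ℂ 𝓗 𝓗 ℝ ℝ).contDiff.comp_contDiffOn hA) hu

theorem hasDerivWithinAt_clm_apply_complex {A : ℝ → 𝓗 →L[ℂ] 𝓗} {A' : 𝓗 →L[ℂ] 𝓗} {u : ℝ → 𝓗}
    {u' : 𝓗} {t : ℝ} (hA : HasDerivWithinAt A A' I t) (hu : HasDerivWithinAt u u' I t) :
    HasDerivWithinAt (fun t => A t (u t)) (A' (u t) + A t u') I t :=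
  HasDerivWithinAt.clm_apply
    ((ContinuousLinearMap.restrictScalarsL ℂ 𝓗 𝓗 ℝ ℝ).hasFDerivAt.comp_hasDerivWithinAt t hA) hu

theorem ContDiffOn.iteratedDerivWithin_of_le {y : ℝ → 𝓗} {N j k : ℕ} (hy : ContDiffOn ℝ N y I)
    (hI : UniqueDiffOn ℝ I) (h : j + k ≤ N) : ContDiffOn ℝ k (iteratedDerivWithin j y I) I := by
  induction j generalizing k with
  | zero =>
    rw [iteratedDerivWithin_zero]
    exact hy.of_le (by exact_mod_cast (by omega : k ≤ N))
  | succ j ih =>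
    rw [iteratedDerivWithin_succ]
    exact (ih (k := k + 1) (by omega)).derivWithin hI (by push_cast; exact le_rfl)

theorem contDiffOn_add_of_iteratedDerivWithin {y : ℝ → 𝓗} {N k : ℕ} (hI : UniqueDiffOn ℝ I)
    (hy : ContDiffOn ℝ N y I) (h : ContDiffOn ℝ k (iteratedDerivWithin N y I) I) :
    ContDiffOn ℝ (N + k : ℕ) y I := by
  induction N generalizing y with
  | zero => simpa using h
  | succ N ih =>
    rw [show N + 1 + k = (N + k) + 1 by omega]
    push_cast at hy ⊢
    rw [contDiffOn_succ_iff_derivWithin hI] at hy ⊢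
    refine ⟨hy.1, by simp, ?_⟩
    rw [iteratedDerivWithin_succ'] at h
    exact_mod_cast ih hy.2.2 h

theorem contDiffOn_succ_of_hasDerivWithinAt {y y' : ℝ → 𝓗} {k : ℕ} (hI : UniqueDiffOn ℝ I)
    (h : ∀ t ∈ I, HasDerivWithinAt y (y' t) I t) (h' : ContDiffOn ℝ k y' I) :
    ContDiffOn ℝ (k + 1 : ℕ) y I := by
  push_cast
  rw [contDiffOn_succ_iff_derivWithin hI]
  exact ⟨fun t ht => (h t ht).differentiableWithinAt, by simp,
    h'.congr fun t ht => (h t ht).derivWithin (hI t ht)⟩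

theorem iteratedDerivWithin_eq_of_chain {u : ℕ → ℝ → 𝓗} {n : ℕ} (hI : UniqueDiffOn ℝ I)
    (h : ∀ k < n, ∀ t ∈ I, HasDerivWithinAt (u k) (u (k + 1) t) I t) {k : ℕ} (hk : k ≤ n) :
    ∀ t ∈ I, iteratedDerivWithin k (u 0) I t = u k t := by
  induction k with
  | zero => intro t _; rw [iteratedDerivWithin_zero]
  | succ k ih =>
    intro t ht
    rw [iteratedDerivWithin_succ, derivWithin_congr (fun t ht => ih (by omega) t ht)
      (ih (by omega) t ht)]
    exact (h k (by omega) t ht).derivWithin (hI t ht)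

theorem contDiffOn_of_chain {u : ℕ → ℝ → 𝓗} {n : ℕ} (hI : UniqueDiffOn ℝ I)
    (h : ∀ k < n, ∀ t ∈ I, HasDerivWithinAt (u k) (u (k + 1) t) I t)
    (hc : ContinuousOn (u n) I) : ContDiffOn ℝ n (u 0) I := by
  induction n generalizing u with
  | zero => simpa using hc
  | succ n ih =>
    exact contDiffOn_succ_of_hasDerivWithinAt hI (h 0 (by omega))
      (ih (u := fun k => u (k + 1)) (fun k hk => h (k + 1) (by omega)) hc)

/-- A family with `z_j = c_j - z_{j+1}'`, `z_j` of class `Cʲ`, and `z_j = 0` for large `j`. -/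
structure IsQuasiSeq (I : Set ℝ) (c z : ℕ → ℝ → 𝓗) : Prop where
  smooth : ∀ j : ℕ, ContDiffOn ℝ j (z j) I
  step : ∀ j, ∀ t ∈ I, z j t = c j t - derivWithin (z (j + 1)) I t
  eventually_zero : ∃ K, ∀ j ≥ K, ∀ t ∈ I, z j t = 0

/-- Each term is determined by the next one, and both sequences vanish far out; hence a downward
induction. This is the tool that identifies quasi-derivatives without reference to the formal order.
-/
theorem IsQuasiSeq.unique {c c' z z' : ℕ → ℝ → 𝓗} (h : IsQuasiSeq I c z)
    (h' : IsQuasiSeq I c' z') (hc : ∀ j, ∀ t ∈ I, c j t = c' j t) (j : ℕ) :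
    ∀ t ∈ I, z j t = z' j t := by
  obtain ⟨K, hK⟩ := h.eventually_zero
  obtain ⟨K', hK'⟩ := h'.eventually_zero
  have : ∀ d j, K + K' ≤ j + d → ∀ t ∈ I, z j t = z' j t := by
    intro d
    induction d with
    | zero => intro j hj t ht; rw [hK j (by omega) t ht, hK' j (by omega) t ht]
    | succ d ih =>
      intro j hj t ht
      rw [h.step j t ht, h'.step j t ht, hc j t ht,
        derivWithin_congr (ih (j + 1) (by omega)) (ih (j + 1) (by omega) t ht)]
  exact this (K + K') j (by omega)

theorem IsQuasiSeq.differentiableOn {c z : ℕ → ℝ → 𝓗} (h : IsQuasiSeq I c z) (j : ℕ) :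
    DifferentiableOn ℝ (z (j + 1)) I :=
  (h.smooth (j + 1)).differentiableOn (by simp)

theorem IsQuasiSeq.add {c c' z z' : ℕ → ℝ → 𝓗} (h : IsQuasiSeq I c z) (h' : IsQuasiSeq I c' z') :
    IsQuasiSeq I (fun j t => c j t + c' j t) (fun j t => z j t + z' j t) where
  smooth j := (h.smooth j).add (h'.smooth j)
  step j t ht := by
    rw [h.step j t ht, h'.step j t ht,
      derivWithin_fun_add (h.differentiableOn j t ht) (h'.differentiableOn j t ht)]
    abel
  eventually_zero := by
    obtain ⟨K, hK⟩ := h.eventually_zero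
    obtain ⟨K', hK'⟩ := h'.eventually_zero
    exact ⟨K + K', fun j hj t ht => by
      rw [hK j (by omega) t ht, hK' j (by omega) t ht, add_zero]⟩

theorem IsQuasiSeq.const_smul {c z : ℕ → ℝ → 𝓗} (h : IsQuasiSeq I c z) (a : ℂ) :
    IsQuasiSeq I (fun j t => a • c j t) (fun j t => a • z j t) where
  smooth j := (h.smooth j).const_smul a
  step j t ht := by
    rw [h.step j t ht, derivWithin_fun_const_smul_field, smul_sub]
  eventually_zero := by
    obtain ⟨K, hK⟩ := h.eventually_zero
    exact ⟨K, fun j hj t ht => by rw [hK j (by omega) t ht, smul_zero]⟩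

theorem IsQuasiSeq.sub {c c' z z' : ℕ → ℝ → 𝓗} (h : IsQuasiSeq I c z) (h' : IsQuasiSeq I c' z') :
    IsQuasiSeq I (fun j t => c j t - c' j t) (fun j t => z j t - z' j t) := by
  have := h.add (h'.const_smul (-1))
  simpa only [neg_smul, one_smul, ← sub_eq_add_neg] using this

/-- Unrolling the recursion leaves the remainder `± D^K z_K`, which vanishes. The class `Cʲ` of
`z_j` is exactly what makes every step differentiable. -/
theorem IsQuasiSeq.zero_eq_sum {c z : ℕ → ℝ → 𝓗} (h : IsQuasiSeq I c z) (hI : UniqueDiffOn ℝ I)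
    (hc : ∀ j : ℕ, ContDiffOn ℝ j (c j) I) {K : ℕ} (hK : ∀ t ∈ I, z K t = 0) {t : ℝ} (ht : t ∈ I) :
    z 0 t = ∑ k ∈ Finset.range K, (-1 : ℂ) ^ k • iteratedDerivWithin k (c k) I t := by
  have key : ∀ K, z 0 t = ∑ k ∈ Finset.range K, (-1 : ℂ) ^ k • iteratedDerivWithin k (c k) I t
      + (-1 : ℂ) ^ K • iteratedDerivWithin K (z K) I t := by
    intro K
    induction K with
    | zero => simp
    | succ K ih =>
      have e : iteratedDerivWithin K (z K) I t = iteratedDerivWithin K (c K) I t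
          - iteratedDerivWithin (K + 1) (z (K + 1)) I t := by
        rw [iteratedDerivWithin_succ', ← iteratedDerivWithin_sub ht hI (hc K t ht)]
        · exact iteratedDerivWithin_congr (fun τ hτ => h.step K τ hτ) ht
        · exact ((h.smooth (K + 1)).derivWithin hI (by push_cast; exact le_rfl)) t ht
      rw [ih, e, Finset.sum_range_succ, pow_succ]
      module
  have hz : iteratedDerivWithin K (z K) I t = 0 := by
    rw [iteratedDerivWithin_congr (g := fun _ => (0 : 𝓗)) (fun τ hτ => hK τ hτ) ht]
    simp
  rw [key K, hz, smul_zero, add_zero]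

end Calculus

/-! ### Quasi-derivatives of a function -/

namespace OpExpr

variable {𝓗 : Type*} [NormedAddCommGroup 𝓗] [InnerProductSpace ℂ 𝓗] {L : OpExpr 𝓗} {N : ℕ}
  {I : Set ℝ} {y : ℝ → 𝓗}

/-- The jet of a function on `I`. -/
def jet (I : Set ℝ) (y : ℝ → 𝓗) (t : ℝ) (j : ℕ) : 𝓗 := iteratedDerivWithin j y I t

theorem contDiffOn_p_jet (hL : L.IsOfOrder N) (hs : L.IsSmoothOn I) (hI : UniqueDiffOn ℝ I)
    (hy : ContDiffOn ℝ N y I) (j : ℕ) :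
    ContDiffOn ℝ j (fun t => L.p j t (iteratedDerivWithin j y I t)) I := by
  rcases Nat.lt_or_ge N (2 * j) with h | h
  · simp only [hL.p_eq_zero j h, Pi.zero_apply, zero_apply]
    exact contDiffOn_const
  · exact contDiffOn_clm_apply_complex (hs.p_smooth j) (hy.iteratedDerivWithin_of_le hI (by omega))

theorem contDiffOn_s_jet (hL : L.IsOfOrder N) (hs : L.IsSmoothOn I) (hI : UniqueDiffOn ℝ I)
    (hy : ContDiffOn ℝ N y I) (j : ℕ) :
    ContDiffOn ℝ j (fun t => L.s (j + 1) t (iteratedDerivWithin (j + 1) y I t)) I := by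
  rcases Nat.lt_or_ge (N + 1) (2 * (j + 1)) with h | h
  · simp only [hL.s_eq_zero (j + 1) h, Pi.zero_apply, zero_apply]
    exact contDiffOn_const
  · exact contDiffOn_clm_apply_complex
      ((hs.s_smooth (j + 1)).of_le (by exact_mod_cast Nat.le_succ j))
      (hy.iteratedDerivWithin_of_le hI (by omega))

theorem contDiffOn_q_jet (hL : L.IsOfOrder N) (hs : L.IsSmoothOn I) (hI : UniqueDiffOn ℝ I)
    (hy : ContDiffOn ℝ N y I) (j : ℕ) :
    ContDiffOn ℝ j (fun t => L.q j t (iteratedDerivWithin (j - 1) y I t)) I := by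
  rcases Nat.eq_zero_or_pos j with h0 | h0
  · subst h0
    simp only [hL.q_zero, Pi.zero_apply, zero_apply]
    exact contDiffOn_const
  · rcases Nat.lt_or_ge (N + 1) (2 * j) with h | h
    · simp only [hL.q_eq_zero j h, Pi.zero_apply, zero_apply]
      exact contDiffOn_const
    · exact contDiffOn_clm_apply_complex (hs.q_smooth j)
        (hy.iteratedDerivWithin_of_le hI (by omega))

theorem contDiffOn_coef (hL : L.IsOfOrder N) (hs : L.IsSmoothOn I) (hI : UniqueDiffOn ℝ I)
    (hy : ContDiffOn ℝ N y I) (j : ℕ) : ContDiffOn ℝ j (fun t => L.coef j t (jet I y t)) I :=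
  (contDiffOn_p_jet hL hs hI hy j).add
    (((contDiffOn_s_jet hL hs hI hy j).sub (contDiffOn_q_jet hL hs hI hy j)).const_smul _)

/-- Coefficients beyond the order vanish: `s_{n+1} = 0` for `N = 2n`, and `p_{n+1} = s_{n+2} = 0`
for `N = 2n + 1`. So in both parities the recursion starts at the index `(N + 1) / 2`, with nothing
to differentiate. -/
theorem quasiDeriv_mid (hL : L.IsOfOrder N) (I : Set ℝ) (y : ℝ → 𝓗) :
    L.quasiDeriv I N y (N / 2) = fun t => L.coef ((N + 1) / 2) t (jet I y t) := by
  have e : L.quasiDeriv I N y (N / 2) = L.midQuasiDeriv I N y := by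
    rcases h : N / 2 with _ | k
    · simp only [quasiDeriv, h, if_true]
    · simp only [quasiDeriv, h, lt_irrefl, if_false, if_true]
  rw [e]
  funext t
  unfold midQuasiDeriv coef jet
  obtain ⟨n, rfl | rfl⟩ := Nat.even_or_odd' N
  · rw [if_pos (even_two_mul n), show 2 * n / 2 = n by omega, show (2 * n + 1) / 2 = n by omega,
      hL.s_eq_zero (n + 1) (by omega)]
    simp [sub_eq_add_neg]
  · rw [if_neg (by simp), show (2 * n + 1) / 2 = n by omega,
      show (2 * n + 1 + 1) / 2 = n + 1 by omega, hL.s_eq_zero (n + 1 + 1) (by omega),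
      hL.p_eq_zero (n + 1) (by omega)]
    simp

theorem quasiDeriv_step (L : OpExpr 𝓗) {N j : ℕ} (hj : j < (N + 1) / 2) (I : Set ℝ) (y : ℝ → 𝓗)
    (t : ℝ) : L.quasiDeriv I N y (N - j) t
      = L.coef j t (jet I y t) - derivWithin (L.quasiDeriv I N y (N - (j + 1))) I t := by
  obtain ⟨k, hk⟩ : ∃ k, N - j = k + 1 := ⟨N - j - 1, by omega⟩
  have hk' : N - (j + 1) = k := by omega
  rw [hk, hk']
  simp only [quasiDeriv]
  rw [if_neg (by omega), if_neg (by omega), show N - (k + 1) = j by omega]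
  unfold coef jet
  abel

/-- The quasi-derivatives of order `N - j`, extended by `0` beyond the middle one. -/
def quasiSeq (L : OpExpr 𝓗) (I : Set ℝ) (N : ℕ) (y : ℝ → 𝓗) (j : ℕ) : ℝ → 𝓗 :=
  if j ≤ (N + 1) / 2 then L.quasiDeriv I N y (N - j) else fun _ => 0

theorem quasiSeq_step (hL : L.IsOfOrder N) (I : Set ℝ) (y : ℝ → 𝓗) (j : ℕ) (t : ℝ) :
    L.quasiSeq I N y j t
      = L.coef j t (jet I y t) - derivWithin (L.quasiSeq I N y (j + 1)) I t := by
  unfold quasiSeq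
  rcases lt_trichotomy j ((N + 1) / 2) with h | h | h
  · rw [if_pos (by omega), if_pos (by omega), L.quasiDeriv_step h]
  · rw [if_pos (by omega), if_neg (by omega), h, show N - (N + 1) / 2 = N / 2 by omega,
      quasiDeriv_mid hL]
    simp
  · rw [if_neg (by omega), if_neg (by omega), coef_eq_zero hL h]
    simp

theorem isQuasiSeq (hL : L.IsOfOrder N) (hs : L.IsSmoothOn I) (hI : UniqueDiffOn ℝ I)
    (hy : ContDiffOn ℝ N y I) :
    IsQuasiSeq I (fun j t => L.coef j t (jet I y t)) (L.quasiSeq I N y) where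
  smooth j := by
    have : ∀ d j, (N + 1) / 2 < j + d → ContDiffOn ℝ j (L.quasiSeq I N y j) I := by
      intro d
      induction d with
      | zero =>
        intro j hj
        rw [quasiSeq, if_neg (by omega)]
        exact contDiffOn_const
      | succ d ih =>
        intro j hj
        refine ((contDiffOn_coef hL hs hI hy j).sub
          ((ih (j + 1) (by omega)).derivWithin hI (by push_cast; exact le_rfl))).congr
            fun t _ => quasiSeq_step hL I y j t
    exact this ((N + 1) / 2 + 1) j (by omega)
  step j t _ := quasiSeq_step hL I y j t
  eventually_zero := ⟨(N + 1) / 2 + 1, fun j hj t _ => by rw [quasiSeq, if_neg (by omega)]⟩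

/-- The quasi-derivative of order `N` unrolls into an alternating sum of derivatives. It is `L[y]`
because `(-1)ᵏ = i^{2k}` and `(-1)ᵏ (i/2) = ½ i^{2k+1}`; shifting the index of the `q`-terms absorbs
their sign. -/
theorem apply_eq_quasiSeq (hL : L.IsOfOrder N) (hs : L.IsSmoothOn I) (hI : UniqueDiffOn ℝ I)
    (hy : ContDiffOn ℝ N y I) {t : ℝ} (ht : t ∈ I) :
    L.apply I N y t = L.quasiSeq I N y 0 t := by
  rw [(isQuasiSeq hL hs hI hy).zero_eq_sum hI (contDiffOn_coef hL hs hI hy)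
    (K := (N + 1) / 2 + 1) (fun t _ => by rw [quasiSeq, if_neg (by omega)]) ht]
  have hP := contDiffOn_p_jet hL hs hI hy
  have hS := contDiffOn_s_jet hL hs hI hy
  have hQ := contDiffOn_q_jet hL hs hI hy
  have e : ∀ k, iteratedDerivWithin k (fun t => L.coef k t (jet I y t)) I t
      = iteratedDerivWithin k (fun t => L.p k t (iteratedDerivWithin k y I t)) I t
        + (Complex.I / 2) • (iteratedDerivWithin k
              (fun t => L.s (k + 1) t (iteratedDerivWithin (k + 1) y I t)) I t
          - iteratedDerivWithin k
              (fun t => L.q k t (iteratedDerivWithin (k - 1) y I t)) I t) := fun k => by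
    rw [← iteratedDerivWithin_sub ht hI (hS k t ht) (hQ k t ht),
      ← iteratedDerivWithin_const_smul_field]
    exact iteratedDerivWithin_add ht hI (hP k t ht)
      ((((hS k).sub (hQ k)).const_smul (Complex.I / 2)) t ht)
  have e1 : ∑ k ∈ Finset.range ((N + 1) / 2 + 1), (-1 : ℂ) ^ k •
        iteratedDerivWithin k (fun t => L.p k t (iteratedDerivWithin k y I t)) I t
      = ∑ j ∈ Finset.range (N / 2 + 1), Complex.I ^ (2 * j) •
        iteratedDerivWithin j (fun τ => L.p j τ (iteratedDerivWithin j y I τ)) I t := by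
    simp only [pow_mul, Complex.I_sq]
    symm
    refine Finset.sum_subset (Finset.range_mono (by omega)) fun j _ hj => ?_
    rw [Finset.mem_range] at hj
    simp [hL.p_eq_zero j (by omega)]
  have e2 : ∑ k ∈ Finset.range ((N + 1) / 2 + 1), ((-1 : ℂ) ^ k * (Complex.I / 2)) •
        iteratedDerivWithin k (fun t => L.s (k + 1) t (iteratedDerivWithin (k + 1) y I t)) I t
      = ∑ j ∈ Finset.range ((N + 1) / 2), (Complex.I ^ (2 * j + 1) * (1 / 2)) •
        iteratedDerivWithin j (fun τ => L.s (j + 1) τ (iteratedDerivWithin (j + 1) y I τ)) I t := by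
    rw [Finset.sum_range_succ, hL.s_eq_zero _ (by omega)]
    simp only [Pi.zero_apply, zero_apply, iteratedDerivWithin_fun_const_zero, smul_zero, add_zero]
    refine Finset.sum_congr rfl fun j _ => ?_
    rw [pow_succ, pow_mul, Complex.I_sq, mul_assoc, mul_one_div]
  have e3 : ∑ k ∈ Finset.range ((N + 1) / 2 + 1), ((-1 : ℂ) ^ k * (Complex.I / 2)) •
        iteratedDerivWithin k (fun t => L.q k t (iteratedDerivWithin (k - 1) y I t)) I t
      = -∑ j ∈ Finset.range ((N + 1) / 2), (Complex.I ^ (2 * j + 1) * (1 / 2)) •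
        iteratedDerivWithin (j + 1) (fun τ => L.q (j + 1) τ (iteratedDerivWithin j y I τ)) I t := by
    rw [Finset.sum_range_succ', hL.q_zero, ← Finset.sum_neg_distrib]
    simp only [Pi.zero_apply, zero_apply, iteratedDerivWithin_fun_const_zero, smul_zero, add_zero,
      Nat.add_sub_cancel]
    refine Finset.sum_congr rfl fun j _ => ?_
    rw [← neg_smul]
    congr 1
    rw [pow_succ, pow_succ, pow_mul, Complex.I_sq]
    ring
  have e4 : ∀ k, (-1 : ℂ) ^ k • iteratedDerivWithin k (fun t => L.coef k t (jet I y t)) I t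
      = (-1 : ℂ) ^ k • iteratedDerivWithin k (fun t => L.p k t (iteratedDerivWithin k y I t)) I t
        + (((-1 : ℂ) ^ k * (Complex.I / 2)) • iteratedDerivWithin k
              (fun t => L.s (k + 1) t (iteratedDerivWithin (k + 1) y I t)) I t
          - ((-1 : ℂ) ^ k * (Complex.I / 2)) • iteratedDerivWithin k
              (fun t => L.q k t (iteratedDerivWithin (k - 1) y I t)) I t) := fun k => by
    rw [e]
    module
  rw [Finset.sum_congr rfl fun k _ => e4 k, Finset.sum_add_distrib, Finset.sum_sub_distrib, e1, e2,
    e3, apply]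
  simp only [smul_add, Finset.sum_add_distrib]
  abel

end OpExpr

/-! ### The first order system expressed by jets and quasi-derivatives -/

namespace OpExpr

variable {𝓗 : Type*} [NormedAddCommGroup 𝓗] [InnerProductSpace ℂ 𝓗] [CompleteSpace 𝓗]

/-- The factor by which the conventions for the vectors of quasi-derivatives of first order
expressions differ from those for other odd orders. -/
def firstOrderFactor (r : ℕ) : ℂ := if r = 1 then Complex.I else 1

theorem firstOrderFactor_of_pos {r : ℕ} (h : 0 < r / 2) : firstOrderFactor r = 1 :=
  if_neg (by omega)

theorem firstOrderFactor_ne_zero (r : ℕ) : firstOrderFactor r ≠ 0 := by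
  unfold firstOrderFactor
  split_ifs
  · exact Complex.I_ne_zero
  · exact one_ne_zero

theorem coord_vecF (L : OpExpr 𝓗) (I : Set ℝ) {r k : ℕ} (hk : k < r) (s : ℕ) (f : ℝ → 𝓗) (t : ℝ) :
    coord r k (L.vecF I r s f t) = if r = 1 then f t
      else if k < r / 2 then (if k ≤ s / 2 then iteratedDerivWithin k f I t else 0)
      else if k < 2 * (r / 2) then
        (if s = r then L.quasiDeriv I r f (r - (k - r / 2 + 1)) t else 0)
      else (if s + 1 = r then -(Complex.I • iteratedDerivWithin (r / 2) f I t) else 0) := by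
  rw [coord_apply hk]
  rfl

theorem coord_vecY (L m : OpExpr 𝓗) (I : Set ℝ) {r k : ℕ} (hk : k < r) (s : ℕ) (y f : ℝ → 𝓗)
    (t : ℝ) : coord r k (L.vecY m I r s y f t) = if r = 1 then y t
      else if k < r / 2 then iteratedDerivWithin k y I t
      else if k < 2 * (r / 2) then
        L.quasiDeriv I r y (r - (k - r / 2 + 1)) t
          - (if 2 * (k - r / 2 + 1) ≤ s then m.quasiDeriv I s f (s - (k - r / 2 + 1)) t else 0)
      else -(Complex.I • iteratedDerivWithin (r / 2) y I t) := by
  rw [coord_apply hk]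
  rfl

/-- The vector `F` is made so that the jet recovered from it is the jet of `f`, at the indices seen
by `m`. For `r = 1` the convention `F = f` replaces `-if`, hence the scalar factor. -/
theorem jetVec_vecF {K : OpExpr 𝓗} {r s : ℕ} (hK : K.IsOfOrder r) (hr : 0 < r) (hs : Even s)
    (hsr : s ≤ r) {t : ℝ} (hu : Even r → IsUnit (K.p (r / 2) t)) (I : Set ℝ) (f : ℝ → 𝓗) {k : ℕ}
    (hk : 2 * k ≤ s) :
    K.jetVec r t (K.vecF I r s f t) k = firstOrderFactor r • jet I f t k := by
  by_cases hr1 : r = 1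
  · subst hr1
    obtain rfl : k = 0 := by omega
    have : ¬Even 1 := by decide
    have h0 := K.jetVec_odd this t (K.vecF I 1 s f t)
    simp only [show (1 : ℕ) / 2 = 0 from rfl] at h0
    rw [h0, coord_vecF K I (by omega)]
    simp [firstOrderFactor, jet]
  · rw [firstOrderFactor, if_neg hr1, one_smul, jet]
    rcases Nat.lt_or_ge k (r / 2) with h | h
    · rw [K.jetVec_of_lt t _ h, coord_vecF K I (by omega), if_neg hr1, if_pos h, if_pos (by omega)]
    · obtain rfl : k = r / 2 := by omega
      by_cases he : Even r
      · have he' := he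
        obtain ⟨n, rfl⟩ := he'
        have hn : (n + n) / 2 = n := by omega
        rw [K.jetVec_even he, coord_vecF K I (by omega), coord_vecF K I (by omega), if_neg hr1,
          if_neg (by omega), if_pos (by omega), if_pos (by omega), if_neg hr1, if_pos (by omega),
          if_pos (by omega), show n + n - (2 * ((n + n) / 2) - 1 - (n + n) / 2 + 1) = (n + n) / 2 by
            omega, quasiDeriv_mid hK, show (n + n + 1) / 2 = (n + n) / 2 by omega]
        have e : K.coef ((n + n) / 2) t (jet I f t)
            + (Complex.I / 2) • K.q ((n + n) / 2) t (iteratedDerivWithin ((n + n) / 2 - 1) f I t)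
            = K.p ((n + n) / 2) t (iteratedDerivWithin ((n + n) / 2) f I t) := by
          rw [coef, congrFun (hK.s_eq_zero ((n + n) / 2 + 1) (by omega)) t]
          simp [jet]
        rw [e, ← mul_apply_eq_comp, Ring.inverse_mul_cancel _ (hu he), one_apply_eq_self]
      · rw [K.jetVec_odd he, coord_vecF K I (by have := Nat.not_even_iff.1 he; omega), if_neg hr1,
          if_neg (by omega), if_neg (by omega), if_pos (by
            have := Nat.not_even_iff.1 he
            obtain ⟨c, rfl⟩ := hs
            omega),
          smul_neg, smul_smul, Complex.I_mul_I, neg_one_smul, neg_neg]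

theorem coef_jetVec_vecF {K m : OpExpr 𝓗} {r s : ℕ} (hK : K.IsOfOrder r) (hm : m.IsOfOrder s)
    (hr : 0 < r) (hs : Even s) (hsr : s ≤ r) {t : ℝ} (hu : Even r → IsUnit (K.p (r / 2) t))
    (I : Set ℝ) (f : ℝ → 𝓗) (j : ℕ) :
    m.coef j t (K.jetVec r t (K.vecF I r s f t))
      = firstOrderFactor r • m.coef j t (jet I f t) := by
  rw [← coef_smul]
  exact coef_congr hm hs j t fun k hk => jetVec_vecF hK hr hs hsr hu I f hk

/-- The components of `x` are those of the vector of quasi-derivatives that belongs to the jet `U`,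
the quasi-derivatives `w` and the coefficients `γ` of the right hand side. -/
structure IsQuasiVec (L : OpExpr 𝓗) (r : ℕ) (t : ℝ) (x : HilbertPow 𝓗 r) (U w γ : ℕ → 𝓗) :
    Prop where
  zero : w 0 = 0
  lt : ∀ k < r / 2, coord r k x = U k
  quasi : ∀ j < r / 2, coord r (r / 2 + j) x = w (j + 1)
  last : ¬Even r → coord r (2 * (r / 2)) x = -(Complex.I • firstOrderFactor r • U (r / 2))
  mid : Even r → w (r / 2) = L.coef (r / 2) t U - γ (r / 2)

variable {L : OpExpr 𝓗} {r : ℕ} {t : ℝ} {x : HilbertPow 𝓗 r} {U w γ : ℕ → 𝓗}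

theorem IsQuasiVec.quasiVec_eq (h : L.IsQuasiVec r t x U w γ) {j : ℕ} (hj : j ≤ r / 2) :
    quasiVec r x j = w j := by
  rcases j with _ | j
  · rw [quasiVec, if_neg (by omega), h.zero]
  · rw [quasiVec, if_pos (by omega), show r / 2 + (j + 1) - 1 = r / 2 + j by omega,
      h.quasi j (by omega)]

theorem IsQuasiVec.jetVec_lt (h : L.IsQuasiVec r t x U w γ) {k : ℕ} (hk : k < r / 2) :
    L.jetVec r t x k = U k := by
  rw [L.jetVec_of_lt t x hk, h.lt k hk]

theorem IsQuasiVec.jetVec_odd (h : L.IsQuasiVec r t x U w γ) (he : ¬Even r) :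
    L.jetVec r t x (r / 2) = firstOrderFactor r • U (r / 2) := by
  rw [L.jetVec_odd he, h.last he, smul_neg, smul_smul, Complex.I_mul_I, neg_one_smul, neg_neg]

theorem coef_mid_even (hL : L.IsOfOrder r) (he : Even r) (t : ℝ) (U : ℕ → 𝓗) :
    L.coef (r / 2) t U = L.p (r / 2) t (U (r / 2))
      - (Complex.I / 2) • L.q (r / 2) t (U (r / 2 - 1)) := by
  obtain ⟨n, rfl⟩ := he
  rw [coef, congrFun (hL.s_eq_zero ((n + n) / 2 + 1) (by omega)) t]
  simp [sub_eq_add_neg]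

/-- The component `y^{[n]} - f^{[s-n]}` contains the right-hand side, so inverting `p_n` does not
return `y^{(n)}` but misses it by `p_n⁻¹ γ_n`. The weight contains the terms that compensate for
this. -/
theorem IsQuasiVec.jetVec_even (h : L.IsQuasiVec r t x U w γ) (hL : L.IsOfOrder r) (hr : 0 < r)
    (he : Even r) (hu : IsUnit (L.p (r / 2) t)) :
    L.jetVec r t x (r / 2) = U (r / 2) - Ring.inverse (L.p (r / 2) t) (γ (r / 2)) := by
  have hn : 0 < r / 2 := by
    obtain ⟨n, rfl⟩ := he
    omega
  have e : coord r (2 * (r / 2) - 1) x + (Complex.I / 2) • L.q (r / 2) t (coord r (r / 2 - 1) x)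
      = L.p (r / 2) t (U (r / 2)) - γ (r / 2) := by
    have := h.quasi (r / 2 - 1) (by omega)
    rw [show r / 2 + (r / 2 - 1) = 2 * (r / 2) - 1 by omega, Nat.sub_add_cancel hn, h.mid he,
      coef_mid_even hL he] at this
    rw [this, h.lt _ (by omega)]
    abel
  rw [L.jetVec_even he, e, map_sub, ← mul_apply_eq_comp, Ring.inverse_mul_cancel _ hu,
    one_apply_eq_self]

/-- The last row for odd `r` is the equation for the derivative of `-(i/2) q_{n+1} y^{(n)}`,
multiplied by `iκ`. The term `b`, which stands for `s_{n+1} y^{(n+1)}`, occurs once from `Q*` and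
once from the coefficient, with opposite signs. -/
theorem hasDeriv_last_iff {κ : ℂ} (hκ : κ ≠ 0) {a b c d e : 𝓗} :
    (Complex.I / 2) • (-(Complex.I • κ • a) + -(Complex.I • κ • b))
        + (Complex.I / 2) • -(Complex.I • κ • c)
        + Complex.I • (κ • d - κ • (e - (Complex.I / 2) • b)) = (0 : 𝓗) ↔
      -((Complex.I / 2) • (c + a)) = -d + e := by
  have hI : ∀ v : 𝓗, (Complex.I / 2) • Complex.I • κ • v = -((κ / 2) • v) := fun v => by
    rw [smul_smul, smul_smul, ← neg_smul]
    congr 1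
    linear_combination (κ / 2) * Complex.I_sq
  have hI' : ∀ v : 𝓗, Complex.I • κ • (Complex.I / 2) • v = -((κ / 2) • v) := fun v => by
    rw [smul_smul, smul_smul, ← neg_smul]
    congr 1
    linear_combination (κ / 2) * Complex.I_sq
  have key : (Complex.I / 2) • (-(Complex.I • κ • a) + -(Complex.I • κ • b))
        + (Complex.I / 2) • -(Complex.I • κ • c)
        + Complex.I • (κ • d - κ • (e - (Complex.I / 2) • b))
      = (Complex.I * κ) • (-((Complex.I / 2) • (c + a)) - (-d + e)) := by
    have h2 : ∀ v : 𝓗, (Complex.I * κ) • (Complex.I / 2) • v = -((κ / 2) • v) := fun v => by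
      rw [mul_smul, hI']
    simp only [smul_add, smul_sub, smul_neg, hI, hI', h2]
    module
  rw [key, smul_eq_zero, sub_eq_zero]
  simp [hκ]

/-- The first order system in terms of jets and quasi-derivatives. -/
theorem IsQuasiVec.sysLHS_iff {K m : OpExpr 𝓗} {s : ℕ} {I : Set ℝ} {f : ℝ → 𝓗}
    (hL : L.IsOfOrder r) (hK : K.IsOfOrder r) (hm : m.IsOfOrder s) (hr : 0 < r) (hs : Even s)
    (hsr : s ≤ r) (hKL : K.IsAdjointAt L t) (huL : Even r → IsUnit (L.p (r / 2) t))
    (hadj : ContinuousLinearMap.adjoint (L.q (r / 2 + 1) t) = L.s (r / 2 + 1) t)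
    {q' : 𝓗 →L[ℂ] 𝓗} (hI : UniqueDiffWithinAt ℝ I t)
    (hq : HasDerivWithinAt (L.q (r / 2 + 1)) q' I t)
    (h : L.IsQuasiVec r t x U w fun j => m.coef j t (jet I f t)) {x' : HilbertPow 𝓗 r}
    (hlast : ¬Even r → coord r (2 * (r / 2)) x'
      = -(Complex.I • firstOrderFactor r • U (r / 2 + 1))) :
    sysLHS (L.opQ r t) (derivWithin (L.opQ r) I t) (L.opH r t) x x'
        = K.opW m r t (K.vecF I r s f t) ↔
      (∀ i < r / 2, coord r (r / 2 + i) x'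
        = -w i + (L.coef i t U - m.coef i t (jet I f t))) ∧
      (∀ i < r / 2, coord r i x' = U (i + 1)) ∧
      (¬Even r → -((Complex.I / 2) • (q' (U (r / 2)) + L.q (r / 2 + 1) t (U (r / 2 + 1))))
        = -w (r / 2) + (L.coef (r / 2) t U - m.coef (r / 2) t (jet I f t))) := by
  have huK : Even r → IsUnit (K.p (r / 2) t) := fun he => by
    rw [← hKL.symm.p, ← ContinuousLinearMap.star_eq_adjoint, isUnit_star]
    exact huL he
  have hγ := coef_jetVec_vecF hK hm hr hs hsr huK I f
  rw [sysLHS_eq_iff hL hI hq hadj]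
  refine and_congr ?_ (and_congr ?_ ?_)
  · refine forall_congr' fun i => forall_congr' fun hi => ?_
    have hc : ∀ v : ℕ → 𝓗, L.coef i t v
        = L.p i t (v i) + (Complex.I / 2) • (L.s (i + 1) t (v (i + 1)) - L.q i t (v (i - 1))) :=
      fun _ => rfl
    -- At `i = n - 1` with even `r` the error `p_n⁻¹ γ_n` of the recovered jet contributes `-(i/2)
    -- s_n p_n⁻¹ γ_n`, which is balanced by the extra term in this row of the weight.
    have e : L.coef i t (L.jetVec r t x) - coord r i (K.opW m r t (K.vecF I r s f t))
        = L.coef i t U - m.coef i t (jet I f t) := by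
      rw [coord_opW_lt hr hm.q_zero hKL _ hi, hγ, hγ, firstOrderFactor_of_pos (by omega), one_smul,
        one_smul]
      rcases Nat.lt_or_ge (i + 1) (r / 2) with h1 | h1
      · rw [if_neg (by omega), hc (L.jetVec r t x), hc U, h.jetVec_lt hi, h.jetVec_lt h1,
          h.jetVec_lt (by omega : i - 1 < r / 2), sub_zero]
      · obtain h1 : i + 1 = r / 2 := by omega
        rw [hc (L.jetVec r t x), hc U, h.jetVec_lt hi, h.jetVec_lt (by omega : i - 1 < r / 2), h1]
        by_cases he : Even r
        · rw [if_pos ⟨he, rfl⟩, h.jetVec_even hL hr he (huL he), map_sub]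
          module
        · rw [if_neg (by tauto), h.jetVec_odd he, firstOrderFactor_of_pos (by omega), one_smul,
            sub_zero]
    rw [h.quasiVec_eq hi.le, ← e]
    constructor
    · intro h'
      rw [← h']
      abel
    · intro h'
      rw [h']
      abel
  · refine forall_congr' fun i => forall_congr' fun hi => ?_
    have e : L.jetVec r t x (i + 1) + coord r (r / 2 + i) (K.opW m r t (K.vecF I r s f t))
        = U (i + 1) := by
      rw [coord_opW_add hr hm.q_zero hKL _ hi, hγ, firstOrderFactor_of_pos (by omega), one_smul]
      rcases Nat.lt_or_ge (i + 1) (r / 2) with h1 | h1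
      · rw [if_neg (by omega), h.jetVec_lt h1, add_zero]
      · obtain h1 : i + 1 = r / 2 := by omega
        rw [h1]
        by_cases he : Even r
        · rw [if_pos ⟨he, rfl⟩, h.jetVec_even hL hr he (huL he)]
          abel
        · rw [if_neg (by tauto), h.jetVec_odd he, firstOrderFactor_of_pos (by omega), one_smul,
            add_zero]
    rw [sub_eq_iff_eq_add, add_comm (coord r (r / 2 + i) _), e]
  · refine forall_congr' fun he => ?_
    rw [hlast he, h.last he, coord_opW_last hm.q_zero _ he, hγ, h.quasiVec_eq le_rfl,
      ← hasDeriv_last_iff (firstOrderFactor_ne_zero r) (a := L.q (r / 2 + 1) t (U (r / 2 + 1)))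
        (b := L.s (r / 2 + 1) t (U (r / 2 + 1))) (c := q' (U (r / 2)))]
    have e1 : w (r / 2) = firstOrderFactor r • w (r / 2) := by
      rcases Nat.eq_zero_or_pos (r / 2) with h0 | h0
      · rw [h0, h.zero, smul_zero]
      · rw [firstOrderFactor_of_pos h0, one_smul]
    have e2 : L.coef (r / 2) t (L.jetVec r t x) = firstOrderFactor r • (L.coef (r / 2) t U
        - (Complex.I / 2) • L.s (r / 2 + 1) t (U (r / 2 + 1))) := by
      rw [coef, coef, h.jetVec_odd he, L.jetVec_of_gt t x (Nat.lt_succ_self _)]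
      rcases Nat.eq_zero_or_pos (r / 2) with h0 | h0
      · simp only [h0, congrFun hL.q_zero t, Pi.zero_apply, zero_apply, map_zero, map_smul]
        module
      · rw [h.jetVec_lt (by omega : r / 2 - 1 < r / 2), firstOrderFactor_of_pos h0]
        simp only [one_smul, map_zero]
        module
    rw [e2, ← sub_eq_zero, ← e1]
    nth_rewrite 1 [e1]
    simp only [map_neg, map_smul, ← e1]
    have e3 : ∀ P v : 𝓗, P + Complex.I • (w (r / 2) - firstOrderFactor r • v)
        - -(Complex.I • firstOrderFactor r • m.coef (r / 2) t (jet I f t))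
        = P + Complex.I • (w (r / 2) - firstOrderFactor r • (v - m.coef (r / 2) t (jet I f t))) :=
      fun P v => by module
    rw [e3, sub_right_comm]

end OpExpr

theorem ContDiffOn.ringInverse {𝓗 : Type*} [NormedAddCommGroup 𝓗] [InnerProductSpace ℂ 𝓗]
    [CompleteSpace 𝓗] {A : ℝ → 𝓗 →L[ℂ] 𝓗} {I : Set ℝ} {k : ℕ} (hA : ContDiffOn ℝ k A I)
    (hu : ∀ t ∈ I, IsUnit (A t)) : ContDiffOn ℝ k (fun t => Ring.inverse (A t)) I := by
  intro t ht
  obtain ⟨u, hu⟩ := hu t ht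
  have h1 : ContDiffAt ℂ k Ring.inverse (A t) := by
    rw [← hu]
    exact contDiffAt_ringInverse ℂ u
  exact (h1.restrict_scalars ℝ).comp_contDiffWithinAt t (hA t ht)

/-! ### Regularity of the solutions of the system -/

namespace OpExpr

variable {𝓗 : Type*} [NormedAddCommGroup 𝓗] [InnerProductSpace ℂ 𝓗]

/-- The standing assumptions on one expression of order `r`. -/
structure IsRegular [CompleteSpace 𝓗] (L : OpExpr 𝓗) (I : Set ℝ) (r : ℕ) : Prop where
  order : L.IsOfOrder r
  smooth : L.IsSmoothOn I
  unit_even : Even r → ∀ t ∈ I, IsUnit (L.p (r / 2) t)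
  unit_odd : ¬Even r → ∀ t ∈ I, IsUnit (L.q (r / 2 + 1) t + L.s (r / 2 + 1) t)
  adjoint_q : ∀ t ∈ I, ContinuousLinearMap.adjoint (L.q (r / 2 + 1) t) = L.s (r / 2 + 1) t

variable {L m : OpExpr 𝓗} {I : Set ℝ} {r s : ℕ} {y f : ℝ → 𝓗}

theorem quasiSeq_top (hL : L.IsOfOrder r) (I : Set ℝ) (y : ℝ → 𝓗) {j : ℕ} (hj : (r + 1) / 2 ≤ j)
    (t : ℝ) : L.quasiSeq I r y j t = L.coef j t (jet I y t) := by
  rw [quasiSeq_step hL, quasiSeq, if_neg (by omega)]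
  simp

theorem contDiffOn_coef_of_le (hs : L.IsSmoothOn I) (hI : UniqueDiffOn ℝ I)
    {N j d : ℕ} (hy : ContDiffOn ℝ N y I) (hd : d ≤ j) (hN : j + 1 + d ≤ N) :
    ContDiffOn ℝ d (fun t => L.coef j t (jet I y t)) I := by
  refine (contDiffOn_clm_apply_complex ((hs.p_smooth j).of_le (by exact_mod_cast hd))
    (hy.iteratedDerivWithin_of_le hI (by omega))).add (((contDiffOn_clm_apply_complex
      ((hs.s_smooth (j + 1)).of_le (by exact_mod_cast hd.trans (Nat.le_succ j)))
    (hy.iteratedDerivWithin_of_le hI (by omega))).sub (contDiffOn_clm_apply_complex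
      ((hs.q_smooth j).of_le (by exact_mod_cast hd))
    (hy.iteratedDerivWithin_of_le hI (by omega)))).const_smul _)

variable [CompleteSpace 𝓗]

/-- One step of the bootstrap: the top derivative is solved for. For even `r` the middle relation
gives `p_n y^{(n)} = w_n + γ_n + (i/2) q_n y^{(n-1)}`. For odd `r` that relation contains only
`y^{(n)}`, so it is differentiated, and comparison with the equation for `w_{n+1}'` gives an
expression for `(i/2)(q_{n+1} + s_{n+1}) y^{(n+1)}`. -/
theorem contDiffOn_top_deriv (hL : L.IsRegular I r) (hm : m.IsOfOrder s) (hms : m.IsSmoothOn I)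
    (hs : Even s) (hsr : s ≤ r) (hI : UniqueDiffOn ℝ I) (hf : ContDiffOn ℝ s f I)
    {w : ℕ → ℝ → 𝓗} {k : ℕ} (hk : k < r / 2) (hy : ContDiffOn ℝ ((r + 1) / 2 + k : ℕ) y I)
    (hw : ∀ j < (r + 1) / 2, ∀ t ∈ I, HasDerivWithinAt (w (j + 1))
      (-w j t + (L.coef j t (jet I y t) - m.coef j t (jet I f t))) I t)
    (hmid : ∀ t ∈ I, w ((r + 1) / 2) t
      = L.coef ((r + 1) / 2) t (jet I y t) - m.coef ((r + 1) / 2) t (jet I f t))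
    (hwn : ContDiffOn ℝ (k + 1 : ℕ) (w (r / 2)) I) :
    ContDiffOn ℝ (k + 1 : ℕ) (iteratedDerivWithin ((r + 1) / 2) y I) I := by
  have hγ : ContDiffOn ℝ (k + 1 : ℕ) (fun t => m.coef (r / 2) t (jet I f t)) I :=
    (contDiffOn_coef hm hms hI hf (r / 2)).of_le (by exact_mod_cast hk)
  have hq : ContDiffOn ℝ (k + 1 : ℕ)
      (fun t => L.q (r / 2) t (iteratedDerivWithin (r / 2 - 1) y I t)) I :=
    contDiffOn_clm_apply_complex ((hL.smooth.q_smooth _).of_le (by exact_mod_cast hk))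
      (hy.iteratedDerivWithin_of_le hI (by omega))
  by_cases he : Even r
  · have hn : (r + 1) / 2 = r / 2 := by
      obtain ⟨c, rfl⟩ := he
      omega
    rw [hn] at hmid ⊢
    refine (contDiffOn_clm_apply_complex (ContDiffOn.ringInverse
      ((hL.smooth.p_smooth _).of_le (by exact_mod_cast hk)) (hL.unit_even he))
      ((hwn.add hγ).add (hq.const_smul (Complex.I / 2)))).congr fun t ht => ?_
    have e : (fun t => w (r / 2) t) t + m.coef (r / 2) t (jet I f t)
        + (Complex.I / 2) • L.q (r / 2) t (iteratedDerivWithin (r / 2 - 1) y I t)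
        = L.p (r / 2) t (iteratedDerivWithin (r / 2) y I t) := by
      dsimp only
      rw [hmid t ht, coef_mid_even hL.order he, jet, jet]
      abel
    dsimp only [Pi.add_apply, Pi.smul_apply] at e ⊢
    rw [e, ← mul_apply_eq_comp, Ring.inverse_mul_cancel _ (hL.unit_even he t ht),
      one_apply_eq_self]
  · have hn : (r + 1) / 2 = r / 2 + 1 := by
      have := Nat.not_even_iff.1 he
      omega
    rw [hn] at hmid hy hw ⊢
    have hγ0 : ∀ t, m.coef (r / 2 + 1) t (jet I f t) = 0 := fun t =>
      coef_eq_zero hm (by obtain ⟨c, rfl⟩ := hs; omega) t _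
    have hc : ∀ t, L.coef (r / 2 + 1) t (jet I y t)
        = -((Complex.I / 2) • L.q (r / 2 + 1) t (iteratedDerivWithin (r / 2) y I t)) := fun t => by
      have := Nat.not_even_iff.1 he
      rw [coef, congrFun (hL.order.s_eq_zero (r / 2 + 1 + 1) (by omega)) t,
        congrFun (hL.order.p_eq_zero (r / 2 + 1) (by omega)) t]
      simp [jet]
    have hu : ∀ t ∈ I, IsUnit ((Complex.I / 2) • (L.q (r / 2 + 1) t + L.s (r / 2 + 1) t)) :=
      fun t ht => (hL.unit_odd he t ht).smul (Units.mk0 (Complex.I / 2) (by simp))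
    have hq1 := hL.smooth.q_smooth (r / 2 + 1)
    have hA : ContDiffOn ℝ (k + 1 : ℕ)
        (fun t => (Complex.I / 2) • (L.q (r / 2 + 1) t + L.s (r / 2 + 1) t)) I :=
      (((hq1.add (hL.smooth.s_smooth (r / 2 + 1))).const_smul (Complex.I / 2)).of_le
        (by exact_mod_cast (by omega : k + 1 ≤ r / 2 + 1)))
    have hp : ContDiffOn ℝ (k + 1 : ℕ)
        (fun t => L.p (r / 2) t (iteratedDerivWithin (r / 2) y I t)) I :=
      contDiffOn_clm_apply_complex ((hL.smooth.p_smooth _).of_le (by exact_mod_cast hk))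
        (hy.iteratedDerivWithin_of_le hI (by omega))
    have hq' : ContDiffOn ℝ (k + 1 : ℕ) (fun t => derivWithin (L.q (r / 2 + 1)) I t
        (iteratedDerivWithin (r / 2) y I t)) I :=
      contDiffOn_clm_apply_complex (hq1.derivWithin hI (by exact_mod_cast (by omega)))
        (hy.iteratedDerivWithin_of_le hI (by omega))
    refine (contDiffOn_clm_apply_complex (ContDiffOn.ringInverse hA hu)
      ((((hwn.sub hp).add (hq.const_smul (Complex.I / 2))).add hγ).sub
        (hq'.const_smul (Complex.I / 2)))).congr fun t ht => ?_
    -- The derivative of `w_{n+1} = -(i/2) q_{n+1} y^{(n)}` by the product rule, to be compared with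
    -- the one prescribed by the system.
    have hd : HasDerivWithinAt (w (r / 2 + 1)) (-((Complex.I / 2) •
        (derivWithin (L.q (r / 2 + 1)) I t (iteratedDerivWithin (r / 2) y I t)
          + L.q (r / 2 + 1) t (iteratedDerivWithin (r / 2 + 1) y I t)))) I t := by
      have h1 : HasDerivWithinAt (iteratedDerivWithin (r / 2) y I)
          (iteratedDerivWithin (r / 2 + 1) y I t) I t := by
        rw [iteratedDerivWithin_succ]
        exact (hy.differentiableOn_iteratedDerivWithin
          (by exact_mod_cast (by omega)) hI t ht).hasDerivWithinAt
      have h2 : HasDerivWithinAt (L.q (r / 2 + 1)) (derivWithin (L.q (r / 2 + 1)) I t) I t :=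
        (hq1.differentiableOn (by simp) t ht).hasDerivWithinAt
      refine ((hasDerivWithinAt_clm_apply_complex h2 h1).const_smul
        (Complex.I / 2)).neg.congr_of_mem (fun τ hτ => ?_) ht
      rw [hmid τ hτ, hγ0, hc, sub_zero]
      rfl
    have hd' := (hI t ht).eq_deriv _ (hw (r / 2) (by omega) t ht) hd
    have e : w (r / 2) t - L.p (r / 2) t (iteratedDerivWithin (r / 2) y I t)
        + (Complex.I / 2) • L.q (r / 2) t (iteratedDerivWithin (r / 2 - 1) y I t)
        + m.coef (r / 2) t (jet I f t)
        - (Complex.I / 2) • derivWithin (L.q (r / 2 + 1)) I t (iteratedDerivWithin (r / 2) y I t)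
        = ((Complex.I / 2) • (L.q (r / 2 + 1) t + L.s (r / 2 + 1) t))
            (iteratedDerivWithin (r / 2 + 1) y I t) := by
      rw [coef] at hd'
      simp only [jet, smul_add, smul_sub, smul_apply, add_apply] at hd' ⊢
      rw [← sub_eq_zero] at hd' ⊢
      rw [← neg_eq_zero, ← hd']
      abel
    try dsimp only [Pi.add_apply, Pi.smul_apply, Pi.sub_apply]
    rw [e, ← mul_apply_eq_comp, Ring.inverse_mul_cancel _ (hu t ht), one_apply_eq_self]

/-- Bootstrap on `k`: if `y` has `(r+1)/2 + k` derivatives and `w_j` has `min(j, k)`, the equations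
give the `w_j` one more up to `j`, and then the middle relation gives `y` one more. It stops at `k =
r/2`, where `(r+1)/2 + r/2 = r`. -/
theorem contDiffOn_of_quasi_system (hL : L.IsRegular I r) (hm : m.IsOfOrder s)
    (hms : m.IsSmoothOn I) (hs : Even s) (hsr : s ≤ r) (hI : UniqueDiffOn ℝ I)
    (hf : ContDiffOn ℝ s f I) {w : ℕ → ℝ → 𝓗} (hy : ContDiffOn ℝ ((r + 1) / 2 : ℕ) y I)
    (hw0 : ∀ t ∈ I, w 0 t = 0)
    (hw : ∀ j < (r + 1) / 2, ∀ t ∈ I, HasDerivWithinAt (w (j + 1))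
      (-w j t + (L.coef j t (jet I y t) - m.coef j t (jet I f t))) I t)
    (hmid : ∀ t ∈ I, w ((r + 1) / 2) t
      = L.coef ((r + 1) / 2) t (jet I y t) - m.coef ((r + 1) / 2) t (jet I f t)) :
    ContDiffOn ℝ r y I ∧ ∀ j ≤ r / 2, ContDiffOn ℝ j (w j) I := by
  have hw0' : ∀ k : ℕ, ContDiffOn ℝ k (w 0) I := fun k =>
    (contDiffOn_const (c := (0 : 𝓗))).congr hw0
  have stepw : ∀ k : ℕ, ContDiffOn ℝ ((r + 1) / 2 + k : ℕ) y I →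
      (∀ j ≤ r / 2, ContDiffOn ℝ (min j k : ℕ) (w j) I) →
      ∀ j ≤ r / 2, ContDiffOn ℝ (min j (k + 1) : ℕ) (w j) I := by
    intro k hyk hwk j hj
    rcases j with _ | j
    · exact hw0' _
    · rw [Nat.succ_min_succ]
      refine contDiffOn_succ_of_hasDerivWithinAt hI (hw j (by omega)) ?_
      refine (hwk j (by omega)).neg.add ((contDiffOn_coef_of_le hL.smooth hI hyk
        (min_le_left j k) (by omega)).sub ?_)
      exact (contDiffOn_coef hm hms hI hf j).of_le (by exact_mod_cast min_le_left j k)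
  have main : ∀ k ≤ r / 2, ContDiffOn ℝ ((r + 1) / 2 + k : ℕ) y I ∧
      ∀ j ≤ r / 2, ContDiffOn ℝ (min j k : ℕ) (w j) I := by
    intro k
    induction k with
    | zero =>
      refine fun _ => ⟨hy, fun j hj => ?_⟩
      rcases j with _ | j
      · exact hw0' _
      · rw [Nat.min_zero]
        exact contDiffOn_zero.2 fun t ht => (hw j (by omega) t ht).continuousWithinAt
    | succ k ih =>
      intro hk
      obtain ⟨h1, h2⟩ := ih (by omega)
      have h3 := stepw k h1 h2
      refine ⟨?_, h3⟩
      have h4 := contDiffOn_top_deriv hL hm hms hs hsr hI hf (by omega : k < r / 2) h1 hw hmid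
        (by simpa [Nat.min_eq_right (by omega : k + 1 ≤ r / 2)] using h3 (r / 2) le_rfl)
      exact contDiffOn_add_of_iteratedDerivWithin hI hy h4
  obtain ⟨h1, h2⟩ := main (r / 2) le_rfl
  refine ⟨?_, fun j hj => ?_⟩
  · rwa [show (r + 1) / 2 + r / 2 = r by omega] at h1
  · have := h2 j hj
    rwa [min_eq_left hj] at this

/-- Extended by zero, `w` is a quasi-sequence for the same data as the difference of the
quasi-derivatives of `y` and `f`; uniqueness identifies them. -/
theorem quasi_system_eq (hL : L.IsRegular I r) (hm : m.IsOfOrder s)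
    (hms : m.IsSmoothOn I) (hsr : s ≤ r) (hI : UniqueDiffOn ℝ I)
    (hf : ContDiffOn ℝ s f I) {w : ℕ → ℝ → 𝓗} (hy : ContDiffOn ℝ r y I)
    (hwc : ∀ j ≤ r / 2, ContDiffOn ℝ j (w j) I)
    (hw : ∀ j < (r + 1) / 2, ∀ t ∈ I, HasDerivWithinAt (w (j + 1))
      (-w j t + (L.coef j t (jet I y t) - m.coef j t (jet I f t))) I t)
    (hmid : ∀ t ∈ I, w ((r + 1) / 2) t
      = L.coef ((r + 1) / 2) t (jet I y t) - m.coef ((r + 1) / 2) t (jet I f t)) {j : ℕ}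
    (hj : j ≤ (r + 1) / 2) :
    ∀ t ∈ I, w j t = L.quasiSeq I r y j t - m.quasiSeq I s f j t := by
  have hc : ∀ j : ℕ, ContDiffOn ℝ j
      (fun t => L.coef j t (jet I y t) - m.coef j t (jet I f t)) I := fun j =>
    (contDiffOn_coef hL.order hL.smooth hI hy j).sub (contDiffOn_coef hm hms hI hf j)
  have hW : IsQuasiSeq I (fun j t => L.coef j t (jet I y t) - m.coef j t (jet I f t))
      (fun j => if j ≤ (r + 1) / 2 then w j else fun _ => 0) := by
    refine ⟨fun j => ?_, fun j t ht => ?_, (r + 1) / 2 + 1, fun j hj t _ => ?_⟩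
    · split_ifs with h
      · rcases h.lt_or_eq with h | h
        · exact hwc j (by omega)
        · subst h
          exact (hc _).congr hmid
      · exact contDiffOn_const
    · rcases lt_trichotomy j ((r + 1) / 2) with h | h | h
      · rw [if_pos h.le, if_pos (by omega), (hw j h t ht).derivWithin (hI t ht)]
        abel
      · rw [if_pos h.le, if_neg (by omega), h, hmid t ht]
        simp
      · rw [if_neg (by omega), if_neg (by omega), coef_eq_zero hL.order h,
          coef_eq_zero hm (by omega)]
        simp
    · rw [if_neg (by omega)]
  intro t ht
  have := hW.unique ((isQuasiSeq hL.order hL.smooth hI hy).sub (isQuasiSeq hm hms hI hf))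
    (fun _ _ _ => rfl) j t ht
  rwa [if_pos hj] at this

end OpExpr

/-! ### Equivalence of the equation of higher order and the system -/

namespace OpExpr

variable {𝓗 : Type*} [NormedAddCommGroup 𝓗] [InnerProductSpace ℂ 𝓗] [CompleteSpace 𝓗]
  {L K m : OpExpr 𝓗} {I : Set ℝ} {r s : ℕ} {y f : ℝ → 𝓗}

theorem quasiSeq_of_le {j : ℕ} (hj : j ≤ (r + 1) / 2) (t : ℝ) :
    L.quasiSeq I r y j t = L.quasiDeriv I r y (r - j) t := by
  rw [quasiSeq, if_pos hj]

theorem quasiSeq_even (hs : Even s) (j : ℕ) (t : ℝ) :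
    m.quasiSeq I s f j t = if 2 * j ≤ s then m.quasiDeriv I s f (s - j) t else 0 := by
  obtain ⟨c, rfl⟩ := hs
  rw [quasiSeq]
  by_cases h : 2 * j ≤ c + c
  · rw [if_pos h, if_pos (by omega)]
  · rw [if_neg h, if_neg (by omega)]

theorem exists_coord_eq (r : ℕ) (v : ℕ → 𝓗) :
    ∃ x : HilbertPow 𝓗 r, ∀ k < r, coord r k x = v k :=
  ⟨WithLp.toLp 2 fun i : Fin r => v i, fun k hk => by rw [coord_apply hk]⟩

theorem isQuasiVec_vecY (hL : L.IsOfOrder r) (hm : m.IsOfOrder s) (hr : 0 < r) (hs : Even s)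
    (hsr : s ≤ r) {t : ℝ} (h0 : L.quasiSeq I r y 0 t = m.quasiSeq I s f 0 t) :
    L.IsQuasiVec r t (L.vecY m I r s y f t) (jet I y t)
      (fun j => L.quasiSeq I r y j t - m.quasiSeq I s f j t)
      (fun j => m.coef j t (jet I f t)) where
  zero := by rw [h0, sub_self]
  lt k hk := by
    rw [coord_vecY L m I (by omega), if_neg (by omega), if_pos hk, jet]
  quasi j hj := by
    rw [coord_vecY L m I (by omega), if_neg (by omega), if_neg (by omega), if_pos (by omega),
      show r / 2 + j - r / 2 + 1 = j + 1 by omega, quasiSeq_of_le (by omega), quasiSeq_even hs]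
  last he := by
    have hr' := Nat.not_even_iff.1 he
    rw [coord_vecY L m I (by omega), jet]
    by_cases h1 : r = 1
    · subst h1
      simp [firstOrderFactor, smul_smul]
    · rw [if_neg h1, if_neg (by omega), if_neg (by omega), firstOrderFactor, if_neg h1, one_smul]
  mid he := by
    have hr' : (r + 1) / 2 = r / 2 := by
      obtain ⟨c, rfl⟩ := he
      omega
    rw [quasiSeq_top hL I y hr'.le, quasiSeq_top hm I f (by omega)]

/-- The vector of quasi-derivatives of a solution satisfies the first order system. -/
theorem vecY_solves (hL : L.IsRegular I r) (hK : K.IsOfOrder r) (hm : m.IsOfOrder s)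
    (hms : m.IsSmoothOn I) (hr : 0 < r) (hs : Even s) (hsr : s ≤ r) (hI : UniqueDiffOn ℝ I)
    (hKL : ∀ t ∈ I, K.IsAdjointAt L t) (hy : ContDiffOn ℝ r y I) (hf : ContDiffOn ℝ s f I)
    (h : ∀ t ∈ I, L.apply I r y t = m.apply I s f t) {t : ℝ} (ht : t ∈ I) :
    ∃ x', HasDerivWithinAt (L.vecY m I r s y f) x' I t ∧
      sysLHS (L.opQ r t) (derivWithin (L.opQ r) I t) (L.opH r t) (L.vecY m I r s y f t) x'
        = K.opW m r t (K.vecF I r s f t) := by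
  have hz := (isQuasiSeq hL.order hL.smooth hI hy).sub (isQuasiSeq hm hms hI hf)
  have hq : ∀ τ ∈ I, L.IsQuasiVec r τ (L.vecY m I r s y f τ) (jet I y τ)
      (fun j => L.quasiSeq I r y j τ - m.quasiSeq I s f j τ)
      (fun j => m.coef j τ (jet I f τ)) := fun τ hτ =>
    isQuasiVec_vecY hL.order hm hr hs hsr (by
      rw [← apply_eq_quasiSeq hL.order hL.smooth hI hy hτ, ← apply_eq_quasiSeq hm hms hI hf hτ,
        h τ hτ])
  have hjet : ∀ k < r, HasDerivWithinAt (iteratedDerivWithin k y I) (jet I y t (k + 1)) I t :=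
    fun k hk => by
      rw [jet, iteratedDerivWithin_succ]
      exact (hy.differentiableOn_iteratedDerivWithin (by exact_mod_cast hk) hI t
        ht).hasDerivWithinAt
  have hzd : ∀ j, HasDerivWithinAt (fun τ => L.quasiSeq I r y (j + 1) τ
      - m.quasiSeq I s f (j + 1) τ) (-(L.quasiSeq I r y j t - m.quasiSeq I s f j t)
        + (L.coef j t (jet I y t) - m.coef j t (jet I f t))) I t := fun j => by
    have h1 := (hz.differentiableOn j t ht).hasDerivWithinAt
    have h2 : L.quasiSeq I r y j t - m.quasiSeq I s f j t
        = L.coef j t (jet I y t) - m.coef j t (jet I f t)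
          - derivWithin (fun τ => L.quasiSeq I r y (j + 1) τ - m.quasiSeq I s f (j + 1) τ) I t :=
      hz.step j t ht
    rw [h2]
    convert h1 using 1
    abel
  obtain ⟨x', hx'⟩ := exists_coord_eq r (fun k => if k < r / 2 then jet I y t (k + 1)
    else if k < 2 * (r / 2) then -(L.quasiSeq I r y (k - r / 2) t - m.quasiSeq I s f (k - r / 2) t)
        + (L.coef (k - r / 2) t (jet I y t) - m.coef (k - r / 2) t (jet I f t))
    else -(Complex.I • firstOrderFactor r • jet I y t (r / 2 + 1)))
  have h1 : ∀ i < r / 2, coord r i x' = jet I y t (i + 1) := fun i hi => by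
    rw [hx' i (by omega), if_pos hi]
  have h2 : ∀ i < r / 2, coord r (r / 2 + i) x'
      = -(L.quasiSeq I r y i t - m.quasiSeq I s f i t)
        + (L.coef i t (jet I y t) - m.coef i t (jet I f t)) := fun i hi => by
    rw [hx' (r / 2 + i) (by omega), if_neg (by omega), if_pos (by omega), Nat.add_sub_cancel_left]
  have h3 : ¬Even r → coord r (2 * (r / 2)) x'
      = -(Complex.I • firstOrderFactor r • jet I y t (r / 2 + 1)) := fun he => by
    rw [hx' _ (by have := Nat.not_even_iff.1 he; omega), if_neg (by omega), if_neg (by omega)]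
  have hq1 : HasDerivWithinAt (L.q (r / 2 + 1)) (derivWithin (L.q (r / 2 + 1)) I t) I t :=
    ((hL.smooth.q_smooth (r / 2 + 1)).differentiableOn (by simp) t ht).hasDerivWithinAt
  refine ⟨x', hasDerivWithinAt_of_coord fun k hk => ?_, ?_⟩
  · rcases index_cases hk with hk | ⟨i, hi, rfl⟩ | ⟨he, rfl⟩
    · rw [h1 k hk]
      exact (hjet k (by omega)).congr_of_mem (fun τ hτ => (hq τ hτ).lt k hk) ht
    · rw [h2 i hi]
      exact (hzd i).congr_of_mem (fun τ hτ => (hq τ hτ).quasi i hi) ht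
    · rw [h3 he]
      exact (((hjet (r / 2) (by omega)).const_smul (firstOrderFactor r)).const_smul
        Complex.I).neg.congr_of_mem (fun τ hτ => (hq τ hτ).last he) ht
  · refine ((hq t ht).sysLHS_iff hL.order hK hm hr hs hsr (hKL t ht)
      (fun he => hL.unit_even he t ht) (hL.adjoint_q t ht) (hI t ht) hq1 h3).2
      ⟨h2, h1, fun he => ?_⟩
    have hr' := Nat.not_even_iff.1 he
    have hM : (r + 1) / 2 = r / 2 + 1 := by omega
    -- For odd `r` the last row compares two derivatives of the middle quasi-derivative `-(i/2)
    -- q_{n+1} y^{(n)}`: by the product rule and by the recursion.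
    refine (hI t ht).eq_deriv _ ?_ (hzd (r / 2))
    refine ((hasDerivWithinAt_clm_apply_complex hq1 (hjet (r / 2) (by omega))).const_smul
      (Complex.I / 2)).neg.congr_of_mem (fun τ hτ => ?_) ht
    rw [quasiSeq_top hL.order I y hM.le, quasiSeq_top hm I f (by omega),
      coef_eq_zero hm (by obtain ⟨c, rfl⟩ := hs; omega), sub_zero, coef,
      congrFun (hL.order.s_eq_zero (r / 2 + 1 + 1) (by omega)) τ,
      congrFun (hL.order.p_eq_zero (r / 2 + 1) (by omega)) τ]
    simp [jet]

theorem vecY_eq_of_isQuasiVec {t : ℝ} {x : HilbertPow 𝓗 r} {w γ : ℕ → 𝓗} (hs : Even s)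
    (hx : L.IsQuasiVec r t x (jet I y t) w γ)
    (hw : ∀ j ≤ (r + 1) / 2, w j = L.quasiSeq I r y j t - m.quasiSeq I s f j t) :
    L.vecY m I r s y f t = x := by
  refine ext_coord fun k hk => ?_
  rw [coord_vecY L m I hk]
  by_cases h1 : r = 1
  · subst h1
    obtain rfl : k = 0 := by omega
    have h := hx.last (by decide)
    simp only [show 2 * (1 / 2) = 0 by rfl, show (1 : ℕ) / 2 = 0 by rfl] at h
    rw [h, if_pos rfl, firstOrderFactor, if_pos rfl, smul_smul, Complex.I_mul_I, neg_one_smul,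
      neg_neg, jet, iteratedDerivWithin_zero]
  · rw [if_neg h1]
    rcases index_cases hk with hk | ⟨j, hj, rfl⟩ | ⟨he, rfl⟩
    · rw [if_pos hk, hx.lt k hk, jet]
    · rw [if_neg (by omega), if_pos (by omega), hx.quasi j hj, hw (j + 1) (by omega),
        show r / 2 + j - r / 2 + 1 = j + 1 by omega, quasiSeq_of_le (by omega), quasiSeq_even hs]
    · rw [if_neg (by omega), if_neg (by omega), hx.last he, firstOrderFactor, if_neg h1, one_smul,
        jet]

/-- The first component of a solution of the first order system solves the equation of higher
order. -/
theorem apply_of_system (hL : L.IsRegular I r) (hK : K.IsOfOrder r) (hm : m.IsOfOrder s)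
    (hms : m.IsSmoothOn I) (hr : 0 < r) (hs : Even s) (hsr : s ≤ r) (hI : UniqueDiffOn ℝ I)
    (hKL : ∀ t ∈ I, K.IsAdjointAt L t) (hf : ContDiffOn ℝ s f I) {x : ℝ → HilbertPow 𝓗 r}
    (h : ∀ t ∈ I, ∃ x', HasDerivWithinAt x x' I t ∧
      sysLHS (L.opQ r t) (derivWithin (L.opQ r) I t) (L.opH r t) (x t) x'
        = K.opW m r t (K.vecF I r s f t)) :
    ContDiffOn ℝ r (fun t => coord r 0 (x t)) I ∧
      (∀ t ∈ I, L.apply I r (fun t => coord r 0 (x t)) t = m.apply I s f t) ∧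
      ∀ t ∈ I, L.vecY m I r s (fun t => coord r 0 (x t)) f t = x t := by
  choose! x' hx' hsys using h
  have hκ := firstOrderFactor_ne_zero r
  have hq1 : ∀ t ∈ I, HasDerivWithinAt (L.q (r / 2 + 1)) (derivWithin (L.q (r / 2 + 1)) I t) I t :=
    fun t ht =>
    ((hL.smooth.q_smooth (r / 2 + 1)).differentiableOn (by simp) t ht).hasDerivWithinAt
  set γ : ℝ → ℕ → 𝓗 := fun t j => m.coef j t (jet I f t) with hγ
  -- For odd `r` the middle index `n + 1` is not among the components of `x`, and `w_{n+1}` is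
  -- defined as `-(i/2) q_{n+1}` applied to the would-be `y^{(n)}`.
  set w : ℕ → ℝ → 𝓗 := fun j t => if j ≤ r / 2 then quasiVec r (x t) j
    else -((Complex.I / 2) • L.q (r / 2 + 1) t
      ((firstOrderFactor r)⁻¹ • Complex.I • coord r (2 * (r / 2)) (x t))) with hw
  -- The candidate jet. For even `r` its entry `n` restores the missing `γ_n` before inverting
  -- `p_n`; for odd `r` its entry `n + 1` has to be read off from `x'`.
  set U : ℕ → ℝ → 𝓗 := fun k t => if k < r / 2 then coord r k (x t)
    else if k = r / 2 then (if Even r then Ring.inverse (L.p (r / 2) t)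
        (coord r (2 * (r / 2) - 1) (x t) + γ t (r / 2)
          + (Complex.I / 2) • L.q (r / 2) t (coord r (r / 2 - 1) (x t)))
      else (firstOrderFactor r)⁻¹ • Complex.I • coord r (2 * (r / 2)) (x t))
    else if ¬Even r ∧ k = r / 2 + 1 then
      (firstOrderFactor r)⁻¹ • Complex.I • coord r (2 * (r / 2)) (x' t)
    else 0 with hU
  have hIκ : ∀ v : 𝓗, -(Complex.I • firstOrderFactor r • (firstOrderFactor r)⁻¹ • Complex.I • v)
      = v := fun v => by
    rw [smul_smul (firstOrderFactor r), mul_inv_cancel₀ hκ, one_smul, smul_smul, Complex.I_mul_I,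
      neg_one_smul, neg_neg]
  have hquasi : ∀ t ∈ I, L.IsQuasiVec r t (x t) (fun k => U k t) (fun j => w j t) (γ t) := by
    intro t ht
    refine ⟨?_, fun k hk => ?_, fun j hj => ?_, fun he => ?_, fun he => ?_⟩
    · simp [hw, quasiVec]
    · simp only [hU, if_pos hk]
    · simp only [hw]
      rw [if_pos (by omega), quasiVec, if_pos (by omega),
        show r / 2 + (j + 1) - 1 = r / 2 + j by omega]
    · simp only [hU, lt_irrefl, if_false, if_true, he]
      rw [hIκ]
    · have hn : 0 < r / 2 := by
        obtain ⟨c, rfl⟩ := he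
        omega
      rw [coef_mid_even hL.order he]
      simp only [hU, hw, lt_irrefl, if_false, if_true, he, le_refl]
      rw [if_pos (by omega), ← mul_apply_eq_comp, Ring.mul_inverse_cancel _ (hL.unit_even he t ht),
        one_apply_eq_self, quasiVec, if_pos (by omega),
        show r / 2 + r / 2 - 1 = 2 * (r / 2) - 1 by omega]
      abel
  have hrows := fun t (ht : t ∈ I) => ((hquasi t ht).sysLHS_iff hL.order hK hm hr hs hsr (hKL t ht)
      (fun he => hL.unit_even he t ht) (hL.adjoint_q t ht) (hI t ht) (hq1 t ht) (x' := x' t)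
      (fun he => by
        simp only [hU]
        rw [if_neg (by omega), if_neg (by omega), if_pos ⟨he, trivial⟩, hIκ])).1 (hsys t ht)
  have hcoord : ∀ k, ∀ t ∈ I, HasDerivWithinAt (fun t => coord r k (x t)) (coord r k (x' t)) I t :=
    fun k t ht => hasDerivWithinAt_coord (hx' t ht) k
  have hchain : ∀ k < (r + 1) / 2, ∀ t ∈ I, HasDerivWithinAt (U k) (U (k + 1) t) I t := by
    intro k hk t ht
    rcases Nat.lt_or_ge k (r / 2) with h | h
    · rw [← (hrows t ht).2.1 k h]
      exact (hcoord k t ht).congr_of_mem (fun τ hτ => by simp only [hU, if_pos h]) ht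
    · obtain rfl : k = r / 2 := by omega
      have he : ¬Even r := fun he => by
        obtain ⟨c, rfl⟩ := he
        omega
      have e : U (r / 2 + 1) t = (firstOrderFactor r)⁻¹ • Complex.I •
          coord r (2 * (r / 2)) (x' t) := by
        simp only [hU]
        rw [if_neg (by omega), if_neg (by omega), if_pos ⟨he, trivial⟩]
      rw [e]
      exact (((hcoord _ t ht).const_smul Complex.I).const_smul _).congr_of_mem
        (fun τ hτ => by simp only [hU, lt_irrefl, if_false, if_true, he]; rfl) ht
  have hcc : ∀ k, ContinuousOn (fun t => coord r k (x t)) I := fun k t ht =>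
    (hcoord k t ht).continuousWithinAt
  have hγc : ∀ j, ContinuousOn (fun t => γ t j) I := fun j =>
    (contDiffOn_coef hm hms hI hf j).continuousOn
  have hq0 : ∀ (A : ℝ → 𝓗 →L[ℂ] 𝓗) (v : ℝ → 𝓗), ContinuousOn A I → ContinuousOn v I →
      ContinuousOn (fun t => A t (v t)) I := fun A v hA hv => hA.clm_apply hv
  have hqw : ∀ j ≤ r / 2, ContinuousOn (w j) I := by
    intro j hj
    rcases j with _ | j
    · exact continuousOn_const.congr fun t ht => (hquasi t ht).zero
    · exact (hcc (r / 2 + j)).congr fun t ht => ((hquasi t ht).quasi j (by omega)).symm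
  -- The derivative `x'` is not known to be continuous. For odd `r` the top entry is therefore
  -- expressed by the last row, solved for `(q_{n+1} + s_{n+1}) U_{n+1}`, in continuous quantities.
  have hUc : ContinuousOn (U ((r + 1) / 2)) I := by
    by_cases he : Even r
    · have hn : (r + 1) / 2 = r / 2 := by
        obtain ⟨c, rfl⟩ := he
        omega
      rw [hn]
      have hp := (ContDiffOn.ringInverse ((hL.smooth.p_smooth (r / 2)))
        (hL.unit_even he)).continuousOn
      refine (hq0 _ _ hp (((hcc (2 * (r / 2) - 1)).add (hγc (r / 2))).add
        ((hq0 _ _ (hL.smooth.q_smooth (r / 2)).continuousOn (hcc (r / 2 - 1))).const_smul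
          (Complex.I / 2)))).congr fun t ht => ?_
      simp only [hU, lt_irrefl, if_false, if_true, he]
      rfl
    · have hn : (r + 1) / 2 = r / 2 + 1 := by
        have := Nat.not_even_iff.1 he
        omega
      rw [hn]
      have hu : ∀ t ∈ I, IsUnit (L.q (r / 2 + 1) t + L.s (r / 2 + 1) t) := hL.unit_odd he
      have hq2 := hL.smooth.q_smooth (r / 2 + 1)
      have hUk : ∀ k ≤ r / 2, ContinuousOn (U k) I := fun k hk t ht =>
        (hchain k (by omega) t ht).continuousWithinAt
      have hinv : ContinuousOn
          (fun t => Ring.inverse (L.q (r / 2 + 1) t + L.s (r / 2 + 1) t)) I :=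
        (ContDiffOn.ringInverse (hq2.add (hL.smooth.s_smooth (r / 2 + 1))) hu).continuousOn
      have hrhs := (hq0 _ _ hinv (((((hqw (r / 2) le_rfl).sub (hq0 _ _
        (hL.smooth.p_smooth (r / 2)).continuousOn (hUk (r / 2) le_rfl))).add ((hq0 _ _
        (hL.smooth.q_smooth (r / 2)).continuousOn (hUk (r / 2 - 1) (by omega))).const_smul
          (Complex.I / 2))).add (hγc (r / 2))).sub ((hq0 _ _ (hq2.derivWithin hI
            (m := 0) (by simp)).continuousOn (hUk (r / 2) le_rfl)).const_smul
              (Complex.I / 2)))).const_smul (Complex.I / 2)⁻¹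
      refine hrhs.congr fun t ht => ?_
      have h3 := (hrows t ht).2.2 he
      have e : w (r / 2) t - L.p (r / 2) t (U (r / 2) t)
          + (Complex.I / 2) • L.q (r / 2) t (U (r / 2 - 1) t) + γ t (r / 2)
          - (Complex.I / 2) • derivWithin (L.q (r / 2 + 1)) I t (U (r / 2) t)
          = (Complex.I / 2) • (L.q (r / 2 + 1) t + L.s (r / 2 + 1) t) (U (r / 2 + 1) t) := by
        rw [coef] at h3
        simp only [smul_add, smul_sub, add_apply, hγ] at h3 ⊢
        rw [← sub_eq_zero] at h3 ⊢
        rw [← h3]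
        abel
      dsimp only [Pi.add_apply, Pi.smul_apply, Pi.sub_apply] at e ⊢
      rw [e, map_smul, smul_smul, inv_mul_cancel₀ (by simp), one_smul, ← mul_apply_eq_comp,
        Ring.inverse_mul_cancel _ (hu t ht), one_apply_eq_self]
  have hU0 : ∀ t ∈ I, U 0 t = coord r 0 (x t) := by
    intro t ht
    rcases Nat.eq_zero_or_pos (r / 2) with h | h
    · have h1 : r = 1 := by omega
      subst h1
      have h' := (hquasi t ht).last (by decide)
      simp only [show 2 * (1 / 2) = 0 by rfl, show (1 : ℕ) / 2 = 0 by rfl] at h'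
      rw [h', firstOrderFactor, if_pos rfl, smul_smul, Complex.I_mul_I, neg_one_smul, neg_neg]
    · exact ((hquasi t ht).lt 0 h).symm
  set y : ℝ → 𝓗 := fun t => coord r 0 (x t) with hy
  have hjetU : ∀ k ≤ (r + 1) / 2, ∀ t ∈ I, jet I y t k = U k t := by
    intro k hk t ht
    rw [← iteratedDerivWithin_eq_of_chain hI hchain hk t ht, jet]
    exact (iteratedDerivWithin_congr hU0 ht).symm
  have hyM : ContDiffOn ℝ ((r + 1) / 2 : ℕ) y I :=
    (contDiffOn_of_chain hI hchain hUc).congr fun t ht => (hU0 t ht).symm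
  have hcoef : ∀ j ≤ (r + 1) / 2, ∀ t ∈ I,
      L.coef j t (jet I y t) = L.coef j t (fun k => U k t) := by
    intro j hj t ht
    rw [coef, coef, hjetU j hj t ht, hjetU (j - 1) (by omega) t ht]
    rcases hj.lt_or_eq with h | h
    · rw [hjetU (j + 1) h t ht]
    · rw [congrFun (hL.order.s_eq_zero (j + 1) (by omega)) t]
      rfl
  have hwd : ∀ j < (r + 1) / 2, ∀ t ∈ I, HasDerivWithinAt (w (j + 1))
      (-w j t + (L.coef j t (jet I y t) - m.coef j t (jet I f t))) I t := by
    intro j hj t ht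
    rw [hcoef j hj.le t ht]
    rcases Nat.lt_or_ge j (r / 2) with h | h
    · rw [← (hrows t ht).1 j h]
      exact (hcoord _ t ht).congr_of_mem (fun τ hτ => ((hquasi τ hτ).quasi j h).symm) ht
    · obtain rfl : j = r / 2 := by omega
      have he : ¬Even r := fun he => by
        obtain ⟨c, rfl⟩ := he
        omega
      rw [← (hrows t ht).2.2 he]
      refine ((hasDerivWithinAt_clm_apply_complex (hq1 t ht)
        (hchain (r / 2) hj t ht)).const_smul (Complex.I / 2)).neg.congr_of_mem
          (fun τ hτ => ?_) ht
      simp only [hw, hU, lt_irrefl, if_false, if_true, he]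
      rw [if_neg (by omega)]
      rfl
  have hmid : ∀ t ∈ I, w ((r + 1) / 2) t
      = L.coef ((r + 1) / 2) t (jet I y t) - m.coef ((r + 1) / 2) t (jet I f t) := by
    intro t ht
    rw [hcoef _ le_rfl t ht]
    by_cases he : Even r
    · have hn : (r + 1) / 2 = r / 2 := by
        obtain ⟨c, rfl⟩ := he
        omega
      rw [hn]
      exact (hquasi t ht).mid he
    · have hr' := Nat.not_even_iff.1 he
      have hn : (r + 1) / 2 = r / 2 + 1 := by omega
      rw [hn, coef_eq_zero hm (by obtain ⟨c, rfl⟩ := hs; omega), sub_zero, coef,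
        congrFun (hL.order.s_eq_zero (r / 2 + 1 + 1) (by omega)) t,
        congrFun (hL.order.p_eq_zero (r / 2 + 1) (by omega)) t]
      simp only [hw, hU, Nat.add_sub_cancel, lt_irrefl, if_false, if_true, he]
      rw [if_neg (by omega)]
      simp
  have hw0 : ∀ t ∈ I, w 0 t = 0 := fun t ht => (hquasi t ht).zero
  obtain ⟨hyr, hwc⟩ := contDiffOn_of_quasi_system hL hm hms hs hsr hI hf hyM hw0 hwd hmid
  have heq := fun {j : ℕ} (hj : j ≤ (r + 1) / 2) =>
    quasi_system_eq hL hm hms hsr hI hf hyr hwc hwd hmid hj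
  refine ⟨hyr, fun t ht => ?_, fun t ht => ?_⟩
  · rw [apply_eq_quasiSeq hL.order hL.smooth hI hyr ht, apply_eq_quasiSeq hm hms hI hf ht,
      ← sub_eq_zero, ← heq (Nat.zero_le _) t ht, hw0 t ht]
  · refine vecY_eq_of_isQuasiVec (w := fun j => w j t) (γ := γ t) hs ?_ fun j hj => heq hj t ht
    have h := hquasi t ht
    refine ⟨h.zero, fun k hk => ?_, h.quasi, fun he => ?_, fun he => ?_⟩
    · rw [h.lt k hk, hjetU k (by omega) t ht]
    · rw [h.last he, hjetU _ (by omega) t ht]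
    · rw [h.mid he, hcoef _ (by omega) t ht]

end OpExpr

/-! ### Families of Nevanlinna functions: uniform comparison of parameters -/

section NevanlinnaFamily

/-- `Im f / Im` for nonreal values of the argument, and the derivative for real ones. -/
def nevRatio (f : ℂ → ℂ) (z : ℂ) : ℝ := if z.im = 0 then (deriv f z).re else (f z).im / z.im

theorem nevRatio_of_im_ne_zero {z : ℂ} (hz : z.im ≠ 0) (f : ℂ → ℂ) :
    nevRatio f z = (f z).im / z.im := if_neg hz

/-- A family of Nevanlinna functions, analytic in neighbourhoods that do not depend on the
index. -/
structure IsNevFamily {ι : Type*} (dom : Set ℂ) (h : ι → ℂ → ℂ) : Prop where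
  nonreal_mem : ∀ z : ℂ, z.im ≠ 0 → z ∈ dom
  analytic : ∀ μ ∈ dom, ∃ U : Set ℂ, IsOpen U ∧ μ ∈ U ∧ ∀ i, DifferentiableOn ℂ (h i) U
  nonneg : ∀ z : ℂ, z.im ≠ 0 → ∀ i, 0 ≤ (h i z).im / z.im
  symm : ∀ z ∈ dom, ∀ i, h i (conj z) = conj (h i z)

/-- At `w` the functions of a family are dominated by their values at `z`. -/
def NevCompare {ι : Type*} (h : ι → ℂ → ℂ) (w z : ℂ) : Prop :=
  ∃ C : ℝ, 0 ≤ C ∧ ∀ i, nevRatio (h i) w ≤ C * nevRatio (h i) z ∧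
    ‖h i z - h i w‖ ≤ C * nevRatio (h i) z

variable {ι : Type*} {dom : Set ℂ} {h : ι → ℂ → ℂ}

theorem NevCompare.trans {w z x : ℂ} (h₁ : NevCompare h w z) (h₂ : NevCompare h z x) :
    NevCompare h w x := by
  obtain ⟨C, hC, h₁⟩ := h₁
  obtain ⟨C', hC', h₂⟩ := h₂
  refine ⟨C' + C * C' , by positivity, fun i => ?_⟩
  obtain ⟨a1, b1⟩ := h₁ i
  obtain ⟨a2, b2⟩ := h₂ i
  have hn : 0 ≤ C' * nevRatio (h i) x := (norm_nonneg _).trans b2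
  have hm : C * nevRatio (h i) z ≤ C * (C' * nevRatio (h i) x) :=
    mul_le_mul_of_nonneg_left a2 hC
  constructor
  · linarith
  · have : h i x - h i w = (h i x - h i z) + (h i z - h i w) := by ring
    rw [this]
    linarith [norm_add_le (h i x - h i z) (h i z - h i w)]

namespace IsNevFamily

theorem nevRatio_nonneg (H : IsNevFamily dom h) {z : ℂ} (hz : z.im ≠ 0) (i : ι) :
    0 ≤ nevRatio (h i) z := by
  rw [nevRatio_of_im_ne_zero hz]
  exact H.nonneg z hz i

theorem abs_im_eq (H : IsNevFamily dom h) {z : ℂ} (hz : z.im ≠ 0) (i : ι) :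
    |(h i z).im| = |z.im| * nevRatio (h i) z := by
  rw [← abs_of_nonneg (H.nevRatio_nonneg hz i), ← abs_mul, nevRatio_of_im_ne_zero hz,
    mul_div_cancel₀ _ hz]

/-- Harnack's inequality. -/
theorem exists_radius (H : IsNevFamily dom h) {w : ℂ} (hw : w.im ≠ 0) :
    ∃ R : ℝ, 0 < R ∧ Metric.ball w R ⊆ {z | z.im ≠ 0} ∧ ∀ z, ‖z - w‖ ≤ R / 2 → ∀ i,
      ‖h i z - h i w‖ ≤ 4 * ‖z - w‖ / R * |(h i w).im| := by
  obtain ⟨U, hU, hwU, hd⟩ := H.analytic w (H.nonreal_mem w hw)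
  have hV : IsOpen {z : ℂ | 0 < z.im * w.im} :=
    isOpen_lt continuous_const (Complex.continuous_im.mul continuous_const)
  have hwV : w ∈ {z : ℂ | 0 < z.im * w.im} := mul_self_pos.2 hw
  obtain ⟨R, hR, hball⟩ := Metric.isOpen_iff.1 (hU.inter hV) w ⟨hwU, hwV⟩
  refine ⟨R, hR, fun z hz h0 => ?_, fun z hz i => ?_⟩
  · have := (hball hz).2
    simp only [mem_ofPred_eq] at h0 this
    rw [h0, zero_mul] at this
    exact lt_irrefl _ this
  -- With `σ` the sign of `Im w`, the function `-iσ h_i` has nonnegative real part on the ball,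
  -- which lies in one half-plane.
  have key : ∀ σ : ℝ, |σ| = 1 → 0 < σ * w.im →
      ‖h i z - h i w‖ ≤ 4 * ‖z - w‖ / R * |(h i w).im| := fun σ h1 hσ => by
    have hre : ∀ z, ((-Complex.I * σ) * h i z).re = σ * (h i z).im := fun z => by
      simp [Complex.mul_re, Complex.mul_im]
    have hpos : ∀ z ∈ Metric.ball w R, 0 ≤ ((-Complex.I * σ) * h i z).re := fun z hz => by
      have hz' : 0 < z.im * w.im := (hball hz).2
      have hzim : z.im ≠ 0 := fun h0 => by simp [h0] at hz'
      rw [hre]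
      have h2 := H.nonneg z hzim i
      have hσz : 0 < σ * z.im := by
        have : 0 < (σ * z.im) * (w.im * w.im * σ * σ)  := by nlinarith [mul_pos hσ hz', sq_nonneg σ, mul_pos (mul_pos hσ hz') (mul_pos hσ hσ), abs_mul_abs_self σ]
        exact pos_of_mul_pos_left this (by nlinarith [mul_self_nonneg (w.im * σ)])
      have h3 : σ * (h i z).im = (σ * z.im) * ((h i z).im / z.im) := by field_simp
      rw [h3]
      exact mul_nonneg hσz.le h2
    have := norm_sub_le_of_re_nonneg hR
      (((hd i).mono fun z hz => (hball hz).1).const_mul (-Complex.I * σ)) hpos hz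
    rw [← mul_sub, norm_mul, hre] at this
    have hn : ‖(-Complex.I * σ : ℂ)‖ = 1 := by simp [h1]
    rw [hn, one_mul] at this
    refine this.trans (mul_le_mul_of_nonneg_left ?_ (by positivity))
    calc _ ≤ |σ * (h i w).im| := le_abs_self _
      _ = _ := by rw [abs_mul, h1, one_mul]
  rcases lt_or_gt_of_ne hw with h0 | h0
  · exact key (-1) (by norm_num) (by linarith)
  · exact key 1 (by norm_num) (by linarith)

/-- Within `R/8` of `w` Harnack's inequality changes `h_i` by at most half of `|Im h_i(w)|`, so the
imaginary parts at the two points agree up to a factor 2, in both directions and uniformly in `i`.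
-/
theorem compare_nhds (H : IsNevFamily dom h) {w : ℂ} (hw : w.im ≠ 0) :
    ∀ᶠ z in 𝓝 w, NevCompare h w z ∧ NevCompare h z w := by
  obtain ⟨R, hR, hb, hh⟩ := H.exists_radius hw
  filter_upwards [Metric.ball_mem_nhds w (by linarith : (0 : ℝ) < R / 8)] with z hz
  have hzR : ‖z - w‖ < R / 8 := by simpa [dist_eq_norm] using hz
  have hzi : z.im ≠ 0 := hb (by
    rw [Metric.mem_ball, dist_eq_norm]; linarith)
  have hhalf : ∀ i, ‖h i z - h i w‖ ≤ 1 / 2 * |(h i w).im| := fun i => by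
    refine (hh z (by linarith) i).trans (mul_le_mul_of_nonneg_right ?_ (abs_nonneg _))
    rw [div_le_iff₀ hR]
    linarith
  have him : ∀ i, |(h i z).im - (h i w).im| ≤ 1 / 2 * |(h i w).im| := fun i =>
    (Complex.abs_im_le_norm (h i z - h i w)).trans (hhalf i)
  have e1 : ∀ i, |(h i z).im| ≤ 2 * |(h i w).im| := fun i => by
    have h1 := abs_add_le ((h i z).im - (h i w).im) ((h i w).im)
    rw [sub_add_cancel] at h1
    linarith [him i, abs_nonneg (h i w).im]
  have e2 : ∀ i, |(h i w).im| ≤ 2 * |(h i z).im| := fun i => by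
    have h1 := abs_sub_abs_le_abs_sub (h i w).im (h i z).im
    rw [abs_sub_comm] at h1
    linarith [him i]
  have hz0 := abs_pos.2 hzi
  have hw0 := abs_pos.2 hw
  simp only [H.abs_im_eq hzi, H.abs_im_eq hw] at e1 e2 hhalf
  refine ⟨⟨2 * |z.im| / |w.im| + |z.im|, by positivity, fun i => ?_⟩,
    ⟨2 * |w.im| / |z.im| + |w.im|, by positivity, fun i => ?_⟩⟩
  · have n0 := H.nevRatio_nonneg hzi i
    have n1 := mul_nonneg hz0.le n0
    constructor
    · have : nevRatio (h i) w ≤ 2 * |z.im| / |w.im| * nevRatio (h i) z := by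
        rw [div_mul_eq_mul_div, le_div_iff₀ hw0]
        linarith [e2 i]
      linarith
    · have : 0 ≤ 2 * |z.im| / |w.im| * nevRatio (h i) z := by positivity
      linarith [hhalf i, e2 i]
  · have n0 := H.nevRatio_nonneg hw i
    have n1 := mul_nonneg hw0.le n0
    constructor
    · have : nevRatio (h i) z ≤ 2 * |w.im| / |z.im| * nevRatio (h i) w := by
        rw [div_mul_eq_mul_div, le_div_iff₀ hz0]
        linarith [e1 i]
      linarith
    · have : 0 ≤ 2 * |w.im| / |z.im| * nevRatio (h i) w := by positivity
      rw [norm_sub_rev]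
      linarith [hhalf i]

/-- The comparison is transitive and holds symmetrically near each point, so it propagates along a
connected set; this is the Harnack chain. -/
theorem compare_of_isPreconnected (H : IsNevFamily dom h) {s : Set ℂ} (hs : IsPreconnected s)
    (h0 : s ⊆ {z | z.im ≠ 0}) {w z : ℂ} (hw : w ∈ s) (hz : z ∈ s) : NevCompare h w z :=
  hs.induction₂' (NevCompare h)
    (fun _ hx => eventually_nhdsWithin_of_eventually_nhds (H.compare_nhds (h0 hx)))
    (fun _ _ _ _ _ _ h₁ h₂ => h₁.trans h₂) hw hz

theorem compare_conj (H : IsNevFamily dom h) {z : ℂ} (hz : z.im ≠ 0) :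
    NevCompare h (conj z) z := by
  have hzc : (conj z).im ≠ 0 := by simpa using hz
  refine ⟨1 + 2 * |z.im|, by positivity, fun i => ?_⟩
  have n0 := H.nevRatio_nonneg hz i
  have n1 := mul_nonneg (abs_nonneg z.im) n0
  have hs := H.symm z (H.nonreal_mem z hz) i
  have e : nevRatio (h i) (conj z) = nevRatio (h i) z := by
    rw [nevRatio_of_im_ne_zero hzc, nevRatio_of_im_ne_zero hz, hs, Complex.conj_im,
      Complex.conj_im, neg_div_neg_eq]
  constructor
  · rw [e]; linarith
  · rw [hs, Complex.sub_conj, norm_mul, Complex.norm_I, mul_one, Complex.norm_real,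
      Real.norm_eq_abs, abs_mul, abs_two, H.abs_im_eq hz]
    linarith

/-- Each half-plane is connected; the two are linked by conjugation, under which `Im h_i / Im z`
does not change. -/
theorem compare_nonreal (H : IsNevFamily dom h) {w z : ℂ} (hw : w.im ≠ 0) (hz : z.im ≠ 0) :
    NevCompare h w z := by
  have up : ∀ {w z : ℂ}, 0 < w.im → 0 < z.im → NevCompare h w z := fun hw hz =>
    H.compare_of_isPreconnected (convex_halfSpace_im_gt 0).isPreconnected
      (fun x hx => ne_of_gt hx) hw hz
  have down : ∀ {w z : ℂ}, w.im < 0 → z.im < 0 → NevCompare h w z := fun hw hz =>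
    H.compare_of_isPreconnected (convex_halfSpace_im_lt 0).isPreconnected
      (fun x hx => ne_of_lt hx) hw hz
  rcases lt_or_gt_of_ne hw with h1 | h1 <;> rcases lt_or_gt_of_ne hz with h2 | h2
  · exact down h1 h2
  · exact (down (z := conj z) h1 (by simpa using h2)).trans (H.compare_conj hz)
  · exact (up (z := conj z) h1 (by simpa using h2)).trans (H.compare_conj hz)
  · exact up h1 h2

theorem compare (H : IsNevFamily dom h) {w z : ℂ} (hw : w ∈ dom) (hz : z.im ≠ 0) :
    NevCompare h w z := by
  rcases eq_or_ne w.im 0 with h0 | h0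
  swap
  · exact H.compare_nonreal h0 hz
  obtain ⟨c, rfl⟩ : ∃ c : ℝ, w = c := ⟨w.re, Complex.ext (by simp) (by simpa using h0)⟩
  obtain ⟨U, hU, hwU, hd⟩ := H.analytic _ hw
  obtain ⟨R, hR, hball⟩ := Metric.nhds_basis_closedBall.mem_iff.1 (hU.mem_nhds hwU)
  have him : ((c : ℂ) + (R / 8 : ℝ) * Complex.I).im = R / 8 := by simp
  have hne : ((c : ℂ) + (R / 8 : ℝ) * Complex.I).im ≠ 0 := by rw [him]; positivity
  -- A real point is first compared with the nonreal point `c + iR/8` inside its disc of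
  -- analyticity, by the estimate for typically real functions.
  refine NevCompare.trans (z := (c : ℂ) + (R / 8 : ℝ) * Complex.I) ?_ (H.compare_nonreal hne hz)
  refine ⟨4 + 4 * (R / 8), by positivity, fun i => ?_⟩
  have hreal : (h i c).im = 0 := by
    have := congrArg Complex.im (H.symm _ hw i)
    rw [Complex.conj_ofReal, Complex.conj_im] at this
    linarith
  obtain ⟨b1, b2⟩ := typicallyReal_bounds hR ((hd i).mono hball) hreal
    (fun z _ hz => H.nonneg z hz i) (fun z _ hz => H.symm z (H.nonreal_mem z hz) i)
  have n0 := H.nevRatio_nonneg hne i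
  have e : nevRatio (h i) ((c : ℂ) + (R / 8 : ℝ) * Complex.I)
      = (h i ((c : ℂ) + (R / 8 : ℝ) * Complex.I)).im / (R / 8) := by
    rw [nevRatio_of_im_ne_zero hne, him]
  have e' : nevRatio (h i) c = (deriv (h i) c).re := if_pos (Complex.ofReal_im c)
  rw [← e] at b1 b2
  rw [e']
  have n1 : 0 ≤ (R / 8) * nevRatio (h i) ((c : ℂ) + (R / 8 : ℝ) * Complex.I) := by positivity
  constructor <;> linarith

end IsNevFamily

end NevanlinnaFamily

/-! ### Forms and Hamiltonians as functions of the coefficients -/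

namespace OpExpr

variable {𝓗 : Type*} [NormedAddCommGroup 𝓗] [InnerProductSpace ℂ 𝓗]

theorem jetForm_add_left (L : OpExpr 𝓗) (N : ℕ) (t : ℝ) (u v w : ℕ → 𝓗) :
    L.jetForm N t (u + v) w = L.jetForm N t u w + L.jetForm N t v w := by
  simp only [jetForm, Pi.add_apply, map_add, inner_add_right, Finset.sum_add_distrib,
    Finset.sum_sub_distrib]
  ring

theorem jetForm_smul_left (L : OpExpr 𝓗) (N : ℕ) (t : ℝ) (u v : ℕ → 𝓗) (c : ℂ) :
    L.jetForm N t (c • u) v = c * L.jetForm N t u v := by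
  simp only [jetForm, Pi.smul_apply, map_smul, inner_smul_right, Finset.mul_sum, mul_add]
  congr 1
  refine Finset.sum_congr rfl fun j _ => ?_
  ring

theorem sub_jetForm (L K : OpExpr 𝓗) (N : ℕ) (t : ℝ) (u v : ℕ → 𝓗) :
    (L - K).jetForm N t u v = L.jetForm N t u v - K.jetForm N t u v := by
  have hp : ∀ j, (L - K).p j t = L.p j t - K.p j t := fun _ => rfl
  have hq : ∀ j, (L - K).q j t = L.q j t - K.q j t := fun _ => rfl
  have hs : ∀ j, (L - K).s j t = L.s j t - K.s j t := fun _ => rfl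
  simp only [jetForm, hp, hq, hs, sub_apply, inner_sub_right,
    Finset.sum_sub_distrib]
  ring

theorem IsAdjointAt.jetForm_conj [CompleteSpace 𝓗] {L K : OpExpr 𝓗} {t : ℝ}
    (h : L.IsAdjointAt K t) (N : ℕ) (u v : ℕ → 𝓗) :
    conj (L.jetForm N t u v) = K.jetForm N t v u := by
  have hp : ∀ j (x y : 𝓗), inner ℂ (L.p j t x) y = inner ℂ x (K.p j t y) := fun j x y => by
    rw [← h.p, ContinuousLinearMap.adjoint_inner_right]
  have hs : ∀ j (x y : 𝓗), inner ℂ (L.s j t x) y = inner ℂ x (K.q j t y) := fun j x y => by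
    rw [← h.s, ContinuousLinearMap.adjoint_inner_right]
  have hq : ∀ j (x y : 𝓗), inner ℂ (L.q j t x) y = inner ℂ x (K.s j t y) := fun j x y => by
    rw [← h.q, ContinuousLinearMap.adjoint_inner_right]
  simp only [jetForm, map_add, map_mul, map_sum, map_sub, inner_conj_symm, hp, hs, hq, map_div₀,
    Complex.conj_I, Complex.conj_ofNat]
  congr 1
  rw [Finset.mul_sum, Finset.mul_sum]
  refine Finset.sum_congr rfl fun j _ => ?_
  ring

/-- The form of an expression as a sesquilinear map on jets. -/
def jetSesq (L : OpExpr 𝓗) (N : ℕ) (t : ℝ) : (ℕ → 𝓗) →ₗ⋆[ℂ] (ℕ → 𝓗) →ₗ[ℂ] ℂ :=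
  LinearMap.mk₂'ₛₗ (starRingEnd ℂ) (RingHom.id ℂ) (fun v u => L.jetForm N t u v)
    (fun _ _ _ => L.jetForm_add_right N t _ _ _) (fun _ _ _ => L.jetForm_smul_right N t _ _ _)
    (fun _ _ _ => L.jetForm_add_left N t _ _ _) (fun _ _ _ => L.jetForm_smul_left N t _ _ _)

theorem jetSesq_apply (L : OpExpr 𝓗) (N : ℕ) (t : ℝ) (u v : ℕ → 𝓗) :
    L.jetSesq N t v u = L.jetForm N t u v := rfl

theorem jetForm_single_right {L : OpExpr 𝓗} {r : ℕ} (hL : L.IsOfOrder r) (t : ℝ) (u : ℕ → 𝓗)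
    {k : ℕ} (x : 𝓗) :
    L.jetForm r t u (Pi.single k x) = inner ℂ x (L.coef k t u) := by
  rw [jetForm_eq_sum hL (le_max_left _ k) t, Finset.sum_eq_single k]
  · rw [Pi.single_eq_same]
  · intro j _ hj
    rw [Pi.single_eq_of_ne hj, inner_zero_left]
  · intro hk
    exact absurd (Finset.mem_range.2 (Nat.lt_succ_of_le (le_max_right _ _))) hk

theorem coef_single_succ (L : OpExpr 𝓗) (k : ℕ) (t : ℝ) (x : 𝓗) :
    L.coef k t (Pi.single (k + 1) x) = (Complex.I / 2) • L.s (k + 1) t x := by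
  simp [coef, Pi.single_apply, show k - 1 ≠ k + 1 by omega]

theorem continuousOn_opH {L : OpExpr 𝓗} {I : Set ℝ} {r : ℕ} [CompleteSpace 𝓗]
    (hs : L.IsSmoothOn I) (hu : Even r → ∀ t ∈ I, IsUnit (L.p (r / 2) t)) :
    ContinuousOn (L.opH r) I := by
  refine continuousOn_blockOp fun i _ j _ => ?_
  have hp : ∀ j, ContinuousOn (fun t => L.p j t) I := fun j => (hs.p_smooth j).continuousOn
  have hq : ∀ j, ContinuousOn (fun t => L.q j t) I := fun j => (hs.q_smooth j).continuousOn
  have hss : ∀ j, ContinuousOn (fun t => L.s j t) I := fun j => (hs.s_smooth j).continuousOn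
  unfold entryH
  by_cases he : Even r
  · have hi : ContinuousOn (fun t => Ring.inverse (L.p (r / 2) t)) I :=
      (ContDiffOn.ringInverse (k := 0) ((hs.p_smooth _).of_le (by simp)) (hu he)).continuousOn
    simp only [he, if_true, entryHEven]
    split_ifs <;> fun_prop
  · simp only [he, if_false, entryHOdd]
    split_ifs <;> fun_prop

theorem differentiableAt_opH {l : ℂ → OpExpr 𝓗} {r : ℕ} {t : ℝ} [CompleteSpace 𝓗] {z : ℂ}
    (hp : ∀ j, DifferentiableAt ℂ (fun z => (l z).p j t) z)
    (hq : ∀ j, DifferentiableAt ℂ (fun z => (l z).q j t) z)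
    (hss : ∀ j, DifferentiableAt ℂ (fun z => (l z).s j t) z)
    (hu : Even r → IsUnit ((l z).p (r / 2) t)) :
    DifferentiableAt ℂ (fun z => (l z).opH r t) z := by
  refine differentiableAt_blockOp fun i _ j _ => ?_
  unfold entryH
  by_cases he : Even r
  · have hi : DifferentiableAt ℂ (fun z => Ring.inverse ((l z).p (r / 2) t)) z :=
      DifferentiableAt.comp (g := Ring.inverse) (f := fun z => (l z).p (r / 2) t) z
        (differentiableAt_inverse (𝕜 := ℂ) (hu he)) (hp _)
    simp only [he, if_true, entryHEven]
    split_ifs <;> fun_prop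
  · simp only [he, if_false, entryHOdd]
    split_ifs <;> fun_prop

end OpExpr

/-! ### The family `l_λ`: domination by the density and independence of `Q` -/

namespace NevanlinnaExprPair

variable {𝓗 : Type*} [NormedAddCommGroup 𝓗] [InnerProductSpace ℂ 𝓗] [CompleteSpace 𝓗]
variable (D : NevanlinnaExprPair 𝓗)

theorem conj_mem {z : ℂ} (hz : z ∈ D.dom) : conj z ∈ D.dom := by
  rcases eq_or_ne z.im 0 with h | h
  · rwa [Complex.conj_eq_iff_im.2 h]
  · exact D.nonreal_mem _ (by simpa using h)

theorem isAdjointAt {z : ℂ} (hz : z ∈ D.dom) {t : ℝ} (ht : t ∈ D.ivl) :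
    (D.l z).IsAdjointAt (D.l (conj z)) t where
  p j := by rw [(D.l_symm z hz t ht j).1, ContinuousLinearMap.adjoint_adjoint]
  q j := by rw [(D.l_symm z hz t ht j).2, ContinuousLinearMap.adjoint_adjoint]
  s j := by rw [(D.l_symm _ (D.conj_mem hz) t ht j).2, Complex.conj_conj]

theorem isAdjointAt_conj {z : ℂ} (hz : z ∈ D.dom) {t : ℝ} (ht : t ∈ D.ivl) :
    (D.l (conj z)).IsAdjointAt (D.l z) t := (D.isAdjointAt hz ht).symm

theorem differentiableOn_jetForm {U : Set ℂ} {t : ℝ}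
    (h : ∀ j : ℕ, DifferentiableOn ℂ (fun z => (D.l z).p j t) U ∧
      DifferentiableOn ℂ (fun z => (D.l z).q j t) U ∧
      DifferentiableOn ℂ (fun z => (D.l z).s j t) U) (u v : ℕ → 𝓗) :
    DifferentiableOn ℂ (fun z => (D.l z).jetForm D.r t u v) U := by
  have hi : ∀ (A : ℂ → 𝓗 →L[ℂ] 𝓗) (x y : 𝓗), DifferentiableOn ℂ A U →
      DifferentiableOn ℂ (fun z => (inner ℂ y (A z x) : ℂ)) U := fun A x y hA =>
    (innerSL ℂ y).differentiable.comp_differentiableOn (hA.clm_apply (differentiableOn_const x))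
  unfold OpExpr.jetForm
  refine DifferentiableOn.add (DifferentiableOn.fun_sum fun j _ => hi _ _ _ (h j).1)
    (DifferentiableOn.const_mul (DifferentiableOn.fun_sum fun j _ =>
      (hi _ _ _ (h _).2.2).sub (hi _ _ _ (h _).2.1)) _)

/-- The functions `z ↦ -l_z{u, u}`, indexed by the points of `[a, b]` and the jets `u`. -/
def negForm (i : D.ivl × (ℕ → 𝓗)) (z : ℂ) : ℂ := -(D.l z).jetForm D.r i.1 i.2 i.2

/-- Points and jets serve together as the index. This is where the neighbourhoods of analyticity
independent of `t` are needed: they make the comparison constants uniform on `[a, b]`. -/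
theorem isNevFamily_negForm : IsNevFamily D.dom D.negForm where
  nonreal_mem := D.nonreal_mem
  analytic μ hμ := by
    obtain ⟨U, hU, hm, h⟩ := D.l_analytic μ hμ
    exact ⟨U, hU, hm, fun i => (D.differentiableOn_jetForm (h i.1 i.1.2) _ _).neg⟩
  nonneg z hz i := by
    rw [negForm, Complex.neg_im]
    exact (D.m_nonneg i.1 i.1.2 i.2).trans (D.m_le z hz i.1 i.1.2 i.2)
  symm z hz i := by
    rw [negForm, negForm, map_neg, (D.isAdjointAt hz i.1.2).jetForm_conj]

/-- The quadratic form `-Im l_z / Im z` (for real `z`, the form of `-∂l_z/∂z`) on jets. -/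
def nevDens (z : ℂ) (t : ℝ) (u : ℕ → 𝓗) : ℝ :=
  nevRatio (fun w => -(D.l w).jetForm D.r t u u) z

theorem nevForm_eq (z : ℂ) (y : ℝ → 𝓗) (t : ℝ) :
    D.nevForm z y t = D.nevDens z t (OpExpr.jet D.ivl y t) := by
  unfold nevForm nevDens nevRatio
  split_ifs
  · rw [deriv.fun_neg, Complex.neg_re]
    rfl
  · rfl

theorem nevDens_eq {z : ℂ} (hz : z.im ≠ 0) (t : ℝ) (u : ℕ → 𝓗) :
    D.nevDens z t u = -((D.l z).jetForm D.r t u u).im / z.im := by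
  rw [nevDens, nevRatio_of_im_ne_zero hz, Complex.neg_im]

theorem nevDens_nonneg {z : ℂ} (hz : z.im ≠ 0) {t : ℝ} (ht : t ∈ D.ivl) (u : ℕ → 𝓗) :
    0 ≤ D.nevDens z t u :=
  D.isNevFamily_negForm.nevRatio_nonneg hz (⟨t, ht⟩, u)

theorem nevDens_le {w z : ℂ} (hw : w ∈ D.dom) (hz : z.im ≠ 0) :
    ∃ C, 0 ≤ C ∧ ∀ t ∈ D.ivl, ∀ u, D.nevDens w t u ≤ C * D.nevDens z t u := by
  obtain ⟨C, hC, h⟩ := D.isNevFamily_negForm.compare hw hz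
  exact ⟨C, hC, fun t ht u => (h (⟨t, ht⟩, u)).1⟩

theorem re_jetSesq {z : ℂ} (hz : z.im ≠ 0) (t : ℝ) (u : ℕ → 𝓗) :
    (((Complex.I / z.im) • (D.l z).jetSesq D.r t) u u).re = D.nevDens z t u := by
  rw [D.nevDens_eq hz, LinearMap.smul_apply, LinearMap.smul_apply, OpExpr.jetSesq_apply,
    smul_eq_mul, div_mul_eq_mul_div, Complex.div_ofReal_re, Complex.I_mul_re]

/-- The difference of two expressions of the family is dominated by the form of `-Im l_z / Im z`. -/
theorem norm_sq_sub_jetForm_le {w z : ℂ} (hw : w ∈ D.dom) (hz : z.im ≠ 0) :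
    ∃ C, 0 ≤ C ∧ ∀ t ∈ D.ivl, ∀ u v, ‖(D.l w - D.l z).jetForm D.r t u v‖ ^ 2
      ≤ C * (D.nevDens z t u * D.nevDens z t v) := by
  obtain ⟨C, hC, h⟩ := D.isNevFamily_negForm.compare hw hz
  refine ⟨4 * C ^ 2, by positivity, fun t ht u v => ?_⟩
  have := norm_sq_le_of_norm_diag_le ((D.l w - D.l z).jetSesq D.r t)
    ((Complex.I / z.im) • (D.l z).jetSesq D.r t) hC
    (fun u => by rw [D.re_jetSesq hz]; exact D.nevDens_nonneg hz ht u)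
    (fun u => by
      rw [D.re_jetSesq hz, OpExpr.jetSesq_apply, OpExpr.sub_jetForm]
      have := (h (⟨t, ht⟩, u)).2
      simp only [negForm] at this
      rwa [neg_sub_neg] at this) v u
  rw [D.re_jetSesq hz, D.re_jetSesq hz, OpExpr.jetSesq_apply] at this
  rwa [mul_comm (D.nevDens z t u)]

/-- The form of `l_w - l_z` is dominated by the density at `z`, which vanishes on a jet concentrated
at the index `n + 1`. Tested against jets concentrated at `n`, the difference of the coefficients
`s_{n+1}` must vanish. -/
theorem s_top_eq {w z : ℂ} (hw : w ∈ D.dom) (hz : z.im ≠ 0) {t : ℝ} (ht : t ∈ D.ivl) :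
    (D.l w).s (D.r / 2 + 1) t = (D.l z).s (D.r / 2 + 1) t := by
  have ow := D.l_order w hw
  have oz := D.l_order z (D.nonreal_mem z hz)
  obtain ⟨C, _, h⟩ := D.norm_sq_sub_jetForm_le hw hz
  ext x
  refine ext_inner_left ℂ fun y => ?_
  have h1 := h t ht (Pi.single (D.r / 2 + 1) x) (Pi.single (D.r / 2) y)
  have h0 : D.nevDens z t (Pi.single (D.r / 2 + 1) x) = 0 := by
    have hp : (D.l z).p (D.r / 2 + 1) = 0 := oz.p_eq_zero _ (by omega)
    have hq : (D.l z).s (D.r / 2 + 1 + 1) = 0 := oz.s_eq_zero _ (by omega)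
    rw [D.nevDens_eq hz, OpExpr.jetForm_single_right oz]
    simp [OpExpr.coef, hp, hq]
  rw [h0, zero_mul, mul_zero, OpExpr.jetForm_single_right (ow.sub oz),
    OpExpr.coef_single_succ] at h1
  have h2 : (inner ℂ y ((Complex.I / 2) • (D.l w - D.l z).s (D.r / 2 + 1) t x) : ℂ) = 0 :=
    norm_eq_zero.1 (pow_eq_zero_iff two_ne_zero |>.1 (le_antisymm h1 (sq_nonneg _)))
  rw [inner_smul_right, mul_eq_zero, or_iff_right (by simp),
    show (D.l w - D.l z).s (D.r / 2 + 1) t x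
      = (D.l w).s (D.r / 2 + 1) t x - (D.l z).s (D.r / 2 + 1) t x from rfl, inner_sub_right,
    sub_eq_zero] at h2
  exact h2

theorem I_im_ne_zero : Complex.I.im ≠ 0 := by simp

theorem adjoint_q_top {z : ℂ} (hz : z ∈ D.dom) {t : ℝ} (ht : t ∈ D.ivl) :
    ContinuousLinearMap.adjoint ((D.l z).q (D.r / 2 + 1) t) = (D.l z).s (D.r / 2 + 1) t := by
  rw [(D.isAdjointAt hz ht).q, D.s_top_eq (D.conj_mem hz) I_im_ne_zero ht,
    D.s_top_eq hz I_im_ne_zero ht]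

theorem q_top_eq {w z : ℂ} (hw : w ∈ D.dom) (hz : z.im ≠ 0) {t : ℝ} (ht : t ∈ D.ivl) :
    (D.l w).q (D.r / 2 + 1) t = (D.l z).q (D.r / 2 + 1) t := by
  apply ContinuousLinearMap.adjoint.injective
  rw [D.adjoint_q_top hw ht, D.adjoint_q_top (D.nonreal_mem z hz) ht, D.s_top_eq hw hz ht]

theorem isRegular {z : ℂ} (hz : z ∈ D.dom) : (D.l z).IsRegular D.ivl D.r where
  order := D.l_order z hz
  smooth := D.l_smooth z hz
  unit_even h := D.l_unit_even h z hz
  unit_odd h := D.l_unit_odd h z hz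
  adjoint_q _ ht := D.adjoint_q_top hz ht

theorem Q_eq {w z : ℂ} (hw : w ∈ D.dom) (hz : z.im ≠ 0) {t : ℝ} (ht : t ∈ D.ivl) :
    D.Q w t = D.Q z t := by
  rw [Q, Q, OpExpr.opQ_eq_cornerOp, OpExpr.opQ_eq_cornerOp, D.q_top_eq hw hz ht]

theorem contDiffOn_Q {z : ℂ} (hz : z ∈ D.dom) : ContDiffOn ℝ 1 (D.Q z) D.ivl :=
  OpExpr.contDiffOn_opQ (((D.l_smooth z hz).q_smooth _).of_le (by norm_cast; omega))

theorem isUnit_opRe_Q {z : ℂ} (hz : z ∈ D.dom) {t : ℝ} (ht : t ∈ D.ivl) :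
    IsUnit (opRe (D.Q z t)) := by
  rw [Q, OpExpr.opQ_eq_cornerOp, opRe_cornerOp]
  refine isUnit_cornerOp fun h => ?_
  rw [opRe, D.adjoint_q_top hz ht]
  exact (D.l_unit_odd h z hz t ht).smul (Units.mk0 (1 / 2 : ℂ) (by norm_num))

theorem continuousOn_H {z : ℂ} (hz : z ∈ D.dom) : ContinuousOn (D.H z) D.ivl :=
  OpExpr.continuousOn_opH (D.l_smooth z hz) fun h => D.l_unit_even h z hz

theorem differentiableAt_H {z : ℂ} (hz : z ∈ D.dom) {t : ℝ} (ht : t ∈ D.ivl) :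
    DifferentiableAt ℂ (fun z => D.H z t) z := by
  obtain ⟨U, hU, hm, h⟩ := D.l_analytic z hz
  exact OpExpr.differentiableAt_opH
    (fun j => (h t ht j).1.differentiableAt (hU.mem_nhds hm))
    (fun j => (h t ht j).2.1.differentiableAt (hU.mem_nhds hm))
    (fun j => (h t ht j).2.2.differentiableAt (hU.mem_nhds hm))
    fun he => D.l_unit_even he z hz t ht

theorem adjoint_H {z : ℂ} (hz : z ∈ D.dom) {t : ℝ} (ht : t ∈ D.ivl) :
    ContinuousLinearMap.adjoint (D.H z t) = D.H (conj z) t :=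
  OpExpr.adjoint_opH (D.isAdjointAt hz ht) D.r

theorem inner_H_sub {w z : ℂ} (hw : w ∈ D.dom) (hz : z ∈ D.dom) {t : ℝ} (ht : t ∈ D.ivl)
    (x' x : HilbertPow 𝓗 D.r) :
    (inner ℂ x' (D.H w t x) : ℂ) - inner ℂ x' (D.H (conj z) t x)
      = -(D.l w - D.l (conj z)).jetForm D.r t ((D.l w).jetVec D.r t x)
        ((D.l z).jetVec D.r t x') :=
  OpExpr.inner_opH_sub D.r_pos (D.l_order w hw) (D.l_order _ (D.conj_mem hz))
    (D.isAdjointAt_conj hz ht) (fun h => D.l_unit_even h w hw t ht)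
    (fun h => D.l_unit_even h _ (D.conj_mem hz) t ht) x' x

/-- The difference of the Hamiltonians at `z` and `conj z` is minus the form of `l_z - l_{conj z}`
on jets, and here both jets are recovered through `l_z`. So `Im H` is represented by `-Im l_z`. -/
theorem inner_weight {z : ℂ} (hz : z.im ≠ 0) {t : ℝ} (ht : t ∈ D.ivl)
    (x : HilbertPow 𝓗 D.r) :
    (inner ℂ x (D.weight z t x) : ℂ) = (D.nevDens z t ((D.l z).jetVec D.r t x) : ℂ) := by
  have hd := D.nonreal_mem z hz
  have e := D.inner_H_sub hd hd ht x x
  have h1 : D.weight z t x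
      = ((z.im : ℂ)⁻¹ * (1 / (2 * Complex.I))) • (D.H z t x - D.H (conj z) t x) := by
    rw [weight, opIm, D.adjoint_H hd ht, smul_smul]
    rfl
  rw [h1, inner_smul_right, inner_sub_right, e, OpExpr.sub_jetForm,
    ← (D.isAdjointAt hd ht).jetForm_conj, Complex.sub_conj, D.nevDens_eq hz]
  push_cast
  field_simp

end NevanlinnaExprPair

/-! ### Perturbation of systems; the operator solutions `X_λ` -/

section Systems

variable {E : Type*} [NormedAddCommGroup E] [InnerProductSpace ℂ E] [CompleteSpace E] {a b : ℝ}
  {Q H X Y : ℝ → E →L[ℂ] E}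

theorem IsFund.congr {Q₂ H₂ : ℝ → E →L[ℂ] E} (h : IsFund a b Q H X) (hQ : EqOn Q Q₂ (Icc a b))
    (hH : EqOn H H₂ (Icc a b)) : IsFund a b Q₂ H₂ X where
  smooth := h.smooth
  initial := h.initial
  equation t ht := by
    have := h.equation t ht
    rw [hQ ht, hH ht, derivWithin_congr (f := fun τ => Q₂ τ * X τ)
      (fun τ hτ => by simp only [hQ hτ]) (by simp only [hQ ht])] at this
    exact this

theorem exists_isFund (hab : a < b) (h0 : (0 : ℝ) ∈ Icc a b) (hQ : ContDiffOn ℝ 1 Q (Icc a b))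
    (hu : ∀ t ∈ Icc a b, IsUnit (opRe (Q t))) (hH : ContinuousOn H (Icc a b)) :
    ∃ X, IsFund a b Q H X :=
  ⟨_, isFund_odeSol hab h0 hQ hu
    ⟨_, continuousOn_iff_continuous_domRestrict.1 (continuousOn_sysCoef hab hQ hu hH)⟩ fun _ => rfl⟩

theorem exists_norm_le_of_continuousOn {F : Type*} [NormedAddCommGroup F] {f : ℝ → F}
    (hf : ContinuousOn f (Icc a b)) : ∃ C, 0 ≤ C ∧ ∀ t ∈ Icc a b, ‖f t‖ ≤ C := by
  obtain ⟨C, hC⟩ := isCompact_Icc.exists_bound_of_continuousOn hf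
  exact ⟨max C 0, le_max_right _ _, fun t ht => (hC t ht).trans (le_max_left _ _)⟩

namespace IsFundPair

theorem continuousOn_left (h : IsFundPair a b Q H X Y) : ContinuousOn X (Icc a b) :=
  h.fund.smooth.continuousOn

theorem continuousOn_right (h : IsFundPair a b Q H X Y) : ContinuousOn Y (Icc a b) :=
  h.fund_adj.smooth.continuousOn

theorem continuousOn_adjoint (h : IsFundPair a b Q H X Y) :
    ContinuousOn (fun s => ContinuousLinearMap.adjoint (Y s)) (Icc a b) :=
  ContinuousLinearMap.adjoint.continuous.comp_continuousOn h.continuousOn_right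

theorem norm_integral_adjoint_le (h : IsFundPair a b Q H X Y) : ∃ C, 0 ≤ C ∧ ∀ g : ℝ → E,
    ContinuousOn g (Icc a b) → ∀ t ∈ Icc a b,
      ‖∫ s in a..t, ContinuousLinearMap.adjoint (Y s) (g s)‖ ≤ C * ∫ s in a..b, ‖g s‖ := by
  obtain ⟨C, hC, hY⟩ := exists_norm_le_of_continuousOn h.continuousOn_adjoint
  refine ⟨C, hC, fun g hg t ht => ?_⟩
  have hint : IntervalIntegrable (fun s => ‖g s‖) volume a b := by
    refine ContinuousOn.intervalIntegrable ?_
    rw [uIcc_of_le h.lt.le]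
    exact hg.norm
  have hint' : IntervalIntegrable (fun s => C * ‖g s‖) volume a t :=
    (hint.mono_set (by rw [uIcc_of_le h.lt.le, uIcc_of_le ht.1]; exact Icc_subset_Icc_right ht.2)).const_mul C
  calc _ ≤ ∫ s in a..t, C * ‖g s‖ :=
        intervalIntegral.norm_integral_le_of_norm_le ht.1 (.of_forall fun s hs =>
          ((ContinuousLinearMap.adjoint (Y s)).le_opNorm _).trans (mul_le_mul_of_nonneg_right
            (hY s ⟨hs.1.le, hs.2.trans ht.2⟩) (norm_nonneg _))) hint'
    _ ≤ ∫ s in a..b, C * ‖g s‖ :=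
        intervalIntegral.integral_mono_interval le_rfl ht.1 ht.2
          (.of_forall fun s => by positivity) (hint.const_mul C)
    _ = _ := intervalIntegral.integral_const_mul _ _

/-- The dependence of the solutions on a perturbation of the system. -/
theorem exists_norm_sub_le (h : IsFundPair a b Q H X Y) : ∃ C, 0 ≤ C ∧ ∀ (g x x' : ℝ → E),
    ContinuousOn g (Icc a b) → (∀ t ∈ Icc a b, HasDerivWithinAt x (x' t) (Icc a b) t) →
    (∀ t ∈ Icc a b, sysLHS (Q t) (derivWithin Q (Icc a b) t) (H t) (x t) (x' t) = g t) →
    ∀ t ∈ Icc a b, ‖x t - X t (x 0)‖ ≤ C * ∫ s in a..b, ‖g s‖ := by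
  obtain ⟨C₁, hC₁, h₁⟩ := exists_norm_le_of_continuousOn h.continuousOn_left
  obtain ⟨C₂, hC₂, h₂⟩ := h.norm_integral_adjoint_le
  set J := Ring.inverse (Complex.I • opRe (Q 0)) with hJ
  refine ⟨2 * (C₁ * (‖J‖ * C₂)), by positivity, fun g x x' hg hx ex t ht => ?_⟩
  set e : ℝ → E := fun t => X t (0 + J (∫ s in a..t, ContinuousLinearMap.adjoint (Y s) (g s)))
    with he
  obtain ⟨e', de, ee⟩ := h.variation hg 0 (x := e) fun t _ => rfl
  have key := h.eq_apply_zero (x := fun t => x t - e t) (x' := fun t => x' t - e' t)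
    (fun t ht => (hx t ht).sub (de t ht))
    (fun t ht => by rw [sysLHS_sub, ex t ht, ee t ht, sub_self]) ht
  have hb : ∀ t ∈ Icc a b, ‖0 + J (∫ s in a..t, ContinuousLinearMap.adjoint (Y s) (g s))‖
      ≤ ‖J‖ * (C₂ * ∫ s in a..b, ‖g s‖) := fun t ht => by
    rw [zero_add]
    exact (J.le_opNorm _).trans (mul_le_mul_of_nonneg_left (h₂ g hg t ht) (norm_nonneg _))
  have h0 : 0 ≤ ‖J‖ * (C₂ * ∫ s in a..b, ‖g s‖) := (norm_nonneg _).trans (hb t ht)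
  have hX : ∀ v : E, ‖v‖ ≤ ‖J‖ * (C₂ * ∫ s in a..b, ‖g s‖) →
      ‖X t v‖ ≤ C₁ * (‖J‖ * (C₂ * ∫ s in a..b, ‖g s‖)) := fun v hv =>
    ((X t).le_opNorm v).trans (mul_le_mul (h₁ t ht) hv (norm_nonneg _) hC₁)
  have e0 : e 0 = 0 + J (∫ s in a..0, ContinuousLinearMap.adjoint (Y s) (g s)) := by
    rw [he]
    simp only [h.fund.initial, one_apply_eq_self]
  have : x t - X t (x 0) = e t - X t (e 0) := by
    have key' : x t - e t = X t (x 0 - e 0) := key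
    rw [map_sub] at key'
    rw [sub_eq_sub_iff_sub_eq_sub, key']
  rw [this]
  calc _ ≤ ‖e t‖ + ‖X t (e 0)‖ := norm_sub_le _ _
    _ ≤ C₁ * (‖J‖ * (C₂ * ∫ s in a..b, ‖g s‖)) + C₁ * (‖J‖ * (C₂ * ∫ s in a..b, ‖g s‖)) :=
        add_le_add (hX _ (hb t ht)) (hX _ (by rw [e0]; exact hb 0 h.zero_mem))
    _ = _ := by ring

end IsFundPair

end Systems

namespace OpExpr

variable {𝓗 : Type*} [NormedAddCommGroup 𝓗] [InnerProductSpace ℂ 𝓗] [CompleteSpace 𝓗]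

theorem continuousOn_opW {L m : OpExpr 𝓗} {I : Set ℝ} {r : ℕ}
    (hs : L.IsSmoothOn I) (hu : Even r → ∀ t ∈ I, IsUnit (L.p (r / 2) t)) (hm : m.IsSmoothOn I) :
    ContinuousOn (L.opW m r) I := by
  refine continuousOn_blockOp fun i _ j _ => ?_
  have hp : ∀ j, ContinuousOn (fun t => m.p j t) I := fun j => (hm.p_smooth j).continuousOn
  have hq : ∀ j, ContinuousOn (fun t => m.q j t) I := fun j => (hm.q_smooth j).continuousOn
  have hss : ∀ j, ContinuousOn (fun t => m.s j t) I := fun j => (hm.s_smooth j).continuousOn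
  have hJ : ∀ k j, ContinuousOn (fun t => L.entryJet r t k j) I := fun k j => by
    have hq : ∀ j, ContinuousOn (fun t => L.q j t) I := fun j => (hs.q_smooth j).continuousOn
    unfold entryJet
    by_cases he : Even r
    · have hi : ContinuousOn (fun t => Ring.inverse (L.p (r / 2) t)) I :=
        (ContDiffOn.ringInverse (k := 0) ((hs.p_smooth _).of_le (by simp)) (hu he)).continuousOn
      simp only [he, if_true]
      split_ifs <;> fun_prop
    · simp only [he, if_false]
      split_ifs <;> fun_prop
  have hF : ∀ k l, ContinuousOn (fun t => m.entryForm t k l) I := fun k l => by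
    unfold entryForm
    split_ifs <;> fun_prop
  exact continuousOn_finsetSum _ fun k _ => continuousOn_finsetSum _ fun l _ =>
    ((ContinuousLinearMap.adjoint.continuous.comp_continuousOn (hJ k i)).mul (hF k l)).mul (hJ l j)

end OpExpr

namespace NevanlinnaExprPair

variable {𝓗 : Type*} [NormedAddCommGroup 𝓗] [InnerProductSpace ℂ 𝓗] [CompleteSpace 𝓗]
variable (D : NevanlinnaExprPair 𝓗)

set_option maxHeartbeats 1000000 in
theorem isFundSol_iff (z : ℂ) (X : ℝ → D.Op) :
    D.IsFundSol z X ↔ IsFund D.a D.b (D.Q z) (D.H z) X :=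
  ⟨fun h => ⟨h.smooth, h.initial, h.equation⟩, fun h => ⟨h.smooth, h.initial, h.equation⟩⟩

theorem isFund_X {z : ℂ} (hz : z ∈ D.dom) : IsFund D.a D.b (D.Q z) (D.H z) (D.X z) := by
  have h := exists_isFund D.a_lt_b D.zero_mem (D.contDiffOn_Q hz)
    (fun t ht => D.isUnit_opRe_Q hz ht) (D.continuousOn_H hz)
  rw [← isFundSol_iff]
  exact Classical.epsilon_spec (h.imp fun X hX => (D.isFundSol_iff z X).2 hX)

theorem Q_eq_I {z : ℂ} (hz : z ∈ D.dom) : EqOn (D.Q z) (D.Q Complex.I) D.ivl := fun _ ht =>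
  D.Q_eq hz I_im_ne_zero ht

/-- `Q` is the same at `z` and `conj z`, and `H_z* = H_{conj z}`; hence `X_{conj z}` is the
fundamental solution of the adjoint system. -/
theorem isFundPair {z : ℂ} (hz : z ∈ D.dom) :
    IsFundPair D.a D.b (D.Q z) (D.H z) (D.X z) (D.X (conj z)) :=
  ⟨D.a_lt_b, D.zero_mem, D.contDiffOn_Q hz, fun _ ht => D.isUnit_opRe_Q hz ht, D.isFund_X hz,
    (D.isFund_X (D.conj_mem hz)).congr
      (fun _ ht => (D.Q_eq_I (D.conj_mem hz) ht).trans (D.Q_eq_I hz ht).symm)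
      fun _ ht => (D.adjoint_H hz ht).symm⟩

end NevanlinnaExprPair

section Auxiliary

variable {E : Type*} [NormedAddCommGroup E] [InnerProductSpace ℂ E] [CompleteSpace E] {a b : ℝ}

theorem continuousOn_inv_smul_opIm {H : ℝ → E →L[ℂ] E} {I : Set ℝ} (hH : ContinuousOn H I)
    (c : ℂ) : ContinuousOn (fun t => c • opIm (H t)) I :=
  ((hH.sub (ContinuousLinearMap.adjoint.continuous.comp_continuousOn hH)).const_smul
    (1 / (2 * Complex.I))).const_smul c

theorem continuousOn_inner_apply_self {W X : ℝ → E →L[ℂ] E} {I : Set ℝ} (hW : ContinuousOn W I)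
    (hX : ContinuousOn X I) (u : E) :
    ContinuousOn (fun t => (inner ℂ (X t u) (W t (X t u)) : ℂ).re) I :=
  Complex.continuous_re.comp_continuousOn ((hX.clm_apply continuousOn_const).inner (𝕜 := ℂ)
    (hW.clm_apply (hX.clm_apply continuousOn_const)))

theorem sysLHS_sub_coef (Q Q' H K : E →L[ℂ] E) (x x' : E) :
    sysLHS Q Q' K x x' = sysLHS Q Q' H x x' + (H x - K x) := by
  unfold sysLHS
  abel

theorem continuousOn_sub_apply {H K X : ℝ → E →L[ℂ] E} {I : Set ℝ} (hH : ContinuousOn H I)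
    (hK : ContinuousOn K I) (hX : ContinuousOn X I) (u : E) :
    ContinuousOn (fun t => H t (X t u) - K t (X t u)) I :=
  (hH.clm_apply (hX.clm_apply continuousOn_const)).sub
    (hK.clm_apply (hX.clm_apply continuousOn_const))

/-- A form of the Cauchy–Schwarz inequality with an immaterial factor 4: integrate `‖g‖ ≤ τ +
‖g‖²/τ` and optimise over `τ`. -/
theorem sq_integral_norm_le {g : ℝ → E} (hab : a ≤ b) (hg : ContinuousOn g (Icc a b)) :
    (∫ s in a..b, ‖g s‖) ^ 2 ≤ 4 * (b - a) * ∫ s in a..b, ‖g s‖ ^ 2 := by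
  rw [← uIcc_of_le hab] at hg
  have h1 : IntervalIntegrable (fun s => ‖g s‖) volume a b := hg.norm.intervalIntegrable
  have h2 : IntervalIntegrable (fun s => ‖g s‖ ^ 2) volume a b :=
    (hg.norm.pow 2).intervalIntegrable
  refine sq_le_of_forall_pos_le (sub_nonneg.2 hab)
    (intervalIntegral.integral_nonneg hab fun s _ => by positivity)
    (intervalIntegral.integral_nonneg hab fun s _ => norm_nonneg _) fun τ hτ => ?_
  have : ∫ s in a..b, ‖g s‖ ≤ ∫ s in a..b, (τ + ‖g s‖ ^ 2 / τ) := by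
    refine intervalIntegral.integral_mono_on hab h1
      (intervalIntegrable_const.add (h2.div_const τ)) fun s _ => ?_
    rw [← sub_nonneg]
    have e : τ + ‖g s‖ ^ 2 / τ - ‖g s‖ = ((τ - ‖g s‖ / 2) ^ 2 + 3 / 4 * ‖g s‖ ^ 2) / τ := by
      field_simp
      ring
    rw [e]
    positivity
  rwa [intervalIntegral.integral_add intervalIntegrable_const (h2.div_const τ),
    intervalIntegral.integral_const, intervalIntegral.integral_div, smul_eq_mul,
    mul_comm (b - a)] at this

end Auxiliary

namespace OpExpr

variable {𝓗 : Type*} [NormedAddCommGroup 𝓗] [InnerProductSpace ℂ 𝓗]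

theorem iteratedDerivWithin_zero_fun (I : Set ℝ) (j : ℕ) :
    iteratedDerivWithin j (fun _ : ℝ => (0 : 𝓗)) I = fun _ => 0 := by
  induction j with
  | zero => exact iteratedDerivWithin_zero
  | succ j ih =>
    funext t
    rw [iteratedDerivWithin_succ, ih]
    simp

theorem jet_zero_fun (I : Set ℝ) (t : ℝ) : jet I (fun _ : ℝ => (0 : 𝓗)) t = 0 := by
  funext j
  rw [jet, iteratedDerivWithin_zero_fun]
  rfl

theorem apply_zero_fun (L : OpExpr 𝓗) (I : Set ℝ) (N : ℕ) (t : ℝ) :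
    L.apply I N (fun _ => 0) t = 0 := by
  simp [apply, iteratedDerivWithin_zero_fun]

theorem coef_zero (L : OpExpr 𝓗) (j : ℕ) (t : ℝ) : L.coef j t 0 = 0 := by
  simp [coef]

theorem opW_vecF_zero [CompleteSpace 𝓗] {K m : OpExpr 𝓗} {r s : ℕ} (hK : K.IsOfOrder r)
    (hm : m.IsOfOrder s) (hr : 0 < r) (hs : Even s) (hsr : s ≤ r) {t : ℝ}
    (hu : Even r → IsUnit (K.p (r / 2) t)) (I : Set ℝ) :
    K.opW m r t (K.vecF I r s (fun _ => 0) t) = 0 := by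
  refine ext_coord fun k hk => ?_
  rw [coord_opW hr hm.q_zero t _ hk, map_zero]
  refine Finset.sum_eq_zero fun j _ => ?_
  rw [coef_jetVec_vecF hK hm hr hs hsr hu, jet_zero_fun, coef_zero, smul_zero, map_zero]

theorem norm_firstOrderFactor (r : ℕ) : ‖firstOrderFactor r‖ = 1 := by
  unfold firstOrderFactor
  split_ifs <;> simp

theorem norm_coord_le (r k : ℕ) (x : HilbertPow 𝓗 r) : ‖coord r k x‖ ≤ ‖x‖ := by
  rcases lt_or_ge k r with h | h
  · rw [coord_apply h]
    exact PiLp.norm_apply_le x _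
  · rw [coord_eq_zero h]
    simp

/-- For solutions of `L[y] = 0` the vector of quasi-derivatives determines the jet. -/
theorem jetVec_vecY_zero [CompleteSpace 𝓗] {L m : OpExpr 𝓗} {I : Set ℝ} {r s : ℕ}
    (hL : L.IsRegular I r) (hm : m.IsOfOrder s) (hms : m.IsSmoothOn I) (hr : 0 < r) (hs : Even s)
    (hsr : s ≤ r) (hI : UniqueDiffOn ℝ I) {y : ℝ → 𝓗} (hy : ContDiffOn ℝ r y I) {t : ℝ}
    (ht : t ∈ I) (h : L.apply I r y t = 0) {k : ℕ} (hk : k ≤ r / 2) :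
    L.jetVec r t (L.vecY m I r s y (fun _ => 0) t) k = firstOrderFactor r • jet I y t k := by
  have h0 : L.quasiSeq I r y 0 t = m.quasiSeq I s (fun _ => 0) 0 t := by
    rw [← apply_eq_quasiSeq hL.order hL.smooth hI hy ht, h,
      ← apply_eq_quasiSeq hm hms hI contDiffOn_const ht, apply_zero_fun]
  have hq := isQuasiVec_vecY hL.order hm hr hs hsr h0
  rcases hk.lt_or_eq with hk | rfl
  · rw [hq.jetVec_lt hk, firstOrderFactor_of_pos (by omega), one_smul]
  · by_cases he : Even r
    · rw [hq.jetVec_even hL.order hr he (hL.unit_even he t ht), jet_zero_fun, coef_zero, map_zero,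
        sub_zero, firstOrderFactor_of_pos (by obtain ⟨c, rfl⟩ := he; omega), one_smul]
    · exact hq.jetVec_odd he

end OpExpr

/-! ### Comparison of densities and Hamiltonians for two parameters -/

namespace NevanlinnaExprPair

variable {𝓗 : Type*} [NormedAddCommGroup 𝓗] [InnerProductSpace ℂ 𝓗] [CompleteSpace 𝓗]
variable (D : NevanlinnaExprPair 𝓗)

/-- The parallelogram law, with the nonnegative density of `u - v` dropped. -/
theorem nevDens_add_le {z : ℂ} (hz : z.im ≠ 0) {t : ℝ} (ht : t ∈ D.ivl) (u v : ℕ → 𝓗) :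
    D.nevDens z t (u + v) ≤ 2 * D.nevDens z t u + 2 * D.nevDens z t v := by
  have h := D.nevDens_nonneg hz ht (u + (-1 : ℂ) • v)
  rw [← D.re_jetSesq hz] at h ⊢
  rw [← D.re_jetSesq hz t u, ← D.re_jetSesq hz t v]
  simp only [map_add, map_smul, LinearMap.add_apply, LinearMap.map_smulₛₗ, LinearMap.smul_apply,
    map_neg, map_one, smul_eq_mul, Complex.add_re, neg_mul, one_mul, Complex.neg_re, neg_neg,
    mul_neg, mul_add] at h ⊢
  linarith

theorem nevDens_smul {z : ℂ} (hz : z.im ≠ 0) (t : ℝ) {c : ℂ} (hc : ‖c‖ = 1) (u : ℕ → 𝓗) :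
    D.nevDens z t (c • u) = D.nevDens z t u := by
  rw [D.nevDens_eq hz, D.nevDens_eq hz, OpExpr.jetForm_smul_left, OpExpr.jetForm_smul_right,
    ← mul_assoc, Complex.mul_conj, Complex.normSq_eq_norm_sq, hc]
  simp

theorem nevDens_eq_zero {z : ℂ} (hz : z.im ≠ 0) (t : ℝ) {u : ℕ → 𝓗}
    (hu : ∀ k ≤ D.r / 2, u k = 0) : D.nevDens z t u = 0 := by
  have : (D.l z).jetForm D.r t u u = 0 := by
    unfold OpExpr.jetForm
    rw [Finset.sum_eq_zero, Finset.sum_eq_zero, mul_zero, add_zero]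
    · intro j hj
      rw [hu j (by have := Finset.mem_range.1 hj; omega)]
      simp
    · intro j hj
      rw [hu j (by have := Finset.mem_range.1 hj; omega)]
      simp
  rw [D.nevDens_eq hz, this]
  simp

theorem nevDens_congr_le {z : ℂ} (hz : z.im ≠ 0) {t : ℝ} (ht : t ∈ D.ivl) {u v : ℕ → 𝓗}
    (h : ∀ k ≤ D.r / 2, u k = v k) : D.nevDens z t u ≤ 2 * D.nevDens z t v := by
  have h1 := D.nevDens_add_le hz ht v (u - v)
  rw [D.nevDens_eq_zero hz t (u := u - v) fun k hk => sub_eq_zero.2 (h k hk)] at h1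
  simpa using h1

theorem continuousOn_weight {z : ℂ} (hz : z ∈ D.dom) : ContinuousOn (D.weight z) D.ivl :=
  continuousOn_inv_smul_opIm (D.continuousOn_H hz) _

/-- Putting `l_z` in the place of `m` in the weight formed with `l_w` gives an operator that
represents the form of `l_z` on jets recovered through `l_w`; it is continuous in `t`, hence
bounded. -/
theorem nevDens_jetVec_le {w z : ℂ} (hw : w ∈ D.dom) (hz : z.im ≠ 0) :
    ∃ C, 0 ≤ C ∧ ∀ t ∈ D.ivl, ∀ x,
      D.nevDens z t ((D.l w).jetVec D.r t x) ≤ C * ‖x‖ ^ 2 := by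
  have hd := D.nonreal_mem z hz
  obtain ⟨C, hC, h⟩ := exists_norm_le_of_continuousOn (OpExpr.continuousOn_opW (r := D.r)
    (D.l_smooth w hw) (fun h => D.l_unit_even h w hw) (D.l_smooth z hd))
  refine ⟨C / |z.im|, by positivity, fun t ht x => ?_⟩
  rw [D.nevDens_eq hz, ← OpExpr.inner_opW D.r_pos (D.l_order z hd)]
  refine (le_abs_self _).trans ?_
  rw [abs_div, abs_neg, div_mul_eq_mul_div]
  refine div_le_div_of_nonneg_right ((Complex.abs_im_le_norm _).trans
    ((norm_inner_le_norm _ _).trans ?_)) (abs_nonneg _)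
  have := mul_le_mul_of_nonneg_left ((((D.l w).opW (D.l z) D.r t).le_opNorm x).trans
    (mul_le_mul_of_nonneg_right (h t ht) (norm_nonneg _))) (norm_nonneg x)
  linarith

theorem nevDens_single_le {z : ℂ} (hz : z.im ≠ 0) :
    ∃ C, 0 ≤ C ∧ ∀ t ∈ D.ivl, ∀ v : 𝓗,
      D.nevDens z t (Pi.single (D.r / 2) v) ≤ C * ‖v‖ ^ 2 := by
  have hd := D.nonreal_mem z hz
  have ho := D.l_order z hd
  obtain ⟨C, hC, h⟩ := exists_norm_le_of_continuousOn ((D.l_smooth z hd).p_smooth (D.r / 2)).continuousOn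
  refine ⟨C / |z.im|, by positivity, fun t ht v => ?_⟩
  have hq0 : (D.l z).q 0 t = 0 := congrFun ho.q_zero t
  have : (D.l z).coef (D.r / 2) t (Pi.single (D.r / 2) v) = (D.l z).p (D.r / 2) t v := by
    rcases Nat.eq_zero_or_pos (D.r / 2) with h0 | h0
    · simp [OpExpr.coef, h0, hq0]
    · simp [OpExpr.coef, Pi.single_apply, show D.r / 2 - 1 ≠ D.r / 2 by omega]
  rw [D.nevDens_eq hz, OpExpr.jetForm_single_right ho, this]
  refine (le_abs_self _).trans ?_
  rw [abs_div, abs_neg, div_mul_eq_mul_div]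
  refine div_le_div_of_nonneg_right ((Complex.abs_im_le_norm _).trans
    ((norm_inner_le_norm _ _).trans ?_)) (abs_nonneg _)
  have := mul_le_mul_of_nonneg_left ((((D.l z).p (D.r / 2) t).le_opNorm v).trans
    (mul_le_mul_of_nonneg_right (h t ht) (norm_nonneg _))) (norm_nonneg v)
  linarith

/-- Test the difference with `v = (H_z - H_w) x` itself: `‖v‖⁴` is at most a constant times the
density of `x` times that of `v`, and the latter is bounded by `‖v‖²`. -/
theorem norm_sq_H_sub_le {w z : ℂ} (hw : w ∈ D.dom) (hz : z.im ≠ 0) :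
    ∃ C, 0 ≤ C ∧ ∀ t ∈ D.ivl, ∀ x, ‖D.H z t x - D.H w t x‖ ^ 2
      ≤ C * D.nevDens z t ((D.l z).jetVec D.r t x) := by
  have hd := D.nonreal_mem z hz
  obtain ⟨C₁, h₁, hC₁⟩ := D.norm_sq_sub_jetForm_le hw hz
  obtain ⟨C₂, h₂, hC₂⟩ := D.nevDens_jetVec_le (D.conj_mem hw) hz
  refine ⟨C₁ * C₂, by positivity, fun t ht x => ?_⟩
  set v := D.H z t x - D.H w t x with hv
  have e := D.inner_H_sub hd (D.conj_mem hw) ht v x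
  rw [Complex.conj_conj, ← inner_sub_right, ← hv] at e
  have e2 : ‖(inner ℂ v v : ℂ)‖ ^ 2 ≤ C₁ * (D.nevDens z t ((D.l z).jetVec D.r t x)
      * D.nevDens z t ((D.l (conj w)).jetVec D.r t v)) := by
    rw [e, norm_neg, OpExpr.sub_jetForm, norm_sub_rev, ← OpExpr.sub_jetForm]
    exact hC₁ t ht _ _
  have e3 := hC₂ t ht v
  have n0 := D.nevDens_nonneg hz ht ((D.l z).jetVec D.r t x)
  rw [inner_self_eq_norm_sq_to_K, norm_pow] at e2
  simp only [RCLike.norm_ofReal, abs_norm] at e2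
  rcases eq_or_ne v 0 with h0 | h0
  · rw [h0, norm_zero, zero_pow two_ne_zero]
    positivity
  · have hp : 0 < ‖v‖ ^ 2 := by positivity
    refine le_of_mul_le_mul_right ?_ hp
    calc ‖v‖ ^ 2 * ‖v‖ ^ 2 = (‖v‖ ^ 2) ^ 2 := by ring
      _ ≤ _ := e2
      _ ≤ C₁ * (D.nevDens z t ((D.l z).jetVec D.r t x) * (C₂ * ‖v‖ ^ 2)) := by gcongr
      _ = _ := by ring

/-- The jets recovered through `l_w` and `l_z` differ at most in the entry `n`, and for even `r` the
difference is a component of `(H_w - H_z) x`, which the density already controls. -/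
theorem nevDens_jetVec_le_add {w z : ℂ} (hw : w ∈ D.dom) (hz : z.im ≠ 0) :
    ∃ C, 0 ≤ C ∧ ∀ t ∈ D.ivl, ∀ x, D.nevDens z t ((D.l w).jetVec D.r t x)
      ≤ C * D.nevDens z t ((D.l z).jetVec D.r t x) := by
  obtain ⟨C₁, h₁, hC₁⟩ := D.nevDens_single_le hz
  obtain ⟨C₂, h₂, hC₂⟩ := D.norm_sq_H_sub_le hw hz
  refine ⟨2 + 2 * (C₁ * C₂), by positivity, fun t ht x => ?_⟩
  have n0 := D.nevDens_nonneg hz ht ((D.l z).jetVec D.r t x)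
  by_cases he : Even D.r
  · set v := coord D.r (D.r / 2 + (D.r / 2 - 1)) (D.H w t x - D.H z t x) with hv
    have hr : 0 < D.r / 2 := by obtain ⟨c, hc⟩ := he; have := D.r_pos; omega
    have e : (D.l w).jetVec D.r t x = (D.l z).jetVec D.r t x + Pi.single (D.r / 2) v := by
      funext k
      rw [Pi.add_apply]
      rcases lt_trichotomy k (D.r / 2) with hk | rfl | hk
      · rw [OpExpr.jetVec_of_lt _ _ _ hk, OpExpr.jetVec_of_lt _ _ _ hk,
          Pi.single_eq_of_ne hk.ne, add_zero]
      · rw [Pi.single_eq_same, hv, map_sub, H, H, OpExpr.coord_opH_add x (by omega),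
          OpExpr.coord_opH_add x (by omega), Nat.sub_add_cancel hr, add_sub_cancel]
      · rw [OpExpr.jetVec_of_gt _ _ _ hk, OpExpr.jetVec_of_gt _ _ _ hk,
          Pi.single_eq_of_ne hk.ne', add_zero]
    have hvn : ‖v‖ ^ 2 ≤ C₂ * D.nevDens z t ((D.l z).jetVec D.r t x) := by
      refine (pow_le_pow_left₀ (norm_nonneg _) (OpExpr.norm_coord_le _ _ _) 2).trans ?_
      rw [norm_sub_rev]
      exact hC₂ t ht x
    rw [e]
    have := D.nevDens_add_le hz ht ((D.l z).jetVec D.r t x) (Pi.single (D.r / 2) v)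
    have h3 := hC₁ t ht v
    have h4 := mul_le_mul_of_nonneg_left hvn h₁
    linarith
  · rw [OpExpr.jetVec_odd_indep (D.l w) (D.l z) he]
    have : 0 ≤ (1 + 2 * (C₁ * C₂)) * D.nevDens z t ((D.l z).jetVec D.r t x) := by positivity
    linarith

end NevanlinnaExprPair

/-! ### Transfer of the definiteness condition to all nonreal parameters -/

namespace NevanlinnaExprPair

variable {𝓗 : Type*} [NormedAddCommGroup 𝓗] [InnerProductSpace ℂ 𝓗] [CompleteSpace 𝓗]
variable (D : NevanlinnaExprPair 𝓗)

/-- The density `(W_z X_z u, X_z u)`. -/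
def energy (z : ℂ) (u : HilbertPow 𝓗 D.r) (t : ℝ) : ℝ :=
  (inner ℂ (D.X z t u) (D.weight z t (D.X z t u)) : ℂ).re

theorem energy_eq {z : ℂ} (hz : z.im ≠ 0) {t : ℝ} (ht : t ∈ D.ivl) (u : HilbertPow 𝓗 D.r) :
    D.energy z u t = D.nevDens z t ((D.l z).jetVec D.r t (D.X z t u)) := by
  rw [energy, D.inner_weight hz ht, Complex.ofReal_re]

theorem continuousOn_energy {z : ℂ} (hz : z.im ≠ 0) (u : HilbertPow 𝓗 D.r) :
    ContinuousOn (D.energy z u) D.ivl :=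
  continuousOn_inner_apply_self (D.continuousOn_weight (D.nonreal_mem z hz))
    (D.isFundPair (D.nonreal_mem z hz)).continuousOn_left u

theorem energy_nonneg {z : ℂ} (hz : z.im ≠ 0) {t : ℝ} (ht : t ∈ D.ivl) (u : HilbertPow 𝓗 D.r) :
    0 ≤ D.energy z u t := by
  rw [D.energy_eq hz ht]
  exact D.nevDens_nonneg hz ht _

/-- The solutions of the systems for two parameters differ by at most the energy. -/
theorem norm_sq_X_sub_le {w z : ℂ} (hw : w ∈ D.dom) (hz : z.im ≠ 0) :
    ∃ C, 0 ≤ C ∧ ∀ u, ∀ t ∈ D.ivl, ‖D.X w t u - D.X z t u‖ ^ 2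
      ≤ C * ∫ s in D.a..D.b, D.energy z u s := by
  have hd := D.nonreal_mem z hz
  have P := D.isFundPair hw
  have Pz := D.isFundPair hd
  obtain ⟨C₁, h₁, hC₁⟩ := P.exists_norm_sub_le
  obtain ⟨C₂, h₂, hC₂⟩ := D.norm_sq_H_sub_le hw hz
  have hab := D.a_lt_b.le
  refine ⟨C₁ ^ 2 * (4 * (D.b - D.a) * C₂), by
    have := sub_nonneg.2 hab; positivity, fun u t ht => ?_⟩
  -- `X_z u` is regarded as a solution of the system at `w` with right-hand side `g = (H_z - H_w)
  -- X_z u`, whose `L²` norm is bounded by the energy.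
  set g : ℝ → HilbertPow 𝓗 D.r := fun t => D.H z t (D.X z t u) - D.H w t (D.X z t u) with hg
  have cg : ContinuousOn g D.ivl := continuousOn_sub_apply (D.continuousOn_H hd)
    (D.continuousOn_H hw) Pz.continuousOn_left u
  obtain ⟨x', dx, ex⟩ := Pz.hasDeriv_apply u
  have hQ : EqOn (D.Q w) (D.Q z) D.ivl := fun t ht => D.Q_eq hw hz ht
  have key := hC₁ g (fun t => D.X z t u) x' cg dx (fun t ht => by
    rw [sysLHS_sub_coef _ _ (D.H z t), hQ ht, derivWithin_congr hQ (hQ ht), ex t ht, zero_add]) t ht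
  have h0 : D.X z 0 u = u := by rw [Pz.fund.initial, one_apply_eq_self]
  simp only [h0] at key
  have hE : IntervalIntegrable (D.energy z u) volume D.a D.b := by
    refine ContinuousOn.intervalIntegrable ?_
    rw [uIcc_of_le hab]
    exact D.continuousOn_energy hz u
  have hgi : IntervalIntegrable (fun s => ‖g s‖ ^ 2) volume D.a D.b := by
    refine ContinuousOn.intervalIntegrable ?_
    rw [uIcc_of_le hab]
    exact cg.norm.pow 2
  have h3 : ∫ s in D.a..D.b, ‖g s‖ ^ 2 ≤ C₂ * ∫ s in D.a..D.b, D.energy z u s := by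
    rw [← intervalIntegral.integral_const_mul]
    refine intervalIntegral.integral_mono_on hab hgi (hE.const_mul C₂) fun s hs => ?_
    rw [D.energy_eq hz hs]
    exact hC₂ s hs _
  calc _ = ‖D.X z t u - D.X w t u‖ ^ 2 := by rw [norm_sub_rev]
    _ ≤ (C₁ * ∫ s in D.a..D.b, ‖g s‖) ^ 2 := pow_le_pow_left₀ (norm_nonneg _) key 2
    _ = C₁ ^ 2 * (∫ s in D.a..D.b, ‖g s‖) ^ 2 := mul_pow _ _ _
    _ ≤ C₁ ^ 2 * (4 * (D.b - D.a) * (C₂ * ∫ s in D.a..D.b, D.energy z u s)) := by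
        refine mul_le_mul_of_nonneg_left ((sq_integral_norm_le hab cg).trans
          (mul_le_mul_of_nonneg_left h3 ?_)) (sq_nonneg _)
        have := sub_nonneg.2 hab
        positivity
    _ = _ := by ring

/-- The solutions of `l_w[y] = 0` are the first components of the solutions of the system. -/
theorem solution_of_X {w : ℂ} (hw : w ∈ D.dom) (u : HilbertPow 𝓗 D.r) :
    ContDiffOn ℝ D.r (fun t => coord D.r 0 (D.X w t u)) D.ivl ∧
      (∀ t ∈ D.ivl, (D.l w).apply D.ivl D.r (fun t => coord D.r 0 (D.X w t u)) t = 0) ∧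
      ∀ t ∈ D.ivl, (D.l w).vecY D.m D.ivl D.r D.s (fun t => coord D.r 0 (D.X w t u))
        (fun _ => 0) t = D.X w t u := by
  obtain ⟨x', dx, ex⟩ := (D.isFundPair hw).hasDeriv_apply u
  obtain ⟨h1, h2, h3⟩ := OpExpr.apply_of_system (f := fun _ => 0) (D.isRegular hw)
    (D.l_order _ (D.conj_mem hw)) D.m_order D.m_smooth D.r_pos D.s_even D.s_le_r D.uniqueDiffOn
    (fun t ht => D.isAdjointAt_conj hw ht) contDiffOn_const fun t ht => ⟨x' t, dx t ht, by
      rw [OpExpr.opW_vecF_zero (D.l_order _ (D.conj_mem hw)) D.m_order D.r_pos D.s_even D.s_le_r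
        fun h => D.l_unit_even h _ (D.conj_mem hw) t ht]
      exact ex t ht⟩
  exact ⟨h1, fun t ht => (h2 t ht).trans (D.m.apply_zero_fun _ _ _), h3⟩

/-- The definiteness condition carries over to all nonreal values of the parameter. -/
theorem exists_le_integral_energy (hD : D.IsDefinite) {z : ℂ} (hz : z.im ≠ 0) :
    ∃ δ : ℝ, 0 < δ ∧ ∀ u, δ * ‖u‖ ^ 2 ≤ ∫ t in D.a..D.b, D.energy z u t := by
  obtain ⟨w, hw, α, hα, β, hβ, h0, δ, hδ, hdef⟩ := hD
  obtain ⟨C₁, h₁, hC₁⟩ := D.nevDens_le hw hz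
  obtain ⟨C₂, h₂, hC₂⟩ := D.nevDens_jetVec_le hw hz
  obtain ⟨C₃, h₃, hC₃⟩ := D.nevDens_jetVec_le_add hw hz
  obtain ⟨C₄, h₄, hC₄⟩ := D.norm_sq_X_sub_le hw hz
  have hab := D.a_lt_b.le
  have hba := sub_nonneg.2 hab
  set A : ℝ := C₁ * (2 * (2 * C₃)) with hA
  set B : ℝ := C₁ * (2 * (2 * (C₂ * C₄))) with hB
  have hA0 : 0 ≤ A := by positivity
  have hB0 : 0 ≤ B := by positivity
  refine ⟨δ / (A + B * (D.b - D.a) + 1), by positivity, fun u => ?_⟩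
  obtain ⟨hy, hl, hv⟩ := D.solution_of_X hw u
  set y : ℝ → 𝓗 := fun t => coord D.r 0 (D.X w t u) with hyd
  set S : ℝ := ∫ t in D.a..D.b, D.energy z u t with hS
  have hE : IntervalIntegrable (D.energy z u) volume D.a D.b := by
    refine ContinuousOn.intervalIntegrable ?_
    rw [uIcc_of_le hab]
    exact D.continuousOn_energy hz u
  have hS0 : 0 ≤ S := intervalIntegral.integral_nonneg hab fun t ht => D.energy_nonneg hz ht u
  -- Pass from the density at `w` to that at `z`, from the jet of `y` to the jet recovered from `X_w
  -- u`, and then to `X_z u`. The last replacement costs a multiple of the total energy `S`.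
  have hpt : ∀ t ∈ D.ivl, D.nevForm w y t ≤ A * D.energy z u t + B * S := fun t ht => by
    have e1 : D.nevDens z t (OpExpr.jet D.ivl y t)
        ≤ 2 * D.nevDens z t ((D.l w).jetVec D.r t (D.X w t u)) := by
      rw [← D.nevDens_smul hz t (OpExpr.norm_firstOrderFactor D.r) (OpExpr.jet D.ivl y t)]
      refine D.nevDens_congr_le hz ht fun k hk => ?_
      rw [← hv t ht]
      exact (OpExpr.jetVec_vecY_zero (D.isRegular hw) D.m_order D.m_smooth D.r_pos D.s_even
        D.s_le_r D.uniqueDiffOn hy ht (hl t ht) hk).symm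
    have e2 : D.nevDens z t ((D.l w).jetVec D.r t (D.X w t u))
        ≤ 2 * (C₂ * (C₄ * S)) + 2 * (C₃ * D.energy z u t) := by
      have e : (D.l w).jetVec D.r t (D.X w t u)
          = (D.l w).jetVec D.r t (D.X w t u - D.X z t u) + (D.l w).jetVec D.r t (D.X z t u) := by
        rw [← OpExpr.jetVec_add, sub_add_cancel]
      rw [e]
      refine (D.nevDens_add_le hz ht _ _).trans (add_le_add ?_ ?_)
      · exact mul_le_mul_of_nonneg_left ((hC₂ t ht _).trans
          (mul_le_mul_of_nonneg_left (hC₄ u t ht) h₂)) two_pos.le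
      · rw [D.energy_eq hz ht]
        exact mul_le_mul_of_nonneg_left (hC₃ t ht _) two_pos.le
    rw [D.nevForm_eq]
    calc _ ≤ C₁ * D.nevDens z t (OpExpr.jet D.ivl y t) := hC₁ t ht _
      _ ≤ C₁ * (2 * (2 * (C₂ * (C₄ * S)) + 2 * (C₃ * D.energy z u t))) := by
          refine mul_le_mul_of_nonneg_left (e1.trans ?_) h₁
          linarith
      _ = _ := by rw [hA, hB]; ring
  have hαβ : α ≤ β := h0.1.trans h0.2
  have hsub : uIcc α β ⊆ uIcc D.a D.b := by
    rw [uIcc_of_le hαβ, uIcc_of_le hab]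
    exact Icc_subset_Icc hα.1 hβ.2
  have hR : IntervalIntegrable (fun t => A * D.energy z u t + B * S) volume D.a D.b :=
    (hE.const_mul A).add intervalIntegrable_const
  have hpos : ∀ t ∈ D.ivl, 0 ≤ A * D.energy z u t + B * S := fun t ht => by
    have := D.energy_nonneg hz ht u
    positivity
  have hval : ∫ t in D.a..D.b, (A * D.energy z u t + B * S) = (A + B * (D.b - D.a)) * S := by
    rw [intervalIntegral.integral_add (hE.const_mul A) intervalIntegrable_const,
      intervalIntegral.integral_const_mul, intervalIntegral.integral_const, smul_eq_mul, ← hS]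
    ring
  have hle : ∫ t in α..β, D.nevForm w y t ≤ (A + B * (D.b - D.a)) * S := by
    -- Integrability of the density at `w` is not established here. If it fails, the integral is `0`
    -- by convention and the bound is trivial.
    by_cases hi : IntervalIntegrable (D.nevForm w y) volume α β
    · calc _ ≤ ∫ t in α..β, (A * D.energy z u t + B * S) :=
            intervalIntegral.integral_mono_on hαβ hi (hR.mono_set hsub) fun t ht =>
              hpt t ⟨hα.1.trans ht.1, ht.2.trans hβ.2⟩
        _ ≤ ∫ t in D.a..D.b, (A * D.energy z u t + B * S) :=
            intervalIntegral.integral_mono_interval hα.1 hαβ hβ.2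
              ((ae_restrict_iff' measurableSet_Ioc).2 (.of_forall fun t ht =>
                hpos t (Ioc_subset_Icc_self ht))) hR
        _ = _ := hval
    · rw [intervalIntegral.integral_undef hi]
      positivity
  have := hdef y hy hl
  have h00 : (D.l w).vecY D.m D.ivl D.r D.s y 0 0 = u := by
    have := hv 0 D.zero_mem
    rw [(D.isFundPair hw).fund.initial, one_apply_eq_self] at this
    exact this
  rw [h00] at this
  rw [div_mul_eq_mul_div, div_le_iff₀ (by positivity)]
  linarith

end NevanlinnaExprPair

/-! ### Abstract Nevanlinna systems: analyticity and definite boundary values -/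

section NevSystem

variable {E : Type*} [NormedAddCommGroup E] [InnerProductSpace ℂ E] [CompleteSpace E] {a b : ℝ}

/-- The weight `Im H_z / Im z`. -/
def nevWeight (H : ℂ → ℝ → E →L[ℂ] E) (z : ℂ) (t : ℝ) : E →L[ℂ] E :=
  ((z.im : ℂ)⁻¹) • opIm (H z t)

/-- The form `(Re Q(t) x, x)`. -/
def bdryForm₁ (Q : ℝ → E →L[ℂ] E) (t : ℝ) (x : E) : ℝ := (inner ℂ x (opRe (Q t) x) : ℂ).re

/-- A Hamiltonian system which depends on a nonreal parameter in the Nevanlinna manner, with its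
operator solutions `X_z`. -/
structure IsNevSystem (a b : ℝ) (Q : ℝ → E →L[ℂ] E) (H X : ℂ → ℝ → E →L[ℂ] E) : Prop where
  pair : ∀ z : ℂ, z.im ≠ 0 → IsFundPair a b Q (H z) (X z) (X (conj z))
  cont : ∀ z : ℂ, z.im ≠ 0 → ContinuousOn (H z) (Icc a b)
  adj : ∀ z : ℂ, z.im ≠ 0 → ∀ t ∈ Icc a b, ContinuousLinearMap.adjoint (H z t) = H (conj z) t
  diff : ∀ z : ℂ, z.im ≠ 0 → ∀ t ∈ Icc a b, DifferentiableAt ℂ (fun z => H z t) z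
  nonneg : ∀ z : ℂ, z.im ≠ 0 → ∀ t ∈ Icc a b, ∀ x,
    0 ≤ (inner ℂ x (nevWeight H z t x) : ℂ).re
  definite : ∀ z : ℂ, z.im ≠ 0 → ∃ δ : ℝ, 0 < δ ∧ ∀ u, δ * ‖u‖ ^ 2 ≤
    ∫ t in a..b, (inner ℂ (X z t u) (nevWeight H z t (X z t u)) : ℂ).re

theorem inner_opIm_self (A : E →L[ℂ] E) (x : E) :
    (inner ℂ x (opIm A x) : ℂ) = ((inner ℂ x (A x) : ℂ).im : ℂ) := by
  have : opIm A x = (1 / (2 * Complex.I)) • (A x - ContinuousLinearMap.adjoint A x) := rfl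
  rw [this, inner_smul_right, inner_sub_right, ContinuousLinearMap.adjoint_inner_right,
    ← inner_conj_symm (A x) x, Complex.sub_conj]
  push_cast
  field_simp

theorem inner_nevWeight (H : ℂ → ℝ → E →L[ℂ] E) (z : ℂ) (t : ℝ) (x : E) :
    (inner ℂ x (nevWeight H z t x) : ℂ) = (((inner ℂ x (H z t x) : ℂ).im / z.im : ℝ) : ℂ) := by
  have : nevWeight H z t x = ((z.im : ℂ)⁻¹) • opIm (H z t) x := rfl
  rw [this, inner_smul_right, inner_opIm_self, Complex.ofReal_div, div_eq_inv_mul]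

theorem im_conj_ne_zero {z : ℂ} (hz : z.im ≠ 0) : (conj z).im ≠ 0 := by simpa using hz

namespace IsNevSystem

variable {Q : ℝ → E →L[ℂ] E} {H X : ℂ → ℝ → E →L[ℂ] E}

theorem re_inner_nevWeight (z : ℂ) (t : ℝ) (x : E) :
    (inner ℂ x (nevWeight H z t x) : ℂ).re = (inner ℂ x (H z t x) : ℂ).im / z.im := by
  rw [inner_nevWeight, Complex.ofReal_re]

theorem isNevFamily (h : IsNevSystem a b Q H X) :
    IsNevFamily {z : ℂ | z.im ≠ 0}
      (fun (i : Icc a b × E) z => (inner ℂ i.2 (H z i.1 i.2) : ℂ)) where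
  nonreal_mem _ hz := hz
  analytic μ hμ := by
    refine ⟨{z | z.im ≠ 0}, isOpen_ne_fun Complex.continuous_im continuous_const, hμ,
      fun i z hz => ?_⟩
    exact ((innerSL ℂ i.2).differentiableAt.comp z
      ((h.diff z hz i.1 i.1.2).clm_apply (differentiableAt_const i.2))).differentiableWithinAt
  nonneg z hz i := by
    rw [← re_inner_nevWeight]
    exact h.nonneg z hz i.1 i.1.2 i.2
  symm z hz i := by
    rw [← h.adj z hz i.1 i.1.2, ContinuousLinearMap.adjoint_inner_right, inner_conj_symm]

/-- Harnack's inequality for `z ↦ (H_z x, x)`, uniform in `t` and `x`, becomes a norm estimate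
through the numerical radius. This provides continuity in the parameter uniformly in `t`. -/
theorem exists_norm_H_sub_le (h : IsNevSystem a b Q H X) {w : ℂ} (hw : w.im ≠ 0) :
    ∃ R : ℝ, 0 < R ∧ Metric.ball w R ⊆ {z | z.im ≠ 0} ∧ ∀ z, ‖z - w‖ ≤ R / 2 → ∀ t ∈ Icc a b,
      ‖H z t - H w t‖ ≤ 8 * ‖z - w‖ / R * ‖H w t‖ := by
  obtain ⟨R, hR, hb, hh⟩ := h.isNevFamily.exists_radius hw
  refine ⟨R, hR, hb, fun z hz t ht => ?_⟩
  have := opNorm_le_of_norm_inner_self_le (H z t - H w t) (C := 4 * ‖z - w‖ / R * ‖H w t‖)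
    (by positivity) fun x => by
      rw [sub_apply, inner_sub_right, mul_assoc]
      refine (hh z hz (⟨t, ht⟩, x)).trans (mul_le_mul_of_nonneg_left ?_ (by positivity))
      refine (Complex.abs_im_le_norm _).trans ((norm_inner_le_norm _ _).trans ?_)
      have := mul_le_mul_of_nonneg_left ((H w t).le_opNorm x) (norm_nonneg x)
      dsimp only
      linarith
  refine this.trans (le_of_eq ?_)
  ring

/-- The coefficient of the normal form is holomorphic for each `t` and, by Harnack's inequality,
continuous in the parameter uniformly in `t`; so it is holomorphic with values in `C([a, b])`. The
Volterra solution depends analytically on it and agrees with `X_z` by uniqueness. -/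
theorem differentiableAt_X (h : IsNevSystem a b Q H X) {t : ℝ} (ht : t ∈ Icc a b) {z : ℂ}
    (hz : z.im ≠ 0) : DifferentiableAt ℂ (fun z => X z t) z := by
  have P := h.pair z hz
  have hab := P.lt
  have hc : ∀ w : ℂ, w.im ≠ 0 → ContinuousOn (sysCoef a b Q (H w)) (Icc a b) := fun w hw =>
    continuousOn_sysCoef hab P.smooth P.unit (h.cont w hw)
  classical
  set A : ℂ → C(Icc a b, E →L[ℂ] E) := fun w =>
    if hw : w.im ≠ 0 then ⟨_, continuousOn_iff_continuous_domRestrict.1 (hc w hw)⟩ else 0 with hA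
  have hAt : ∀ w : ℂ, w.im ≠ 0 → ∀ t : Icc a b, A w t = sysCoef a b Q (H w) t := fun w hw t => by
    simp only [hA, dif_pos hw]
    rfl
  have hU : IsOpen {z : ℂ | z.im ≠ 0} := isOpen_ne_fun Complex.continuous_im continuous_const
  obtain ⟨C, hC, hCi⟩ := exists_norm_le_of_continuousOn (f := fun t => Ring.inverse (opRe (Q t)))
    (a := a) (b := b) fun t ht => ContinuousAt.comp_continuousWithinAt
      (g := Ring.inverse) (f := fun t => opRe (Q t)) (NormedRing.inverse_continuousAt (P.unit t ht).unit)
      (continuousOn_opRe P.smooth.continuousOn t ht)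
  have hcont : ContinuousOn A {z : ℂ | z.im ≠ 0} := fun w hw => by
    obtain ⟨R, hR, hb, hle⟩ := h.exists_norm_H_sub_le hw
    obtain ⟨K, hK, hKH⟩ := exists_norm_le_of_continuousOn (h.cont w hw)
    refine ContinuousAt.continuousWithinAt (tendsto_iff_norm_sub_tendsto_zero.2 ?_)
    refine squeeze_zero' (.of_forall fun _ => norm_nonneg _)
      (g := fun v => C * (8 * ‖v - w‖ / R * K)) ?_ ?_
    · filter_upwards [Metric.ball_mem_nhds w (half_pos hR)] with v hv
      have hv' : ‖v - w‖ < R / 2 := by simpa [dist_eq_norm] using hv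
      have hvi : v.im ≠ 0 := hb (Metric.ball_subset_ball (by linarith) hv)
      refine (ContinuousMap.norm_le _ (by positivity)).2 fun t => ?_
      rw [ContinuousMap.sub_apply, hAt v hvi, hAt w hw]
      have : sysCoef a b Q (H v) t - sysCoef a b Q (H w) t
          = -Complex.I • (Ring.inverse (opRe (Q t)) * (H v t - H w t)) := by
        rw [sysCoef, sysCoef, ← smul_sub, ← mul_sub, sub_sub_sub_cancel_right]
      rw [this, norm_smul, norm_neg, Complex.norm_I, one_mul]
      refine (norm_mul_le _ _).trans (mul_le_mul (hCi t t.2) ((hle v hv'.le t t.2).trans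
        (mul_le_mul_of_nonneg_left (hKH t t.2) (by positivity))) (norm_nonneg _) hC)
    · have : Continuous fun v : ℂ => C * (8 * ‖v - w‖ / R * K) := by fun_prop
      have h2 := this.tendsto w
      simpa using h2
  have hd : DifferentiableOn ℂ A {z : ℂ | z.im ≠ 0} := by
    refine differentiableOn_continuousMap hU hcont fun t => ?_
    have : DifferentiableOn ℂ (fun w => sysCoef a b Q (H w) t) {z : ℂ | z.im ≠ 0} := fun w hw =>
      (DifferentiableAt.fun_const_smul (((h.diff w hw t t.2).sub_const _).const_mul _)
        (-Complex.I)).differentiableWithinAt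
    exact this.congr fun w hw => hAt w hw t
  have h1 := differentiableAt_odeSol hab.le P.zero_mem (hd.differentiableAt (hU.mem_nhds hz))
  have h2 : DifferentiableAt ℂ (fun w => odeSol hab.le P.zero_mem (A w) ⟨t, ht⟩) z :=
    DifferentiableAt.comp (g := ContinuousMap.evalCLM ℂ (⟨t, ht⟩ : Icc a b)) z
      (ContinuousLinearMap.differentiableAt _) h1
  refine h2.congr_of_eventuallyEq ?_
  filter_upwards [hU.mem_nhds hz] with w hw
  rw [← (h.pair w hw).unique (isFund_odeSol hab P.zero_mem P.smooth P.unit (A w) (hAt w hw)) ht,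
    IccExtend_of_mem _ _ ht]

theorem continuousOn_nevWeight (h : IsNevSystem a b Q H X) {z : ℂ} (hz : z.im ≠ 0) :
    ContinuousOn (nevWeight H z) (Icc a b) := continuousOn_inv_smul_opIm (h.cont z hz) _

theorem continuousOn_energy (h : IsNevSystem a b Q H X) {z : ℂ} (hz : z.im ≠ 0) (u : E) :
    ContinuousOn (fun t => (inner ℂ (X z t u) (nevWeight H z t (X z t u)) : ℂ).re) (Icc a b) :=
  continuousOn_inner_apply_self (h.continuousOn_nevWeight hz) (h.pair z hz).continuousOn_left u

/-- Lagrange's identity for a solution paired with itself, integrated: the derivative of `(Re Q x,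
x)` is `2 Im (H x, x)`. -/
theorem bdryForm₁_sub (h : IsNevSystem a b Q H X) {z : ℂ} (hz : z.im ≠ 0) (u : E) :
    bdryForm₁ Q b (X z b u) - bdryForm₁ Q a (X z a u)
      = 2 * z.im * ∫ t in a..b, (inner ℂ (X z t u) (nevWeight H z t (X z t u)) : ℂ).re := by
  have P := h.pair z hz
  obtain ⟨x', dx, ex⟩ := P.hasDeriv_apply u
  have hd : ∀ t ∈ Icc a b, HasDerivWithinAt (fun t => bdryForm₁ Q t (X z t u))
      (2 * z.im * (inner ℂ (X z t u) (nevWeight H z t (X z t u)) : ℂ).re) (Icc a b) t :=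
    fun t ht => by
      have hQ := (P.smooth.differentiableOn one_ne_zero t ht).hasDerivWithinAt
      have := hasDerivWithinAt_inner_opRe hQ (dx t ht) (dx t ht) (ex t ht) (ex t ht)
      have h2 := (Complex.reCLM.hasFDerivAt (x := _)).comp_hasDerivWithinAt t this
      have e : (2 * z.im * (inner ℂ (X z t u) (nevWeight H z t (X z t u)) : ℂ).re)
          = (Complex.I * (inner ℂ (H z t (X z t u)) (X z t u) - inner ℂ (X z t u) (H z t (X z t u)))
        + Complex.I * (inner ℂ (0 : E) (X z t u) - inner ℂ (X z t u) (0 : E))).re := by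
        rw [re_inner_nevWeight, ← inner_conj_symm (H z t (X z t u)) (X z t u),
          inner_zero_left, inner_zero_right]
        generalize (inner ℂ (X z t u) (H z t (X z t u)) : ℂ) = w
        have : 2 * z.im * (w.im / z.im) = 2 * w.im := by field_simp
        rw [this]
        simp
        ring
      rw [e]
      exact h2
  rw [← intervalIntegral.integral_const_mul]
  refine (intervalIntegral.integral_eq_sub_of_hasDerivAt_of_le P.lt.le
    (f := fun t => bdryForm₁ Q t (X z t u))
    (fun t ht => (hd t ht).continuousWithinAt)
    (fun t ht => (hd t (Ioo_subset_Icc_self ht)).hasDerivAt (Icc_mem_nhds ht.1 ht.2)) ?_).symm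
  refine ContinuousOn.intervalIntegrable ?_
  rw [uIcc_of_le P.lt.le]
  exact (h.continuousOn_energy hz u).const_smul (2 * z.im)

/-- The quadratic form of `(Im z) diag (Re Q(a), -Re Q(b))`. -/
def _root_.pairForm (a b : ℝ) (Q : ℝ → E →L[ℂ] E) (z : ℂ) (x : E × E) : ℝ :=
  z.im * (bdryForm₁ Q a x.1 - bdryForm₁ Q b x.2)

theorem exists_pairForm_le (h : IsNevSystem a b Q H X) {z : ℂ} (hz : z.im ≠ 0) :
    ∃ c : ℝ, 0 < c ∧ ∀ u, pairForm a b Q z (X z a u, X z b u) ≤ -(c * ‖u‖ ^ 2) := by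
  obtain ⟨δ, hδ, hu⟩ := h.definite z hz
  refine ⟨2 * z.im ^ 2 * δ, by positivity, fun u => ?_⟩
  have e := h.bdryForm₁_sub hz u
  have := mul_le_mul_of_nonneg_left (hu u) (by positivity : 0 ≤ 2 * z.im ^ 2)
  unfold pairForm
  linear_combination this - z.im * e

/-- Conjugating the parameter only changes the sign of the factor `Im z` in the form, so uniform
negativity at `conj z` is uniform positivity at `z`. -/
theorem exists_le_pairForm_conj (h : IsNevSystem a b Q H X) {z : ℂ} (hz : z.im ≠ 0) :
    ∃ c : ℝ, 0 < c ∧ ∀ u, c * ‖u‖ ^ 2 ≤ pairForm a b Q z (X (conj z) a u, X (conj z) b u) := by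
  obtain ⟨c, hc, hu⟩ := h.exists_pairForm_le (im_conj_ne_zero hz)
  refine ⟨c, hc, fun u => ?_⟩
  have := hu u
  unfold pairForm at this ⊢
  rw [Complex.conj_im] at this
  linarith

end IsNevSystem

end NevSystem

/-! ### Maximal nonnegative subspaces and invertibility of `X(a)⁻¹𝓜 - X(b)⁻¹𝓝` -/

section BdryPairs

variable {E : Type*} [NormedAddCommGroup E] [InnerProductSpace ℂ E] [CompleteSpace E] {a b : ℝ}
  {Q : ℝ → E →L[ℂ] E}

/-- A maximal subspace among those on which the quadratic form `F` is nonnegative. -/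
def IsMaxNonnegSubspace {V : Type*} [AddCommGroup V] [Module ℂ V] (F : V → ℝ)
    (S : Submodule ℂ V) : Prop :=
  (∀ x ∈ S, 0 ≤ F x) ∧ ∀ S' : Submodule ℂ V, S ≤ S' → (∀ x ∈ S', 0 ≤ F x) → S' = S

namespace IsNevSystem

theorem continuous_pairForm (a b : ℝ) (Q : ℝ → E →L[ℂ] E) (z : ℂ) :
    Continuous (pairForm a b Q z) := by
  unfold pairForm bdryForm₁
  fun_prop

theorem bdryForm₁_add (Q : ℝ → E →L[ℂ] E) (t : ℝ) (x y : E) :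
    bdryForm₁ Q t (x + y) = bdryForm₁ Q t x + 2 * (inner ℂ x (opRe (Q t) y) : ℂ).re
      + bdryForm₁ Q t y := by
  unfold bdryForm₁
  have : (inner ℂ y (opRe (Q t) x) : ℂ).re = (inner ℂ x (opRe (Q t) y) : ℂ).re := by
    rw [← inner_opRe_left, ← inner_conj_symm, Complex.conj_re]
  rw [map_add, inner_add_left, inner_add_right, inner_add_right, Complex.add_re, Complex.add_re,
    Complex.add_re, this]
  ring

theorem bdryForm₁_smul (Q : ℝ → E →L[ℂ] E) (t : ℝ) (c : ℂ) (x : E) :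
    bdryForm₁ Q t (c • x) = ‖c‖ ^ 2 * bdryForm₁ Q t x := by
  unfold bdryForm₁
  rw [map_smul, inner_smul_left, inner_smul_right, ← mul_assoc, mul_comm (conj c),
    Complex.mul_conj, Complex.normSq_eq_norm_sq, Complex.re_ofReal_mul]

theorem pairForm_add_smul (z : ℂ) {s p : E × E}
    (h : (inner ℂ p.1 (opRe (Q a) s.1) : ℂ) = inner ℂ p.2 (opRe (Q b) s.2)) (c : ℂ) :
    pairForm a b Q z (s + c • p) = pairForm a b Q z s + ‖c‖ ^ 2 * pairForm a b Q z p := by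
  have e : ∀ t (x y : E), (inner ℂ x (opRe (Q t) (c • y)) : ℂ).re
      = (c * conj (inner ℂ y (opRe (Q t) x))).re := fun t x y => by
    rw [map_smul, inner_smul_right, inner_conj_symm, inner_opRe_left]
  simp only [pairForm, Prod.fst_add, Prod.snd_add, Prod.smul_fst, Prod.smul_snd, bdryForm₁_add,
    bdryForm₁_smul, e, h]
  ring

/-- The form is continuous, so the closure is still nonnegative, and maximality forces equality. -/
theorem _root_.IsMaxNonnegSubspace.isClosed {z : ℂ} {S : Submodule ℂ (E × E)}
    (hS : IsMaxNonnegSubspace (pairForm a b Q z) S) : IsClosed (S : Set (E × E)) := by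
  have h := hS.2 S.topologicalClosure S.le_topologicalClosure fun x hx => by
    have : (S.topologicalClosure : Set (E × E)) ⊆ {x | 0 ≤ pairForm a b Q z x} := by
      rw [Submodule.topologicalClosure_coe]
      exact closure_minimal hS.1
        (isClosed_le continuous_const (continuous_pairForm a b Q z))
    exact this hx
  rw [← h]
  exact S.isClosed_topologicalClosure

/-- Adjoining a nonnegative vector that is orthogonal in the sense of the form creates no cross
terms, so the enlarged subspace is still nonnegative. -/
theorem _root_.IsMaxNonnegSubspace.mem_of_orthogonal {z : ℂ} {S : Submodule ℂ (E × E)}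
    (hS : IsMaxNonnegSubspace (pairForm a b Q z) S) {p : E × E}
    (hp : 0 ≤ pairForm a b Q z p)
    (h : ∀ s ∈ S, (inner ℂ p.1 (opRe (Q a) s.1) : ℂ) = inner ℂ p.2 (opRe (Q b) s.2)) : p ∈ S := by
  have := hS.2 (S ⊔ Submodule.span ℂ {p}) le_sup_left fun x hx => by
    obtain ⟨s, hs, y, hy, rfl⟩ := Submodule.mem_sup.1 hx
    obtain ⟨c, rfl⟩ := Submodule.mem_span_singleton.1 hy
    rw [pairForm_add_smul z (h s hs)]
    have := hS.1 s hs
    positivity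
  rw [← this]
  exact (le_sup_right : Submodule.span ℂ {p} ≤ _) (Submodule.mem_span_singleton_self p)

variable {H X : ℂ → ℝ → E →L[ℂ] E}

/-- Completing the square absorbs `2Cvk` into half of `c v²`. -/
theorem sq_le_of_mul_sq_le {c C v k : ℝ} (hc : 0 < c) (h : c * v ^ 2 ≤ C * (2 * v * k + k ^ 2)) :
    v ^ 2 ≤ 2 / c * (2 * C ^ 2 / c + C) * k ^ 2 := by
  have h1 : 2 * C * v * k ≤ c / 2 * v ^ 2 + 2 * C ^ 2 / c * k ^ 2 := by
    have : c / 2 * v ^ 2 + 2 * C ^ 2 / c * k ^ 2 - 2 * C * v * k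
        = (c * v - 2 * C * k) ^ 2 / (2 * c) := by field_simp; ring
    have h2 : 0 ≤ (c * v - 2 * C * k) ^ 2 / (2 * c) := by positivity
    linarith
  have h3 : c / 2 * v ^ 2 ≤ (2 * C ^ 2 / c + C) * k ^ 2 := by linarith
  calc v ^ 2 = 2 / c * (c / 2 * v ^ 2) := by field_simp
    _ ≤ 2 / c * ((2 * C ^ 2 / c + C) * k ^ 2) := mul_le_mul_of_nonneg_left h3 (by positivity)
    _ = _ := by ring

/-- If the pair `(X(a) v, X(b) (v - k))` is nonnegative, then `v` is bounded by `k`. -/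
theorem exists_norm_le_of_nonneg (h : IsNevSystem a b Q H X) {z : ℂ} (hz : z.im ≠ 0) :
    ∃ C : ℝ, 0 ≤ C ∧ ∀ v k, 0 ≤ pairForm a b Q z (X z a v, X z b (v - k)) → ‖v‖ ≤ C * ‖k‖ := by
  obtain ⟨c, hc, hu⟩ := h.exists_pairForm_le hz
  set C := |z.im| * (‖X z b‖ ^ 2 * ‖opRe (Q b)‖) with hC
  have hC0 : 0 ≤ C := by positivity
  have hb : ∀ x y : E, |(inner ℂ (X z b x) (opRe (Q b) (X z b y)) : ℂ).re|
      ≤ ‖X z b‖ ^ 2 * ‖opRe (Q b)‖ * (‖x‖ * ‖y‖) := fun x y => by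
    refine (Complex.abs_re_le_norm _).trans ((norm_inner_le_norm _ _).trans ?_)
    calc _ ≤ (‖X z b‖ * ‖x‖) * (‖opRe (Q b)‖ * (‖X z b‖ * ‖y‖)) :=
          mul_le_mul ((X z b).le_opNorm x) (((opRe (Q b)).le_opNorm _).trans
            (mul_le_mul_of_nonneg_left ((X z b).le_opNorm y) (norm_nonneg _))) (norm_nonneg _)
            (by positivity)
      _ = _ := by ring
  refine ⟨√(2 / c * (2 * C ^ 2 / c + C)), by positivity, fun v k hvk => ?_⟩
  refine (le_abs_self _).trans (abs_le_of_sq_le_sq ?_ (by positivity))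
  rw [mul_pow, Real.sq_sqrt (by positivity)]
  refine sq_le_of_mul_sq_le hc ?_
  have e : pairForm a b Q z (X z a v, X z b (v - k)) = pairForm a b Q z (X z a v, X z b v)
      + z.im * (2 * (inner ℂ (X z b v) (opRe (Q b) (X z b k)) : ℂ).re)
      - z.im * (inner ℂ (X z b k) (opRe (Q b) (X z b k)) : ℂ).re := by
    have e1 : X z b (v - k) = X z b v + (-1 : ℂ) • X z b k := by
      rw [map_sub, sub_eq_add_neg, neg_one_smul]
    unfold pairForm
    dsimp only
    rw [e1, bdryForm₁_add, bdryForm₁_smul, norm_neg, norm_one, map_smul, inner_smul_right]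
    simp only [neg_mul, one_mul, Complex.neg_re, one_pow, bdryForm₁]
    ring
  have h1 := hu v
  have h2 : ∀ x y : E, |z.im * (inner ℂ (X z b x) (opRe (Q b) (X z b y)) : ℂ).re|
      ≤ C * (‖x‖ * ‖y‖) := fun x y => by
    rw [abs_mul, hC, mul_assoc]
    exact mul_le_mul_of_nonneg_left (hb x y) (abs_nonneg _)
  have h3 := (le_abs_self _).trans (h2 v k)
  have h4 := (neg_abs_le _).trans' (neg_le_neg (h2 k k))
  rw [e] at hvk
  linarith

/-- `X_z(a)⁻¹ 𝓜 - X_z(b)⁻¹ 𝓝`. -/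
def _root_.diffOp (a b : ℝ) (X : ℂ → ℝ → E →L[ℂ] E) (z : ℂ) (Mb Nb : E →L[ℂ] E) : E →L[ℂ] E :=
  Ring.inverse (X z a) * Mb - Ring.inverse (X z b) * Nb

theorem X_mul_inverse (h : IsNevSystem a b Q H X) {z : ℂ} (hz : z.im ≠ 0) {t : ℝ}
    (ht : t ∈ Icc a b) (x : E) : X z t (Ring.inverse (X z t) x) = x := by
  have := Ring.mul_inverse_cancel _ ((h.pair z hz).isUnit ht)
  exact DFunLike.congr_fun this x

theorem left_mem (h : IsNevSystem a b Q H X) {z : ℂ} (hz : z.im ≠ 0) : a ∈ Icc a b :=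
  ⟨le_rfl, (h.pair z hz).lt.le⟩

theorem right_mem (h : IsNevSystem a b Q H X) {z : ℂ} (hz : z.im ≠ 0) : b ∈ Icc a b :=
  ⟨(h.pair z hz).lt.le, le_rfl⟩

/-- With `v = X(a)⁻¹𝓜x` the boundary pair of `x` is `(X(a)v, X(b)(v - Kx))`, and its nonnegativity
bounds `v` by `Kx`. On the other hand `x ↦ (𝓜x, 𝓝x)` is injective with closed range, hence bounded
below. -/
theorem exists_norm_le_diffOp (h : IsNevSystem a b Q H X) {z : ℂ} (hz : z.im ≠ 0)
    {Mb Nb : E →L[ℂ] E} (hn : ∀ x, x ≠ 0 → 0 < ‖Mb x‖ + ‖Nb x‖)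
    (hS : IsMaxNonnegSubspace (pairForm a b Q z)
      (LinearMap.range ((Mb : E →ₗ[ℂ] E).prod (Nb : E →ₗ[ℂ] E)))) :
    ∃ C : ℝ, 0 ≤ C ∧ ∀ x, ‖x‖ ≤ C * ‖diffOp a b X z Mb Nb x‖ := by
  obtain ⟨C, hC, hk⟩ := h.exists_norm_le_of_nonneg hz
  set T := Mb.prod Nb with hT
  have hinj : Function.Injective T := by
    rw [injective_iff_map_eq_zero]
    intro x hx
    by_contra h0
    have := hn x h0
    have h1 : Mb x = 0 := congrArg Prod.fst hx
    have h2 : Nb x = 0 := congrArg Prod.snd hx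
    rw [h1, h2] at this
    simp at this
  have hcl : IsClosed (range T) := by
    have := hS.isClosed
    exact this
  obtain ⟨c, hc⟩ := T.antilipschitz_of_injective_of_isClosed_range hinj hcl
  refine ⟨c * ((‖X z a‖ + ‖X z b‖) * (C + 1)), by positivity, fun x => ?_⟩
  set K := diffOp a b X z Mb Nb with hK
  set v := Ring.inverse (X z a) (Mb x) with hv
  have e1 : X z a v = Mb x := h.X_mul_inverse hz (h.left_mem hz) _
  have e2 : X z b (v - K x) = Nb x := by
    have : v - K x = Ring.inverse (X z b) (Nb x) := by
      rw [hK, hv]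
      exact sub_sub_cancel _ _
    rw [this, h.X_mul_inverse hz (h.right_mem hz)]
  have h1 : ‖v‖ ≤ C * ‖K x‖ := hk v (K x) (by
    rw [e1, e2]
    exact hS.1 _ ⟨x, rfl⟩)
  have h2 : ‖x‖ ≤ c * ‖T x‖ := by
    simpa using hc.le_mul_dist x 0
  have h3 : ‖Mb x‖ ≤ ‖X z a‖ * ((C + 1) * ‖K x‖) := by
    rw [← e1]
    refine ((X z a).le_opNorm v).trans (mul_le_mul_of_nonneg_left ?_ (norm_nonneg _))
    linarith [norm_nonneg (K x)]
  have h4 : ‖Nb x‖ ≤ ‖X z b‖ * ((C + 1) * ‖K x‖) := by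
    rw [← e2]
    refine ((X z b).le_opNorm _).trans (mul_le_mul_of_nonneg_left ?_ (norm_nonneg _))
    linarith [norm_sub_le v (K x)]
  have h5 : ‖T x‖ ≤ (‖X z a‖ + ‖X z b‖) * ((C + 1) * ‖K x‖) := by
    have : ‖T x‖ = max ‖Mb x‖ ‖Nb x‖ := rfl
    rw [this, add_mul]
    have p1 : 0 ≤ ‖X z a‖ * ((C + 1) * ‖K x‖) := by positivity
    have p2 : 0 ≤ ‖X z b‖ * ((C + 1) * ‖K x‖) := by positivity
    exact max_le (by linarith) (by linarith)
  calc _ ≤ c * ‖T x‖ := h2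
    _ ≤ c * ((‖X z a‖ + ‖X z b‖) * ((C + 1) * ‖K x‖)) :=
        mul_le_mul_of_nonneg_left h5 c.2
    _ = _ := by ring

/-- Write `w = G η`. Orthogonality of `w` to the range says that `p = (X_{conj z}(a)η, X_{conj
z}(b)η)` is form-orthogonal to the subspace. As `p` is nonnegative, maximality puts it into the
subspace, so it is orthogonal to itself; uniform positivity gives `η = 0`. -/
theorem diffOp_orthogonal (h : IsNevSystem a b Q H X) {z : ℂ} (hz : z.im ≠ 0)
    {Mb Nb : E →L[ℂ] E}
    (hS : IsMaxNonnegSubspace (pairForm a b Q z)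
      (LinearMap.range ((Mb : E →ₗ[ℂ] E).prod (Nb : E →ₗ[ℂ] E)))) {w : E}
    (hw : ∀ x, (inner ℂ w (diffOp a b X z Mb Nb x) : ℂ) = 0) : w = 0 := by
  have P := h.pair z hz
  have hG := P.unit 0 P.zero_mem
  set η := Ring.inverse (opRe (Q 0)) w with hη
  have hGη : opRe (Q 0) η = w := DFunLike.congr_fun (Ring.mul_inverse_cancel _ hG) w
  obtain ⟨c, hc, hpos⟩ := h.exists_le_pairForm_conj hz
  have key : ∀ t ∈ Icc a b, ∀ x, (inner ℂ (X (conj z) t η) (opRe (Q t) x) : ℂ)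
      = inner ℂ w (Ring.inverse (X z t) x) := fun t ht x => by
    have e := P.adjoint_mul_mul ht
    have e2 : ContinuousLinearMap.adjoint (X (conj z) t) (opRe (Q t) (X z t (Ring.inverse (X z t) x)))
        = opRe (Q 0) (Ring.inverse (X z t) x) := DFunLike.congr_fun e _
    rw [h.X_mul_inverse hz ht] at e2
    rw [← ContinuousLinearMap.adjoint_inner_right, e2, ← inner_opRe_left, hGη]
  have horth : ∀ s ∈ LinearMap.range ((Mb : E →ₗ[ℂ] E).prod (Nb : E →ₗ[ℂ] E)),
      (inner ℂ (X (conj z) a η) (opRe (Q a) s.1) : ℂ)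
        = inner ℂ (X (conj z) b η) (opRe (Q b) s.2) := by
    rintro _ ⟨x, rfl⟩
    rw [key a (h.left_mem hz), key b (h.right_mem hz), ← sub_eq_zero, ← inner_sub_right]
    exact hw x
  have hp := hpos η
  have hmem := hS.mem_of_orthogonal (p := (X (conj z) a η, X (conj z) b η))
    (le_trans (by positivity) hp) horth
  have h0 := horth _ hmem
  have hz0 : pairForm a b Q z (X (conj z) a η, X (conj z) b η) = 0 := by
    unfold pairForm bdryForm₁
    dsimp only at h0 ⊢
    rw [h0, sub_self, mul_zero]
  rw [hz0] at hp
  have : ‖η‖ ^ 2 = 0 := le_antisymm (by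
    by_contra hne
    push Not at hne
    nlinarith) (sq_nonneg _)
  have hη0 : η = 0 := norm_eq_zero.1 (pow_eq_zero_iff two_ne_zero |>.1 this)
  rw [← hGη, hη0, map_zero]

theorem isUnit_diffOp (h : IsNevSystem a b Q H X) {z : ℂ} (hz : z.im ≠ 0)
    {Mb Nb : E →L[ℂ] E} (hn : ∀ x, x ≠ 0 → 0 < ‖Mb x‖ + ‖Nb x‖)
    (hS : IsMaxNonnegSubspace (pairForm a b Q z)
      (LinearMap.range ((Mb : E →ₗ[ℂ] E).prod (Nb : E →ₗ[ℂ] E)))) :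
    IsUnit (diffOp a b X z Mb Nb) := by
  obtain ⟨C, hC, hK⟩ := h.exists_norm_le_diffOp hz hn hS
  rw [ContinuousLinearMap.isUnit_iff_bijective,
    ContinuousLinearMap.bijective_iff_dense_range_and_antilipschitz]
  refine ⟨?_, ⟨C, hC⟩, AddMonoidHomClass.antilipschitz_of_bound _ hK⟩
  rw [Submodule.topologicalClosure_eq_top_iff, Submodule.eq_bot_iff]
  intro w hw
  refine h.diffOp_orthogonal hz hS fun x => ?_
  have : (inner ℂ (diffOp a b X z Mb Nb x) w : ℂ) = 0 :=
    (Submodule.mem_orthogonal _ w).1 hw _ ⟨x, rfl⟩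
  rw [← inner_conj_symm, this, map_zero]

end IsNevSystem

end BdryPairs

/-! ### The characteristic operator of a boundary pair -/

section CharOps

variable {E : Type*} [NormedAddCommGroup E] [InnerProductSpace ℂ E] [CompleteSpace E] {a b : ℝ}
  {Q : ℝ → E →L[ℂ] E} {H X : ℂ → ℝ → E →L[ℂ] E}

/-- The operator `(i Re Q(0))⁻¹`. -/
def jumpOp (Q : ℝ → E →L[ℂ] E) : E →L[ℂ] E := Ring.inverse (Complex.I • opRe (Q 0))

/-- `-½ (X(a)⁻¹ 𝓜 + X(b)⁻¹ 𝓝) (X(a)⁻¹ 𝓜 - X(b)⁻¹ 𝓝)⁻¹ (i Re Q(0))⁻¹`. -/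
def charOpOf (a b : ℝ) (Q : ℝ → E →L[ℂ] E) (X : ℂ → ℝ → E →L[ℂ] E) (Mb Nb : ℂ → E →L[ℂ] E)
    (z : ℂ) : E →L[ℂ] E :=
  (-(1 / 2) : ℂ) • ((Ring.inverse (X z a) * Mb z + Ring.inverse (X z b) * Nb z)
    * Ring.inverse (diffOp a b X z (Mb z) (Nb z)) * jumpOp Q)

/-- The conditions on the pair `𝓜_z`, `𝓝_z`. -/
structure IsBdryFamily (a b : ℝ) (Q : ℝ → E →L[ℂ] E) (Mb Nb : ℂ → E →L[ℂ] E) : Prop where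
  analytic_left : DifferentiableOn ℂ Mb {z | z.im ≠ 0}
  analytic_right : DifferentiableOn ℂ Nb {z | z.im ≠ 0}
  symm : ∀ z : ℂ, z.im ≠ 0 → ContinuousLinearMap.adjoint (Mb (conj z)) * opRe (Q a) * Mb z
    = ContinuousLinearMap.adjoint (Nb (conj z)) * opRe (Q b) * Nb z
  nondegenerate : ∀ z : ℂ, z.im ≠ 0 → ∀ h : E, h ≠ 0 → 0 < ‖Mb z h‖ + ‖Nb z h‖
  maxNonneg : ∀ z : ℂ, z.im ≠ 0 → IsMaxNonnegSubspace (pairForm a b Q z)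
    (LinearMap.range ((Mb z : E →ₗ[ℂ] E).prod (Nb z : E →ₗ[ℂ] E)))

/-- Insert `1 = (A - B)K⁻¹` in front of `J`: the halves combine and only `A` survives; with the
opposite sign only `B` does. -/
theorem half_mul_cancel_left {A B Ki J : E →L[ℂ] E} (hK : (A - B) * Ki = 1) :
    (-(1 / 2) : ℂ) • ((A + B) * Ki * J) - (1 / 2 : ℂ) • J = -(A * Ki * J) := by
  have : (1 / 2 : ℂ) • J = (1 / 2 : ℂ) • ((A - B) * Ki * J) := by rw [hK, one_mul]
  rw [this, add_mul, sub_mul, add_mul, sub_mul]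
  module

theorem half_mul_cancel_right {A B Ki J : E →L[ℂ] E} (hK : (A - B) * Ki = 1) :
    (-(1 / 2) : ℂ) • ((A + B) * Ki * J) + (1 / 2 : ℂ) • J = -(B * Ki * J) := by
  have : (1 / 2 : ℂ) • J = (1 / 2 : ℂ) • ((A - B) * Ki * J) := by rw [hK, one_mul]
  rw [this, add_mul, sub_mul, add_mul, sub_mul]
  module

theorem isUnit_I_smul {g : E →L[ℂ] E} (hg : IsUnit g) : IsUnit (Complex.I • g) :=
  hg.smul (Units.mk0 Complex.I Complex.I_ne_zero)

theorem jumpOp_eq (hg : IsUnit (opRe (Q 0))) :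
    jumpOp Q = (-Complex.I) • Ring.inverse (opRe (Q 0)) := by
  have h1 : (Complex.I • opRe (Q 0)) * ((-Complex.I) • Ring.inverse (opRe (Q 0))) = 1 := by
    rw [smul_mul_smul_comm, Ring.mul_inverse_cancel _ hg]
    simp
  have h2 := Ring.inverse_mul_cancel _ (isUnit_I_smul hg)
  exact left_inv_eq_right_inv h2 h1

theorem adjoint_jumpOp (hg : IsUnit (opRe (Q 0))) :
    ContinuousLinearMap.adjoint (jumpOp Q) = -jumpOp Q := by
  rw [jumpOp_eq hg, OpExpr.adjoint_smul', OpExpr.adjoint_ringInverse, adjoint_opRe]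
  simp

/-- A Cayley-type argument: if `A'* g A = B'* g B`, then expansion gives `(A' - B')* g (-(A + B)) =
(A' + B')* g (A - B)`, both sides keeping just the mixed terms. Dividing by the invertible factors
gives the symmetry. -/
theorem charOp_symm_aux {A B A' B' g : E →L[ℂ] E} (hg : IsUnit g)
    (hgs : ContinuousLinearMap.adjoint g = g) (hK : IsUnit (A - B)) (hK' : IsUnit (A' - B'))
    (h : ContinuousLinearMap.adjoint A' * g * A = ContinuousLinearMap.adjoint B' * g * B) :
    -((A + B) * Ring.inverse (A - B) * Ring.inverse g)
      = ContinuousLinearMap.adjoint ((A' + B') * Ring.inverse (A' - B') * Ring.inverse g) := by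
  rw [OpExpr.adjoint_mul', OpExpr.adjoint_mul', OpExpr.adjoint_ringInverse,
    OpExpr.adjoint_ringInverse, hgs]
  have hKs : IsUnit (ContinuousLinearMap.adjoint (A' - B')) := by
    have := hK'.star
    rwa [ContinuousLinearMap.star_eq_adjoint] at this
  have key : ContinuousLinearMap.adjoint (A' - B') * (g * -(A + B))
      = ContinuousLinearMap.adjoint (A' + B') * (g * (A - B)) := by
    rw [map_sub, map_add]
    rw [mul_assoc, mul_assoc] at h
    simp only [mul_neg, mul_add, mul_sub, sub_mul, add_mul, h]
    abel
  calc -((A + B) * Ring.inverse (A - B) * Ring.inverse g)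
      = Ring.inverse g * (Ring.inverse (ContinuousLinearMap.adjoint (A' - B'))
          * (ContinuousLinearMap.adjoint (A' - B') * (g * -(A + B)))
            * Ring.inverse (A - B) * Ring.inverse g) := by
        rw [Ring.inverse_mul_cancel_left _ _ hKs, mul_assoc g, mul_assoc g,
          Ring.inverse_mul_cancel_left _ _ hg, neg_mul, neg_mul]
    _ = _ := by
        rw [key, mul_assoc, mul_assoc, mul_assoc, mul_assoc, Ring.mul_inverse_cancel_left _ _ hK,
          Ring.mul_inverse_cancel _ hg, mul_one]

namespace IsNevSystem

theorem isUnit_X (h : IsNevSystem a b Q H X) {z : ℂ} (hz : z.im ≠ 0) {t : ℝ}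
    (ht : t ∈ Icc a b) : IsUnit (X z t) := (h.pair z hz).isUnit ht

theorem isUnit_opRe_zero (h : IsNevSystem a b Q H X) : IsUnit (opRe (Q 0)) :=
  let P := h.pair Complex.I (by simp)
  P.unit 0 P.zero_mem

theorem differentiableAt_inverse_X (h : IsNevSystem a b Q H X) {z : ℂ} (hz : z.im ≠ 0) {t : ℝ}
    (ht : t ∈ Icc a b) : DifferentiableAt ℂ (fun z => Ring.inverse (X z t)) z :=
  DifferentiableAt.comp (g := Ring.inverse) (f := fun z => X z t) z
    (differentiableAt_inverse (𝕜 := ℂ) (h.isUnit_X hz ht)) (h.differentiableAt_X ht hz)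

variable {Mb Nb : ℂ → E →L[ℂ] E}

theorem isUnit_diffOp_family (h : IsNevSystem a b Q H X) (hb : IsBdryFamily a b Q Mb Nb) {z : ℂ}
    (hz : z.im ≠ 0) : IsUnit (diffOp a b X z (Mb z) (Nb z)) :=
  h.isUnit_diffOp hz (hb.nondegenerate z hz) (hb.maxNonneg z hz)

theorem isOpen_nonreal : IsOpen {z : ℂ | z.im ≠ 0} :=
  isOpen_ne_fun Complex.continuous_im continuous_const

theorem differentiableOn_charOpOf (h : IsNevSystem a b Q H X) (hb : IsBdryFamily a b Q Mb Nb) :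
    DifferentiableOn ℂ (charOpOf a b Q X Mb Nb) {z | z.im ≠ 0} := fun z hz => by
  have hA : DifferentiableAt ℂ (fun z => Ring.inverse (X z a) * Mb z) z :=
    (h.differentiableAt_inverse_X hz (h.left_mem hz)).mul
      (hb.analytic_left.differentiableAt (isOpen_nonreal.mem_nhds hz))
  have hB : DifferentiableAt ℂ (fun z => Ring.inverse (X z b) * Nb z) z :=
    (h.differentiableAt_inverse_X hz (h.right_mem hz)).mul
      (hb.analytic_right.differentiableAt (isOpen_nonreal.mem_nhds hz))
  have hK : DifferentiableAt ℂ (fun z => Ring.inverse (diffOp a b X z (Mb z) (Nb z))) z :=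
    DifferentiableAt.comp (g := Ring.inverse) (f := fun z => diffOp a b X z (Mb z) (Nb z)) z
      (differentiableAt_inverse (𝕜 := ℂ) (h.isUnit_diffOp_family hb hz)) (hA.sub hB)
  exact (DifferentiableAt.fun_const_smul (((hA.add hB).mul hK).mul_const (jumpOp Q))
    (-(1 / 2) : ℂ)).differentiableWithinAt

/-- The identity `X_{conj z}(t)* Re Q(t) X_z(t) = Re Q(0)` moves the symmetry condition of the
boundary pair from the end points to `0`. -/
theorem adjoint_inverse_mul (h : IsNevSystem a b Q H X) {z : ℂ} (hz : z.im ≠ 0) {t : ℝ}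
    (ht : t ∈ Icc a b) (A A' : E →L[ℂ] E) :
    ContinuousLinearMap.adjoint (Ring.inverse (X (conj z) t) * A') * opRe (Q 0)
        * (Ring.inverse (X z t) * A)
      = ContinuousLinearMap.adjoint A' * opRe (Q t) * A := by
  rw [← (h.pair z hz).adjoint_mul_mul ht]
  have e1 : X z t * (Ring.inverse (X z t) * A) = A :=
    Ring.mul_inverse_cancel_left _ _ (h.isUnit_X hz ht)
  have e2 : ContinuousLinearMap.adjoint (Ring.inverse (X (conj z) t) * A')
      * ContinuousLinearMap.adjoint (X (conj z) t) = ContinuousLinearMap.adjoint A' := by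
    rw [← OpExpr.adjoint_mul', Ring.mul_inverse_cancel_left _ _
      (h.isUnit_X (im_conj_ne_zero hz) ht)]
  rw [mul_assoc, mul_assoc (ContinuousLinearMap.adjoint (X (conj z) t) * opRe (Q t)), e1,
    mul_assoc, ← mul_assoc, e2, mul_assoc]

theorem charOpOf_symm (h : IsNevSystem a b Q H X) (hb : IsBdryFamily a b Q Mb Nb) {z : ℂ}
    (hz : z.im ≠ 0) :
    charOpOf a b Q X Mb Nb z = ContinuousLinearMap.adjoint (charOpOf a b Q X Mb Nb (conj z)) := by
  have hg := h.isUnit_opRe_zero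
  have key := charOp_symm_aux hg (adjoint_opRe _) (h.isUnit_diffOp_family hb hz)
    (h.isUnit_diffOp_family hb (im_conj_ne_zero hz)) (by
      rw [h.adjoint_inverse_mul hz (h.left_mem hz), h.adjoint_inverse_mul hz (h.right_mem hz),
        hb.symm z hz])
  unfold charOpOf
  rw [jumpOp_eq hg, mul_smul_comm, mul_smul_comm, OpExpr.adjoint_smul', OpExpr.adjoint_smul']
  unfold diffOp
  rw [← key]
  simp [Complex.conj_ofNat]

/-- The initial constants of the kernel solution are `-X(a)⁻¹𝓜 K⁻¹J v`, so its value at `a` is `𝓜h`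
with `h = -K⁻¹J v`. The same `h` occurs at `b`, and this is the boundary condition. -/
theorem charOpOf_left (h : IsNevSystem a b Q H X) (hb : IsBdryFamily a b Q Mb Nb) {z : ℂ}
    (hz : z.im ≠ 0) (v : E) :
    X z a ((charOpOf a b Q X Mb Nb z - (1 / 2 : ℂ) • jumpOp Q) v)
      = Mb z (-(Ring.inverse (diffOp a b X z (Mb z) (Nb z)) (jumpOp Q v))) := by
  have := Ring.mul_inverse_cancel _ (h.isUnit_diffOp_family hb hz)
  rw [charOpOf, half_mul_cancel_left this]
  have e : (-(Ring.inverse (X z a) * Mb z * Ring.inverse (diffOp a b X z (Mb z) (Nb z))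
      * jumpOp Q)) v = -(Ring.inverse (X z a)
        (Mb z (Ring.inverse (diffOp a b X z (Mb z) (Nb z)) (jumpOp Q v)))) := rfl
  rw [e, map_neg, map_neg, h.X_mul_inverse hz (h.left_mem hz)]

theorem charOpOf_right (h : IsNevSystem a b Q H X) (hb : IsBdryFamily a b Q Mb Nb) {z : ℂ}
    (hz : z.im ≠ 0) (v : E) :
    X z b ((charOpOf a b Q X Mb Nb z + (1 / 2 : ℂ) • jumpOp Q) v)
      = Nb z (-(Ring.inverse (diffOp a b X z (Mb z) (Nb z)) (jumpOp Q v))) := by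
  have := Ring.mul_inverse_cancel _ (h.isUnit_diffOp_family hb hz)
  rw [charOpOf, half_mul_cancel_right this]
  have e : (-(Ring.inverse (X z b) * Nb z * Ring.inverse (diffOp a b X z (Mb z) (Nb z))
      * jumpOp Q)) v = -(Ring.inverse (X z b)
        (Nb z (Ring.inverse (diffOp a b X z (Mb z) (Nb z)) (jumpOp Q v)))) := rfl
  rw [e, map_neg, map_neg, h.X_mul_inverse hz (h.right_mem hz)]

/-- The boundary values of a solution determine its constants. -/
theorem const_of_bdry (h : IsNevSystem a b Q H X) (hb : IsBdryFamily a b Q Mb Nb) {z : ℂ}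
    (hz : z.im ≠ 0) {ξ v x : E} (ha : X z a ξ = Mb z x) (hbb : X z b (ξ + jumpOp Q v) = Nb z x) :
    ξ = (charOpOf a b Q X Mb Nb z - (1 / 2 : ℂ) • jumpOp Q) v := by
  have inj : ∀ {t : ℝ} (_ : t ∈ Icc a b) {x y : E}, X z t x = y → x = Ring.inverse (X z t) y :=
    fun ht x y hxy => by
      have := DFunLike.congr_fun (Ring.inverse_mul_cancel _ (h.isUnit_X hz ht)) x
      rw [← hxy]
      exact this.symm
  have e1 := inj (h.left_mem hz) ha
  have e2 := inj (h.right_mem hz) hbb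
  have e3 : diffOp a b X z (Mb z) (Nb z) x = -jumpOp Q v := by
    have : diffOp a b X z (Mb z) (Nb z) x
        = Ring.inverse (X z a) (Mb z x) - Ring.inverse (X z b) (Nb z x) := rfl
    rw [this, ← e1, ← e2]
    abel
  have hK := h.isUnit_diffOp_family hb hz
  have e4 : x = -(Ring.inverse (diffOp a b X z (Mb z) (Nb z)) (jumpOp Q v)) := by
    have := DFunLike.congr_fun (Ring.inverse_mul_cancel _ hK) x
    rw [← map_neg, ← e3]
    exact this.symm
  have e5 := inj (h.left_mem hz) (h.charOpOf_left hb hz v)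
  rw [e5, ← e4]
  exact e1

end IsNevSystem

end CharOps

/-! ### The kernel integral as a solution by variation of constants -/

section Kernels

variable {E : Type*} [NormedAddCommGroup E] [InnerProductSpace ℂ E] [CompleteSpace E] {a b : ℝ}
  {Q : ℝ → E →L[ℂ] E} {H X : ℂ → ℝ → E →L[ℂ] E}

/-- The kernel `X_z(t) {M - ½ sgn(s - t) (i Re Q(0))⁻¹} X_{conj z}(s)*`. -/
def kernelOp (Q : ℝ → E →L[ℂ] E) (X : ℂ → ℝ → E →L[ℂ] E) (M : E →L[ℂ] E) (z : ℂ) (t s : ℝ) :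
    E →L[ℂ] E :=
  X z t * (M - ((1 / 2 * Real.sign (s - t) : ℝ) : ℂ) • jumpOp Q)
    * ContinuousLinearMap.adjoint (X (conj z) s)

/-- The function `t ↦ X_z(t) [(M - ½ J) ∫ X_{conj z}* g + J ∫_a^t X_{conj z}* g]`. -/
def kernelSol (a b : ℝ) (Q : ℝ → E →L[ℂ] E) (X : ℂ → ℝ → E →L[ℂ] E) (M : E →L[ℂ] E) (z : ℂ)
    (g : ℝ → E) (t : ℝ) : E :=
  X z t ((M - (1 / 2 : ℂ) • jumpOp Q)
      (∫ s in a..b, ContinuousLinearMap.adjoint (X (conj z) s) (g s))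
    + jumpOp Q (∫ s in a..t, ContinuousLinearMap.adjoint (X (conj z) s) (g s)))

namespace IsNevSystem

theorem intervalIntegrable_adjoint (h : IsNevSystem a b Q H X) {z : ℂ} (hz : z.im ≠ 0)
    {g : ℝ → E} (hg : IntegrableOn g (Icc a b)) :
    IntegrableOn (fun s => ContinuousLinearMap.adjoint (X (conj z) s) (g s)) (Icc a b) := by
  obtain ⟨C, hC, hY⟩ := exists_norm_le_of_continuousOn (h.pair z hz).continuousOn_adjoint
  refine (hg.norm.const_mul C).mono' ?_ ?_
  · have h1 := (h.pair z hz).continuousOn_adjoint.aestronglyMeasurable measurableSet_Icc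
      (μ := volume)
    exact isBoundedBilinearMap_apply.continuous.comp_aestronglyMeasurable
      (h1.prodMk hg.aestronglyMeasurable)
  · refine (ae_restrict_iff' measurableSet_Icc).2 (.of_forall fun s hs => ?_)
    exact (ContinuousLinearMap.le_opNorm _ _).trans
      (mul_le_mul_of_nonneg_right (hY s hs) (norm_nonneg _))

theorem integral_kernelOp (h : IsNevSystem a b Q H X) {z : ℂ} (hz : z.im ≠ 0) {g : ℝ → E}
    (hg : IntegrableOn g (Icc a b)) (M : E →L[ℂ] E) {t : ℝ} (ht : t ∈ Icc a b) :
    ∫ s in a..b, kernelOp Q X M z t s (g s) = kernelSol a b Q X M z g t := by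
  have hi := h.intervalIntegrable_adjoint hz hg
  set v : ℝ → E := fun s => ContinuousLinearMap.adjoint (X (conj z) s) (g s) with hv
  have i1 : IntervalIntegrable v volume a t :=
    (intervalIntegrable_iff_integrableOn_Icc_of_le ht.1).2 (hi.mono_set (Icc_subset_Icc_right ht.2))
  have i2 : IntervalIntegrable v volume t b :=
    (intervalIntegrable_iff_integrableOn_Icc_of_le ht.2).2 (hi.mono_set (Icc_subset_Icc_left ht.1))
  set A₁ : E →L[ℂ] E := X z t * (M + (1 / 2 : ℂ) • jumpOp Q) with hA₁
  set A₂ : E →L[ℂ] E := X z t * (M - (1 / 2 : ℂ) • jumpOp Q) with hA₂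
  -- To the left of `t` the sign is `-1`; at `s = t` it is `0`, a null set, hence the equality only
  -- almost everywhere.
  have e1 : ∀ᵐ s, s ∈ uIoc a t → A₁ (v s) = kernelOp Q X M z t s (g s) := by
    have hne : ∀ᵐ s : ℝ, s ≠ t := by simp [ae_iff, measure_singleton]
    filter_upwards [hne] with s hs hst
    rw [uIoc_of_le ht.1] at hst
    have : Real.sign (s - t) = -1 := Real.sign_of_neg (sub_neg.2 (lt_of_le_of_ne hst.2 hs))
    have e : (M - ((1 / 2 * Real.sign (s - t) : ℝ) : ℂ) • jumpOp Q)
        = M + (1 / 2 : ℂ) • jumpOp Q := by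
      rw [this]
      push_cast
      module
    unfold kernelOp
    rw [e]
    rfl
  have e2 : ∀ s ∈ uIoc t b, A₂ (v s) = kernelOp Q X M z t s (g s) := fun s hst => by
    rw [uIoc_of_le ht.2] at hst
    have : Real.sign (s - t) = 1 := Real.sign_of_pos (sub_pos.2 hst.1)
    have e : (M - ((1 / 2 * Real.sign (s - t) : ℝ) : ℂ) • jumpOp Q)
        = M - (1 / 2 : ℂ) • jumpOp Q := by
      rw [this]
      push_cast
      module
    unfold kernelOp
    rw [e]
    rfl
  have j1 : IntervalIntegrable (fun s => A₁ (v s)) volume a t :=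
    ⟨A₁.integrable_comp i1.1, A₁.integrable_comp i1.2⟩
  have j2 : IntervalIntegrable (fun s => A₂ (v s)) volume t b :=
    ⟨A₂.integrable_comp i2.1, A₂.integrable_comp i2.2⟩
  have k1 := j1.congr_ae ((ae_restrict_iff' measurableSet_uIoc).2 e1)
  have k2 := j2.congr_ae ((ae_restrict_iff' measurableSet_uIoc).2 (.of_forall e2))
  have l1 : ∫ s in a..t, A₁ (v s) = A₁ (∫ s in a..t, v s) :=
    A₁.intervalIntegral_comp_comm i1
  have l2 : ∫ s in t..b, A₂ (v s) = A₂ (∫ s in t..b, v s) :=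
    A₂.intervalIntegral_comp_comm i2
  rw [← intervalIntegral.integral_add_adjacent_intervals k1 k2,
    ← intervalIntegral.integral_congr_ae e1, ← intervalIntegral.integral_congr_ae (.of_forall e2),
    l1, l2, kernelSol, ← intervalIntegral.integral_add_adjacent_intervals i1 i2]
  rw [hA₁, hA₂]
  simp only [mul_apply_eq_comp, ← map_add]
  congr 1
  simp only [add_apply, sub_apply, map_add, smul_apply]
  module

theorem kernelSol_left (M : E →L[ℂ] E) (z : ℂ) (g : ℝ → E) :
    kernelSol a b Q X M z g a = X z a ((M - (1 / 2 : ℂ) • jumpOp Q)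
      (∫ s in a..b, ContinuousLinearMap.adjoint (X (conj z) s) (g s))) := by
  rw [kernelSol, intervalIntegral.integral_same, map_zero, add_zero]

theorem kernelSol_right (M : E →L[ℂ] E) (z : ℂ) (g : ℝ → E) :
    kernelSol a b Q X M z g b = X z b ((M + (1 / 2 : ℂ) • jumpOp Q)
      (∫ s in a..b, ContinuousLinearMap.adjoint (X (conj z) s) (g s))) := by
  rw [kernelSol]
  congr 1
  simp only [add_apply, sub_apply, smul_apply]
  module

theorem continuousOn_kernelSol (h : IsNevSystem a b Q H X) {z : ℂ} (hz : z.im ≠ 0) {g : ℝ → E}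
    (hg : IntegrableOn g (Icc a b)) (M : E →L[ℂ] E) :
    ContinuousOn (kernelSol a b Q X M z g) (Icc a b) := by
  have hi := h.intervalIntegrable_adjoint hz hg
  have := intervalIntegral.continuousOn_primitive_interval (a := a) (b := b) (μ := volume)
    (f := fun s => ContinuousLinearMap.adjoint (X (conj z) s) (g s))
    (by rwa [uIcc_of_le (h.pair z hz).lt.le])
  rw [uIcc_of_le (h.pair z hz).lt.le] at this
  exact (h.pair z hz).continuousOn_left.clm_apply
    (continuousOn_const.add ((jumpOp Q).continuous.comp_continuousOn this))

theorem hasDerivWithinAt_kernelSol (h : IsNevSystem a b Q H X) {z : ℂ} (hz : z.im ≠ 0)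
    {g : ℝ → E} (hg : ContinuousOn g (Icc a b)) (M : E →L[ℂ] E) :
    ∃ x' : ℝ → E,
      (∀ t ∈ Icc a b, HasDerivWithinAt (kernelSol a b Q X M z g) (x' t) (Icc a b) t) ∧
      ∀ t ∈ Icc a b, sysLHS (Q t) (derivWithin Q (Icc a b) t) (H z t)
        (kernelSol a b Q X M z g t) (x' t) = g t :=
  (h.pair z hz).variation hg _ fun _ _ => rfl

/-- The solutions of the inhomogeneous system. -/
theorem eq_of_system (h : IsNevSystem a b Q H X) {z : ℂ} (hz : z.im ≠ 0) {g x x' : ℝ → E}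
    (hg : ContinuousOn g (Icc a b))
    (hx : ∀ t ∈ Icc a b, HasDerivWithinAt x (x' t) (Icc a b) t)
    (ex : ∀ t ∈ Icc a b, sysLHS (Q t) (derivWithin Q (Icc a b) t) (H z t) (x t) (x' t) = g t) :
    ∃ ξ, ∀ t ∈ Icc a b, x t = X z t (ξ
      + jumpOp Q (∫ s in a..t, ContinuousLinearMap.adjoint (X (conj z) s) (g s))) := by
  set e : ℝ → E := fun t => X z t (0
    + jumpOp Q (∫ s in a..t, ContinuousLinearMap.adjoint (X (conj z) s) (g s))) with he
  obtain ⟨e', de, ee⟩ := (h.pair z hz).variation hg 0 (x := e) fun t _ => rfl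
  refine ⟨x 0 - e 0, fun t ht => ?_⟩
  have key : x t - e t = X z t (x 0 - e 0) :=
    (h.pair z hz).eq_apply_zero (x := fun t => x t - e t) (x' := fun t => x' t - e' t)
      (fun t ht => (hx t ht).sub (de t ht))
      (fun t ht => by rw [sysLHS_sub, ex t ht, ee t ht, sub_self]) ht
  rw [map_add, ← key, he]
  simp only [zero_add, sub_add_cancel]

/-- The solutions of the inhomogeneous system that satisfy the boundary conditions. -/
theorem eq_kernelSol_of_bdry (h : IsNevSystem a b Q H X) {Mb Nb : ℂ → E →L[ℂ] E}
    (hb : IsBdryFamily a b Q Mb Nb) {z : ℂ} (hz : z.im ≠ 0) {g x x' : ℝ → E}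
    (hg : ContinuousOn g (Icc a b))
    (hx : ∀ t ∈ Icc a b, HasDerivWithinAt x (x' t) (Icc a b) t)
    (ex : ∀ t ∈ Icc a b, sysLHS (Q t) (derivWithin Q (Icc a b) t) (H z t) (x t) (x' t) = g t)
    {η : E} (ha : x a = Mb z η) (hbb : x b = Nb z η) {t : ℝ} (ht : t ∈ Icc a b) :
    x t = kernelSol a b Q X (charOpOf a b Q X Mb Nb z) z g t := by
  obtain ⟨ξ, hξ⟩ := h.eq_of_system hz hg hx ex
  have e1 := hξ a (h.left_mem hz)
  rw [intervalIntegral.integral_same, map_zero, add_zero] at e1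
  have e2 := h.const_of_bdry hb hz (e1.symm.trans ha) ((hξ b (h.right_mem hz)).symm.trans hbb)
  rw [hξ t ht, e2, kernelSol]

theorem kernelSol_bdry (h : IsNevSystem a b Q H X) {Mb Nb : ℂ → E →L[ℂ] E}
    (hb : IsBdryFamily a b Q Mb Nb) {z : ℂ} (hz : z.im ≠ 0) (g : ℝ → E) :
    ∃ η, kernelSol a b Q X (charOpOf a b Q X Mb Nb z) z g a = Mb z η ∧
      kernelSol a b Q X (charOpOf a b Q X Mb Nb z) z g b = Nb z η := by
  exact ⟨_, (kernelSol_left _ z g).trans (h.charOpOf_left hb hz _),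
    (kernelSol_right _ z g).trans (h.charOpOf_right hb hz _)⟩

theorem continuousOn_bdryForm₁ (hQ : ContinuousOn Q (Icc a b)) {x : ℝ → E}
    (hx : ContinuousOn x (Icc a b)) : ContinuousOn (fun t => bdryForm₁ Q t (x t)) (Icc a b) :=
  Complex.continuous_re.comp_continuousOn
    (hx.inner (𝕜 := ℂ) ((continuousOn_opRe hQ).clm_apply hx))

theorem tendsto_bdry {f : ℝ → ℝ} (hab : a < b) (hf : ContinuousOn f (Icc a b)) (c : ℝ) :
    Tendsto (fun e : ℝ × ℝ => c * (f e.2 - f e.1)) (𝓝[>] a ×ˢ 𝓝[<] b) (𝓝 (c * (f b - f a))) := by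
  have h1 : Tendsto f (𝓝[>] a) (𝓝 (f a)) := by
    rw [← nhdsWithin_Ioo_eq_nhdsGT hab]
    exact (hf a ⟨le_rfl, hab.le⟩).mono_left (nhdsWithin_mono _ Ioo_subset_Icc_self)
  have h2 : Tendsto f (𝓝[<] b) (𝓝 (f b)) := by
    rw [← nhdsWithin_Ioo_eq_nhdsLT hab]
    exact (hf b ⟨hab.le, le_rfl⟩).mono_left (nhdsWithin_mono _ Ioo_subset_Icc_self)
  exact ((h2.comp tendsto_snd).sub (h1.comp tendsto_fst)).const_mul c

theorem nevWeight_conj (h : IsNevSystem a b Q H X) {z : ℂ} (hz : z.im ≠ 0) {t : ℝ}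
    (ht : t ∈ Icc a b) : nevWeight H (conj z) t = nevWeight H z t := by
  unfold nevWeight opIm
  rw [h.adj _ (im_conj_ne_zero hz) t ht, Complex.conj_conj, ← h.adj z hz t ht, Complex.conj_im,
    ← neg_sub (H z t), smul_neg, Complex.ofReal_neg, inv_neg, neg_smul, smul_neg, neg_neg]

/-- `‖WF‖ ≤ 1 + ‖WF‖²`, and `‖WF‖²` is at most `4‖W‖ (WF, F)` with `W` bounded on the compact
interval. `F` itself need not be integrable. -/
theorem integrableOn_nevWeight (h : IsNevSystem a b Q H X) {z : ℂ} (hz : z.im ≠ 0) {F : ℝ → E}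
    (hm : AEStronglyMeasurable F (volume.restrict (Icc a b)))
    (hF : IntegrableOn (fun t => (inner ℂ (F t) (nevWeight H z t (F t)) : ℂ).re) (Icc a b)) :
    IntegrableOn (fun t => nevWeight H z t (F t)) (Icc a b) := by
  obtain ⟨C, hC, hW⟩ := exists_norm_le_of_continuousOn (h.continuousOn_nevWeight hz)
  have hc : IntegrableOn (fun _ : ℝ => (1 : ℝ)) (Icc a b) := integrableOn_const (by simp)
  refine (hc.add (hF.const_mul (4 * C))).mono' ?_ ?_
  · have h1 := (h.continuousOn_nevWeight hz).aestronglyMeasurable measurableSet_Icc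
      (μ := volume)
    exact isBoundedBilinearMap_apply.continuous.comp_aestronglyMeasurable (h1.prodMk hm)
  · refine (ae_restrict_iff' measurableSet_Icc).2 (.of_forall fun t ht => ?_)
    have h1 := norm_sq_apply_le_of_nonneg (nevWeight H z t) (h.nonneg z hz t ht)
      (fun x => by rw [inner_nevWeight, Complex.ofReal_im]) (F t)
    have h2 := h.nonneg z hz t ht (F t)
    have h3 : 4 * ‖nevWeight H z t‖ * (inner ℂ (F t) (nevWeight H z t (F t)) : ℂ).re
        ≤ 4 * C * (inner ℂ (F t) (nevWeight H z t (F t)) : ℂ).re := by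
      gcongr
      exact hW t ht
    have h4 : ‖nevWeight H z t (F t)‖ ≤ 1 + ‖nevWeight H z t (F t)‖ ^ 2 := by
      nlinarith [sq_nonneg (‖nevWeight H z t (F t)‖ - 1), norm_nonneg (nevWeight H z t (F t))]
    exact h4.trans (by simpa using h1.trans h3)

end IsNevSystem

end Kernels

/-! ### The boundary pair of a characteristic operator -/

section Converse

variable {E : Type*} [NormedAddCommGroup E] [InnerProductSpace ℂ E] [CompleteSpace E] {a b : ℝ}
  {Q : ℝ → E →L[ℂ] E} {H X : ℂ → ℝ → E →L[ℂ] E}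

namespace IsNevSystem

/-- The operator `X_{conj z}* W_z X_{conj z}`. -/
def energyOp (H X : ℂ → ℝ → E →L[ℂ] E) (z : ℂ) (s : ℝ) : E →L[ℂ] E :=
  ContinuousLinearMap.adjoint (X (conj z) s) * (nevWeight H z s * X (conj z) s)

theorem continuousOn_energyOp (h : IsNevSystem a b Q H X) {z : ℂ} (hz : z.im ≠ 0) :
    ContinuousOn (energyOp H X z) (Icc a b) :=
  (h.pair z hz).continuousOn_adjoint.mul
    ((h.continuousOn_nevWeight hz).mul (h.pair z hz).continuousOn_right)

theorem inner_energyOp (h : IsNevSystem a b Q H X) {z : ℂ} (hz : z.im ≠ 0) {s : ℝ}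
    (hs : s ∈ Icc a b) (u : E) :
    (inner ℂ u (energyOp H X z s u) : ℂ).re
      = (inner ℂ (X (conj z) s u) (nevWeight H (conj z) s (X (conj z) s u)) : ℂ).re := by
  rw [h.nevWeight_conj hz hs]
  have : energyOp H X z s u = ContinuousLinearMap.adjoint (X (conj z) s)
    (nevWeight H z s (X (conj z) s u)) := rfl
  rw [this, ContinuousLinearMap.adjoint_inner_right]

theorem re_inner_integral {P : ℝ → E →L[ℂ] E} {α β : ℝ} (hP : IntervalIntegrable P volume α β)
    (u : E) : (inner ℂ u ((∫ s in α..β, P s) u) : ℂ).re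
      = ∫ s in α..β, (inner ℂ u (P s u) : ℂ).re := by
  have h1 : IntervalIntegrable (fun s => P s u) volume α β :=
    ⟨(ContinuousLinearMap.apply ℂ E u).integrable_comp hP.1,
      (ContinuousLinearMap.apply ℂ E u).integrable_comp hP.2⟩
  have h2 : IntervalIntegrable (fun s => (inner ℂ u (P s u) : ℂ)) volume α β :=
    ⟨(innerSL ℂ u).integrable_comp h1.1, (innerSL ℂ u).integrable_comp h1.2⟩
  rw [ContinuousLinearMap.intervalIntegral_apply hP]
  have h3 : (inner ℂ u (∫ s in α..β, P s u) : ℂ) = ∫ s in α..β, (inner ℂ u (P s u) : ℂ) :=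
    ((innerSL ℂ u).intervalIntegral_comp_comm h1).symm
  rw [h3]
  exact (intervalIntegral.intervalIntegral_re (𝕜 := ℂ) h2).symm

/-- The definiteness condition also holds on a compact part of the open interval. -/
theorem exists_isUnit_integral (h : IsNevSystem a b Q H X) {z : ℂ} (hz : z.im ≠ 0) :
    ∃ α β : ℝ, a < α ∧ α ≤ β ∧ β < b ∧ IsUnit (∫ s in α..β, energyOp H X z s) := by
  have hab := (h.pair z hz).lt
  have hc := h.continuousOn_energyOp hz
  obtain ⟨C, hC, hb⟩ := exists_norm_le_of_continuousOn hc
  obtain ⟨δ, hδ, hd⟩ := h.definite (conj z) (im_conj_ne_zero hz)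
  have hba := sub_pos.2 hab
  -- Each removed end piece costs at most `Cε‖u‖²`. Since `4Cε ≤ δ`, at least `δ/2` remains of the
  -- definiteness constant, and `ε ≤ (b - a)/4` keeps the middle interval nondegenerate.
  set ε := min ((b - a) / 4) (δ / (4 * (C + 1))) with hε
  have hε0 : 0 < ε := lt_min (by positivity) (by positivity)
  have hε1 : ε ≤ (b - a) / 4 := min_le_left _ _
  have hε2 : 4 * C * ε ≤ δ := by
    have h1 : ε * (4 * (C + 1)) ≤ δ := (le_div_iff₀ (by positivity)).1 (min_le_right _ _)
    nlinarith
  have hi : ∀ {α β : ℝ}, a ≤ α → α ≤ β → β ≤ b →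
      IntervalIntegrable (energyOp H X z) volume α β := fun h1 h2 h3 => by
    refine ContinuousOn.intervalIntegrable ?_
    rw [uIcc_of_le h2]
    exact hc.mono (Icc_subset_Icc h1 h3)
  refine ⟨a + ε, b - ε, by linarith, by linarith, by linarith, ?_⟩
  refine ContinuousLinearMap.isUnit_of_forall_le_norm_inner_map _
    (c := ⟨δ / 2, by positivity⟩) (half_pos hδ) fun u => ?_
  rw [norm_inner_symm]
  refine le_trans ?_ ((le_abs_self _).trans (Complex.abs_re_le_norm _))
  rw [re_inner_integral (hi (by linarith) (by linarith) (by linarith))]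
  set f : ℝ → ℝ := fun s => (inner ℂ u (energyOp H X z s u) : ℂ).re with hf
  have hfc : ContinuousOn f (Icc a b) := Complex.continuous_re.comp_continuousOn
    (continuousOn_const.inner (𝕜 := ℂ) (hc.clm_apply continuousOn_const))
  have hfb : ∀ s ∈ Icc a b, ‖f s‖ ≤ C * ‖u‖ ^ 2 := fun s hs => by
    refine (Complex.abs_re_le_norm _).trans ((norm_inner_le_norm _ _).trans ?_)
    have := mul_le_mul_of_nonneg_left (((energyOp H X z s).le_opNorm u).trans
      (mul_le_mul_of_nonneg_right (hb s hs) (norm_nonneg u))) (norm_nonneg u)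
    linarith
  have fi : ∀ {α β : ℝ}, a ≤ α → α ≤ β → β ≤ b → IntervalIntegrable f volume α β :=
    fun h1 h2 h3 => by
      refine ContinuousOn.intervalIntegrable ?_
      rw [uIcc_of_le h2]
      exact hfc.mono (Icc_subset_Icc h1 h3)
  have e1 : δ * ‖u‖ ^ 2 ≤ ∫ s in a..b, f s := by
    refine (hd u).trans_eq (intervalIntegral.integral_congr fun s hs => ?_)
    rw [uIcc_of_le hab.le] at hs
    exact (h.inner_energyOp hz hs u).symm
  have e2 : (∫ s in a..(a + ε), f s) ≤ C * ‖u‖ ^ 2 * ε := by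
    refine (Real.le_norm_self _).trans ((intervalIntegral.norm_integral_le_of_norm_le_const
      (C := C * ‖u‖ ^ 2) fun s hs => ?_).trans_eq ?_)
    · rw [uIoc_of_le (by linarith)] at hs
      exact hfb s ⟨hs.1.le, by linarith [hs.2]⟩
    · rw [add_sub_cancel_left, abs_of_pos hε0]
  have e3 : (∫ s in (b - ε)..b, f s) ≤ C * ‖u‖ ^ 2 * ε := by
    refine (Real.le_norm_self _).trans ((intervalIntegral.norm_integral_le_of_norm_le_const
      (C := C * ‖u‖ ^ 2) fun s hs => ?_).trans_eq ?_)
    · rw [uIoc_of_le (by linarith)] at hs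
      exact hfb s ⟨by linarith [hs.1], hs.2⟩
    · rw [sub_sub_cancel, abs_of_pos hε0]
  have e4 : (∫ s in a..b, f s) = (∫ s in a..(a + ε), f s) + (∫ s in (a + ε)..(b - ε), f s)
      + ∫ s in (b - ε)..b, f s := by
    rw [intervalIntegral.integral_add_adjacent_intervals (fi le_rfl (by linarith) (by linarith))
      (fi (by linarith) (by linarith) (by linarith)),
      intervalIntegral.integral_add_adjacent_intervals (fi le_rfl (by linarith) (by linarith))
      (fi (by linarith) (by linarith) le_rfl)]
  have e5 := mul_le_mul_of_nonneg_right hε2 (sq_nonneg ‖u‖)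
  change ‖u‖ ^ 2 * (δ / 2) ≤ _
  linarith

/-- Every vector is `∫ X_{conj z}* W_z F` for some `F` with compact support. -/
theorem exists_integral_eq (h : IsNevSystem a b Q H X) {z : ℂ} (hz : z.im ≠ 0) (v : E) :
    ∃ F : ℝ → E, AEStronglyMeasurable F (volume.restrict (Icc a b)) ∧
      IntegrableOn (fun t => (inner ℂ (F t) (nevWeight H z t (F t)) : ℂ).re) (Icc a b) ∧
      (∃ α β : ℝ, a < α ∧ β < b ∧ ∀ t, t ∉ Icc α β → F t = 0) ∧
      ∫ s in a..b, ContinuousLinearMap.adjoint (X (conj z) s) (nevWeight H z s (F s)) = v := by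
  obtain ⟨α, β, hα, hαβ, hβ, hu⟩ := h.exists_isUnit_integral hz
  set T := ∫ s in α..β, energyOp H X z s with hT
  set η := Ring.inverse T v with hη
  have hTη : T η = v := DFunLike.congr_fun (Ring.mul_inverse_cancel _ hu) v
  have hP := h.pair z hz
  have hsub : Icc α β ⊆ Icc a b := Icc_subset_Icc hα.le hβ.le
  -- With `T` the invertible energy integral over `[α, β]` and `η = T⁻¹v`, the function `1_{[α,β]}
  -- X_{conj z} η` integrates to `Tη = v`.
  refine ⟨(Icc α β).indicator fun s => X (conj z) s η, ?_, ?_, ⟨α, β, hα, hβ, fun t ht =>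
    indicator_of_notMem ht _⟩, ?_⟩
  · exact ((hP.continuousOn_right.clm_apply continuousOn_const).aestronglyMeasurable
      measurableSet_Icc).indicator measurableSet_Icc
  · have hc : IntegrableOn (fun t => (inner ℂ (X (conj z) t η)
        (nevWeight H z t (X (conj z) t η)) : ℂ).re) (Icc a b) :=
      (continuousOn_inner_apply_self (h.continuousOn_nevWeight hz)
        hP.continuousOn_right η).integrableOn_Icc
    refine (hc.indicator measurableSet_Icc (t := Icc α β)).congr (.of_forall fun t => ?_)
    by_cases ht : t ∈ Icc α β
    · simp only [indicator_of_mem ht]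
    · simp only [indicator_of_notMem ht, inner_zero_left, Complex.zero_re]
  · have hi : IntervalIntegrable (energyOp H X z) volume α β := by
      refine ContinuousOn.intervalIntegrable ?_
      rw [uIcc_of_le hαβ]
      exact (h.continuousOn_energyOp hz).mono hsub
    rw [← hTη, hT, ContinuousLinearMap.intervalIntegral_apply hi,
      intervalIntegral.integral_of_le hP.lt.le, intervalIntegral.integral_of_le hαβ,
      ← integral_Icc_eq_integral_Ioc, ← integral_Icc_eq_integral_Ioc]
    have : (fun s => ContinuousLinearMap.adjoint (X (conj z) s) (nevWeight H z s
        ((Icc α β).indicator (fun s => X (conj z) s η) s)))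
        = (Icc α β).indicator fun s => energyOp H X z s η := by
      funext s
      by_cases hs : s ∈ Icc α β
      · rw [indicator_of_mem hs, indicator_of_mem hs]
        rfl
      · rw [indicator_of_notMem hs, indicator_of_notMem hs, map_zero, map_zero]
    rw [this, setIntegral_indicator measurableSet_Icc, inter_eq_right.2 hsub]

variable {M : ℂ → E →L[ℂ] E}

/-- The boundary pair of an operator function `M`. -/
def leftOf (a : ℝ) (Q : ℝ → E →L[ℂ] E) (X : ℂ → ℝ → E →L[ℂ] E) (M : ℂ → E →L[ℂ] E) (z : ℂ) :
    E →L[ℂ] E := X z a * (M z - (1 / 2 : ℂ) • jumpOp Q)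

/-- The boundary pair of an operator function `M`. -/
def rightOf (b : ℝ) (Q : ℝ → E →L[ℂ] E) (X : ℂ → ℝ → E →L[ℂ] E) (M : ℂ → E →L[ℂ] E) (z : ℂ) :
    E →L[ℂ] E := X z b * (M z + (1 / 2 : ℂ) • jumpOp Q)

/-- The terms with `M` cancel, so the operator to be inverted for this pair is constant and
invertible whatever `M` is. -/
theorem diffOp_of (h : IsNevSystem a b Q H X) {z : ℂ} (hz : z.im ≠ 0) :
    diffOp a b X z (leftOf a Q X M z) (rightOf b Q X M z) = -jumpOp Q := by
  rw [diffOp, leftOf, rightOf, Ring.inverse_mul_cancel_left _ _ (h.isUnit_X hz (h.left_mem hz)),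
    Ring.inverse_mul_cancel_left _ _ (h.isUnit_X hz (h.right_mem hz))]
  module

theorem isUnit_jumpOp (h : IsNevSystem a b Q H X) : IsUnit (jumpOp Q) :=
  (isUnit_I_smul h.isUnit_opRe_zero).ringInverse

theorem charOpOf_of (h : IsNevSystem a b Q H X) {z : ℂ} (hz : z.im ≠ 0) :
    charOpOf a b Q X (leftOf a Q X M) (rightOf b Q X M) z = M z := by
  have hJ := h.isUnit_jumpOp
  have hinv : Ring.inverse (-jumpOp Q) * jumpOp Q = -1 := by
    have := Ring.inverse_mul_cancel _ hJ.neg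
    rw [mul_neg] at this
    exact neg_eq_iff_eq_neg.1 this
  rw [charOpOf, h.diffOp_of hz, leftOf, rightOf,
    Ring.inverse_mul_cancel_left _ _ (h.isUnit_X hz (h.left_mem hz)),
    Ring.inverse_mul_cancel_left _ _ (h.isUnit_X hz (h.right_mem hz)), mul_assoc, hinv]
  rw [mul_neg, mul_one]
  module

/-- As `J* = -J` and `Jg = gJ = -i`, the mixed terms cancel on each side, and both sides are `M g M
- ¼ J g J`. -/
theorem adjoint_mul_half {M M' J g : E →L[ℂ] E} (hJ : ContinuousLinearMap.adjoint J = -J)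
    (hM : ContinuousLinearMap.adjoint M' = M) (hJg : J * g = -Complex.I • 1)
    (hgJ : g * J = -Complex.I • 1) :
    ContinuousLinearMap.adjoint (M' - (1 / 2 : ℂ) • J) * g * (M - (1 / 2 : ℂ) • J)
      = ContinuousLinearMap.adjoint (M' + (1 / 2 : ℂ) • J) * g * (M + (1 / 2 : ℂ) • J) := by
  have hh : conj (1 / 2 : ℂ) = 1 / 2 := by simp [Complex.conj_ofNat]
  rw [map_sub, map_add, OpExpr.adjoint_smul', hJ, hM, hh]
  simp only [sub_mul, add_mul, mul_sub, mul_add, smul_mul_assoc, mul_smul_comm, neg_mul, smul_neg,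
    mul_assoc, hJg, hgJ, mul_one, one_mul, mul_neg]
  module

theorem isBdryFamily_of (h : IsNevSystem a b Q H X)
    (hM : DifferentiableOn ℂ M {z | z.im ≠ 0})
    (hsymm : ∀ z : ℂ, z.im ≠ 0 → M z = ContinuousLinearMap.adjoint (M (conj z)))
    (hpos : ∀ z : ℂ, z.im ≠ 0 → ∀ v, 0 ≤ pairForm a b Q z
      (X z a ((M z - (1 / 2 : ℂ) • jumpOp Q) v), X z b ((M z + (1 / 2 : ℂ) • jumpOp Q) v))) :
    IsBdryFamily a b Q (leftOf a Q X M) (rightOf b Q X M) where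
  analytic_left z hz := ((h.differentiableAt_X (h.left_mem hz) hz).mul
    ((hM.differentiableAt (isOpen_nonreal.mem_nhds hz)).sub_const _)).differentiableWithinAt
  analytic_right z hz := ((h.differentiableAt_X (h.right_mem hz) hz).mul
    ((hM.differentiableAt (isOpen_nonreal.mem_nhds hz)).add_const _)).differentiableWithinAt
  symm z hz := by
    have hg := h.isUnit_opRe_zero
    rw [← h.adjoint_inverse_mul hz (h.left_mem hz), ← h.adjoint_inverse_mul hz (h.right_mem hz),
      leftOf, leftOf, rightOf, rightOf,
      Ring.inverse_mul_cancel_left _ _ (h.isUnit_X hz (h.left_mem hz)),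
      Ring.inverse_mul_cancel_left _ _ (h.isUnit_X hz (h.right_mem hz)),
      Ring.inverse_mul_cancel_left _ _ (h.isUnit_X (im_conj_ne_zero hz) (h.left_mem hz)),
      Ring.inverse_mul_cancel_left _ _ (h.isUnit_X (im_conj_ne_zero hz) (h.right_mem hz))]
    refine adjoint_mul_half (adjoint_jumpOp hg) (hsymm z hz).symm ?_ ?_
    · rw [jumpOp_eq hg, smul_mul_assoc, Ring.inverse_mul_cancel _ hg]
    · rw [jumpOp_eq hg, mul_smul_comm, Ring.mul_inverse_cancel _ hg]
  nondegenerate z hz x hx := by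
    by_contra hc
    have h1 : leftOf a Q X M z x = 0 := norm_le_zero_iff.1 (by
      linarith [norm_nonneg (leftOf a Q X M z x), norm_nonneg (rightOf b Q X M z x)])
    have h2 : rightOf b Q X M z x = 0 := norm_le_zero_iff.1 (by
      linarith [norm_nonneg (leftOf a Q X M z x), norm_nonneg (rightOf b Q X M z x)])
    have h3 : diffOp a b X z (leftOf a Q X M z) (rightOf b Q X M z) x = 0 := by
      change Ring.inverse (X z a) (leftOf a Q X M z x) - Ring.inverse (X z b) (rightOf b Q X M z x)
        = 0
      rw [h1, h2, map_zero, map_zero, sub_zero]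
    rw [h.diffOp_of hz] at h3
    have h4 : x = Ring.inverse (jumpOp Q) (jumpOp Q x) :=
      (DFunLike.congr_fun (Ring.inverse_mul_cancel _ h.isUnit_jumpOp) x).symm
    have h5 : jumpOp Q x = 0 := neg_eq_zero.1 h3
    rw [h5, map_zero] at h4
    exact hx h4
  maxNonneg z hz := by
    refine ⟨?_, fun S' hS hpos' => le_antisymm (fun x hx => ?_) hS⟩
    · rintro _ ⟨v, rfl⟩
      exact hpos z hz v
    · set ξ := Ring.inverse (X z a) x.1 with hξ
      set ζ := Ring.inverse (X z b) x.2 with hζ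
      -- The choice `J v = ζ - ξ` makes `x` minus the element of the subspace given by `v` equal to
      -- `(X(a)u, X(b)u)` with one and the same `u`. This difference is nonnegative in the larger
      -- subspace and uniformly negative in `u`, hence `u = 0`.
      set v := -(Ring.inverse (jumpOp Q) (ξ - ζ)) with hv
      have hJv : jumpOp Q v = ζ - ξ := by
        have := DFunLike.congr_fun (Ring.mul_inverse_cancel _ h.isUnit_jumpOp) (ξ - ζ)
        rw [hv, map_neg]
        have this' : jumpOp Q (Ring.inverse (jumpOp Q) (ξ - ζ)) = ξ - ζ := this
        rw [this', neg_sub]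
      set u := ξ - (M z - (1 / 2 : ℂ) • jumpOp Q) v with hu
      have hu2 : u = ζ - (M z + (1 / 2 : ℂ) • jumpOp Q) v := by
        rw [hu]
        simp only [sub_apply, add_apply, smul_apply, hJv]
        module
      set s : E × E := (leftOf a Q X M z v, rightOf b Q X M z v) with hs
      have hsm : s ∈ LinearMap.range ((leftOf a Q X M z : E →ₗ[ℂ] E).prod
        (rightOf b Q X M z : E →ₗ[ℂ] E)) := ⟨v, rfl⟩
      have hd : x - s = (X z a u, X z b u) := by
        refine Prod.ext ?_ ?_
        · change x.1 - X z a ((M z - (1 / 2 : ℂ) • jumpOp Q) v) = X z a u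
          rw [hu, map_sub, h.X_mul_inverse hz (h.left_mem hz)]
        · change x.2 - X z b ((M z + (1 / 2 : ℂ) • jumpOp Q) v) = X z b u
          rw [hu2, map_sub, h.X_mul_inverse hz (h.right_mem hz)]
      obtain ⟨c, hc, hneg⟩ := h.exists_pairForm_le hz
      have h1 := hpos' _ (S'.sub_mem hx (hS hsm))
      rw [hd] at h1
      have h2 := hneg u
      have h3 : ‖u‖ ^ 2 = 0 := le_antisymm (by
        by_contra hne
        push Not at hne
        nlinarith) (sq_nonneg _)
      have h4 : u = 0 := norm_eq_zero.1 (pow_eq_zero_iff two_ne_zero |>.1 h3)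
      rw [h4, map_zero, map_zero] at hd
      have h5 : x = s := sub_eq_zero.1 hd
      rw [h5]
      exact hsm

end IsNevSystem

end Converse

/-! ### The shift from `l - n_λ` and `f` to `l_λ` and `f - λy` -/

namespace OpExpr

variable {𝓗 : Type*} [NormedAddCommGroup 𝓗] [InnerProductSpace ℂ 𝓗]
  {L m : OpExpr 𝓗} {I : Set ℝ} {r s : ℕ} {y f : ℝ → 𝓗}

theorem IsSmoothOn.add {K : OpExpr 𝓗} (h : L.IsSmoothOn I) (h' : K.IsSmoothOn I) :
    (L + K).IsSmoothOn I where
  p_smooth j := (h.p_smooth j).add (h'.p_smooth j)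
  q_smooth j := (h.q_smooth j).add (h'.q_smooth j)
  s_smooth j := (h.s_smooth j).add (h'.s_smooth j)

theorem IsSmoothOn.smul (c : ℂ) (h : L.IsSmoothOn I) : (c • L).IsSmoothOn I where
  p_smooth j := (h.p_smooth j).const_smul c
  q_smooth j := (h.q_smooth j).const_smul c
  s_smooth j := (h.s_smooth j).const_smul c

/-- The definition of quasi-derivatives refers to the formal order, which is `r` for the sum but `s`
for `m` alone. The recursion extended by zeros does not see the order, so uniqueness gives
additivity for different orders. -/
theorem quasiSeq_add_smul_left (hL : L.IsOfOrder r) (hs : L.IsSmoothOn I) (hm : m.IsOfOrder s)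
    (hms : m.IsSmoothOn I) (hsr : s ≤ r) (hI : UniqueDiffOn ℝ I) (hy : ContDiffOn ℝ r y I) (z : ℂ)
    (j : ℕ) {t : ℝ} (ht : t ∈ I) :
    (L + z • m).quasiSeq I r y j t = L.quasiSeq I r y j t + z • m.quasiSeq I s y j t := by
  refine (isQuasiSeq (hL.add ((hm.mono hsr).smul z)) (hs.add (hms.smul z)) hI hy).unique
    ((isQuasiSeq hL hs hI hy).add ((isQuasiSeq hm hms hI
      (hy.of_le (by exact_mod_cast hsr))).const_smul z)) (fun j t _ => ?_) j t ht
  rw [coef_add_left, coef_smul_left]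

theorem quasiSeq_sub_smul (hm : m.IsOfOrder s) (hms : m.IsSmoothOn I) (hs : Even s)
    (hI : UniqueDiffOn ℝ I)
    (hf : ContDiffOn ℝ s f I) (hy : ContDiffOn ℝ s y I) (z : ℂ) (j : ℕ) {t : ℝ} (ht : t ∈ I) :
    m.quasiSeq I s (f - z • y) j t = m.quasiSeq I s f j t - z • m.quasiSeq I s y j t := by
  refine (isQuasiSeq hm hms hI (hf.sub (hy.const_smul z))).unique
    ((isQuasiSeq hm hms hI hf).sub ((isQuasiSeq hm hms hI hy).const_smul z)) (fun j t ht => ?_) j t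
      ht
  have e : m.coef j t (jet I (f - z • y) t) = m.coef j t (jet I f t + (-z) • jet I y t) := by
    refine coef_congr hm hs j t fun k hk => ?_
    have hk' : (k : WithTop ℕ∞) ≤ s := by exact_mod_cast (by omega : k ≤ s)
    change iteratedDerivWithin k (f - z • y) I t
      = iteratedDerivWithin k f I t + (-z) • iteratedDerivWithin k y I t
    rw [iteratedDerivWithin_sub (f := f) (g := z • y) ht hI ((hf.of_le hk') t ht)
        (((hy.of_le hk').const_smul z) t ht),
      iteratedDerivWithin_const_smul ht hI z ((hy.of_le hk') t ht), neg_smul, sub_eq_add_neg]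
  refine e.trans ?_
  rw [coef_add, coef_smul, neg_smul, sub_eq_add_neg]

theorem quasiSeq_shift (hL : L.IsOfOrder r) (hs : L.IsSmoothOn I) (hm : m.IsOfOrder s)
    (hms : m.IsSmoothOn I) (hse : Even s) (hsr : s ≤ r) (hI : UniqueDiffOn ℝ I)
    (hy : ContDiffOn ℝ r y I) (hf : ContDiffOn ℝ s f I) (z : ℂ) (j : ℕ) {t : ℝ} (ht : t ∈ I) :
    (L + z • m).quasiSeq I r y j t - m.quasiSeq I s f j t
      = L.quasiSeq I r y j t - m.quasiSeq I s (f - z • y) j t := by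
  rw [quasiSeq_add_smul_left hL hs hm hms hsr hI hy z j ht,
    quasiSeq_sub_smul hm hms hse hI hf (hy.of_le (by exact_mod_cast hsr)) z j ht]
  abel

theorem apply_shift_iff (hL : L.IsOfOrder r) (hs : L.IsSmoothOn I) (hm : m.IsOfOrder s)
    (hms : m.IsSmoothOn I) (hse : Even s) (hsr : s ≤ r) (hI : UniqueDiffOn ℝ I)
    (hy : ContDiffOn ℝ r y I) (hf : ContDiffOn ℝ s f I) (z : ℂ) {t : ℝ} (ht : t ∈ I) :
    (L + z • m).apply I r y t = m.apply I s f t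
      ↔ L.apply I r y t = m.apply I s (f - z • y) t := by
  rw [apply_eq_quasiSeq (hL.add ((hm.mono hsr).smul z)) (hs.add (hms.smul z)) hI hy ht,
    apply_eq_quasiSeq hm hms hI hf ht, apply_eq_quasiSeq hL hs hI hy ht,
    apply_eq_quasiSeq (y := f - z • y) hm hms hI (hf.sub ((hy.of_le (by exact_mod_cast hsr)).const_smul z)) ht,
    ← sub_eq_zero, quasiSeq_shift hL hs hm hms hse hsr hI hy hf z 0 ht, sub_eq_zero]

theorem vecY_shift [CompleteSpace 𝓗] (hL : L.IsOfOrder r) (hs : L.IsSmoothOn I) (hm : m.IsOfOrder s)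
    (hms : m.IsSmoothOn I) (hse : Even s) (hsr : s ≤ r) (hI : UniqueDiffOn ℝ I)
    (hy : ContDiffOn ℝ r y I) (hf : ContDiffOn ℝ s f I) (z : ℂ) {t : ℝ} (ht : t ∈ I) :
    (L + z • m).vecY m I r s y f t = L.vecY m I r s y (f - z • y) t := by
  refine ext_coord fun k hk => ?_
  rw [coord_vecY _ m I hk, coord_vecY L m I hk]
  split_ifs with h1 h2 h3 h4
  · rfl
  · rfl
  all_goals first | rfl | skip
  all_goals
    have := quasiSeq_shift hL hs hm hms hse hsr hI hy hf z (k - r / 2 + 1) ht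
    rw [quasiSeq_of_le (L := L + z • m) (by omega), quasiSeq_of_le (L := L) (by omega),
      quasiSeq_even hse, quasiSeq_even hse] at this
    simpa only [h4, if_true, if_false] using this

theorem quasiSeq_congr {w : ℝ → 𝓗} (hL : L.IsOfOrder r) (hs : L.IsSmoothOn I)
    (hI : UniqueDiffOn ℝ I) (hy : ContDiffOn ℝ r y I) (h : EqOn y w I) (j : ℕ) {t : ℝ}
    (ht : t ∈ I) : L.quasiSeq I r y j t = L.quasiSeq I r w j t := by
  refine (isQuasiSeq hL hs hI hy).unique (isQuasiSeq hL hs hI (hy.congr fun t ht => (h ht).symm))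
    (fun j t ht => ?_) j t ht
  have : jet I y t = jet I w t := funext fun k => iteratedDerivWithin_congr h ht
  rw [this]

theorem apply_congr {w : ℝ → 𝓗} (hL : L.IsOfOrder r) (hs : L.IsSmoothOn I)
    (hI : UniqueDiffOn ℝ I) (hy : ContDiffOn ℝ r y I) (h : EqOn y w I) {t : ℝ} (ht : t ∈ I) :
    L.apply I r y t = L.apply I r w t := by
  rw [apply_eq_quasiSeq hL hs hI hy ht,
    apply_eq_quasiSeq hL hs hI (hy.congr fun t ht => (h ht).symm) ht,
    quasiSeq_congr hL hs hI hy h 0 ht]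

theorem vecY_congr [CompleteSpace 𝓗] {w : ℝ → 𝓗} (hL : L.IsOfOrder r) (hs : L.IsSmoothOn I)
    (hI : UniqueDiffOn ℝ I) (hy : ContDiffOn ℝ r y I) (h : EqOn y w I) {t : ℝ} (ht : t ∈ I) :
    L.vecY m I r s y f t = L.vecY m I r s w f t := by
  refine ext_coord fun k hk => ?_
  rw [coord_vecY _ m I hk, coord_vecY L m I hk, h ht, iteratedDerivWithin_congr h ht,
    iteratedDerivWithin_congr h ht]
  split_ifs with h1 h2 h3 h4
  · rfl
  · rfl
  all_goals first | rfl | skip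
  all_goals
    have := quasiSeq_congr hL hs hI hy h (k - r / 2 + 1) ht
    rw [quasiSeq_of_le (by omega), quasiSeq_of_le (by omega)] at this
    rw [this]

theorem coord_zero_vecY [CompleteSpace 𝓗] (hr : 0 < r) (t : ℝ) :
    coord r 0 (L.vecY m I r s y f t) = y t := by
  rw [coord_vecY _ m I hr]
  split_ifs with h1 h2 h3 h4
  · rfl
  · rw [iteratedDerivWithin_zero]
  all_goals omega

theorem continuousOn_vecF {K : OpExpr 𝓗} (hK : K.IsOfOrder r) (hs : K.IsSmoothOn I)
    (hI : UniqueDiffOn ℝ I) (hf : ContDiffOn ℝ s f I) :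
    ContinuousOn (K.vecF I r s f) I := by
  refine (PiLp.continuous_toLp 2 (fun _ : Fin r => 𝓗)).comp_continuousOn
    (continuousOn_pi.2 fun i => ?_)
  have hd : ∀ k, k ≤ s → ContinuousOn (iteratedDerivWithin k f I) I := fun k hk =>
    hf.continuousOn_iteratedDerivWithin (by exact_mod_cast hk) hI
  have hi := i.2
  by_cases h1 : r = 1
  · simp only [h1, if_true]
    exact hf.continuousOn
  simp only [h1, if_false]
  split_ifs with h2 h3 h4 h5 h6
  · exact hd _ (by omega)
  · exact continuousOn_const
  · subst h5
    have := ((isQuasiSeq hK hs hI hf).smooth (i - s / 2 + 1)).continuousOn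
    rw [quasiSeq, if_pos (by omega)] at this
    exact this
  · exact continuousOn_const
  · exact ((hd _ (by omega)).const_smul Complex.I).neg
  · exact continuousOn_const

end OpExpr

/-! ### Boundary pairs and characteristic operators of the expression pair -/

namespace NevanlinnaExprPair

variable {𝓗 : Type*} [NormedAddCommGroup 𝓗] [InnerProductSpace ℂ 𝓗] [CompleteSpace 𝓗]
variable (D : NevanlinnaExprPair 𝓗) {z : ℂ}

theorem I_mem : Complex.I ∈ D.dom := D.nonreal_mem _ I_im_ne_zero

/-- The matrix at the parameter `i` serves as the common `Q`, which is legitimate because `Q` does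
not depend on the nonreal parameter. -/
theorem isNevSystem (hD : D.IsDefinite) :
    IsNevSystem D.a D.b (D.Q Complex.I) D.H D.X where
  pair z hz := by
    have hz' := D.nonreal_mem z hz
    have h := D.isFundPair hz'
    exact ⟨h.lt, h.zero_mem, D.contDiffOn_Q D.I_mem, fun t ht => D.isUnit_opRe_Q D.I_mem ht,
      h.fund.congr (D.Q_eq_I hz') fun _ _ => rfl, h.fund_adj.congr (D.Q_eq_I hz') fun _ _ => rfl⟩
  cont z hz := D.continuousOn_H (D.nonreal_mem z hz)
  adj z hz t ht := D.adjoint_H (D.nonreal_mem z hz) ht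
  diff z hz t ht := D.differentiableAt_H (D.nonreal_mem z hz) ht
  nonneg z hz t ht x := by
    have h := congrArg Complex.re (D.inner_weight hz ht x)
    rw [Complex.ofReal_re] at h
    exact (D.nevDens_nonneg hz ht _).trans_eq h.symm
  definite z hz := D.exists_le_integral_energy hD hz

theorem jumpOp_Q (hz : z.im ≠ 0) :
    Ring.inverse (Complex.I • D.G z) = jumpOp (D.Q Complex.I) :=
  congrArg (fun A => Ring.inverse (Complex.I • opRe A))
    (D.Q_eq_I (D.nonreal_mem z hz) D.zero_mem)

theorem U_eq (hz : z.im ≠ 0) {t : ℝ} (ht : t ∈ D.ivl) (x : HilbertPow 𝓗 D.r) :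
    D.U z t x = bdryForm₁ (D.Q Complex.I) t x :=
  congrArg (fun A => (inner ℂ x (opRe A x) : ℂ).re) (D.Q_eq_I (D.nonreal_mem z hz) ht)

theorem a_mem : D.a ∈ D.ivl := ⟨le_rfl, D.a_lt_b.le⟩

theorem b_mem : D.b ∈ D.ivl := ⟨D.a_lt_b.le, le_rfl⟩

theorem bdryForm_eq (hz : z.im ≠ 0) : D.bdryForm z = pairForm D.a D.b (D.Q Complex.I) z := by
  funext x
  unfold bdryForm pairForm
  rw [D.U_eq hz D.a_mem, D.U_eq hz D.b_mem]

theorem isMaxNonneg_iff (hz : z.im ≠ 0)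
    (S : Submodule ℂ (HilbertPow 𝓗 D.r × HilbertPow 𝓗 D.r)) :
    D.IsMaxNonneg z S ↔ IsMaxNonnegSubspace (pairForm D.a D.b (D.Q Complex.I) z) S := by
  rw [← D.bdryForm_eq hz]
  exact Iff.rfl

theorem isBdryPair_iff (Mb Nb : ℂ → D.Op) :
    D.IsBdryPair Mb Nb ↔ IsBdryFamily D.a D.b (D.Q Complex.I) Mb Nb := by
  have e : ∀ z : ℂ, z.im ≠ 0 → D.Q z D.a = D.Q Complex.I D.a ∧ D.Q z D.b = D.Q Complex.I D.b :=
    fun z hz => ⟨D.Q_eq_I (D.nonreal_mem z hz) D.a_mem, D.Q_eq_I (D.nonreal_mem z hz) D.b_mem⟩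
  constructor
  · intro h
    refine ⟨h.analytic_left, h.analytic_right, fun z hz => ?_, h.nondegenerate, fun z hz =>
      (D.isMaxNonneg_iff hz _).1 (h.maxNonneg z hz)⟩
    have := h.symm z hz
    rwa [(e z hz).1, (e z hz).2] at this
  · intro h
    refine ⟨h.analytic_left, h.analytic_right, fun z hz => ?_, h.nondegenerate, fun z hz =>
      (D.isMaxNonneg_iff hz _).2 (h.maxNonneg z hz)⟩
    have := h.symm z hz
    rwa [← (e z hz).1, ← (e z hz).2] at this

theorem bdryCharOp_eq (hz : z.im ≠ 0) (Mb Nb : ℂ → D.Op) :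
    D.bdryCharOp Mb Nb z = charOpOf D.a D.b (D.Q Complex.I) D.X Mb Nb z := by
  unfold bdryCharOp
  rw [D.jumpOp_Q hz]
  rfl

theorem kernel_eq (hz : z.im ≠ 0) (M : ℂ → D.Op) (t s : ℝ) :
    D.kernel M z t s = kernelOp (D.Q Complex.I) D.X (M z) z t s := by
  unfold kernel
  rw [D.jumpOp_Q hz]
  rfl

theorem integral_kernel (hD : D.IsDefinite) (hz : z.im ≠ 0) (M : ℂ → D.Op)
    {g : ℝ → HilbertPow 𝓗 D.r} (hg : IntegrableOn g D.ivl) {t : ℝ} (ht : t ∈ D.ivl) :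
    ∫ s in D.a..D.b, D.kernel M z t s (g s)
      = kernelSol D.a D.b (D.Q Complex.I) D.X (M z) z g t := by
  simp only [D.kernel_eq hz]
  exact (D.isNevSystem hD).integral_kernelOp hz hg (M z) ht

theorem systemSol_eq (hD : D.IsDefinite) (hz : z.im ≠ 0) (M : ℂ → D.Op)
    {F : ℝ → HilbertPow 𝓗 D.r} (hm : AEStronglyMeasurable F (volume.restrict D.ivl))
    (hF : IntegrableOn (fun t => (inner ℂ (F t) (D.weight z t (F t))).re) D.ivl)
    {t : ℝ} (ht : t ∈ D.ivl) :
    D.systemSol M z F t = kernelSol D.a D.b (D.Q Complex.I) D.X (M z) z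
      (fun s => nevWeight D.H z s (F s)) t :=
  D.integral_kernel hD hz M ((D.isNevSystem hD).integrableOn_nevWeight hz hm hF) ht

/-- On a finite closed interval `x_λ` is continuous up to the ends, so the limit is simply minus the
boundary form at the end values. -/
theorem tendsto_U_systemSol (hD : D.IsDefinite) (hz : z.im ≠ 0) (M : ℂ → D.Op)
    {F : ℝ → HilbertPow 𝓗 D.r} (hm : AEStronglyMeasurable F (volume.restrict D.ivl))
    (hF : IntegrableOn (fun t => (inner ℂ (F t) (D.weight z t (F t))).re) D.ivl) :
    Tendsto (fun e : ℝ × ℝ => z.im * (D.U z e.2 (D.systemSol M z F e.2)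
        - D.U z e.1 (D.systemSol M z F e.1))) (𝓝[>] D.a ×ˢ 𝓝[<] D.b)
      (𝓝 (-pairForm D.a D.b (D.Q Complex.I) z
        (kernelSol D.a D.b (D.Q Complex.I) D.X (M z) z (fun s => nevWeight D.H z s (F s)) D.a,
          kernelSol D.a D.b (D.Q Complex.I) D.X (M z) z (fun s => nevWeight D.H z s (F s)) D.b))) := by
  set g : ℝ → HilbertPow 𝓗 D.r := fun s => nevWeight D.H z s (F s) with hg
  have hgi : IntegrableOn g D.ivl := (D.isNevSystem hD).integrableOn_nevWeight hz hm hF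
  have hc : ContinuousOn (fun t => D.U z t (D.systemSol M z F t)) D.ivl := by
    refine (IsNevSystem.continuousOn_bdryForm₁ (D.contDiffOn_Q D.I_mem).continuousOn
      ((D.isNevSystem hD).continuousOn_kernelSol hz hgi (M z))).congr fun t ht => ?_
    rw [D.U_eq hz ht, D.systemSol_eq hD hz M hm hF ht]
  have h := IsNevSystem.tendsto_bdry D.a_lt_b hc z.im
  rw [D.U_eq hz D.a_mem, D.U_eq hz D.b_mem, D.systemSol_eq hD hz M hm hF D.a_mem,
    D.systemSol_eq hD hz M hm hF D.b_mem] at h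
  convert h using 2
  unfold pairForm
  ring

theorem isCharOp_bdryCharOp (hD : D.IsDefinite) {Mb Nb : ℂ → D.Op} (hb : D.IsBdryPair Mb Nb) :
    D.IsCharOp (D.bdryCharOp Mb Nb) := by
  have hN := D.isNevSystem hD
  have hb' := (D.isBdryPair_iff Mb Nb).1 hb
  refine ⟨(hN.differentiableOn_charOpOf hb').congr fun z hz => D.bdryCharOp_eq hz Mb Nb,
    fun z hz => ?_, fun z hz F hm hF _ => ⟨_, ?_, D.tendsto_U_systemSol hD hz _ hm hF⟩⟩
  · rw [D.bdryCharOp_eq hz, D.bdryCharOp_eq (im_conj_ne_zero hz)]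
    exact hN.charOpOf_symm hb' hz
  · rw [D.bdryCharOp_eq hz]
    obtain ⟨η, h1, h2⟩ := hN.kernelSol_bdry hb' hz (fun s => nevWeight D.H z s (F s))
    rw [h1, h2]
    exact neg_nonpos.2 ((hb'.maxNonneg z hz).1 _ ⟨η, rfl⟩)

/-- Every `v` is `∫ X*WF` with an admissible compactly supported `F`. The limit in the definition of
a characteristic operator is then minus the boundary form of the pair generated by `v`, and
uniqueness of limits makes that form nonnegative. -/
theorem isBdryPair_of_isCharOp (hD : D.IsDefinite) {M : ℂ → D.Op} (hM : D.IsCharOp M) :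
    D.IsBdryPair (IsNevSystem.leftOf D.a (D.Q Complex.I) D.X M)
      (IsNevSystem.rightOf D.b (D.Q Complex.I) D.X M) := by
  have hN := D.isNevSystem hD
  refine (D.isBdryPair_iff _ _).2 (hN.isBdryFamily_of hM.analytic hM.symm fun z hz v => ?_)
  obtain ⟨F, hm, hF, hcs, hv⟩ := hN.exists_integral_eq hz v
  obtain ⟨c, hc, ht⟩ := hM.boundary z hz F hm hF hcs
  have h := tendsto_nhds_unique ht (D.tendsto_U_systemSol hD hz M hm hF)
  rw [IsNevSystem.kernelSol_left, IsNevSystem.kernelSol_right, hv] at h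
  linarith

end NevanlinnaExprPair

/-! ### The resolvent and the relation `T(λ)` -/

namespace NevanlinnaExprPair

variable {𝓗 : Type*} [NormedAddCommGroup 𝓗] [InnerProductSpace ℂ 𝓗] [CompleteSpace 𝓗]
variable (D : NevanlinnaExprPair 𝓗) {z : ℂ}

theorem lSubN_eq (z : ℂ) : D.lSubN z = D.l z + z • D.m := by
  unfold lSubN n
  refine OpExpr.ext ?_ ?_ ?_
  · change D.lRe.p - (D.lRe.p - z • D.m.p - (D.l z).p) = (D.l z).p + z • D.m.p
    abel
  · change D.lRe.q - (D.lRe.q - z • D.m.q - (D.l z).q) = (D.l z).q + z • D.m.q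
    abel
  · change D.lRe.s - (D.lRe.s - z • D.m.s - (D.l z).s) = (D.l z).s + z • D.m.s
    abel

/-- The right hand side `W(t, l_{conj z}, m) F(t, l_{conj z}, m)` of the first order system. -/
def rhs (z : ℂ) (f : ℝ → 𝓗) (t : ℝ) : HilbertPow 𝓗 D.r :=
  (D.l (conj z)).opW D.m D.r t ((D.l (conj z)).vecF D.ivl D.r D.s f t)

theorem continuousOn_rhs (hz : z.im ≠ 0) {f : ℝ → 𝓗} (hf : ContDiffOn ℝ D.s f D.ivl) :
    ContinuousOn (D.rhs z f) D.ivl := by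
  have hw := D.nonreal_mem _ (im_conj_ne_zero hz)
  have hR := D.isRegular hw
  exact (OpExpr.continuousOn_opW hR.smooth hR.unit_even D.m_smooth).clm_apply
    (OpExpr.continuousOn_vecF hR.order hR.smooth D.uniqueDiffOn hf)

theorem resolventFn_eq (hD : D.IsDefinite) (hz : z.im ≠ 0) (M : ℂ → D.Op) {f : ℝ → 𝓗}
    (hf : ContDiffOn ℝ D.s f D.ivl) {t : ℝ} (ht : t ∈ D.ivl) :
    D.resolventFn M z f t
      = coord D.r 0 (kernelSol D.a D.b (D.Q Complex.I) D.X (M z) z (D.rhs z f) t) := by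
  rw [coord_apply D.r_pos, ← D.integral_kernel hD hz M (D.continuousOn_rhs hz hf).integrableOn_Icc
    ht]
  rfl

theorem sysLHS_opQ (hz : z.im ≠ 0) {t : ℝ} (ht : t ∈ D.ivl) (x x' : HilbertPow 𝓗 D.r) :
    sysLHS ((D.l z).opQ D.r t) (derivWithin ((D.l z).opQ D.r) D.ivl t) ((D.l z).opH D.r t) x x'
      = sysLHS (D.Q Complex.I t) (derivWithin (D.Q Complex.I) D.ivl t) (D.H z t) x x' := by
  have h := D.Q_eq_I (D.nonreal_mem z hz)
  have h1 : (D.l z).opQ D.r t = D.Q Complex.I t := h ht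
  have h2 : derivWithin ((D.l z).opQ D.r) D.ivl t = derivWithin (D.Q Complex.I) D.ivl t :=
    derivWithin_congr h (h ht)
  rw [h1, h2]
  rfl

/-- The functions of the resolvent solve the equation. -/
theorem kernelSol_spec (hD : D.IsDefinite) (hz : z.im ≠ 0) (M : D.Op) {f : ℝ → 𝓗}
    (hf : ContDiffOn ℝ D.s f D.ivl) {x : ℝ → HilbertPow 𝓗 D.r}
    (hx : x = kernelSol D.a D.b (D.Q Complex.I) D.X M z (D.rhs z f)) :
    ContDiffOn ℝ D.r (fun t => coord D.r 0 (x t)) D.ivl ∧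
      (∀ t ∈ D.ivl, (D.l z).apply D.ivl D.r (fun t => coord D.r 0 (x t)) t
        = D.m.apply D.ivl D.s f t) ∧
      ∀ t ∈ D.ivl, (D.l z).vecY D.m D.ivl D.r D.s (fun t => coord D.r 0 (x t)) f t = x t := by
  subst hx
  obtain ⟨x', h1, h2⟩ := (D.isNevSystem hD).hasDerivWithinAt_kernelSol hz
    (D.continuousOn_rhs hz hf) M
  have hz' := D.nonreal_mem z hz
  refine OpExpr.apply_of_system (D.isRegular hz') (D.l_order _ (D.conj_mem hz')) D.m_order
    D.m_smooth D.r_pos D.s_even D.s_le_r D.uniqueDiffOn (fun t ht => D.isAdjointAt_conj hz' ht) hf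
    fun t ht => ⟨x' t, h1 t ht, ?_⟩
  rw [D.sysLHS_opQ hz ht]
  exact h2 t ht

theorem contDiffOn_resolventFn (hD : D.IsDefinite) (hz : z.im ≠ 0) (M : ℂ → D.Op) {f : ℝ → 𝓗}
    (hf : ContDiffOn ℝ D.s f D.ivl) : ContDiffOn ℝ D.r (D.resolventFn M z f) D.ivl :=
  (D.kernelSol_spec hD hz (M z) hf rfl).1.congr fun _ ht => D.resolventFn_eq hD hz M hf ht

/-- The resolvent of a boundary value problem. -/
theorem bdry_problem_iff (hD : D.IsDefinite) {Mb Nb : ℂ → D.Op} (hb : D.IsBdryPair Mb Nb)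
    (hz : z.im ≠ 0) {y f : ℝ → 𝓗} (hy : ContDiffOn ℝ D.r y D.ivl)
    (hf : ContDiffOn ℝ D.s f D.ivl) :
    ((∀ t ∈ D.ivl, (D.l z).apply D.ivl D.r y t = D.m.apply D.ivl D.s f t) ∧
      ∃ h, (D.l z).vecY D.m D.ivl D.r D.s y f D.a = Mb z h ∧
        (D.l z).vecY D.m D.ivl D.r D.s y f D.b = Nb z h) ↔
      ∀ t ∈ D.ivl, y t = D.resolventFn (D.bdryCharOp Mb Nb) z f t := by
  have hN := D.isNevSystem hD
  have hb' := (D.isBdryPair_iff Mb Nb).1 hb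
  have hz' := D.nonreal_mem z hz
  constructor
  · rintro ⟨he, η, ha, hbb⟩ t ht
    have hsys := fun t (ht : t ∈ D.ivl) => OpExpr.vecY_solves (D.isRegular hz')
      (D.l_order _ (D.conj_mem hz')) D.m_order
      D.m_smooth D.r_pos D.s_even D.s_le_r D.uniqueDiffOn (fun t ht => D.isAdjointAt_conj hz' ht)
      hy hf he ht
    choose! x' hx' ex using hsys
    have h := hN.eq_kernelSol_of_bdry hb' hz (D.continuousOn_rhs hz hf) hx'
      (fun t ht => (D.sysLHS_opQ hz ht _ _).symm.trans (ex t ht)) ha hbb ht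
    rw [D.resolventFn_eq hD hz _ hf ht, D.bdryCharOp_eq hz, ← h, OpExpr.coord_zero_vecY D.r_pos]
  · intro h
    obtain ⟨h1, h2, h3⟩ := D.kernelSol_spec hD hz (D.bdryCharOp Mb Nb z) hf rfl
    set w : ℝ → 𝓗 := fun t => coord D.r 0 (kernelSol D.a D.b (D.Q Complex.I) D.X
      (D.bdryCharOp Mb Nb z) z (D.rhs z f) t) with hw
    have hyw : EqOn y w D.ivl := fun t ht => (h t ht).trans (D.resolventFn_eq hD hz _ hf ht)
    have hyw' : ∀ t ∈ D.ivl, (D.l z).vecY D.m D.ivl D.r D.s y f t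
        = (D.l z).vecY D.m D.ivl D.r D.s w f t := fun t ht =>
      OpExpr.vecY_congr (D.l_order _ hz') (D.l_smooth _ hz') D.uniqueDiffOn hy hyw ht
    obtain ⟨η, e1, e2⟩ := hN.kernelSol_bdry hb' hz (D.rhs z f)
    rw [← D.bdryCharOp_eq hz] at e1 e2
    refine ⟨fun t ht => ?_, η, ?_, ?_⟩
    · rw [OpExpr.apply_congr (D.l_order _ hz') (D.l_smooth _ hz') D.uniqueDiffOn hy hyw ht, h2 t ht]
    · rw [hyw' _ D.a_mem, h3 _ D.a_mem, e1]
    · rw [hyw' _ D.b_mem, h3 _ D.b_mem, e2]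

/-- The boundary value problem for `l_λ` after the shift of the right-hand side. In the backward
direction the regularity `C^r` of `y` comes for free, since kernel solutions have it. -/
theorem preT_iff (hD : D.IsDefinite) {Mb Nb : ℂ → D.Op} (hb : D.IsBdryPair Mb Nb)
    (hz : z.im ≠ 0) (y f : D.PreH) :
    (ContDiffOn ℝ D.r y.fn D.ivl ∧
      (∀ t ∈ D.ivl, (D.lSubN z).apply D.ivl D.r y.fn t = D.m.apply D.ivl D.s f.fn t) ∧
      ∃ h : HilbertPow 𝓗 D.r, D.vecYN z y.fn f.fn D.a = Mb z h ∧
        D.vecYN z y.fn f.fn D.b = Nb z h) ↔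
      ∀ t ∈ D.ivl, y.fn t = D.resolventFn (D.bdryCharOp Mb Nb) z (f - z • y).fn t := by
  have hz' := D.nonreal_mem z hz
  have hs : ContDiffOn ℝ D.s (f - z • y).fn D.ivl := (f - z • y).2
  have key : ∀ hy : ContDiffOn ℝ D.r y.fn D.ivl, _ := fun hy =>
    D.bdry_problem_iff hD hb hz hy hs
  have hv : ∀ hy : ContDiffOn ℝ D.r y.fn D.ivl, ∀ t ∈ D.ivl, D.vecYN z y.fn f.fn t
      = (D.l z).vecY D.m D.ivl D.r D.s y.fn (f - z • y).fn t := fun hy t ht => by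
    unfold vecYN
    rw [D.lSubN_eq]
    exact OpExpr.vecY_shift (D.l_order _ hz') (D.l_smooth _ hz') D.m_order D.m_smooth D.s_even
      D.s_le_r D.uniqueDiffOn hy f.2 z ht
  have ha : ∀ hy : ContDiffOn ℝ D.r y.fn D.ivl, ∀ t ∈ D.ivl,
      ((D.lSubN z).apply D.ivl D.r y.fn t = D.m.apply D.ivl D.s f.fn t ↔
        (D.l z).apply D.ivl D.r y.fn t = D.m.apply D.ivl D.s (f - z • y).fn t) :=
    fun hy t ht => by
      rw [D.lSubN_eq]
      exact OpExpr.apply_shift_iff (D.l_order _ hz') (D.l_smooth _ hz') D.m_order D.m_smooth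
        D.s_even D.s_le_r D.uniqueDiffOn hy f.2 z ht
  constructor
  · rintro ⟨hy, he, h, h1, h2⟩
    refine (key hy).1 ⟨fun t ht => (ha hy t ht).1 (he t ht), h, ?_, ?_⟩
    · rw [← hv hy _ D.a_mem, h1]
    · rw [← hv hy _ D.b_mem, h2]
  · intro hres
    have hy : ContDiffOn ℝ D.r y.fn D.ivl := (D.contDiffOn_resolventFn hD hz _ hs).congr hres
    obtain ⟨he, h, h1, h2⟩ := (key hy).2 hres
    exact ⟨hy, fun t ht => (ha hy t ht).2 (he t ht), h, (hv hy _ D.a_mem).trans h1,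
      (hv hy _ D.b_mem).trans h2⟩

theorem toL2m_sub_smul (f y : D.PreH) (z : ℂ) :
    D.toL2m (f - z • y) = D.toL2m f - z • D.toL2m y := by
  unfold toL2m
  rw [UniformSpace.Completion.coe_sub, UniformSpace.Completion.coe_smul]

/-- The map `(y, f) ↦ (f - z y, y)`. -/
def shearHomeo {V : Type*} [AddCommGroup V] [Module ℂ V] [TopologicalSpace V] [ContinuousAdd V]
    [ContinuousSub V] [ContinuousConstSMul ℂ V] (z : ℂ) : V × V ≃ₜ V × V where
  toFun x := (x.2 - z • x.1, x.1)
  invFun x := (x.2, x.1 + z • x.2)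
  left_inv x := by simp
  right_inv x := by simp
  continuous_toFun := by fun_prop
  continuous_invFun := by fun_prop

theorem relResolvent_eq_image (T : Set (D.L2m × D.L2m)) (z : ℂ) :
    D.relResolvent T z = shearHomeo z '' T := by
  ext x
  constructor
  · rintro ⟨y, f, h, rfl⟩
    exact ⟨(y, f), h, rfl⟩
  · rintro ⟨⟨y, f⟩, h, rfl⟩
    exact ⟨y, f, h, rfl⟩

/-- `(y, f) ↦ (f - λy, y)` is a homeomorphism, so it commutes with closure, and before taking
closures it maps the graph of the boundary problem onto the graph of the solution operator on `H`.
-/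
theorem relResolvent_T (hD : D.IsDefinite) {Mb Nb : ℂ → D.Op} (hb : D.IsBdryPair Mb Nb)
    (hz : z.im ≠ 0) :
    D.relResolvent (D.T Mb Nb z) z = D.resolvent (D.bdryCharOp Mb Nb) z := by
  rw [relResolvent_eq_image, T, (shearHomeo z).image_closure, resolvent]
  congr 1
  ext x
  constructor
  · rintro ⟨_, ⟨y, f, h1, h2, h3, rfl⟩, rfl⟩
    refine ⟨f - z • y, y, (D.preT_iff hD hb hz y f).1 ⟨h1, h2, h3⟩, ?_⟩
    rw [toL2m_sub_smul]
    rfl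
  · rintro ⟨f, y, h, rfl⟩
    have e : (f + z • y) - z • y = f := add_sub_cancel_right _ _
    obtain ⟨h1, h2, h3⟩ := (D.preT_iff hD hb hz y (f + z • y)).2 (by rwa [e])
    refine ⟨_, ⟨y, f + z • y, h1, h2, h3, rfl⟩, ?_⟩
    change (D.toL2m (f + z • y) - z • D.toL2m y, D.toL2m y) = _
    rw [← toL2m_sub_smul, e]

theorem resolvent_congr {M M' : ℂ → D.Op} (h : M z = M' z) : D.resolvent M z = D.resolvent M' z := by
  have : D.resolventFn M z = D.resolventFn M' z := by
    unfold resolventFn kernel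
    rw [h]
  unfold resolvent
  rw [this]

end NevanlinnaExprPair

end

theorem corollary3p1 {𝓗 : Type*} [NormedAddCommGroup 𝓗] [InnerProductSpace ℂ 𝓗] [CompleteSpace 𝓗]
    [TopologicalSpace.SeparableSpace 𝓗] (D : NevanlinnaExprPair 𝓗) (hD : D.IsDefinite) :
    (∀ Mb Nb : ℂ → D.Op, D.IsBdryPair Mb Nb →
      (∀ z : ℂ, z.im ≠ 0 → IsUnit (D.bdryDiff Mb Nb z)) ∧
      D.IsCharOp (D.bdryCharOp Mb Nb) ∧
      ∀ z : ℂ, z.im ≠ 0 →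
        (∀ f : D.PreH,
          ContDiffOn ℝ D.r (D.resolventFn (D.bdryCharOp Mb Nb) z f.fn) (Icc D.a D.b)) ∧
        D.relResolvent (D.T Mb Nb z) z = D.resolvent (D.bdryCharOp Mb Nb) z) ∧
    (∀ M : ℂ → D.Op, D.IsCharOp M →
      ∃ Mb Nb : ℂ → D.Op, D.IsBdryPair Mb Nb ∧
        ∀ z : ℂ, z.im ≠ 0 →
          (∀ f : D.PreH, ContDiffOn ℝ D.r (D.resolventFn M z f.fn) (Icc D.a D.b)) ∧
          D.resolvent M z = D.relResolvent (D.T Mb Nb z) z) := by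
  have hN := D.isNevSystem hD
  refine ⟨fun Mb Nb hb => ⟨fun z hz => hN.isUnit_diffOp_family ((D.isBdryPair_iff _ _).1 hb) hz,
    D.isCharOp_bdryCharOp hD hb, fun z hz => ⟨fun f => D.contDiffOn_resolventFn hD hz _ f.2,
      D.relResolvent_T hD hb hz⟩⟩, fun M hM => ⟨_, _, D.isBdryPair_of_isCharOp hD hM,
      fun z hz => ⟨fun f => D.contDiffOn_resolventFn hD hz _ f.2, ?_⟩⟩⟩
  -- Part 1° is applied to the pair constructed from `M`; the characteristic operator of that pair
  -- is `M` again.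
  rw [D.relResolvent_T hD (D.isBdryPair_of_isCharOp hD hM) hz]
  exact D.resolvent_congr ((D.bdryCharOp_eq hz _ _).trans (hN.charOpOf_of hz)).symm
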